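/- **Theorem (Global well-posedness).** Let $d\in\{2,3\}$ and consider the cubic-quartic nonlinear Schrödinger equation $$ i\partial_t u+\tfrac12\Delta u=-|u|^2u+|u|^3u,\qquad u|_{t=0}=u_0,\qquad t\in\mathbb R,\ x\in\mathbb R^d. $$ With $f(z)=-|z|^2z+|z|^3z$, a (global) solution with datum $u_0\in H^1(\mathbb R^d)$ is a function $u\in C(\mathbb R;H^1(\mathbb R^d))$ that satisfies Duhamel's formula $$ u(t)=e^{i\frac t2\Delta}u_0-i\int_0^t e^{i\frac{t-s}2\Delta}f(u(s))\,ds\qquad\text{for all }t\in\mathbb R, $$ as an identity of tempered distributions. Define $$ M(u)=\int_{\mathbb R^d}|u|^2dx,\qquad E(u)=\tfrac12\|\nabla u\|_{L^2}^2-\tfrac12\|u\|_{L^4}^4+\tfrac25\|u\|_{L^5}^5,\qquad P(u)=\int_{\mathbb R^d}\operatorname{Im}(\bar u\nabla u)\,dx, $$ $$ L(u)=\int_{\mathbb R^d}\bar u\,L_zu\,dx,\qquad L_zu=i(x_1\partial_{x_2}u-x_2\partial_{x_1}u), $$ and $\Sigma=\{u\in H^1(\mathbb R^d):|x|u\in L^2(\mathbb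 R^d)\}$ with $\|u\|_\Sigma^2=\|u\|_{L^2}^2+\|\nabla u\|_{L^2}^2+\|xu\|_{L^2}^2$. 1. For every $u_0\in H^1(\mathbb R^d)$ there is a unique global solution $u\in C(\mathbb R;H^1(\mathbb R^d))$. The map $u_0\mapsto u$ is continuous from $H^1(\mathbb R^d)$ to $C(\mathbb R;H^1(\mathbb R^d))$ with the topology of uniform convergence on compact time intervals. Moreover $M(u(t))=M(u_0)$, $E(u(t))=E(u_0)$ and $P(u(t))=P(u_0)$ for all $t\in\mathbb R$. 2. If in addition $u_0\in\Sigma$, then $u\in C(\mathbb R;\Sigma)$ and $L(u(t))=L(u_0)$ for all $t\in\mathbb R$. -/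

import Mathlib

open MeasureTheory
open scoped SchwartzMap FourierTransform LineDeriv

noncomputable section

namespace CubicQuarticNLS

/-- The space `L²(ℝᵈ; ℂ)`. -/
abbrev L2 (d : ℕ) : Type := Lp ℂ 2 (volume : Measure (EuclideanSpace ℝ (Fin d)))

/-- The space `L²(ℝᵈ; ℂᵈ)` of square-integrable vector fields, given by their components, with
`‖g‖² = ∑ⱼ ‖gⱼ‖²`. -/
abbrev L2Vec (d : ℕ) : Type := PiLp 2 (fun _ : Fin d => L2 d)

/-- `H¹(ℝᵈ)`, realised as the graph of the gradient: the pairs `(u, g)` with `u ∈ L²`,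
`g ∈ (L²)ᵈ` and `∂ⱼ u = gⱼ` in the sense of tempered distributions for every `j`. Since `g` is
determined by `u`, these pairs are the functions `u ∈ L²` with `∇u ∈ L²`, and the norm inherited
from the `ℓ²`-product is `‖u‖²_{H¹} = ‖u‖²_{L²} + ‖∇u‖²_{L²}`. -/
def sobolevH1 (d : ℕ) : Submodule ℂ (WithLp 2 (L2 d × L2Vec d)) where
  carrier := {p | ∀ j : Fin d,
    ∂_{EuclideanSpace.single j (1 : ℝ)} (p.fst : 𝓢'(EuclideanSpace ℝ (Fin d), ℂ)) =
      (p.snd j : 𝓢'(EuclideanSpace ℝ (Fin d), ℂ))}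
  zero_mem' := by
    intro j
    ext φ
    simp [TemperedDistribution.lineDerivOp_apply_apply]
  add_mem' := by
    intro p q hp hq j
    have key : ∀ f g : L2 d, ((f + g : L2 d) : 𝓢'(EuclideanSpace ℝ (Fin d), ℂ)) = f + g :=
      fun f g => map_add (Lp.toTemperedDistributionCLM ℂ volume 2) f g
    simp only [WithLp.add_fst, WithLp.add_snd, PiLp.add_apply, key,
      LineDeriv.lineDerivOp_add, hp j, hq j]
  smul_mem' := by
    intro c p hp j
    have key : ∀ f : L2 d, ((c • f : L2 d) : 𝓢'(EuclideanSpace ℝ (Fin d), ℂ)) = c • f :=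
      fun f => map_smul (Lp.toTemperedDistributionCLM ℂ volume 2) c f
    simp only [WithLp.smul_fst, WithLp.smul_snd, PiLp.smul_apply, key,
      LineDeriv.lineDerivOp_smul, hp j]

/-- `H¹(ℝᵈ)` as a normed space. -/
abbrev H1 (d : ℕ) : Type := sobolevH1 d

/-- The function underlying an element of `H¹`. -/
def H1.fn {d : ℕ} (u : H1 d) : L2 d := u.1.fst

/-- The gradient of an element of `H¹`; `u.grad j` is `∂ⱼ u`. -/
def H1.grad {d : ℕ} (u : H1 d) : L2Vec d := u.1.snd

/-- The conformal space `Σ = {u ∈ H¹ : |x| u ∈ L²}`, realised as the pairs `(u, w)` with `u ∈ H¹`,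
`w ∈ (L²)ᵈ` and `wⱼ = xⱼ u` almost everywhere for every `j`. The inherited norm is
`‖u‖²_Σ = ‖u‖²_{L²} + ‖∇u‖²_{L²} + ‖x u‖²_{L²}`. -/
def conformal (d : ℕ) : Submodule ℂ (WithLp 2 (H1 d × L2Vec d)) where
  carrier := {p | ∀ j : Fin d,
    ∀ᵐ x : EuclideanSpace ℝ (Fin d), p.snd j x = (x j : ℂ) * p.fst.fn x}
  zero_mem' := by
    intro j
    filter_upwards [Lp.coeFn_zero ℂ 2 (volume : Measure (EuclideanSpace ℝ (Fin d)))] with x hx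
    have h1 : ((0 : WithLp 2 (H1 d × L2Vec d)).snd j) = (0 : L2 d) := rfl
    have h2 : ((0 : WithLp 2 (H1 d × L2Vec d)).fst.fn) = (0 : L2 d) := rfl
    rw [h1, h2, hx]
    simp
  add_mem' := by
    intro p q hp hq j
    have h1 : (p + q).snd j = p.snd j + q.snd j := rfl
    have h2 : (p + q).fst.fn = p.fst.fn + q.fst.fn := rfl
    filter_upwards [hp j, hq j, Lp.coeFn_add (p.snd j) (q.snd j),
      Lp.coeFn_add p.fst.fn q.fst.fn] with x hpx hqx hx1 hx2
    rw [h1, h2, hx1, hx2, Pi.add_apply, Pi.add_apply, hpx, hqx]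
    ring
  smul_mem' := by
    intro c p hp j
    have h1 : (c • p).snd j = c • p.snd j := rfl
    have h2 : (c • p).fst.fn = c • p.fst.fn := rfl
    filter_upwards [hp j, Lp.coeFn_smul c (p.snd j), Lp.coeFn_smul c p.fst.fn] with x hpx hx1 hx2
    rw [h1, h2, hx1, hx2, Pi.smul_apply, Pi.smul_apply, hpx, smul_eq_mul, smul_eq_mul]
    ring

/-- The conformal space `Σ` as a normed space. -/
abbrev ConformalSpace (d : ℕ) : Type := conformal d

/-- The inclusion `Σ ⊆ H¹`. -/
def ConformalSpace.toH1 {d : ℕ} (u : ConformalSpace d) : H1 d := u.1.fst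

/-- The nonlinearity `f(z) = -|z|² z + |z|³ z`. -/
def nonlinearity (z : ℂ) : ℂ := -((‖z‖ : ℂ) ^ 2 * z) + (‖z‖ : ℂ) ^ 3 * z

/-- The free Schrödinger group `e^{i(t/2)Δ}` on a Schwartz function. With
`𝓕 φ ξ = ∫ e^{-2πi x·ξ} φ(x) dx` the symbol of `Δ` is `-4π²|ξ|²`, so that of `e^{i(t/2)Δ}` is
`e^{-2π²it|ξ|²}`. -/
def freeEvolution {d : ℕ} (t : ℝ) (φ : 𝓢(EuclideanSpace ℝ (Fin d), ℂ)) :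
    EuclideanSpace ℝ (Fin d) → ℂ :=
  𝓕⁻ (fun ξ : EuclideanSpace ℝ (Fin d) =>
    Complex.exp (-(2 * (Real.pi : ℂ) ^ 2 * Complex.I * (t : ℂ) * (‖ξ‖ : ℂ) ^ 2)) *
      𝓕 (φ : EuclideanSpace ℝ (Fin d) → ℂ) ξ)

/-- `u ∈ C(ℝ; H¹)` solves `i ∂ₜu + ½ Δu = -|u|²u + |u|³u`, `u(0) = u₀`, i.e. it satisfies Duhamel's
formula `u(t) = e^{i(t/2)Δ} u₀ - i ∫₀ᵗ e^{i((t-s)/2)Δ} f(u(s)) ds` for all `t ∈ ℝ`, as an identity of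
tempered distributions. The group acts on a tempered distribution `T` by
`⟨e^{i(t/2)Δ} T, φ⟩ = ⟨T, e^{i(t/2)Δ} φ⟩`, its symbol being even; here `⟨v, φ⟩ = ∫ v φ dx`. -/
def IsSolution {d : ℕ} (u₀ : H1 d) (u : C(ℝ, H1 d)) : Prop :=
  ∀ (t : ℝ) (φ : 𝓢(EuclideanSpace ℝ (Fin d), ℂ)),
    ∫ x, (u t).fn x * φ x =
      (∫ x, u₀.fn x * freeEvolution t φ x) -
        Complex.I * ∫ s in (0 : ℝ)..t, ∫ x,
          nonlinearity ((u s).fn x) * freeEvolution (t - s) φ x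

/-- The mass `M(u) = ∫ |u|² dx`. -/
def mass {d : ℕ} (u : H1 d) : ℝ := ∫ x, ‖u.fn x‖ ^ 2

/-- The energy `E(u) = ½ ‖∇u‖²_{L²} - ½ ‖u‖⁴_{L⁴} + (2/5) ‖u‖⁵_{L⁵}`. -/
def energy {d : ℕ} (u : H1 d) : ℝ :=
  1 / 2 * ‖u.grad‖ ^ 2 - 1 / 2 * (∫ x, ‖u.fn x‖ ^ 4) + 2 / 5 * ∫ x, ‖u.fn x‖ ^ 5

/-- The momentum `P(u) = ∫ Im (ū ∇u) dx ∈ ℝᵈ`. -/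
def momentum {d : ℕ} (u : H1 d) : Fin d → ℝ :=
  fun j => ∫ x, (starRingEnd ℂ (u.fn x) * u.grad j x).im

/-- The angular momentum `L(u) = ⟨u, L_z u⟩_{L²} = ∫ ū L_z u dx` for
`L_z u = i (x₁ ∂₂u - x₂ ∂₁u)`. The coordinates `x₁, x₂` are those with indices `0, 1` in `Fin d`.
For `u ∈ Σ` the integrand is integrable, since `xⱼ u` and `∂ₖu` are in `L²`. -/
def angularMomentum {d : ℕ} (hd : 2 ≤ d) (u : ConformalSpace d) : ℂ :=
  ∫ x : EuclideanSpace ℝ (Fin d), starRingEnd ℂ (u.toH1.fn x) *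
    (Complex.I * ((x ⟨0, by omega⟩ : ℂ) * u.toH1.grad ⟨1, by omega⟩ x -
      (x ⟨1, by omega⟩ : ℂ) * u.toH1.grad ⟨0, by omega⟩ x))

end CubicQuarticNLS

end

/-! Since r³ - r² ≥ -1 for r ≥ 0, the potential energy is bounded below by a multiple of the mass,
so mass and energy together bound the H¹ norm for all times. The perturbation theory takes place in
L⁴. The free group maps L^{4/3} to L⁴ with norm at most |t|^{-d/4}, an integrable singularity
because d < 4. Increments of the nonlinearity are bounded by |z - w| times a weight built from |z|,
|z|³, |w|, |w|³, and that weight is in L² on bounded sets of L² ∩ L⁶, hence of H¹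
(`exists_eLpNorm_six_le`). So the nonlinearity is Lipschitz from L⁴ to L^{4/3} there, and a Gronwall
argument with an exponential weight in time compares two solutions of Duhamel's formula
(`exists_norm4_sub_le`). Uniqueness is a special case, and no Strichartz estimates are needed.

The dispersive estimate comes from the Galilean symmetry. The Fourier transform of |ψ|² at η is ⟨ψ,
e^{-2πi⟨η,·⟩}ψ⟩. For ψ = e^{i(t/2)Δ}φ the group cancels and leaves a translation by a multiple of
tη, so an autocorrelation of |φ| bounds it; Plancherel and Young's inequality conclude
(`lintegral_freeS_pow_four_le`).

For existence the modulus in the coefficient -r² + r³ is frozen beyond height R. The truncated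
nonlinearity is globally Lipschitz on L², and in the interaction picture v(t) = e^{-i(t/2)Δ}u(t) the
equation is an ordinary differential equation with a global solution (`exists_isTraj`). Translates
of solutions are solutions, so difference quotients grow at most exponentially and H¹ regularity
persists. The truncation costs at most a small multiple of |z|^{9/2}, which L⁶ controls in L^{4/3}.

The truncated conservation laws are proved with finite differences, since u is only in H¹. For the
energy one differentiates Im⟨u(t), u(t+h)⟩. For the generator of a symmetry group A_h one
differentiates Im⟨u(t), A_h u(t)⟩. The kinetic terms cancel exactly, and a Taylor expansion of the
potential leaves an error of the order of the squared increment, which is o(h); then divide by h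
(`sub_eq_of_approximate_conservation`).

The truncated flows are bounded in H¹ uniformly in R and in time, and they are Cauchy in L²
(`exists_approxFlow_sub_le`). Weak lower semicontinuity gives E(u(t)) ≤ E(u₀) for the limit; the
group property, a consequence of uniqueness, lets this be applied backwards in time and gives
equality. With the energy, the gradient norms converge, which turns weak H¹ convergence into strong
convergence and yields `continuous_flow`.

In Σ the moments are difference quotients of modulations. The free flow moves them at a speed
controlled by the H¹ norm, while a gauge-invariant nonlinearity does not contribute
(`IsTraj.norm_modulation_sub_le`). Angular momentum is the generator of the rotations in the first
coordinate plane; it is treated as a quadratic form, because the generator itself need not map u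
into L². -/

noncomputable section

namespace CubicQuarticNLS

open Filter Topology
open scoped ENNReal NNReal BoundedContinuousFunction

variable {d : ℕ}

/-- The space `ℝᵈ`. -/
abbrev Pt (d : ℕ) : Type := EuclideanSpace ℝ (Fin d)

/-! ### The Hilbert space L². -/

theorem L2.integrable_norm_sq (f : L2 d) : Integrable (fun x => ‖f x‖ ^ 2) :=
  (memLp_two_iff_integrable_sq_norm (Lp.aestronglyMeasurable f)).1 (Lp.memLp f)

theorem L2.norm_sq_eq (f : L2 d) : ‖f‖ ^ 2 = ∫ x, ‖f x‖ ^ 2 := by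
  have h : inner ℂ f f = ((‖f‖ : ℂ)) ^ 2 := inner_self_eq_norm_sq_to_K f
  rw [L2.inner_def] at h
  have h2 : (fun a => inner ℂ (f a) (f a)) = fun a => (((‖f a‖ ^ 2 : ℝ)) : ℂ) := by
    ext a
    rw [inner_self_eq_norm_sq_to_K]
    norm_cast
  rw [h2, integral_complex_ofReal] at h
  exact_mod_cast h.symm

theorem L2.inner_eq (f g : L2 d) : inner ℂ f g = ∫ x, starRingEnd ℂ (f x) * g x := by
  rw [MeasureTheory.L2.inner_def]
  simp only [RCLike.inner_apply, mul_comm]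

theorem L2.norm_sq_eq_of_ae {f : L2 d} {F : Pt d → ℝ} (h : ∀ᵐ x, ‖f x‖ ^ 2 = F x) :
    ‖f‖ ^ 2 = ∫ x, F x := by
  rw [L2.norm_sq_eq]
  exact integral_congr_ae h

/-! ### Unimodular multipliers in position and in frequency. -/

theorem memLp_phase (θ : C(Pt d, ℝ)) (f : L2 d) :
    MemLp (fun x => Complex.exp (Complex.I * θ x) * f x) 2 := by
  have hc : AEStronglyMeasurable (fun x : Pt d => Complex.exp (Complex.I * θ x)) :=
    (by fun_prop : Continuous fun x : Pt d => Complex.exp (Complex.I * θ x)).aestronglyMeasurable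
  refine (Lp.memLp f).of_le (hc.mul (Lp.aestronglyMeasurable f)) (ae_of_all _ fun x => ?_)
  rw [norm_mul, mul_comm Complex.I, Complex.norm_exp_ofReal_mul_I, one_mul]

/-- Multiplication by `e^{iθ}` on `L²`. -/
def phaseOp (θ : C(Pt d, ℝ)) : L2 d →ₗᵢ[ℂ] L2 d where
  toFun f := (memLp_phase θ f).toLp _
  map_add' f g := by
    apply Lp.ext
    filter_upwards [(memLp_phase θ (f + g)).coeFn_toLp, (memLp_phase θ f).coeFn_toLp,
      (memLp_phase θ g).coeFn_toLp, Lp.coeFn_add f g,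
      Lp.coeFn_add ((memLp_phase θ f).toLp _) ((memLp_phase θ g).toLp _)] with x h1 h2 h3 h4 h5
    rw [h1, h5, Pi.add_apply, h2, h3, h4, Pi.add_apply, mul_add]
  map_smul' c f := by
    apply Lp.ext
    filter_upwards [(memLp_phase θ (c • f)).coeFn_toLp, (memLp_phase θ f).coeFn_toLp,
      Lp.coeFn_smul c f, Lp.coeFn_smul c ((memLp_phase θ f).toLp _)] with x h1 h2 h4 h5
    rw [h1, RingHom.id_apply, h5, Pi.smul_apply, h2, h4, Pi.smul_apply, smul_eq_mul, smul_eq_mul]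
    ring
  norm_map' f := by
    have : ‖(memLp_phase θ f).toLp _‖ ^ 2 = ‖f‖ ^ 2 := by
      rw [L2.norm_sq_eq f]
      apply L2.norm_sq_eq_of_ae
      filter_upwards [(memLp_phase θ f).coeFn_toLp] with x hx
      rw [hx, norm_mul, mul_comm Complex.I, Complex.norm_exp_ofReal_mul_I, one_mul]
    exact (sq_eq_sq₀ (norm_nonneg _) (norm_nonneg _)).1 this

theorem coeFn_phaseOp (θ : C(Pt d, ℝ)) (f : L2 d) :
    ∀ᵐ x, phaseOp θ f x = Complex.exp (Complex.I * θ x) * f x :=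
  (memLp_phase θ f).coeFn_toLp

@[simp] theorem phaseOp_zero (f : L2 d) : phaseOp 0 f = f := by
  apply Lp.ext
  filter_upwards [coeFn_phaseOp 0 f] with x hx
  simp [hx]

theorem phaseOp_add (θ₁ θ₂ : C(Pt d, ℝ)) (f : L2 d) :
    phaseOp (θ₁ + θ₂) f = phaseOp θ₁ (phaseOp θ₂ f) := by
  apply Lp.ext
  filter_upwards [coeFn_phaseOp (θ₁ + θ₂) f, coeFn_phaseOp θ₁ (phaseOp θ₂ f),
    coeFn_phaseOp θ₂ f] with x h1 h2 h3
  rw [h1, h2, h3, ← mul_assoc, ← Complex.exp_add]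
  simp [mul_add]

theorem phaseOp_neg_apply (θ : C(Pt d, ℝ)) (f : L2 d) : phaseOp (-θ) (phaseOp θ f) = f := by
  rw [← phaseOp_add, neg_add_cancel, phaseOp_zero]

/-- The Fourier multiplier with symbol `e^{iθ}` on `L²`. -/
def fourierPhase (θ : C(Pt d, ℝ)) : L2 d →ₗᵢ[ℂ] L2 d :=
  ((Lp.fourierTransformₗᵢ (Pt d) ℂ).symm.toLinearIsometry.comp (phaseOp θ)).comp
    (Lp.fourierTransformₗᵢ (Pt d) ℂ).toLinearIsometry

theorem fourierPhase_apply (θ : C(Pt d, ℝ)) (f : L2 d) :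
    fourierPhase θ f = 𝓕⁻ (phaseOp θ (𝓕 f)) := rfl

@[simp] theorem fourier_fourierPhase (θ : C(Pt d, ℝ)) (f : L2 d) :
    𝓕 (fourierPhase θ f) = phaseOp θ (𝓕 f) := by
  rw [fourierPhase_apply, FourierTransform.fourier_fourierInv_eq]

theorem fourier_inj {f g : L2 d} (h : 𝓕 f = 𝓕 g) : f = g :=
  (Lp.fourierTransformₗᵢ (Pt d) ℂ).injective h

@[simp] theorem fourierPhase_zero (f : L2 d) : fourierPhase 0 f = f := fourier_inj (by simp)

theorem fourierPhase_add (θ₁ θ₂ : C(Pt d, ℝ)) (f : L2 d) :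
    fourierPhase (θ₁ + θ₂) f = fourierPhase θ₁ (fourierPhase θ₂ f) :=
  fourier_inj (by simp [phaseOp_add])

theorem L2.fourier_sub (f g : L2 d) : 𝓕 (f - g) = 𝓕 f - 𝓕 g :=
  (Lp.fourierTransformₗᵢ (Pt d) ℂ).map_sub f g

theorem L2.fourier_smul (c : ℂ) (f : L2 d) : 𝓕 (c • f) = c • 𝓕 f :=
  (Lp.fourierTransformₗᵢ (Pt d) ℂ).map_smul c f

theorem norm_fourierPhase_sub (θ : C(Pt d, ℝ)) (f : L2 d) :
    ‖fourierPhase θ f - f‖ = ‖phaseOp θ (𝓕 f) - 𝓕 f‖ := by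
  rw [← fourier_fourierPhase, ← L2.fourier_sub, Lp.norm_fourier_eq]

/-! ### One-parameter groups of phases -/

theorem norm_cexp_sub_one_le (s : ℝ) : ‖Complex.exp (Complex.I * s) - 1‖ ≤ |s| := by
  simpa using Real.norm_exp_I_mul_ofReal_sub_one_le (x := s)

theorem norm_cexp_sub_one_le_two (s : ℝ) : ‖Complex.exp (Complex.I * s) - 1‖ ≤ 2 := by
  refine (norm_sub_le _ _).trans ?_
  rw [mul_comm, Complex.norm_exp_ofReal_mul_I]
  norm_num

theorem norm_sq_phaseOp_sub (θ : C(Pt d, ℝ)) (f : L2 d) :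
    ‖phaseOp θ f - f‖ ^ 2 = ∫ x, ‖Complex.exp (Complex.I * θ x) - 1‖ ^ 2 * ‖f x‖ ^ 2 := by
  apply L2.norm_sq_eq_of_ae
  filter_upwards [coeFn_phaseOp θ f, Lp.coeFn_sub (phaseOp θ f) f] with x h1 h2
  rw [h2, Pi.sub_apply, h1, ← mul_pow, ← norm_mul, sub_mul, one_mul]

theorem tendsto_phaseOp_smul_zero (θ : C(Pt d, ℝ)) (f : L2 d) :
    Tendsto (fun h : ℝ => ‖phaseOp (h • θ) f - f‖ ^ 2) (𝓝 0) (𝓝 0) := by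
  simp only [norm_sq_phaseOp_sub]
  rw [show 𝓝 (0 : ℝ) = 𝓝 (∫ x : Pt d, (0 : ℝ)) by rw [integral_zero]]
  nth_rw 1 [integral_zero]
  refine tendsto_integral_filter_of_dominated_convergence (fun x => 4 * ‖f x‖ ^ 2) ?_ ?_ ?_ ?_
  · refine Eventually.of_forall fun h => AEStronglyMeasurable.mul ?_
      (L2.integrable_norm_sq f).aestronglyMeasurable
    exact (by fun_prop : Continuous fun x : Pt d =>
      ‖Complex.exp (Complex.I * (h • θ) x) - 1‖ ^ 2).aestronglyMeasurable
  · refine Eventually.of_forall fun h => ae_of_all _ fun x => ?_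
    rw [Real.norm_of_nonneg (by positivity)]
    have := norm_cexp_sub_one_le_two ((h • θ) x)
    gcongr
    nlinarith [norm_nonneg (Complex.exp (Complex.I * ((h • θ) x : ℝ)) - 1)]
  · exact (L2.integrable_norm_sq f).const_mul 4
  · refine ae_of_all _ fun x => ?_
    have : Continuous fun h : ℝ =>
        ‖Complex.exp (Complex.I * ((h • θ) x : ℝ)) - 1‖ ^ 2 * ‖f x‖ ^ 2 := by
      simp only [ContinuousMap.smul_apply, smul_eq_mul, Complex.ofReal_mul]
      fun_prop
    simpa using this.tendsto 0

theorem phaseOp_smul_sub (θ : C(Pt d, ℝ)) (f : L2 d) (s t : ℝ) :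
    phaseOp (s • θ) f - phaseOp (t • θ) f
      = phaseOp (t • θ) (phaseOp ((s - t) • θ) f - f) := by
  rw [map_sub, ← phaseOp_add, ← add_smul]
  congr 3
  ring_nf

theorem continuous_phaseOp_smul (θ : C(Pt d, ℝ)) (f : L2 d) :
    Continuous fun s : ℝ => phaseOp (s • θ) f := by
  rw [continuous_iff_continuousAt]
  intro t
  rw [ContinuousAt, tendsto_iff_norm_sub_tendsto_zero]
  have h1 : Tendsto (fun s : ℝ => ‖phaseOp ((s - t) • θ) f - f‖ ^ 2) (𝓝 t) (𝓝 0) := by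
    refine (tendsto_phaseOp_smul_zero θ f).comp ?_
    have : Tendsto (fun s : ℝ => s - t) (𝓝 t) (𝓝 (t - t)) :=
      (continuous_id.sub continuous_const).tendsto t
    simpa using this
  have h2 := h1.sqrt
  simp only [Real.sqrt_sq (norm_nonneg _), Real.sqrt_zero] at h2
  refine h2.congr fun s => ?_
  rw [phaseOp_smul_sub, LinearIsometry.norm_map]

theorem continuous_fourierPhase_smul (θ : C(Pt d, ℝ)) (f : L2 d) :
    Continuous fun s : ℝ => fourierPhase (s • θ) f := by
  simp only [fourierPhase_apply]
  exact (Lp.fourierTransformₗᵢ (Pt d) ℂ).symm.continuous.comp (continuous_phaseOp_smul θ (𝓕 f))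

/-- Joint strong continuity of a phase group. -/
theorem continuous_fourierPhase_comp {X : Type*} [TopologicalSpace X] (θ : C(Pt d, ℝ))
    {s : X → ℝ} {f : X → L2 d} (hs : Continuous s) (hf : Continuous f) :
    Continuous fun x => fourierPhase (s x • θ) (f x) := by
  rw [continuous_iff_continuousAt]
  intro x₀
  rw [ContinuousAt, tendsto_iff_norm_sub_tendsto_zero]
  have h1 : Tendsto (fun x => ‖f x - f x₀‖) (𝓝 x₀) (𝓝 0) :=
    tendsto_iff_norm_sub_tendsto_zero.1 (hf.tendsto x₀)
  have h2 : Tendsto (fun x => ‖fourierPhase (s x • θ) (f x₀) - fourierPhase (s x₀ • θ) (f x₀)‖)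
      (𝓝 x₀) (𝓝 0) :=
    tendsto_iff_norm_sub_tendsto_zero.1
      (((continuous_fourierPhase_smul θ (f x₀)).comp hs).tendsto x₀)
  have h3 := h1.add h2
  rw [add_zero] at h3
  refine squeeze_zero (fun _ => norm_nonneg _) (fun x => ?_) h3
  calc ‖fourierPhase (s x • θ) (f x) - fourierPhase (s x₀ • θ) (f x₀)‖
      ≤ ‖fourierPhase (s x • θ) (f x) - fourierPhase (s x • θ) (f x₀)‖
        + ‖fourierPhase (s x • θ) (f x₀) - fourierPhase (s x₀ • θ) (f x₀)‖ :=
        norm_sub_le_norm_sub_add_norm_sub _ _ _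
    _ = _ := by rw [← map_sub, LinearIsometry.norm_map]

/-- If the difference quotients of `e^{ihθ} f` stay bounded along a sequence, then `θ f ∈ L²`. -/
theorem exists_phase_generator_of_bound (θ : C(Pt d, ℝ)) (f : L2 d) {K : ℝ} (hK : 0 ≤ K)
    {h : ℕ → ℝ} (h0 : Tendsto h atTop (𝓝 0)) (hne : ∀ n, h n ≠ 0)
    (hb : ∀ n, ‖phaseOp (h n • θ) f - f‖ ≤ K * |h n|) :
    ∃ g : L2 d, (∀ᵐ x, g x = Complex.I * θ x * f x) ∧ ‖g‖ ≤ K := by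
  set G : Pt d → ℂ := fun x => Complex.I * θ x * f x with hG
  have hGm : AEStronglyMeasurable G :=
    (by fun_prop : Continuous fun x : Pt d => Complex.I * (θ x : ℂ)).aestronglyMeasurable.mul
      (Lp.aestronglyMeasurable f)
  set F : ℕ → Pt d → ℂ := fun n x => (h n : ℂ)⁻¹ * (phaseOp (h n • θ) f - f : L2 d) x with hF
  have hlim : ∀ᵐ x, Tendsto (fun n => F n x) atTop (𝓝 (G x)) := by
    have h1 := ae_all_iff.2 fun n => coeFn_phaseOp (h n • θ) f
    have h2 := ae_all_iff.2 fun n => Lp.coeFn_sub (phaseOp (h n • θ) f) f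
    filter_upwards [h1, h2] with x h1 h2
    have hd : HasDerivAt (fun s : ℝ => Complex.exp (Complex.I * (s * θ x))) (Complex.I * θ x) 0 := by
      have hd1 : HasDerivAt (fun s : ℝ => Complex.I * ((s : ℂ) * θ x)) (Complex.I * (1 * θ x)) 0 :=
        ((Complex.ofRealCLM.hasDerivAt (x := (0:ℝ))).mul_const _).const_mul _
      simpa using hd1.cexp
    have hd2 := hd.tendsto_slope_zero
    have hh : Tendsto h atTop (𝓝[≠] 0) :=
      tendsto_nhdsWithin_iff.2 ⟨h0, Eventually.of_forall hne⟩
    have h3 := (hd2.comp hh).mul_const (f x)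
    refine h3.congr fun n => ?_
    simp only [hF, h2 n, Pi.sub_apply, h1 n, Function.comp_apply]
    simp
    ring
  -- Fatou's lemma: `G` is not yet known to be square integrable, but it is a pointwise limit of
  -- quotients of norm at most `K`.
  have hle : eLpNorm G 2 ≤ ENNReal.ofReal K := by
    refine (Lp.eLpNorm_lim_le_liminf_eLpNorm (fun n => ?_) G hlim).trans ?_
    · exact (Lp.aestronglyMeasurable _).const_mul _
    · refine (liminf_le_liminf (Eventually.of_forall fun n => ?_)
        (by isBoundedDefault) (by isBoundedDefault)).trans (liminf_const _).le
      have h4 : eLpNorm (F n) 2 = ENNReal.ofReal (|h n|⁻¹) *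
          ENNReal.ofReal ‖phaseOp (h n • θ) f - f‖ := by
        have : F n = (h n : ℂ)⁻¹ • ((phaseOp (h n • θ) f - f : L2 d) : Pt d → ℂ) := rfl
        rw [this, eLpNorm_const_smul, Lp.norm_def, ENNReal.ofReal_toReal (Lp.eLpNorm_ne_top _),
          ← ofReal_norm]
        simp
      rw [h4, ← ENNReal.ofReal_mul (by positivity)]
      apply ENNReal.ofReal_le_ofReal
      rw [inv_mul_le_iff₀ (abs_pos.2 (hne n)), mul_comm]
      exact hb n
  have hmem : MemLp G 2 := ⟨hGm, hle.trans_lt ENNReal.ofReal_lt_top⟩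
  refine ⟨hmem.toLp G, hmem.coeFn_toLp, ?_⟩
  rw [Lp.norm_toLp]
  exact ENNReal.toReal_le_of_le_ofReal hK hle

theorem norm_phaseOp_smul_sub_le (θ : C(Pt d, ℝ)) {f g : L2 d}
    (hg : ∀ᵐ x, g x = Complex.I * θ x * f x) (h : ℝ) :
    ‖phaseOp (h • θ) f - f‖ ≤ |h| * ‖g‖ := by
  refine abs_le_of_sq_le_sq' ?_ (by positivity) |>.2
  rw [norm_sq_phaseOp_sub, mul_pow, L2.norm_sq_eq g, ← integral_const_mul]
  refine integral_mono_of_nonneg (ae_of_all _ fun x => by positivity)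
    ((L2.integrable_norm_sq g).const_mul _) ?_
  filter_upwards [hg] with x hx
  rw [hx, ← mul_pow, ← mul_pow]
  refine pow_le_pow_left₀ (by positivity) ?_ 2
  rw [norm_mul, norm_mul, Complex.norm_I, one_mul, ← mul_assoc]
  refine mul_le_mul_of_nonneg_right ((norm_cexp_sub_one_le _).trans ?_) (norm_nonneg _)
  simp [abs_mul]

theorem tendsto_phaseOp_slope (θ : C(Pt d, ℝ)) {f g : L2 d}
    (hg : ∀ᵐ x, g x = Complex.I * θ x * f x) :
    Tendsto (fun h : ℝ => (h : ℂ)⁻¹ • (phaseOp (h • θ) f - f)) (𝓝[≠] 0) (𝓝 g) := by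
  rw [tendsto_iff_norm_sub_tendsto_zero]
  have key : Tendsto (fun h : ℝ => ‖(h : ℂ)⁻¹ • (phaseOp (h • θ) f - f) - g‖ ^ 2) (𝓝[≠] 0)
      (𝓝 (∫ x : Pt d, (0 : ℝ))) := by
    have e1 : ∀ h : ℝ, ‖(h : ℂ)⁻¹ • (phaseOp (h • θ) f - f) - g‖ ^ 2 =
        ∫ x, ‖((h : ℂ)⁻¹ * (Complex.exp (Complex.I * (h * θ x)) - 1) - Complex.I * θ x) * f x‖ ^ 2 := by
      intro h
      apply L2.norm_sq_eq_of_ae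
      filter_upwards [coeFn_phaseOp (h • θ) f, Lp.coeFn_sub (phaseOp (h • θ) f) f, hg,
        Lp.coeFn_sub ((h : ℂ)⁻¹ • (phaseOp (h • θ) f - f)) g,
        Lp.coeFn_smul (h : ℂ)⁻¹ (phaseOp (h • θ) f - f)] with x h1 h2 h3 h4 h5
      rw [h4, Pi.sub_apply, h5, Pi.smul_apply, h2, Pi.sub_apply, h1, h3, smul_eq_mul]
      congr 2
      simp
      ring
    simp only [e1]
    -- The quotient and its limit both have modulus at most |θ|, so the squared difference is at
    -- most 4θ².
    refine tendsto_integral_filter_of_dominated_convergence (fun x => 4 * ‖g x‖ ^ 2) ?_ ?_ ?_ ?_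
    · refine Eventually.of_forall fun h => ?_
      refine (AEStronglyMeasurable.norm ?_).pow 2
      refine AEStronglyMeasurable.mul ?_ (Lp.aestronglyMeasurable f)
      exact (by fun_prop : Continuous fun x : Pt d => ((h : ℂ)⁻¹ *
        (Complex.exp (Complex.I * (h * θ x)) - 1) - Complex.I * θ x)).aestronglyMeasurable
    · refine Eventually.of_forall fun h => ?_
      filter_upwards [hg] with x hx
      rw [Real.norm_of_nonneg (by positivity), hx, norm_mul, norm_mul _ (f x), mul_pow, mul_pow,
        ← mul_assoc (4 : ℝ)]
      refine mul_le_mul_of_nonneg_right ?_ (sq_nonneg _)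
      have h6 : ‖(h : ℂ)⁻¹ * (Complex.exp (Complex.I * (h * θ x)) - 1)‖ ≤ |θ x| := by
        have := norm_cexp_sub_one_le (h * θ x)
        rw [norm_mul, norm_inv, Complex.norm_real, Real.norm_eq_abs]
        push_cast at this
        rcases eq_or_ne h 0 with rfl | hh
        · simp
        · rw [inv_mul_le_iff₀ (abs_pos.2 hh), ← abs_mul]
          simpa using this
      have h7 : ‖Complex.I * (θ x : ℂ)‖ = |θ x| := by simp
      have h8 := norm_sub_le ((h : ℂ)⁻¹ * (Complex.exp (Complex.I * (h * θ x)) - 1))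
        (Complex.I * (θ x : ℂ))
      rw [h7] at h8 ⊢
      nlinarith [norm_nonneg ((h : ℂ)⁻¹ * (Complex.exp (Complex.I * (h * θ x)) - 1) -
        Complex.I * (θ x : ℂ)), abs_nonneg (θ x)]
    · exact (L2.integrable_norm_sq g).const_mul 4
    · refine ae_of_all _ fun x => ?_
      have hd : HasDerivAt (fun s : ℝ => Complex.exp (Complex.I * (s * θ x)))
          (Complex.I * θ x) 0 := by
        have hd1 : HasDerivAt (fun s : ℝ => Complex.I * ((s : ℂ) * θ x))
            (Complex.I * (1 * θ x)) 0 :=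
          ((Complex.ofRealCLM.hasDerivAt (x := (0:ℝ))).mul_const _).const_mul _
        simpa using hd1.cexp
      have hd2 := hd.tendsto_slope_zero
      simp only [zero_add, Complex.ofReal_zero, zero_mul, mul_zero, Complex.exp_zero,
        Complex.real_smul, Complex.ofReal_inv] at hd2
      have hd3 := (((hd2.sub_const (Complex.I * θ x)).mul_const (f x)).norm).pow 2
      simpa using hd3
  rw [integral_zero] at key
  have h2 := key.sqrt
  simpa only [Real.sqrt_sq (norm_nonneg _), Real.sqrt_zero] using h2

/-- The product of the bounds |s| and 2. Being linear in s, it uses only that |θ|^{1/2} f is in L².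
For the Schrödinger symbol this means H¹ instead of H². -/
theorem norm_cexp_sub_one_sq_le (s : ℝ) : ‖Complex.exp (Complex.I * s) - 1‖ ^ 2 ≤ 2 * |s| := by
  have h1 := norm_cexp_sub_one_le s
  have h2 := norm_cexp_sub_one_le_two s
  nlinarith [norm_nonneg (Complex.exp (Complex.I * s) - 1)]

theorem norm_phaseOp_smul_sub_sq_le (θ : C(Pt d, ℝ)) {f : L2 d}
    (hf : Integrable fun x => |θ x| * ‖f x‖ ^ 2) (h : ℝ) :
    ‖phaseOp (h • θ) f - f‖ ^ 2 ≤ 2 * |h| * ∫ x, |θ x| * ‖f x‖ ^ 2 := by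
  rw [norm_sq_phaseOp_sub, ← integral_const_mul]
  refine integral_mono_of_nonneg (ae_of_all _ fun x => by positivity) (hf.const_mul _)
    (ae_of_all _ fun x => ?_)
  dsimp only
  rw [← mul_assoc]
  refine mul_le_mul_of_nonneg_right ((norm_cexp_sub_one_sq_le _).trans (le_of_eq ?_))
    (by positivity)
  simp [abs_mul, mul_assoc]

/-- On the form domain the squared increment is o(h), not merely O(h): the quotient is dominated by
2|θ||f|² and is pointwise at most |h|θ²|f|². This is what removes the quadratic errors from the
conservation laws. -/
theorem tendsto_norm_phaseOp_sub_sq_div (θ : C(Pt d, ℝ)) {f : L2 d}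
    (hf : Integrable fun x => |θ x| * ‖f x‖ ^ 2) :
    Tendsto (fun h : ℝ => |h|⁻¹ * ‖phaseOp (h • θ) f - f‖ ^ 2) (𝓝 0) (𝓝 0) := by
  simp only [norm_sq_phaseOp_sub, ← integral_const_mul]
  rw [show 𝓝 (0 : ℝ) = 𝓝 (∫ x : Pt d, (0 : ℝ)) by rw [integral_zero]]
  nth_rw 1 [integral_zero]
  have hle : ∀ h s : ℝ, |h|⁻¹ * ‖Complex.exp (Complex.I * (h * s : ℝ)) - 1‖ ^ 2 ≤ 2 * |s| := by
    intro h s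
    have := norm_cexp_sub_one_sq_le (h * s)
    rcases eq_or_ne h 0 with rfl | hh
    · simp
    · rw [inv_mul_le_iff₀ (abs_pos.2 hh)]
      rw [abs_mul] at this
      linarith
  have hle2 : ∀ h s : ℝ, |h|⁻¹ * ‖Complex.exp (Complex.I * (h * s : ℝ)) - 1‖ ^ 2 ≤ |h| * s ^ 2 := by
    intro h s
    have := pow_le_pow_left₀ (norm_nonneg _) (norm_cexp_sub_one_le (h * s)) 2
    rcases eq_or_ne h 0 with rfl | hh
    · simp
    · rw [inv_mul_le_iff₀ (abs_pos.2 hh)]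
      rw [sq_abs] at this
      nlinarith [abs_mul_abs_self h]
  refine tendsto_integral_filter_of_dominated_convergence (fun x => 2 * (|θ x| * ‖f x‖ ^ 2))
    ?_ ?_ ?_ ?_
  · refine Eventually.of_forall fun h => AEStronglyMeasurable.const_mul ?_ _
    refine AEStronglyMeasurable.mul ?_ (L2.integrable_norm_sq f).aestronglyMeasurable
    exact (by fun_prop : Continuous fun x : Pt d =>
      ‖Complex.exp (Complex.I * (h • θ) x) - 1‖ ^ 2).aestronglyMeasurable
  · refine Eventually.of_forall fun h => ae_of_all _ fun x => ?_
    rw [Real.norm_of_nonneg (by positivity), ← mul_assoc, ← mul_assoc]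
    exact mul_le_mul_of_nonneg_right (hle h (θ x)) (by positivity)
  · exact hf.const_mul 2
  · refine ae_of_all _ fun x => ?_
    have h1 : Tendsto (fun h : ℝ => |h| * θ x ^ 2 * ‖f x‖ ^ 2) (𝓝 0) (𝓝 0) := by
      have : Continuous fun h : ℝ => |h| * θ x ^ 2 * ‖f x‖ ^ 2 := by fun_prop
      simpa using this.tendsto 0
    refine squeeze_zero (fun _ => by positivity) (fun h => ?_) h1
    rw [← mul_assoc]
    exact mul_le_mul_of_nonneg_right (hle2 h (θ x)) (by positivity)

theorem im_inner_phaseOp (θ : C(Pt d, ℝ)) (f : L2 d) :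
    (inner ℂ f (phaseOp θ f)).im = ∫ x, Real.sin (θ x) * ‖f x‖ ^ 2 := by
  have hint : Integrable fun x => starRingEnd ℂ (f x) * phaseOp θ f x := by
    have := MeasureTheory.L2.integrable_inner (𝕜 := ℂ) f (phaseOp θ f)
    simpa only [RCLike.inner_apply, mul_comm] using this
  rw [L2.inner_eq]
  have : (∫ x, starRingEnd ℂ (f x) * phaseOp θ f x).im
      = ∫ x, (starRingEnd ℂ (f x) * phaseOp θ f x).im := (integral_im hint).symm
  rw [this]
  apply integral_congr_ae
  filter_upwards [coeFn_phaseOp θ f] with x hx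
  rw [hx]
  have h2 : starRingEnd ℂ (f x) * (Complex.exp (Complex.I * θ x) * f x)
      = ((‖f x‖ ^ 2 : ℝ) : ℂ) * Complex.exp (θ x * Complex.I) := by
    rw [mul_comm (θ x : ℂ)]
    push_cast
    rw [← Complex.mul_conj']
    ring
  rw [h2, Complex.im_ofReal_mul,
    Complex.exp_ofReal_mul_I_im, mul_comm]

/-- The imaginary part involves only sin(hθ), bounded by |hθ|, so the quadratic form of the
generator is recovered on the form domain, even where θ f is not in L². -/
theorem tendsto_im_inner_phaseOp_div (θ : C(Pt d, ℝ)) {f : L2 d}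
    (hf : Integrable fun x => |θ x| * ‖f x‖ ^ 2) :
    Tendsto (fun h : ℝ => h⁻¹ * (inner ℂ f (phaseOp (h • θ) f)).im) (𝓝[≠] 0)
      (𝓝 (∫ x, θ x * ‖f x‖ ^ 2)) := by
  simp only [im_inner_phaseOp, ← integral_const_mul]
  refine tendsto_integral_filter_of_dominated_convergence (fun x => |θ x| * ‖f x‖ ^ 2)
    ?_ ?_ hf ?_
  · refine Eventually.of_forall fun h => AEStronglyMeasurable.const_mul ?_ _
    refine AEStronglyMeasurable.mul ?_ (L2.integrable_norm_sq f).aestronglyMeasurable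
    exact (by fun_prop : Continuous fun x : Pt d => Real.sin ((h • θ) x)).aestronglyMeasurable
  · refine Eventually.of_forall fun h => ae_of_all _ fun x => ?_
    rw [← mul_assoc, norm_mul, norm_mul, Real.norm_eq_abs, Real.norm_eq_abs,
      Real.norm_of_nonneg (by positivity : 0 ≤ ‖f x‖ ^ 2)]
    refine mul_le_mul_of_nonneg_right ?_ (by positivity)
    rcases eq_or_ne h 0 with rfl | hh
    · simp
    · rw [abs_inv, inv_mul_le_iff₀ (abs_pos.2 hh), ← abs_mul]
      exact Real.abs_sin_le_abs
  · refine ae_of_all _ fun x => ?_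
    have hd : HasDerivAt (fun s : ℝ => Real.sin (s * θ x)) (θ x) 0 := by
      have h1 : HasDerivAt (fun s : ℝ => s * θ x) (1 * θ x) 0 := (hasDerivAt_id 0).mul_const _
      simpa using h1.sin
    have hd2 := hd.tendsto_slope_zero.mul_const (‖f x‖ ^ 2)
    simpa [mul_assoc] using hd2

/-! ### The free group, translations and modulations. -/

/-- The symbol `-2π²|ξ|²` of `½Δ`. -/
def freeSymbol (d : ℕ) : C(Pt d, ℝ) := ⟨fun ξ => -(2 * Real.pi ^ 2 * ‖ξ‖ ^ 2), by fun_prop⟩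

/-- The linear symbol `2π⟨a, x⟩`. -/
def linSymbol (a : Pt d) : C(Pt d, ℝ) := ⟨fun x => 2 * Real.pi * inner ℝ a x, by fun_prop⟩

@[simp] theorem freeSymbol_apply (ξ : Pt d) : freeSymbol d ξ = -(2 * Real.pi ^ 2 * ‖ξ‖ ^ 2) := rfl

@[simp] theorem linSymbol_apply (a x : Pt d) : linSymbol a x = 2 * Real.pi * inner ℝ a x := rfl

theorem linSymbol_smul (h : ℝ) (a : Pt d) : linSymbol (h • a) = h • linSymbol a := by
  ext x
  simp [inner_smul_left]
  ring

theorem linSymbol_neg (a : Pt d) : linSymbol (-a) = -linSymbol a := by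
  ext x
  simp

/-- The free Schrödinger group `e^{i(t/2)Δ}` on `L²`. -/
def freeGroup (t : ℝ) : L2 d →ₗᵢ[ℂ] L2 d := fourierPhase (t • freeSymbol d)

theorem freeGroup_add (s t : ℝ) (f : L2 d) : freeGroup (s + t) f = freeGroup s (freeGroup t f) := by
  rw [freeGroup, add_smul, fourierPhase_add]
  rfl

@[simp] theorem freeGroup_zero (f : L2 d) : freeGroup 0 f = f := by
  rw [freeGroup, zero_smul, fourierPhase_zero]

theorem freeGroup_neg_apply (t : ℝ) (f : L2 d) : freeGroup (-t) (freeGroup t f) = f := by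
  rw [← freeGroup_add, neg_add_cancel, freeGroup_zero]

theorem freeGroup_apply_neg (t : ℝ) (f : L2 d) : freeGroup t (freeGroup (-t) f) = f := by
  rw [← freeGroup_add, add_neg_cancel, freeGroup_zero]

theorem continuous_freeGroup_comp {X : Type*} [TopologicalSpace X]
    {s : X → ℝ} {f : X → L2 d} (hs : Continuous s) (hf : Continuous f) :
    Continuous fun x => freeGroup (s x) (f x) :=
  continuous_fourierPhase_comp (freeSymbol d) hs hf

/-- Translation `f ↦ f(· + a)` on `L²`. -/
def translation (a : Pt d) : L2 d →ₗᵢ[ℂ] L2 d := fourierPhase (linSymbol a)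

/-- Modulation `f ↦ e^{2πi⟨a, ·⟩} f` on `L²`. -/
def modulation (a : Pt d) : L2 d →ₗᵢ[ℂ] L2 d := phaseOp (linSymbol a)

/-! ### Schwartz functions -/

theorem hasTemperateGrowth_cexp_I_mul :
    Function.HasTemperateGrowth fun s : ℝ => Complex.exp (Complex.I * s) := by
  refine ⟨(contDiff_const.mul Complex.ofRealCLM.contDiff).cexp, fun n => ⟨0, 1, fun x => ?_⟩⟩
  rw [norm_iteratedFDeriv_eq_norm_iteratedDeriv]
  have h : ∀ n : ℕ, iteratedDeriv n (fun s : ℝ => Complex.exp (Complex.I * s)) =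
      fun s : ℝ => Complex.I ^ n * Complex.exp (Complex.I * s) := by
    intro n
    induction n with
    | zero => simp
    | succ n ih =>
      rw [iteratedDeriv_succ, ih]
      ext s
      have hd : HasDerivAt (fun s : ℝ => Complex.I ^ n * Complex.exp (Complex.I * s))
          (Complex.I ^ n * (Complex.exp (Complex.I * s) * (Complex.I * 1))) s :=
        (((Complex.ofRealCLM.hasDerivAt (x := s)).const_mul Complex.I).cexp).const_mul _
      rw [hd.deriv]
      ring
  rw [h]
  simp [Complex.norm_exp]

theorem hasTemperateGrowth_phase {θ : C(Pt d, ℝ)} (hθ : Function.HasTemperateGrowth θ) :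
    Function.HasTemperateGrowth fun x : Pt d => Complex.exp (Complex.I * θ x) :=
  hasTemperateGrowth_cexp_I_mul.comp hθ

theorem hasTemperateGrowth_linSymbol (a : Pt d) :
    Function.HasTemperateGrowth (linSymbol a) := by
  change Function.HasTemperateGrowth fun x : Pt d => 2 * Real.pi * inner ℝ a x
  fun_prop

theorem hasTemperateGrowth_smul_freeSymbol (t : ℝ) :
    Function.HasTemperateGrowth (t • freeSymbol d) := by
  have : Function.HasTemperateGrowth fun x : Pt d => (t * -(2 * Real.pi ^ 2)) * ‖x‖ ^ 2 := by
    fun_prop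
  convert this using 1
  ext x
  simp
  ring

/-- Multiplication by `e^{iθ}` on Schwartz functions. -/
def phaseS (θ : C(Pt d, ℝ)) (φ : 𝓢(Pt d, ℂ)) : 𝓢(Pt d, ℂ) :=
  SchwartzMap.smulLeftCLM ℂ (fun x : Pt d => Complex.exp (Complex.I * θ x)) φ

/-- The Fourier multiplier `e^{iθ}` on Schwartz functions. -/
def fourierPhaseS (θ : C(Pt d, ℝ)) (φ : 𝓢(Pt d, ℂ)) : 𝓢(Pt d, ℂ) := 𝓕⁻ (phaseS θ (𝓕 φ))

theorem phaseS_apply {θ : C(Pt d, ℝ)} (hθ : Function.HasTemperateGrowth θ) (φ : 𝓢(Pt d, ℂ))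
    (x : Pt d) : phaseS θ φ x = Complex.exp (Complex.I * θ x) * φ x :=
  SchwartzMap.smulLeftCLM_apply_apply (hasTemperateGrowth_phase hθ) φ x

theorem phaseOp_toLp {θ : C(Pt d, ℝ)} (hθ : Function.HasTemperateGrowth θ) (φ : 𝓢(Pt d, ℂ)) :
    phaseOp θ (φ.toLp 2) = (phaseS θ φ).toLp 2 := by
  apply Lp.ext
  filter_upwards [coeFn_phaseOp θ (φ.toLp 2), φ.coeFn_toLp 2, (phaseS θ φ).coeFn_toLp 2]
    with x h1 h2 h3
  rw [h1, h2, h3, phaseS_apply hθ]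

theorem fourierPhase_toLp {θ : C(Pt d, ℝ)} (hθ : Function.HasTemperateGrowth θ)
    (φ : 𝓢(Pt d, ℂ)) : fourierPhase θ (φ.toLp 2) = (fourierPhaseS θ φ).toLp 2 := by
  rw [fourierPhase_apply, SchwartzMap.toLp_fourier_eq, phaseOp_toLp hθ,
    SchwartzMap.toLp_fourierInv_eq]
  rfl

theorem L2.induction_schwartz {p : L2 d → Prop} (hp : IsClosed {f | p f})
    (h : ∀ φ : 𝓢(Pt d, ℂ), p (φ.toLp 2)) (f : L2 d) : p f :=
  DenseRange.induction_on (p := p)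
    (SchwartzMap.denseRange_toLpCLM (F := ℂ) (μ := (volume : Measure (Pt d))) (p := 2)
      ENNReal.ofNat_ne_top) f hp h

/-- The free evolution of a Schwartz function as a Schwartz function. -/
def freeS (t : ℝ) (φ : 𝓢(Pt d, ℂ)) : 𝓢(Pt d, ℂ) := fourierPhaseS (t • freeSymbol d) φ

theorem freeEvolution_eq (t : ℝ) (φ : 𝓢(Pt d, ℂ)) : freeEvolution t φ = freeS t φ := by
  rw [freeS, fourierPhaseS, SchwartzMap.fourierInv_coe, freeEvolution]
  congr 1
  ext ξ
  rw [phaseS_apply (hasTemperateGrowth_smul_freeSymbol t), ← SchwartzMap.fourier_coe]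
  congr 2
  simp
  ring

theorem freeGroup_toLp (t : ℝ) (φ : 𝓢(Pt d, ℂ)) :
    freeGroup t (φ.toLp 2) = (freeS t φ).toLp 2 :=
  fourierPhase_toLp (hasTemperateGrowth_smul_freeSymbol t) φ

/-- The bilinear pairing `∫ f φ` as a continuous linear functional. -/
def pairS (φ : 𝓢(Pt d, ℂ)) : L2 d →L[ℂ] ℂ :=
  innerSL ℂ ((SchwartzMap.postcompCLM (𝕜 := ℝ) (Complex.conjCLE : ℂ →L[ℝ] ℂ) φ).toLp 2 : L2 d)

theorem pairS_apply (φ : 𝓢(Pt d, ℂ)) (f : L2 d) : pairS φ f = ∫ x, f x * φ x := by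
  rw [pairS, innerSL_apply_apply, L2.inner_eq]
  apply integral_congr_ae
  filter_upwards [(SchwartzMap.postcompCLM (𝕜 := ℝ) (Complex.conjCLE : ℂ →L[ℝ] ℂ) φ).coeFn_toLp 2]
    with x hx
  rw [hx, mul_comm]
  simp

theorem L2.eq_of_pairS {f g : L2 d} (h : ∀ φ : 𝓢(Pt d, ℂ), pairS φ f = pairS φ g) : f = g := by
  rw [← sub_eq_zero]
  set w := f - g with hw
  have h0 : ∀ φ, pairS φ w = 0 := fun φ => by rw [hw, map_sub, h, sub_self]
  have : ∀ v : L2 d, inner ℂ v w = 0 := by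
    refine L2.induction_schwartz (isClosed_eq (by fun_prop) (by fun_prop)) fun ψ => ?_
    have h2 := h0 (SchwartzMap.postcompCLM (𝕜 := ℝ) (Complex.conjCLE : ℂ →L[ℝ] ℂ) ψ)
    rw [pairS, innerSL_apply_apply] at h2
    have e : SchwartzMap.postcompCLM (𝕜 := ℝ) (Complex.conjCLE : ℂ →L[ℝ] ℂ)
        (SchwartzMap.postcompCLM (𝕜 := ℝ) (Complex.conjCLE : ℂ →L[ℝ] ℂ) ψ) = ψ := by
      ext x
      simp
    rw [e] at h2
    exact h2
  exact inner_self_eq_zero.1 (this w)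

theorem pairS_toLp (φ ψ : 𝓢(Pt d, ℂ)) : pairS φ (ψ.toLp 2) = ∫ x, ψ x * φ x := by
  rw [pairS_apply]
  apply integral_congr_ae
  filter_upwards [ψ.coeFn_toLp 2] with x hx
  rw [hx]

/-- A multiplier with an even symbol is symmetric for the bilinear pairing. -/
theorem pairS_fourierPhase {θ : C(Pt d, ℝ)} (hθ : Function.HasTemperateGrowth θ)
    (heven : ∀ x, θ (-x) = θ x) (φ : 𝓢(Pt d, ℂ)) (f : L2 d) :
    pairS φ (fourierPhase θ f) = pairS (fourierPhaseS θ φ) f := by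
  refine L2.induction_schwartz (p := fun f => pairS φ (fourierPhase θ f)
    = pairS (fourierPhaseS θ φ) f) (isClosed_eq ?_ ?_) (fun ψ => ?_) f
  · exact (pairS φ).continuous.comp (fourierPhase θ).continuous
  · exact (pairS _).continuous
  rw [fourierPhase_toLp hθ, pairS_toLp, pairS_toLp]
  -- The pairing becomes the integral of e^{iθ} against one Fourier transform and one inverse
  -- transform. Exchanging the two functions amounts to the reflection ξ ↦ -ξ, which leaves an even
  -- θ unchanged.
  have key : ∀ χ₁ χ₂ : 𝓢(Pt d, ℂ), ∫ x, fourierPhaseS θ χ₁ x * χ₂ x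
      = ∫ x, Complex.exp (Complex.I * θ x) * (𝓕 χ₁ x * 𝓕⁻ χ₂ x) := by
    intro χ₁ χ₂
    have h1 := SchwartzMap.integral_fourier_mul_eq (fourierPhaseS θ χ₁) (𝓕⁻ χ₂)
    rw [FourierTransform.fourier_fourierInv_eq] at h1
    rw [← h1]
    congr 1
    ext x
    rw [fourierPhaseS, FourierTransform.fourier_fourierInv_eq, phaseS_apply hθ, mul_assoc]
  rw [key ψ φ]
  simp only [mul_comm (ψ _)]
  rw [key φ ψ, ← integral_neg_eq_self]
  congr 1
  ext x
  have hneg : ∀ χ : 𝓢(Pt d, ℂ), 𝓕⁻ χ (-x) = 𝓕 χ x := by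
    intro χ
    rw [SchwartzMap.fourierInv_coe, SchwartzMap.fourier_coe, Real.fourierInv_eq_fourier_neg,
      neg_neg]
  have hneg2 : ∀ χ : 𝓢(Pt d, ℂ), 𝓕 χ (-x) = 𝓕⁻ χ x := by
    intro χ
    rw [SchwartzMap.fourierInv_coe, SchwartzMap.fourier_coe, Real.fourierInv_eq_fourier_neg]
  rw [hneg, hneg2, heven]
  ring

theorem pairS_freeGroup (t : ℝ) (φ : 𝓢(Pt d, ℂ)) (f : L2 d) :
    pairS φ (freeGroup t f) = pairS (freeS t φ) f :=
  pairS_fourierPhase (hasTemperateGrowth_smul_freeSymbol t) (fun x => by simp) φ f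

/-! ### Translations -/

theorem measurePreserving_add (a : Pt d) :
    MeasurePreserving (fun x : Pt d => x + a) volume volume :=
  measurePreserving_add_right volume a

/-- With the kernel e^{-2πi⟨x,ξ⟩} a phase e^{2πi⟨a,ξ⟩} on the Fourier side shifts the argument by
+a; this fixes the signs of the translations below. -/
theorem fourierPhaseS_linSymbol_apply (a : Pt d) (φ : 𝓢(Pt d, ℂ)) (x : Pt d) :
    fourierPhaseS (linSymbol a) φ x = φ (x + a) := by
  have h1 : phaseS (linSymbol a) (𝓕 φ) = 𝓕 (SchwartzMap.compSubConstCLM ℂ (-a) φ) := by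
    ext ξ
    rw [phaseS_apply (hasTemperateGrowth_linSymbol a), SchwartzMap.fourier_coe,
      SchwartzMap.fourier_coe]
    have h2 := congrFun (VectorFourier.fourierIntegral_comp_add_right Real.fourierChar
      (volume : Measure (Pt d)) (innerₗ (Pt d)) φ a) ξ
    have h3 : (SchwartzMap.compSubConstCLM ℂ (-a) φ : Pt d → ℂ) = φ ∘ fun v => v + a := by
      ext v
      simp
    rw [h3]
    refine Eq.trans ?_ h2.symm
    rw [Circle.smul_def, smul_eq_mul, Real.fourierChar_apply]
    congr 2
    simp
    ring
  rw [fourierPhaseS, h1, FourierTransform.fourierInv_fourier_eq]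
  simp

theorem translation_eq_comp (a : Pt d) (f : L2 d) :
    translation a f = Lp.compMeasurePreserving (fun x : Pt d => x + a) (measurePreserving_add a) f := by
  refine L2.induction_schwartz (p := fun f => translation a f =
    Lp.compMeasurePreserving (fun x : Pt d => x + a) (measurePreserving_add a) f)
    (isClosed_eq (translation a).continuous
      (Lp.isometry_compMeasurePreserving (measurePreserving_add a)).continuous) (fun φ => ?_) f
  rw [translation, fourierPhase_toLp (hasTemperateGrowth_linSymbol a)]
  apply Lp.ext
  have hφ : ∀ᵐ y, (φ.toLp 2 : L2 d) y = φ y := φ.coeFn_toLp 2 volume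
  filter_upwards [(fourierPhaseS (linSymbol a) φ).coeFn_toLp 2,
    Lp.coeFn_compMeasurePreserving (φ.toLp 2) (measurePreserving_add a),
    (measurePreserving_add a).quasiMeasurePreserving.ae hφ] with x h1 h2 h3
  rw [h1, h2, Function.comp_apply, h3, fourierPhaseS_linSymbol_apply]

theorem coeFn_translation (a : Pt d) (f : L2 d) : ∀ᵐ x, translation a f x = f (x + a) := by
  rw [translation_eq_comp]
  exact Lp.coeFn_compMeasurePreserving f (measurePreserving_add a)

/-! ### Sobolev functions on the Fourier side. -/

/-- The symbol `2πξⱼ` of `-i∂ⱼ`. -/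
def coordSymbol (j : Fin d) : C(Pt d, ℝ) := linSymbol (EuclideanSpace.single j 1)

@[simp] theorem coordSymbol_apply (j : Fin d) (ξ : Pt d) :
    coordSymbol j ξ = 2 * Real.pi * ξ j := by
  simp [coordSymbol, EuclideanSpace.inner_single_left]

theorem translation_smul_single (h : ℝ) (j : Fin d) (f : L2 d) :
    translation (h • EuclideanSpace.single j 1) f = fourierPhase (h • coordSymbol j) f := by
  rw [translation, linSymbol_smul]
  rfl

/-- The Fourier transform turns the distributional identity ∂ⱼu = gⱼ into an equality of two locally
integrable functions, and compactly supported smooth test functions separate these. -/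
theorem mem_sobolevH1_iff (p : WithLp 2 (L2 d × L2Vec d)) :
    p ∈ sobolevH1 d ↔
      ∀ j, ∀ᵐ ξ, 𝓕 (p.snd j) ξ = Complex.I * coordSymbol j ξ * 𝓕 p.fst ξ := by
  refine forall_congr' fun j => ?_
  have hinj : Function.Injective (𝓕 : 𝓢'(Pt d, ℂ) → 𝓢'(Pt d, ℂ)) := by
    intro a b hab
    have h1 : 𝓕⁻ (𝓕 a) = a := FourierTransform.fourierInv_fourier_eq a
    have h2 : 𝓕⁻ (𝓕 b) = b := FourierTransform.fourierInv_fourier_eq b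
    rw [← h1, ← h2, hab]
  rw [← hinj.eq_iff, TemperedDistribution.fourier_lineDerivOp_eq,
    Lp.fourier_toTemperedDistribution_eq, Lp.fourier_toTemperedDistribution_eq]
  set a : L2 d := 𝓕 p.fst
  set b : L2 d := 𝓕 (p.snd j)
  set m : Pt d := EuclideanSpace.single j (1 : ℝ)
  have hm : Function.HasTemperateGrowth fun x : Pt d => ((inner ℝ x m : ℝ) : ℂ) := by fun_prop
  have hmj : ∀ x : Pt d, inner ℝ x m = x j := fun x => by
    simp [m, EuclideanSpace.inner_single_right]
  have hL : ∀ φ : 𝓢(Pt d, ℂ), ((2 * Real.pi * Complex.I : ℂ) •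
      TemperedDistribution.smulLeftCLM ℂ (fun x : Pt d => ((inner ℝ x m : ℝ) : ℂ))
        (a : 𝓢'(Pt d, ℂ))) φ = ∫ x, φ x • (Complex.I * coordSymbol j x * a x) := by
    intro φ
    have h1 : ((2 * Real.pi * Complex.I : ℂ) •
      TemperedDistribution.smulLeftCLM ℂ (fun x : Pt d => ((inner ℝ x m : ℝ) : ℂ))
        (a : 𝓢'(Pt d, ℂ))) φ = (2 * Real.pi * Complex.I : ℂ) •
      (TemperedDistribution.smulLeftCLM ℂ (fun x : Pt d => ((inner ℝ x m : ℝ) : ℂ))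
        (a : 𝓢'(Pt d, ℂ))) φ := rfl
    rw [h1, TemperedDistribution.smulLeftCLM_apply_apply, Lp.toTemperedDistribution_apply,
      smul_eq_mul, ← integral_const_mul]
    congr 1
    ext x
    rw [SchwartzMap.smulLeftCLM_apply_apply hm, hmj]
    simp
    ring
  constructor
  · intro h
    have hloc1 : LocallyIntegrable (fun x => Complex.I * coordSymbol j x * a x) := by
      have hc : Continuous fun x : Pt d => Complex.I * (coordSymbol j x : ℂ) := by fun_prop
      exact ((Lp.memLp a).locallyIntegrable (by norm_num)).continuous_smul hc
    have hloc2 : LocallyIntegrable b := (Lp.memLp b).locallyIntegrable (by norm_num)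
    refine ae_eq_of_integral_contDiff_smul_eq hloc2 hloc1 fun g hg hgc => ?_
    have hg₁ : HasCompactSupport (Complex.ofRealCLM ∘ g) := hgc.comp_left rfl
    have hg₂ : ContDiff ℝ (⊤ : ℕ∞) (Complex.ofRealCLM ∘ g) := by fun_prop
    have h2 := congrArg (fun T : 𝓢'(Pt d, ℂ) => T (hg₁.toSchwartzMap hg₂)) h
    rw [hL, Lp.toTemperedDistribution_apply] at h2
    simpa using h2.symm
  · intro h
    ext φ
    rw [hL, Lp.toTemperedDistribution_apply]
    apply integral_congr_ae
    filter_upwards [h] with x hx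
    rw [hx]

theorem H1.fourier_grad (u : H1 d) (j : Fin d) :
    ∀ᵐ ξ, 𝓕 (u.grad j) ξ = Complex.I * coordSymbol j ξ * 𝓕 u.fn ξ :=
  (mem_sobolevH1_iff u.1).1 u.2 j

/-- The element of `H¹` with given function and gradient. -/
def H1.mk (w : L2 d) (g : Fin d → L2 d)
    (h : ∀ j, ∀ᵐ ξ, 𝓕 (g j) ξ = Complex.I * coordSymbol j ξ * 𝓕 w ξ) : H1 d :=
  ⟨WithLp.toLp 2 (w, WithLp.toLp 2 g), (mem_sobolevH1_iff _).2 h⟩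

@[simp] theorem H1.mk_fn (w : L2 d) (g : Fin d → L2 d) (h) : (H1.mk w g h).fn = w := rfl

@[simp] theorem H1.mk_grad (w : L2 d) (g : Fin d → L2 d) (h) (j) : (H1.mk w g h).grad j = g j := rfl

theorem H1.ext_fn {u v : H1 d} (h : u.fn = v.fn) : u = v := by
  have hg : ∀ j, u.grad j = v.grad j := fun j => by
    apply fourier_inj
    apply Lp.ext
    filter_upwards [u.fourier_grad j, v.fourier_grad j] with x h1 h2
    rw [h1, h2, h]
  apply Subtype.ext
  apply WithLp.ofLp_injective
  refine Prod.ext h ?_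
  exact PiLp.ext hg

theorem H1.norm_sq_eq (u : H1 d) : ‖u‖ ^ 2 = ‖u.fn‖ ^ 2 + ‖u.grad‖ ^ 2 :=
  WithLp.prod_norm_sq_eq_of_L2 u.1

theorem L2Vec.norm_sq_eq (g : L2Vec d) : ‖g‖ ^ 2 = ∑ j, ‖g j‖ ^ 2 :=
  PiLp.norm_sq_eq_of_L2 _ g

theorem H1.norm_fn_le (u : H1 d) : ‖u.fn‖ ≤ ‖u‖ :=
  abs_le_of_sq_le_sq' (by rw [u.norm_sq_eq]; nlinarith [sq_nonneg ‖u.grad‖]) (norm_nonneg _) |>.2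

theorem H1.norm_grad_le (u : H1 d) : ‖u.grad‖ ≤ ‖u‖ :=
  abs_le_of_sq_le_sq' (by rw [u.norm_sq_eq]; nlinarith [sq_nonneg ‖u.fn‖]) (norm_nonneg _) |>.2

theorem L2Vec.norm_apply_le (g : L2Vec d) (j : Fin d) : ‖g j‖ ≤ ‖g‖ := PiLp.norm_apply_le g j

theorem H1.norm_grad_apply_le (u : H1 d) (j : Fin d) : ‖u.grad j‖ ≤ ‖u‖ :=
  (L2Vec.norm_apply_le _ _).trans u.norm_grad_le

@[simp] theorem H1.fn_sub (u v : H1 d) : (u - v).fn = u.fn - v.fn := rfl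
@[simp] theorem H1.grad_sub (u v : H1 d) : (u - v).grad = u.grad - v.grad := rfl

theorem H1.continuous_fn : Continuous (H1.fn : H1 d → L2 d) :=
  (WithLp.prod_continuous_ofLp 2 _ _).fst.comp continuous_subtype_val

theorem H1.continuous_grad : Continuous (H1.grad : H1 d → L2Vec d) :=
  (WithLp.prod_continuous_ofLp 2 _ _).snd.comp continuous_subtype_val

/-- Translations of an `H¹` function are Lipschitz in `L²`. -/
theorem H1.norm_translation_sub_le (u : H1 d) (j : Fin d) (h : ℝ) :
    ‖fourierPhase (h • coordSymbol j) u.fn - u.fn‖ ≤ |h| * ‖u.grad j‖ := by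
  rw [norm_fourierPhase_sub, ← Lp.norm_fourier_eq (u.grad j)]
  exact norm_phaseOp_smul_sub_le _ (u.fourier_grad j) h

theorem fourierInv_apply_eq_symm (f : L2 d) :
    𝓕⁻ f = (Lp.fourierTransformₗᵢ (Pt d) ℂ).symm f := rfl

theorem H1.tendsto_translation_slope (u : H1 d) (j : Fin d) :
    Tendsto (fun h : ℝ => (h : ℂ)⁻¹ • (fourierPhase (h • coordSymbol j) u.fn - u.fn)) (𝓝[≠] 0)
      (𝓝 (u.grad j)) := by
  have h1 := tendsto_phaseOp_slope _ (u.fourier_grad j)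
  have h2 := ((Lp.fourierTransformₗᵢ (Pt d) ℂ).symm.continuous.tendsto _).comp h1
  have h3 : (Lp.fourierTransformₗᵢ (Pt d) ℂ).symm (𝓕 (u.grad j)) = u.grad j :=
    (Lp.fourierTransformₗᵢ (Pt d) ℂ).symm_apply_apply _
  rw [h3] at h2
  refine h2.congr fun h => ?_
  rw [Function.comp_apply, map_smul, map_sub]
  congr 2
  exact (Lp.fourierTransformₗᵢ (Pt d) ℂ).symm_apply_apply _

/-- The converse of the Lipschitz bound for translations. It is the source of H¹ regularity below:
the hypothesis concerns L² norms only, survives L² limits, and is needed along a single sequence of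
steps. -/
theorem H1.exists_of_translation_bound (w : L2 d) {K : ℝ} (hK : 0 ≤ K)
    {h : ℕ → ℝ} (h0 : Tendsto h atTop (𝓝 0)) (hne : ∀ n, h n ≠ 0)
    (hb : ∀ j n, ‖fourierPhase (h n • coordSymbol j) w - w‖ ≤ K * |h n|) :
    ∃ u : H1 d, u.fn = w ∧ ∀ j, ‖u.grad j‖ ≤ K := by
  have key : ∀ j, ∃ g : L2 d, (∀ᵐ x, g x = Complex.I * coordSymbol j x * 𝓕 w x) ∧ ‖g‖ ≤ K :=
    fun j => exists_phase_generator_of_bound (coordSymbol j) (𝓕 w) hK h0 hne fun n => by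
      rw [← norm_fourierPhase_sub]
      exact hb j n
  choose g hg hgK using key
  refine ⟨H1.mk w (fun j => 𝓕⁻ (g j)) fun j => ?_, rfl, fun j => ?_⟩
  · rw [FourierTransform.fourier_fourierInv_eq]
    exact hg j
  · rw [H1.mk_grad, fourierInv_apply_eq_symm, LinearIsometryEquiv.norm_map]
    exact hgK j

theorem H1.norm_le_of_bounds {u : H1 d} {A K : ℝ} (hA : ‖u.fn‖ ≤ A) (hK : 0 ≤ K)
    (h : ∀ j, ‖u.grad j‖ ≤ K) : ‖u‖ ≤ A + d * K := by
  have hA0 : 0 ≤ A := (norm_nonneg _).trans hA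
  refine abs_le_of_sq_le_sq' ?_ (by positivity) |>.2
  rw [u.norm_sq_eq, L2Vec.norm_sq_eq]
  have h1 : ∑ j, ‖u.grad j‖ ^ 2 ≤ ∑ _j : Fin d, K ^ 2 :=
    Finset.sum_le_sum fun j _ => pow_le_pow_left₀ (norm_nonneg _) (h j) 2
  simp only [Finset.sum_const, Finset.card_univ, Fintype.card_fin, nsmul_eq_mul] at h1
  have h2 : ‖u.fn‖ ^ 2 ≤ A ^ 2 := pow_le_pow_left₀ (norm_nonneg _) hA 2
  have h3 : (d : ℝ) * K ^ 2 ≤ (d * K) ^ 2 := by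
    rcases Nat.eq_zero_or_pos d with rfl | hd
    · simp
    · have : (1 : ℝ) ≤ d := by exact_mod_cast hd
      nlinarith [sq_nonneg K, mul_nonneg (sub_nonneg.2 this) (sq_nonneg K)]
  nlinarith [mul_nonneg hA0 (mul_nonneg (Nat.cast_nonneg (α := ℝ) d) hK)]

/-- The free group on `H¹`. -/
def H1.free (t : ℝ) (u : H1 d) : H1 d :=
  H1.mk (freeGroup t u.fn) (fun j => freeGroup t (u.grad j)) fun j => by
    rw [freeGroup, fourier_fourierPhase, fourier_fourierPhase]
    filter_upwards [coeFn_phaseOp (t • freeSymbol d) (𝓕 (u.grad j)),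
      coeFn_phaseOp (t • freeSymbol d) (𝓕 u.fn), u.fourier_grad j] with x h1 h2 h3
    rw [h1, h2, h3]
    ring

@[simp] theorem H1.free_fn (t : ℝ) (u : H1 d) : (u.free t).fn = freeGroup t u.fn := rfl

theorem H1.norm_free (t : ℝ) (u : H1 d) : ‖u.free t‖ = ‖u‖ := by
  rw [← sq_eq_sq₀ (norm_nonneg _) (norm_nonneg _), H1.norm_sq_eq, H1.norm_sq_eq,
    L2Vec.norm_sq_eq, L2Vec.norm_sq_eq]
  simp [H1.free]

/-- Integration by parts: the symbol of ∂ⱼ is purely imaginary. -/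
theorem H1.inner_grad (u v : H1 d) (j : Fin d) :
    inner ℂ (u.grad j) v.fn = -inner ℂ u.fn (v.grad j) := by
  rw [← Lp.inner_fourier_eq, ← Lp.inner_fourier_eq u.fn, L2.inner_eq, L2.inner_eq, ← integral_neg]
  apply integral_congr_ae
  filter_upwards [u.fourier_grad j, v.fourier_grad j] with x h1 h2
  rw [h1, h2, map_mul, map_mul, Complex.conj_I, Complex.conj_ofReal]
  ring

/-- A Schwartz function as an element of `H¹`. -/
def H1.ofSchwartz (φ : 𝓢(Pt d, ℂ)) : H1 d :=
  H1.mk (φ.toLp 2) (fun j => (∂_{EuclideanSpace.single j (1 : ℝ)} φ : 𝓢(Pt d, ℂ)).toLp 2)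
      fun j => by
    rw [SchwartzMap.toLp_fourier_eq, SchwartzMap.toLp_fourier_eq, SchwartzMap.fourier_lineDerivOp_eq]
    have hm : Function.HasTemperateGrowth fun x : Pt d =>
        inner ℝ x (EuclideanSpace.single j (1 : ℝ)) := by fun_prop
    filter_upwards [(𝓕 φ).coeFn_toLp 2, SchwartzMap.coeFn_toLp ((2 * Real.pi * Complex.I : ℂ) •
      SchwartzMap.smulLeftCLM ℂ (fun x : Pt d => inner ℝ x (EuclideanSpace.single j (1 : ℝ)))
        (𝓕 φ)) 2] with x h1 h2
    rw [h1, h2]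
    change (2 * Real.pi * Complex.I : ℂ) • (SchwartzMap.smulLeftCLM ℂ
      (fun x : Pt d => inner ℝ x (EuclideanSpace.single j (1 : ℝ))) (𝓕 φ)) x = _
    rw [SchwartzMap.smulLeftCLM_apply_apply hm]
    simp [EuclideanSpace.inner_single_right]
    ring

@[simp] theorem H1.ofSchwartz_fn (φ : 𝓢(Pt d, ℂ)) : (H1.ofSchwartz φ).fn = φ.toLp 2 := rfl

@[simp] theorem H1.ofSchwartz_grad (φ : 𝓢(Pt d, ℂ)) (j : Fin d) :
    (H1.ofSchwartz φ).grad j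
      = (∂_{EuclideanSpace.single j (1 : ℝ)} φ : 𝓢(Pt d, ℂ)).toLp 2 := rfl

/-! ### Kinetic energy on the Fourier side -/

theorem H1.norm_sq_fourier_grad (u : H1 d) :
    ∀ᵐ ξ, ∑ j, ‖𝓕 (u.grad j) ξ‖ ^ 2 = 2 * (|freeSymbol d ξ| * ‖𝓕 u.fn ξ‖ ^ 2) := by
  filter_upwards [ae_all_iff.2 fun j => u.fourier_grad j] with ξ h
  have h1 : ∀ j, ‖𝓕 (u.grad j) ξ‖ ^ 2 = 4 * Real.pi ^ 2 * ‖𝓕 u.fn ξ‖ ^ 2 * ‖ξ j‖ ^ 2 := by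
    intro j
    rw [h j, norm_mul, norm_mul, Complex.norm_I, Complex.norm_real, coordSymbol_apply, norm_mul,
      Real.norm_of_nonneg (by positivity : (0 : ℝ) ≤ 2 * Real.pi)]
    ring
  simp only [h1]
  rw [← Finset.mul_sum, ← EuclideanSpace.norm_sq_eq, freeSymbol_apply, abs_neg,
    abs_of_nonneg (by positivity)]
  ring

theorem H1.integrable_freeSymbol (u : H1 d) :
    Integrable fun ξ => |freeSymbol d ξ| * ‖𝓕 u.fn ξ‖ ^ 2 := by
  have h1 : Integrable fun ξ => ∑ j, ‖𝓕 (u.grad j) ξ‖ ^ 2 :=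
    integrable_finsetSum _ fun j _ => L2.integrable_norm_sq _
  have h2 := (h1.congr u.norm_sq_fourier_grad).const_mul (1 / 2)
  refine h2.congr (ae_of_all _ fun x => ?_)
  ring

theorem H1.integral_abs_freeSymbol (u : H1 d) :
    ∫ ξ, |freeSymbol d ξ| * ‖𝓕 u.fn ξ‖ ^ 2 = 1 / 2 * ‖u.grad‖ ^ 2 := by
  have h1 := integral_congr_ae u.norm_sq_fourier_grad
  rw [integral_finsetSum _ fun j _ => L2.integrable_norm_sq _, integral_const_mul] at h1
  simp only [← L2.norm_sq_eq, Lp.norm_fourier_eq] at h1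
  rw [← L2Vec.norm_sq_eq] at h1
  linarith

theorem H1.integral_freeSymbol (u : H1 d) :
    ∫ ξ, freeSymbol d ξ * ‖𝓕 u.fn ξ‖ ^ 2 = -(1 / 2 * ‖u.grad‖ ^ 2) := by
  rw [← u.integral_abs_freeSymbol, ← integral_neg]
  congr 1
  ext ξ
  rw [freeSymbol_apply, abs_neg, abs_of_nonneg (by positivity)]
  ring

/-- One spatial derivative is worth half a derivative in time. -/
theorem H1.norm_freeGroup_sub_sq_le (u : H1 d) (h : ℝ) :
    ‖freeGroup h u.fn - u.fn‖ ^ 2 ≤ |h| * ‖u.grad‖ ^ 2 := by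
  have h1 := norm_phaseOp_smul_sub_sq_le (freeSymbol d) u.integrable_freeSymbol h
  rw [u.integral_abs_freeSymbol, ← norm_fourierPhase_sub] at h1
  refine h1.trans (le_of_eq ?_)
  ring

theorem H1.tendsto_norm_freeGroup_sub_sq_div (u : H1 d) :
    Tendsto (fun h : ℝ => |h|⁻¹ * ‖freeGroup h u.fn - u.fn‖ ^ 2) (𝓝 0) (𝓝 0) := by
  simp only [freeGroup, norm_fourierPhase_sub]
  exact tendsto_norm_phaseOp_sub_sq_div (freeSymbol d) u.integrable_freeSymbol

theorem H1.tendsto_im_inner_freeGroup_div (u : H1 d) :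
    Tendsto (fun h : ℝ => h⁻¹ * (inner ℂ u.fn (freeGroup h u.fn)).im) (𝓝[≠] 0)
      (𝓝 (-(1 / 2 * ‖u.grad‖ ^ 2))) := by
  have h1 := tendsto_im_inner_phaseOp_div (freeSymbol d) u.integrable_freeSymbol
  rw [u.integral_freeSymbol] at h1
  refine h1.congr fun h => ?_
  rw [← Lp.inner_fourier_eq u.fn (freeGroup h u.fn), freeGroup, fourier_fourierPhase]

/-! ### Modulations and the Galilean transformation -/

theorem fourier_modulation (a : Pt d) (f : L2 d) :
    𝓕 (modulation a f) = translation (-a) (𝓕 f) := by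
  refine L2.induction_schwartz (p := fun f => 𝓕 (modulation a f) = translation (-a) (𝓕 f))
    (isClosed_eq ((Lp.fourierTransformₗᵢ (Pt d) ℂ).continuous.comp (modulation a).continuous)
      ((translation (-a)).continuous.comp (Lp.fourierTransformₗᵢ (Pt d) ℂ).continuous))
    (fun φ => ?_) f
  rw [modulation, phaseOp_toLp (hasTemperateGrowth_linSymbol a), SchwartzMap.toLp_fourier_eq,
    SchwartzMap.toLp_fourier_eq, translation, fourierPhase_toLp (hasTemperateGrowth_linSymbol _)]
  congr 1
  ext ξ
  rw [fourierPhaseS_linSymbol_apply, SchwartzMap.fourier_coe, SchwartzMap.fourier_coe,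
    Real.fourier_eq', Real.fourier_eq']
  congr 1
  ext x
  rw [phaseS_apply (hasTemperateGrowth_linSymbol a), smul_eq_mul, smul_eq_mul, ← mul_assoc,
    ← Complex.exp_add]
  congr 2
  rw [linSymbol_apply, inner_add_right, inner_neg_right, real_inner_comm x a]
  push_cast
  ring

/-- Galilean invariance. Expanding |ξ - a|² in the symbol, the cross term is the phase of a
translation by 2πta, and |a|² gives a scalar phase. -/
theorem modulation_freeGroup (a : Pt d) (t : ℝ) (f : L2 d) :
    modulation a (freeGroup t f) = Complex.exp (Complex.I * (-(2 * Real.pi ^ 2 * t * ‖a‖ ^ 2) : ℝ)) •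
      freeGroup t (translation ((2 * Real.pi * t) • a) (modulation a f)) := by
  apply fourier_inj
  rw [fourier_modulation, L2.fourier_smul, freeGroup, fourier_fourierPhase,
    fourier_fourierPhase, translation.eq_1 ((2 * Real.pi * t) • a), fourier_fourierPhase,
    fourier_modulation]
  apply Lp.ext
  have e1 : ∀ᵐ x, phaseOp (t • freeSymbol d) (𝓕 f) (x + -a)
      = Complex.exp (Complex.I * (t • freeSymbol d) (x + -a)) * 𝓕 f (x + -a) :=
    (measurePreserving_add (-a)).quasiMeasurePreserving.ae (coeFn_phaseOp (t • freeSymbol d) (𝓕 f))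
  filter_upwards [e1, coeFn_translation (-a) (phaseOp (t • freeSymbol d) (𝓕 f)),
    coeFn_translation (-a) (𝓕 f),
    coeFn_phaseOp (linSymbol ((2 * Real.pi * t) • a)) (translation (-a) (𝓕 f)),
    coeFn_phaseOp (t • freeSymbol d) (phaseOp (linSymbol ((2 * Real.pi * t) • a))
      (translation (-a) (𝓕 f))),
    Lp.coeFn_smul (Complex.exp (Complex.I * (-(2 * Real.pi ^ 2 * t * ‖a‖ ^ 2) : ℝ)))
      (phaseOp (t • freeSymbol d) (phaseOp (linSymbol ((2 * Real.pi * t) • a))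
      (translation (-a) (𝓕 f))))] with x h1 h2 h3 h4 h5 h6
  rw [h2, h1, h6, Pi.smul_apply, h5, h4, h3, smul_eq_mul, ← mul_assoc, ← mul_assoc,
    ← Complex.exp_add, ← Complex.exp_add]
  congr 2
  rw [← mul_add, ← mul_add]
  congr 1
  norm_cast
  rw [ContinuousMap.smul_apply, ContinuousMap.smul_apply, freeSymbol_apply, freeSymbol_apply,
    linSymbol_apply, ← sub_eq_add_neg, norm_sub_sq_real, inner_smul_left, real_inner_comm]
  simp
  ring

/-! ### An autocorrelation inequality -/

/-- Young's convolution inequality L^{4/3} * L^{4/3} ⊂ L², by two Cauchy–Schwarz inequalities.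
Writing ab = (ab)^{2/3}(ab)^{1/3} bounds the squared autocorrelation by ∫(ab)^{4/3} ∫(ab)^{2/3}. The
last factor is at most `A`, and Tonelli evaluates the remaining double integral as `A`². -/
theorem lintegral_autocorrelation_sq_le {g : Pt d → ℝ≥0∞} (hg : Measurable g) :
    ∫⁻ η, (∫⁻ x, g x * g (x + η)) ^ 2 ≤ (∫⁻ x, g x ^ (4 / 3 : ℝ)) ^ 3 := by
  set A := ∫⁻ x, g x ^ (4 / 3 : ℝ) with hA
  have hshift : ∀ η : Pt d, ∫⁻ x, g (x + η) ^ (4 / 3 : ℝ) = A := fun η =>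
    lintegral_add_right_eq_self (fun x => g x ^ (4 / 3 : ℝ)) η
  have hpt : ∀ η, (∫⁻ x, g x * g (x + η)) ^ 2
      ≤ (∫⁻ x, g x ^ (4 / 3 : ℝ) * g (x + η) ^ (4 / 3 : ℝ)) * A := by
    intro η
    have hgη : Measurable fun x => g (x + η) := hg.comp (measurable_add_const η)
    have hsplit : ∀ a b : ℝ≥0∞, a * b = (a ^ (4 / 3 : ℝ) * b ^ (4 / 3 : ℝ)) ^ (1 / 2 : ℝ) *
        (a ^ (2 / 3 : ℝ) * b ^ (2 / 3 : ℝ)) ^ (1 / 2 : ℝ) := by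
      intro a b
      rw [ENNReal.mul_rpow_of_nonneg _ _ (by norm_num : (0 : ℝ) ≤ 1 / 2),
        ENNReal.mul_rpow_of_nonneg _ _ (by norm_num : (0 : ℝ) ≤ 1 / 2), ← ENNReal.rpow_mul,
        ← ENNReal.rpow_mul, ← ENNReal.rpow_mul, ← ENNReal.rpow_mul, mul_mul_mul_comm,
        ← ENNReal.rpow_add_of_nonneg _ _ (by norm_num) (by norm_num),
        ← ENNReal.rpow_add_of_nonneg _ _ (by norm_num) (by norm_num)]
      norm_num
    have h1 : ∫⁻ x, g x * g (x + η) ≤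
        (∫⁻ x, g x ^ (4 / 3 : ℝ) * g (x + η) ^ (4 / 3 : ℝ)) ^ (1 / 2 : ℝ) *
        (∫⁻ x, g x ^ (2 / 3 : ℝ) * g (x + η) ^ (2 / 3 : ℝ)) ^ (1 / 2 : ℝ) := by
      have hcs := ENNReal.lintegral_mul_norm_pow_le (μ := (volume : Measure (Pt d)))
        (f := fun x => g x ^ (4 / 3 : ℝ) * g (x + η) ^ (4 / 3 : ℝ))
        (g := fun x => g x ^ (2 / 3 : ℝ) * g (x + η) ^ (2 / 3 : ℝ))
        (by fun_prop) (by fun_prop) (p := 1 / 2) (q := 1 / 2) (by norm_num) (by norm_num)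
        (by norm_num)
      refine le_trans (le_of_eq ?_) hcs
      congr 1
      ext x
      exact hsplit _ _
    have h2 : ∫⁻ x, g x ^ (2 / 3 : ℝ) * g (x + η) ^ (2 / 3 : ℝ) ≤ A := by
      have hcs := ENNReal.lintegral_mul_norm_pow_le (μ := (volume : Measure (Pt d)))
        (f := fun x => g x ^ (4 / 3 : ℝ))
        (g := fun x => g (x + η) ^ (4 / 3 : ℝ))
        (by fun_prop) (by fun_prop) (p := 1 / 2) (q := 1 / 2) (by norm_num) (by norm_num)
        (by norm_num)
      rw [hshift, ← ENNReal.rpow_add_of_nonneg _ _ (by norm_num) (by norm_num)] at hcs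
      norm_num at hcs
      refine le_trans (le_of_eq ?_) hcs
      congr 1
      ext x
      rw [← ENNReal.rpow_mul, ← ENNReal.rpow_mul]
      norm_num
    calc (∫⁻ x, g x * g (x + η)) ^ 2 ≤
        ((∫⁻ x, g x ^ (4 / 3 : ℝ) * g (x + η) ^ (4 / 3 : ℝ)) ^ (1 / 2 : ℝ) *
          A ^ (1 / 2 : ℝ)) ^ 2 := by
          gcongr
          exact h1.trans (by gcongr)
      _ = _ := by
          rw [mul_pow, ← ENNReal.rpow_natCast, ← ENNReal.rpow_natCast, ← ENNReal.rpow_mul,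
            ← ENNReal.rpow_mul]
          norm_num
  have hmeas : Measurable fun p : Pt d × Pt d => g p.2 ^ (4 / 3 : ℝ) * g (p.2 + p.1) ^ (4 / 3 : ℝ) := by
    fun_prop
  calc ∫⁻ η, (∫⁻ x, g x * g (x + η)) ^ 2
      ≤ ∫⁻ η, (∫⁻ x, g x ^ (4 / 3 : ℝ) * g (x + η) ^ (4 / 3 : ℝ)) * A := lintegral_mono hpt
    _ = (∫⁻ η, ∫⁻ x, g x ^ (4 / 3 : ℝ) * g (x + η) ^ (4 / 3 : ℝ)) * A := by
        rw [lintegral_mul_const]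
        exact hmeas.lintegral_prod_right'
    _ = (∫⁻ x, ∫⁻ η, g x ^ (4 / 3 : ℝ) * g (x + η) ^ (4 / 3 : ℝ)) * A := by
        rw [lintegral_lintegral_swap hmeas.aemeasurable]
    _ = A ^ 3 := by
        have h3 : ∀ x : Pt d, ∫⁻ η, g x ^ (4 / 3 : ℝ) * g (x + η) ^ (4 / 3 : ℝ)
            = g x ^ (4 / 3 : ℝ) * A := by
          intro x
          rw [lintegral_const_mul _ (by fun_prop)]
          congr 1
          exact lintegral_add_left_eq_self (fun y => g y ^ (4 / 3 : ℝ)) x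
        simp only [h3]
        rw [lintegral_mul_const _ (by fun_prop)]
        ring

/-! ### The dispersive estimate -/

/-- `|ψ|²` as a Schwartz function. -/
def normSqS (ψ : 𝓢(Pt d, ℂ)) : 𝓢(Pt d, ℂ) :=
  SchwartzMap.pairing (ContinuousLinearMap.mul ℝ ℂ)
    (SchwartzMap.postcompCLM (𝕜 := ℝ) (Complex.conjCLE : ℂ →L[ℝ] ℂ) ψ) ψ

theorem normSqS_apply (ψ : 𝓢(Pt d, ℂ)) (x : Pt d) :
    normSqS ψ x = starRingEnd ℂ (ψ x) * ψ x := by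
  simp [normSqS, SchwartzMap.pairing_apply_apply]

theorem norm_normSqS (ψ : 𝓢(Pt d, ℂ)) (x : Pt d) : ‖normSqS ψ x‖ = ‖ψ x‖ ^ 2 := by
  rw [normSqS_apply, norm_mul, RCLike.norm_conj, sq]

/-- Reading a Fourier coefficient of |ψ|² as a matrix element of a modulation makes the Galilean
transformation applicable. -/
theorem fourier_normSqS (ψ : 𝓢(Pt d, ℂ)) (η : Pt d) :
    𝓕 (normSqS ψ) η = inner ℂ (ψ.toLp 2 : L2 d) (modulation (-η) (ψ.toLp 2)) := by
  rw [SchwartzMap.fourier_coe, Real.fourier_eq', L2.inner_eq]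
  apply integral_congr_ae
  filter_upwards [ψ.coeFn_toLp 2 volume, coeFn_phaseOp (linSymbol (-η)) (ψ.toLp 2)] with x h1 h2
  rw [modulation, h2, h1, normSqS_apply, smul_eq_mul, linSymbol_apply, inner_neg_left,
    real_inner_comm]
  push_cast
  ring_nf

theorem enorm_cexp_I_mul (s : ℝ) : ‖Complex.exp (Complex.I * s)‖ₑ = 1 := by
  rw [← ofReal_norm, mul_comm, Complex.norm_exp_ofReal_mul_I, ENNReal.ofReal_one]

theorem enorm_inner_translation_phaseOp_le (a : Pt d) (θ : C(Pt d, ℝ)) (f : L2 d) :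
    ‖inner ℂ f (translation a (phaseOp θ f))‖ₑ ≤ ∫⁻ x, ‖f x‖ₑ * ‖f (x + a)‖ₑ := by
  rw [L2.inner_eq]
  refine (enorm_integral_le_lintegral_enorm _).trans (le_of_eq ?_)
  apply lintegral_congr_ae
  filter_upwards [coeFn_translation a (phaseOp θ f),
    (measurePreserving_add a).quasiMeasurePreserving.ae (coeFn_phaseOp θ f)] with x h1 h2
  rw [h1, h2, enorm_mul, enorm_mul, enorm_cexp_I_mul, one_mul]
  congr 1
  rw [← ofReal_norm, RCLike.norm_conj, ofReal_norm]

/-- The modulation passes through the free group at the price of a translation by -2πtη. The group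
then stands on both sides of the inner product and disappears, and phases are lost in the absolute
value. -/
theorem norm_fourier_normSqS_freeS_le (t : ℝ) (φ : 𝓢(Pt d, ℂ)) (η : Pt d) :
    ‖𝓕 (normSqS (freeS t φ)) η‖ₑ ≤
      ∫⁻ x, ‖φ x‖ₑ * ‖φ (x + (-(2 * Real.pi * t)) • η)‖ₑ := by
  rw [fourier_normSqS, ← freeGroup_toLp, modulation_freeGroup, inner_smul_right, enorm_mul,
    LinearIsometry.inner_map_map, enorm_cexp_I_mul, one_mul]
  refine (enorm_inner_translation_phaseOp_le _ _ _).trans (le_of_eq ?_)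
  have hφ : ∀ᵐ y, (φ.toLp 2 : L2 d) y = φ y := φ.coeFn_toLp 2 volume
  apply lintegral_congr_ae
  filter_upwards [hφ, (measurePreserving_add ((2 * Real.pi * t) • (-η))).quasiMeasurePreserving.ae
    hφ] with x h1 h2
  rw [h1, h2, smul_neg, neg_smul]

/-- The left side is the squared L² norm of |e^{i(t/2)Δ}φ|². After Plancherel the bound is an
autocorrelation evaluated at -2πtη, and rescaling η produces the decay |t|^{-d}. -/
theorem lintegral_freeS_pow_four_le {t : ℝ} (ht : t ≠ 0) (φ : 𝓢(Pt d, ℂ)) :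
    ∫⁻ x, ‖freeS t φ x‖ₑ ^ 4 ≤ ENNReal.ofReal ((2 * Real.pi * |t|) ^ d)⁻¹ *
      (∫⁻ x, ‖φ x‖ₑ ^ (4 / 3 : ℝ)) ^ 3 := by
  set c : ℝ := -(2 * Real.pi * t) with hc
  have hc0 : c ≠ 0 := by
    rw [hc, neg_ne_zero]
    have := Real.pi_pos
    positivity
  have h1 : ∫⁻ x, ‖freeS t φ x‖ₑ ^ 4 = ∫⁻ x, ‖normSqS (freeS t φ) x‖ₑ ^ 2 := by
    congr 1
    ext x
    rw [← ofReal_norm (normSqS _ _), norm_normSqS, ENNReal.ofReal_pow (norm_nonneg _), ofReal_norm,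
      ← pow_mul]
  have hpl : ∫⁻ x, ‖normSqS (freeS t φ) x‖ₑ ^ 2 = ∫⁻ η, ‖𝓕 (normSqS (freeS t φ)) η‖ₑ ^ 2 := by
    have hconv : ∀ χ : 𝓢(Pt d, ℂ), ∫⁻ x, ‖χ x‖ₑ ^ 2 = ENNReal.ofReal (∫ x, ‖χ x‖ ^ 2) := by
      intro χ
      rw [ofReal_integral_eq_lintegral_ofReal]
      · congr 1
        ext x
        rw [ENNReal.ofReal_pow (norm_nonneg _), ofReal_norm]
      · exact (memLp_two_iff_integrable_sq_norm χ.continuous.aestronglyMeasurable).1 (χ.memLp 2)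
      · exact ae_of_all _ fun x => by positivity
    rw [hconv, hconv, SchwartzMap.integral_norm_sq_fourier]
  set G : Pt d → ℝ≥0∞ := fun η => (∫⁻ x, ‖φ x‖ₑ * ‖φ (x + η)‖ₑ) ^ 2 with hG
  have hGm : Measurable G := by
    have hm : Measurable fun p : Pt d × Pt d => ‖φ p.2‖ₑ * ‖φ (p.2 + p.1)‖ₑ := by
      have := φ.continuous
      fun_prop
    exact hm.lintegral_prod_right'.pow_const 2
  have hscale : ∫⁻ η, G (c • η) = ENNReal.ofReal ((2 * Real.pi * |t|) ^ d)⁻¹ * ∫⁻ η, G η := by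
    have hmap := Measure.map_addHaar_smul (volume : Measure (Pt d)) hc0
    have h2 : ∫⁻ η, G (c • η) = ∫⁻ η, G η ∂(Measure.map (c • ·) volume) :=
      (lintegral_map hGm (measurable_const_smul c)).symm
    rw [h2, hmap, lintegral_smul_measure, smul_eq_mul]
    congr 2
    rw [finrank_euclideanSpace_fin, abs_inv, abs_pow, hc, abs_neg, abs_mul,
      abs_of_nonneg (by positivity : (0 : ℝ) ≤ 2 * Real.pi)]
  rw [h1, hpl]
  calc ∫⁻ η, ‖𝓕 (normSqS (freeS t φ)) η‖ₑ ^ 2 ≤ ∫⁻ η, G (c • η) :=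
        lintegral_mono fun η => pow_le_pow_left' (norm_fourier_normSqS_freeS_le t φ η) 2
    _ ≤ _ := by
        rw [hscale]
        gcongr
        exact lintegral_autocorrelation_sq_le (by have := φ.continuous; fun_prop)

/-! ### Density of Schwartz functions in `H¹` -/

theorem H1.exists_schwartz_norm_sub_lt (u : H1 d) {ε : ℝ} (hε : 0 < ε) :
    ∃ φ : 𝓢(Pt d, ℂ), ‖u - H1.ofSchwartz φ‖ < ε := by
  -- The weight identifies H¹ with L² on the Fourier side: w û is approximated in L² by a Schwartz
  -- function ψ, and φ is the inverse transform of ψ / w.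
  set w : Pt d → ℝ := fun ξ => (1 + ‖ξ‖ ^ 2) ^ (1 / 2 : ℝ) with hw
  set wi : Pt d → ℝ := fun ξ => (1 + ‖ξ‖ ^ 2) ^ (-1 / 2 : ℝ) with hwi
  have hwc : Continuous w := by
    refine Continuous.rpow_const (by fun_prop) fun x => Or.inl ?_
    positivity
  have hwit : Function.HasTemperateGrowth wi := by
    rw [hwi]; fun_prop
  have hwpos : ∀ ξ, 0 < w ξ := fun ξ => by positivity
  have hwiw : ∀ ξ, wi ξ = (w ξ)⁻¹ := fun ξ => by
    rw [hw, hwi, ← Real.rpow_neg (by positivity)]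
    norm_num
  have hw2 : ∀ ξ, w ξ ^ 2 = 1 + ‖ξ‖ ^ 2 := fun ξ => by
    rw [hw, ← Real.rpow_natCast, ← Real.rpow_mul (by positivity)]
    norm_num
  have hmem : MemLp (fun ξ => (w ξ : ℂ) * 𝓕 u.fn ξ) 2 := by
    have hm : AEStronglyMeasurable (fun ξ => (w ξ : ℂ) * 𝓕 u.fn ξ) :=
      (Complex.continuous_ofReal.comp hwc).aestronglyMeasurable.mul (Lp.aestronglyMeasurable _)
    rw [memLp_two_iff_integrable_sq_norm hm]
    have h1 := (L2.integrable_norm_sq (𝓕 u.fn)).add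
      (u.integrable_freeSymbol.const_mul ((2 * Real.pi ^ 2)⁻¹))
    refine h1.congr (ae_of_all _ fun ξ => ?_)
    have hpi := Real.pi_pos.ne'
    simp only [Pi.add_apply, norm_mul, mul_pow, Complex.norm_real, Real.norm_eq_abs, sq_abs, hw2,
      freeSymbol_apply, abs_neg]
    rw [abs_of_nonneg (by positivity)]
    field_simp
  set G : L2 d := hmem.toLp _ with hG
  -- The function costs 1 and each of the d derivatives costs 2π, so the H¹ error is at most (1 +
  -- 2πd)δ = ε/2.
  set δ : ℝ := ε / (2 * (1 + d * (2 * Real.pi))) with hδ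
  have hδ0 : 0 < δ := by have := Real.pi_pos; positivity
  obtain ⟨ψ, hψ⟩ : ∃ ψ : 𝓢(Pt d, ℂ), ‖G - ψ.toLp 2 volume‖ < δ := by
    have := Metric.denseRange_iff.1 (SchwartzMap.denseRange_toLpCLM (F := ℂ)
      (μ := (volume : Measure (Pt d))) (p := 2) ENNReal.ofNat_ne_top) G δ hδ0
    simpa [dist_eq_norm] using this
  set φ : 𝓢(Pt d, ℂ) := 𝓕⁻ (SchwartzMap.smulLeftCLM ℂ wi ψ) with hφ
  set v : H1 d := u - H1.ofSchwartz φ with hv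
  have hφL : 𝓕 (φ.toLp 2 : L2 d) = (SchwartzMap.smulLeftCLM ℂ wi ψ).toLp 2 volume := by
    rw [SchwartzMap.toLp_fourier_eq, hφ, FourierTransform.fourier_fourierInv_eq]
  have hae : ∀ᵐ ξ, w ξ * ‖𝓕 v.fn ξ‖ = ‖(G - ψ.toLp 2 volume : L2 d) ξ‖ := by
    have e1 : 𝓕 v.fn = 𝓕 u.fn - (SchwartzMap.smulLeftCLM ℂ wi ψ).toLp 2 volume := by
      rw [hv, H1.fn_sub, L2.fourier_sub, H1.ofSchwartz_fn, hφL]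
    rw [e1]
    filter_upwards [Lp.coeFn_sub (𝓕 u.fn) ((SchwartzMap.smulLeftCLM ℂ wi ψ).toLp 2 volume),
      (SchwartzMap.smulLeftCLM ℂ wi ψ).coeFn_toLp 2 volume, hmem.coeFn_toLp,
      ψ.coeFn_toLp 2 volume, Lp.coeFn_sub G (ψ.toLp 2 volume)] with ξ h1 h2 h3 h4 h5
    rw [h1, Pi.sub_apply, h2, h5, Pi.sub_apply, h3, h4,
      SchwartzMap.smulLeftCLM_apply_apply hwit, hwiw]
    have hn : ∀ z : ℂ, w ξ * ‖z‖ = ‖(w ξ : ℂ) * z‖ := fun z => by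
      rw [norm_mul, Complex.norm_real, Real.norm_of_nonneg (hwpos ξ).le]
    rw [hn, mul_sub]
    congr 2
    have hne : (w ξ : ℂ) ≠ 0 := by exact_mod_cast (hwpos ξ).ne'
    rw [Complex.real_smul]
    push_cast
    field_simp
  have hw1 : ∀ ξ, 1 ≤ w ξ := fun ξ => by
    nlinarith [hw2 ξ, hwpos ξ, sq_nonneg ‖ξ‖]
  have hwξ : ∀ ξ, ‖ξ‖ ≤ w ξ := fun ξ => by
    nlinarith [hw2 ξ, hwpos ξ, norm_nonneg ξ]
  have hA : ‖v.fn‖ ≤ ‖G - ψ.toLp 2 volume‖ := by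
    rw [← Lp.norm_fourier_eq]
    refine Lp.norm_le_norm_of_ae_le ?_
    filter_upwards [hae] with ξ hξ
    rw [← hξ]
    nlinarith [hw1 ξ, norm_nonneg (𝓕 v.fn ξ)]
  have hB : ∀ j, ‖v.grad j‖ ≤ 2 * Real.pi * ‖G - ψ.toLp 2 volume‖ := by
    intro j
    rw [← Lp.norm_fourier_eq]
    refine Lp.norm_le_mul_norm_of_ae_le_mul ?_
    filter_upwards [hae, v.fourier_grad j] with ξ hξ h2
    rw [← hξ, h2, norm_mul, norm_mul, Complex.norm_I, one_mul, Complex.norm_real,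
      coordSymbol_apply, norm_mul, Real.norm_of_nonneg (by positivity : (0 : ℝ) ≤ 2 * Real.pi),
      mul_assoc]
    have h3 : ‖ξ j‖ ≤ w ξ := (PiLp.norm_apply_le ξ j).trans (hwξ ξ)
    gcongr
  refine ⟨φ, ?_⟩
  have h1 := H1.norm_le_of_bounds hA (by positivity) hB
  have h2 : ‖G - ψ.toLp 2 volume‖ + d * (2 * Real.pi * ‖G - ψ.toLp 2 volume‖)
      ≤ (1 + d * (2 * Real.pi)) * δ := by
    have h4 : (0 : ℝ) ≤ 1 + d * (2 * Real.pi) := by have := Real.pi_pos; positivity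
    calc _ = (1 + d * (2 * Real.pi)) * ‖G - ψ.toLp 2 volume‖ := by ring
      _ ≤ _ := by gcongr
  have h3 : (1 + d * (2 * Real.pi)) * δ = ε / 2 := by
    have : (1 + d * (2 * Real.pi)) ≠ 0 := by have := Real.pi_pos; positivity
    rw [hδ]; field_simp
  linarith

/-! ### The Sobolev inequality for smooth functions with compact support -/

theorem eLpNorm_six_eq (u : Pt d → ℂ) : eLpNorm (fun x => u x ^ 3) 2 = eLpNorm u 6 ^ 3 := by
  have h := eLpNorm_norm_rpow (μ := (volume : Measure (Pt d))) (p := 2) u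
    (by norm_num : (0 : ℝ) < 3)
  have e : (2 : ℝ≥0∞) * ENNReal.ofReal 3 = 6 := by
    rw [ENNReal.ofReal_ofNat]; norm_num
  rw [e] at h
  have h2 : eLpNorm u 6 ^ (3 : ℝ) = eLpNorm u 6 ^ 3 := by
    rw [← ENNReal.rpow_natCast]; norm_num
  rw [← h2, ← h, ← eLpNorm_norm]
  congr 1
  ext x
  rw [norm_pow, ← Real.rpow_natCast]
  norm_num

theorem eLpNorm_le_add_mul {α F G H : Type*} [MeasurableSpace α] {μ : Measure α}
    [NormedAddCommGroup F] [NormedAddCommGroup G] [NormedAddCommGroup H] {p : ℝ≥0∞} (hp : 1 ≤ p)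
    {f : α → F} {g : α → G} {h : α → H} {M : ℝ} (hM : 0 ≤ M) (hg : AEStronglyMeasurable g μ)
    (hh : AEStronglyMeasurable h μ) (hf : ∀ᵐ x ∂μ, ‖f x‖ ≤ ‖g x‖ + M * ‖h x‖) :
    eLpNorm f p μ ≤ eLpNorm g p μ + ENNReal.ofReal M * eLpNorm h p μ := by
  have h1 : eLpNorm f p μ ≤ eLpNorm ((fun x => ‖g x‖) + fun x => M * ‖h x‖) p μ :=
    eLpNorm_mono_ae_real hf
  have h2 := eLpNorm_add_le hg.norm (hh.norm.const_mul M) hp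
  have h3 : eLpNorm (fun x => M * ‖h x‖) p μ ≤ ENNReal.ofReal M * eLpNorm h p μ := by
    refine eLpNorm_le_mul_eLpNorm_of_ae_le_mul (ae_of_all _ fun x => ?_) p
    rw [norm_mul, norm_norm, Real.norm_of_nonneg hM]
  rw [eLpNorm_norm g] at h2
  exact h1.trans (h2.trans (add_le_add le_rfl h3))

theorem eLpNorm_le_sum_of_norm_le {α ι F G : Type*} [MeasurableSpace α] {μ : Measure α}
    [NormedAddCommGroup F] [NormedAddCommGroup G] [Fintype ι] {p : ℝ≥0∞} (hp : 1 ≤ p)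
    {f : α → F} {g : ι → α → G} (hg : ∀ j, AEStronglyMeasurable (g j) μ)
    (hf : ∀ x, ‖f x‖ ≤ ∑ j, ‖g j x‖) : eLpNorm f p μ ≤ ∑ j, eLpNorm (g j) p μ := by
  have h1 : eLpNorm f p μ ≤ eLpNorm (∑ j, fun x => ‖g j x‖) p μ := by
    refine eLpNorm_mono_real fun x => ?_
    rw [Finset.sum_apply]
    exact hf x
  have h2 := eLpNorm_sum_le (s := Finset.univ) (f := fun j x => ‖g j x‖)
    (fun j _ => (hg j).norm) hp
  refine h1.trans (h2.trans (Finset.sum_le_sum fun j _ => ?_))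
  rw [eLpNorm_norm]

theorem eLpNorm_fderiv_pow_le {u : Pt d → ℂ} (hu : ContDiff ℝ 1 u) (n : ℕ) :
    eLpNorm (fderiv ℝ fun x => u x ^ (n + 1)) 1 ≤
      ENNReal.ofReal (n + 1) * (eLpNorm (fun x => u x ^ n) 2 * eLpNorm (fderiv ℝ u) 2) := by
  have hD : Continuous (fderiv ℝ u) := hu.continuous_fderiv (by norm_num)
  have h2 : ∀ x, ‖fderiv ℝ (fun x => u x ^ (n + 1)) x‖
      ≤ ((n : ℝ) + 1) * ‖((fun x => u x ^ n) • fderiv ℝ u) x‖ := by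
    intro x
    have := ((hu.differentiable (by norm_num) x).hasFDerivAt).pow (n + 1)
    rw [this.fderiv, Pi.smul_apply', norm_smul, nsmul_eq_mul, norm_mul,
      Complex.norm_natCast, add_tsub_cancel_right, norm_smul]
    push_cast
    exact (mul_assoc _ _ _).le
  have h3 := eLpNorm_le_mul_eLpNorm_of_ae_le_mul (μ := volume) (ae_of_all _ h2) 1
  have h4 : eLpNorm ((fun x => u x ^ n) • fderiv ℝ u) 1
      ≤ eLpNorm (fun x => u x ^ n) 2 * eLpNorm (fderiv ℝ u) 2 :=
    eLpNorm_smul_le_mul_eLpNorm (p := 2) (q := 2) (r := 1) (μ := (volume : Measure (Pt d)))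
      (φ := fun x => u x ^ n) (f := fderiv ℝ u) hD.aestronglyMeasurable
      (hu.continuous.pow n).aestronglyMeasurable
  exact h3.trans (mul_le_mul_right h4 _)

/-- In the plane ‖v‖₂ ≤ C‖∇v‖₁. For v = u^{n+1} Cauchy–Schwarz applies to ∇v = (n+1)uⁿ∇u. The two
steps n = 1, 2 climb from L² to L⁶. -/
theorem exists_eLpNorm_pow_succ_le : ∃ C : ℝ≥0, ∀ u : Pt 2 → ℂ, ContDiff ℝ 1 u →
    HasCompactSupport u → ∀ n : ℕ, eLpNorm (fun x => u x ^ (n + 1)) 2 ≤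
      C * (ENNReal.ofReal (n + 1) * (eLpNorm (fun x => u x ^ n) 2 * eLpNorm (fderiv ℝ u) 2)) := by
  refine ⟨eLpNormLESNormFDerivOneConst (volume : Measure (Pt 2)) (2 : ℝ≥0), fun u hu hc n => ?_⟩
  have hconj : NNReal.HolderConjugate (Module.finrank ℝ (Pt 2)) 2 := by
    rw [finrank_euclideanSpace_fin]
    exact ⟨by norm_num [← NNReal.coe_inj], by norm_num, by norm_num⟩
  have h1 := eLpNorm_le_eLpNorm_fderiv_one (volume : Measure (Pt 2)) (u := fun x => u x ^ (n + 1))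
    (hu.pow _) (hc.comp_left (g := fun z : ℂ => z ^ (n + 1)) (by simp)) hconj
  have h2 := h1.trans (mul_le_mul_right (eLpNorm_fderiv_pow_le hu n) _)
  exact_mod_cast h2

theorem le_mul_of_le_mul_of_le_mul {A D X Y : ℝ≥0∞} {C : ℝ≥0} (h1 : X ≤ C * (2 * (A * D)))
    (h2 : Y ≤ C * (3 * (X * D))) : Y ≤ (6 * C ^ 2 : ℝ≥0) * (A * D ^ 2) := by
  calc Y ≤ _ := h2
    _ ≤ C * (3 * ((C * (2 * (A * D))) * D)) := by gcongr
    _ = _ := by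
      push_cast
      ring

theorem exists_eLpNorm_six_pow_le : ∃ C : ℝ≥0, ∀ u : Pt 2 → ℂ, ContDiff ℝ 1 u →
    HasCompactSupport u → eLpNorm u 6 ^ 3 ≤ C * (eLpNorm u 2 * eLpNorm (fderiv ℝ u) 2 ^ 2) := by
  obtain ⟨C, hC⟩ := exists_eLpNorm_pow_succ_le
  refine ⟨6 * C ^ 2, fun u hu hc => ?_⟩
  have h1 := hC u hu hc 1
  have h2 := hC u hu hc 2
  simp only [pow_one] at h1
  rw [eLpNorm_six_eq] at h2
  have e1 : ENNReal.ofReal ((1 : ℕ) + 1) = 2 := by norm_num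
  have e2 : ENNReal.ofReal ((2 : ℕ) + 1) = 3 := by norm_num
  rw [e1] at h1
  rw [e2] at h2
  exact le_mul_of_le_mul_of_le_mul h1 h2

theorem exists_eLpNorm_six_le_of_compactSupport (hd : d = 2 ∨ d = 3) :
    ∃ C : ℝ≥0, ∀ u : Pt d → ℂ, ContDiff ℝ 1 u → HasCompactSupport u →
      eLpNorm u 6 ≤ C * (eLpNorm u 2 + eLpNorm (fderiv ℝ u) 2) := by
  rcases hd with rfl | rfl
  · obtain ⟨C₀, hC₀⟩ := exists_eLpNorm_six_pow_le
    refine ⟨C₀ + 1, fun u hu hc => ?_⟩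
    have h := hC₀ u hu hc
    refine (ENNReal.pow_le_pow_left_iff (n := 3) (by norm_num)).1 ?_
    refine h.trans ?_
    set N := eLpNorm u 2
    set D := eLpNorm (fderiv ℝ u) 2
    have h1 : N * D ^ 2 ≤ (N + D) ^ 3 := by
      calc N * D ^ 2 ≤ (N + D) * (N + D) ^ 2 := by gcongr <;> simp
        _ = _ := by ring
    have h2 : (C₀ : ℝ≥0∞) ≤ ((C₀ + 1 : ℝ≥0) : ℝ≥0∞) ^ 3 := by
      have : C₀ ≤ (C₀ + 1) ^ 3 := by
        refine le_trans (le_add_of_nonneg_right zero_le_one) ?_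
        exact le_self_pow₀ (by simp) (by norm_num)
      exact_mod_cast this
    rw [mul_pow]
    gcongr
  -- In dimension three 6 is the critical Sobolev exponent, so the gradient alone suffices.
  · refine ⟨SNormLESNormFDerivOfEqConst ℂ (volume : Measure (Pt 3)) 2, fun u hu hc => ?_⟩
    have := eLpNorm_le_eLpNorm_fderiv_of_eq (volume : Measure (Pt 3)) hu hc (p := 2) (p' := 6)
      (by norm_num) (by simp) (by rw [finrank_euclideanSpace_fin]; norm_num)
    refine (le_trans (by exact_mod_cast this) ?_)
    gcongr
    simp

/-- Cut off by χ(x/(k+1)). The gradient of the cutoff is bounded uniformly in k, which costs only a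
multiple of ‖φ‖₂, and Fatou's lemma removes the cutoff. -/
theorem exists_eLpNorm_six_le_schwartz (hd : d = 2 ∨ d = 3) :
    ∃ C : ℝ≥0, ∀ φ : 𝓢(Pt d, ℂ), eLpNorm φ 6 ≤ C * (eLpNorm φ 2 + eLpNorm (fderiv ℝ φ) 2) := by
  obtain ⟨C, hC⟩ := exists_eLpNorm_six_le_of_compactSupport hd
  let χ : ContDiffBump (0 : Pt d) := ⟨1, 2, one_pos, one_lt_two⟩
  have hχD : Continuous (fderiv ℝ χ) := (χ.contDiff (n := 1)).continuous_fderiv (by norm_num)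
  obtain ⟨M, hM⟩ := hχD.bounded_above_of_compact_support (χ.hasCompactSupport.fderiv ℝ)
  have hM0 : 0 ≤ M := (norm_nonneg _).trans (hM 0)
  refine ⟨C * (2 + M.toNNReal), fun φ => ?_⟩
  set c : ℕ → ℝ := fun k => ((k : ℝ) + 1)⁻¹ with hc
  have hc0 : ∀ k, 0 < c k := fun k => by positivity
  have hc1 : ∀ k, c k ≤ 1 := fun k => inv_le_one_of_one_le₀ (by simp)
  set v : ℕ → Pt d → ℂ := fun k x => χ (c k • x) • φ x with hv
  have hφ1 : ContDiff ℝ 1 φ := φ.smooth 1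
  have hχk : ∀ k, ContDiff ℝ 1 fun x : Pt d => χ (c k • x) := fun k =>
    χ.contDiff.comp (contDiff_const_smul _)
  have hv1 : ∀ k, ContDiff ℝ 1 (v k) := fun k => (hχk k).smul hφ1
  have hvc : ∀ k, HasCompactSupport (v k) := fun k =>
    (χ.hasCompactSupport.comp_smul (hc0 k).ne').smul_right
  have hvle : ∀ k x, ‖v k x‖ ≤ ‖φ x‖ := fun k x => by
    rw [hv]
    simp only [norm_smul, Real.norm_of_nonneg χ.nonneg]
    exact mul_le_of_le_one_left (norm_nonneg _) χ.le_one
  have hDle : ∀ k x, ‖fderiv ℝ (v k) x‖ ≤ ‖fderiv ℝ φ x‖ + M * ‖φ x‖ := fun k x => by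
    have h1 : HasFDerivAt (fun x : Pt d => χ (c k • x))
        ((fderiv ℝ χ (c k • x)).comp (c k • ContinuousLinearMap.id ℝ (Pt d))) x :=
      ((χ.contDiff (n := 1)).differentiable (by norm_num) _).hasFDerivAt.comp x
        ((hasFDerivAt_id x).const_smul (c k))
    have h2 := h1.smul (hφ1.differentiable (by norm_num) x).hasFDerivAt
    have h2' : HasFDerivAt (v k) _ x := h2
    rw [h2'.fderiv]
    refine (norm_add_le _ _).trans (add_le_add ?_ ?_)
    · rw [norm_smul, Real.norm_of_nonneg χ.nonneg]
      exact mul_le_of_le_one_left (norm_nonneg _) χ.le_one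
    · rw [ContinuousLinearMap.norm_smulRight_apply]
      refine mul_le_mul_of_nonneg_right ?_ (norm_nonneg _)
      refine (ContinuousLinearMap.opNorm_comp_le _ _).trans ?_
      rw [norm_smul, Real.norm_of_nonneg (hc0 k).le]
      have h3 : c k * ‖ContinuousLinearMap.id ℝ (Pt d)‖ ≤ 1 := by
        nlinarith [hc0 k, hc1 k, ContinuousLinearMap.norm_id_le (𝕜 := ℝ) (E := Pt d),
          norm_nonneg (ContinuousLinearMap.id ℝ (Pt d))]
      nlinarith [hM (c k • x), norm_nonneg (fderiv ℝ χ (c k • x))]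
  have hbound : ∀ k, eLpNorm (v k) 6
      ≤ (C * (2 + M.toNNReal) : ℝ≥0) * (eLpNorm φ 2 + eLpNorm (fderiv ℝ φ) 2) := by
    intro k
    refine (hC (v k) (hv1 k) (hvc k)).trans ?_
    have h1 : eLpNorm (v k) 2 ≤ eLpNorm φ 2 := eLpNorm_mono (hvle k)
    have hDφ : Continuous (fderiv ℝ φ) := hφ1.continuous_fderiv (by norm_num)
    have h2 := eLpNorm_le_add_mul (μ := volume) (p := 2) (by norm_num) hM0
      hDφ.aestronglyMeasurable φ.continuous.aestronglyMeasurable (ae_of_all _ (hDle k))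
    change _ ≤ _ + (M.toNNReal : ℝ≥0∞) * _ at h2
    rw [ENNReal.coe_mul, mul_assoc]
    refine mul_le_mul_right ((add_le_add h1 h2).trans ?_) _
    generalize eLpNorm φ 2 volume = A
    generalize eLpNorm (fderiv ℝ φ) 2 volume = D
    push_cast
    calc _ ≤ (A + (D + M.toNNReal * A)) + (A + (D + M.toNNReal * D)) := le_self_add
      _ = _ := by ring
  have hlim : ∀ᵐ x, Tendsto (fun k => v k x) atTop (𝓝 (φ x)) := by
    refine ae_of_all _ fun x => ?_
    have h1 : Tendsto (fun k : ℕ => c k • x) atTop (𝓝 ((0 : ℝ) • x)) :=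
      (tendsto_inv_atTop_zero.comp (tendsto_atTop_add_const_right _ _
        tendsto_natCast_atTop_atTop)).smul_const x
    rw [zero_smul] at h1
    have h2 := ((χ.continuous.tendsto 0).comp h1).smul_const (φ x)
    have h3 : χ 0 = 1 := χ.one_of_mem_closedBall (by simp [χ])
    rw [h3, one_smul] at h2
    exact h2
  refine (Lp.eLpNorm_lim_le_liminf_eLpNorm (fun k => (hv1 k).continuous.aestronglyMeasurable)
    _ hlim).trans ?_
  exact (liminf_le_liminf (Eventually.of_forall hbound)
        (by isBoundedDefault) (by isBoundedDefault)).trans (liminf_const _).le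

/-! ### The Sobolev embedding on H¹ by density. -/

/-- Lower semicontinuity of Lebesgue norms under convergence in `L²`. -/
theorem eLpNorm_le_of_tendsto_L2 {f : ℕ → L2 d} {f₀ : L2 d} (h : Tendsto f atTop (𝓝 f₀))
    {p B : ℝ≥0∞} (hB : ∀ n, eLpNorm (f n) p ≤ B) : eLpNorm f₀ p ≤ B := by
  obtain ⟨ns, -, hns⟩ := (tendstoInMeasure_of_tendsto_Lp h).exists_seq_tendsto_ae
  refine (Lp.eLpNorm_lim_le_liminf_eLpNorm (fun k => Lp.aestronglyMeasurable (f (ns k)))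
    _ hns).trans ?_
  exact (liminf_le_liminf (Eventually.of_forall fun k => hB (ns k))
        (by isBoundedDefault) (by isBoundedDefault)).trans (liminf_const _).le

theorem norm_clm_le_sum (L : Pt d →L[ℝ] ℂ) : ‖L‖ ≤ ∑ j, ‖L (EuclideanSpace.single j 1)‖ := by
  refine L.opNorm_le_bound (by positivity) fun x => ?_
  have hx : x = ∑ j, x j • EuclideanSpace.single j (1 : ℝ) := by
    ext i
    simp [Finset.sum_apply, Pi.single_apply]
  calc ‖L x‖ = ‖∑ j, x j • L (EuclideanSpace.single j 1)‖ := by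
        conv_lhs => rw [hx]
        rw [map_sum]
        simp only [map_smul]
    _ ≤ ∑ j, ‖x j • L (EuclideanSpace.single j 1)‖ := norm_sum_le _ _
    _ ≤ ∑ j, ‖x‖ * ‖L (EuclideanSpace.single j 1)‖ := by
        refine Finset.sum_le_sum fun j _ => ?_
        rw [norm_smul]
        gcongr
        exact PiLp.norm_apply_le x j
    _ = _ := by rw [← Finset.mul_sum, mul_comm]

theorem eLpNorm_toLp_two (φ : 𝓢(Pt d, ℂ)) :
    eLpNorm φ 2 = ENNReal.ofReal ‖(φ.toLp 2 : L2 d)‖ := by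
  rw [SchwartzMap.norm_toLp (μ := volume), ENNReal.ofReal_toReal (φ.eLpNorm_lt_top 2 volume).ne]

/-- The Sobolev embedding `H¹ ⊂ L⁶` in dimensions two and three. -/
theorem exists_eLpNorm_six_le (hd : d = 2 ∨ d = 3) :
    ∃ C : ℝ, 0 < C ∧ ∀ u : H1 d, eLpNorm u.fn 6 ≤ ENNReal.ofReal (C * ‖u‖) := by
  obtain ⟨C, hC⟩ := exists_eLpNorm_six_le_schwartz hd
  have hS : ∀ φ : 𝓢(Pt d, ℂ), eLpNorm (H1.ofSchwartz φ).fn 6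
      ≤ ENNReal.ofReal ((C * (1 + d) + 1) * ‖H1.ofSchwartz φ‖) := by
    intro φ
    set N := ‖H1.ofSchwartz φ‖
    have h1 : eLpNorm φ 2 ≤ ENNReal.ofReal N := by
      rw [eLpNorm_toLp_two]
      exact ENNReal.ofReal_le_ofReal (H1.ofSchwartz φ).norm_fn_le
    have h2 : eLpNorm (fderiv ℝ φ) 2 ≤ d * ENNReal.ofReal N := by
      refine (eLpNorm_le_sum_of_norm_le (by norm_num)
        (g := fun j : Fin d => (∂_{EuclideanSpace.single j (1 : ℝ)} φ : 𝓢(Pt d, ℂ)))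
        (fun j => (SchwartzMap.continuous _).aestronglyMeasurable)
        (fun x => norm_clm_le_sum _)).trans ?_
      have h4 : ∀ j : Fin d, eLpNorm (∂_{EuclideanSpace.single j (1 : ℝ)} φ : 𝓢(Pt d, ℂ)) 2
          ≤ ENNReal.ofReal N := fun j => by
        rw [eLpNorm_toLp_two]
        exact ENNReal.ofReal_le_ofReal ((H1.ofSchwartz φ).norm_grad_apply_le j)
      refine (Finset.sum_le_sum fun j _ => h4 j).trans_eq ?_
      simp
    have h3 : eLpNorm (H1.ofSchwartz φ).fn 6 = eLpNorm φ 6 :=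
      eLpNorm_congr_ae (φ.coeFn_toLp 2 volume)
    rw [h3]
    refine (hC φ).trans ?_
    have hN : 0 ≤ N := norm_nonneg _
    rw [ENNReal.ofReal_mul (by positivity)]
    have h5 : ENNReal.ofReal (C * (1 + d) + 1) = C * (1 + d) + 1 := by
      rw [ENNReal.ofReal_add (by positivity) (by norm_num), ENNReal.ofReal_mul (by positivity),
        ENNReal.ofReal_add (by norm_num) (by positivity)]
      simp
    rw [h5]
    refine (mul_le_mul_right (add_le_add h1 h2) _).trans ?_
    generalize ENNReal.ofReal N = X
    calc C * (X + d * X) ≤ C * (X + d * X) + X := le_self_add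
      _ = _ := by ring
  refine ⟨C * (1 + d) + 1, by positivity, fun u => ?_⟩
  -- The approximants may have slightly larger H¹ norm than u, hence the slack δ. The L⁶ norm passes
  -- to the limit by lower semicontinuity, and δ tends to 0 at the end.
  have happ : ∀ δ : ℝ, 0 < δ → eLpNorm u.fn 6 ≤ ENNReal.ofReal ((C * (1 + d) + 1) * (‖u‖ + δ)) := by
    intro δ hδ
    have : ∀ n : ℕ, ∃ φ : 𝓢(Pt d, ℂ), ‖u - H1.ofSchwartz φ‖ < δ / (n + 1) := fun n =>
      u.exists_schwartz_norm_sub_lt (by positivity)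
    choose φ hφ using this
    have hδn : Tendsto (fun n : ℕ => δ / ((n : ℝ) + 1)) atTop (𝓝 0) := by
      simpa [div_eq_mul_inv] using
        (tendsto_one_div_add_atTop_nhds_zero_nat (𝕜 := ℝ)).const_mul δ
    refine eLpNorm_le_of_tendsto_L2 (f := fun n => (H1.ofSchwartz (φ n)).fn) ?_ fun n => ?_
    · rw [tendsto_iff_norm_sub_tendsto_zero]
      refine squeeze_zero (fun _ => norm_nonneg _) (fun n => ?_)
        hδn
      rw [norm_sub_rev]
      exact ((u - H1.ofSchwartz (φ n)).norm_fn_le).trans (hφ n).le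
    · refine (hS (φ n)).trans (ENNReal.ofReal_le_ofReal ?_)
      have h1 : ‖H1.ofSchwartz (φ n)‖ ≤ ‖u‖ + ‖u - H1.ofSchwartz (φ n)‖ := by
        rw [norm_sub_rev]
        exact norm_le_norm_add_norm_sub' _ _
      have h2 : δ / ((n : ℝ) + 1) ≤ δ := div_le_self hδ.le (by simp)
      have := hφ n
      gcongr
      linarith
  have hlim : Tendsto (fun δ : ℝ => ENNReal.ofReal ((C * (1 + d) + 1) * (‖u‖ + δ))) (𝓝[>] 0)
      (𝓝 (ENNReal.ofReal ((C * (1 + d) + 1) * (‖u‖ + 0)))) :=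
    ((ENNReal.continuous_ofReal.comp (by fun_prop : Continuous fun δ : ℝ =>
      (C * (1 + d) + 1) * (‖u‖ + δ))).tendsto 0).mono_left nhdsWithin_le_nhds
  rw [add_zero] at hlim
  exact ge_of_tendsto hlim (eventually_mem_nhdsWithin.mono fun δ hδ => happ δ hδ)

section

/-! ### Lipschitz nonlinearities with gauge invariance -/

/-- A globally Lipschitz nonlinearity of the form `z ↦ c(|z|) z` with a real coefficient. -/
structure GaugeNonlinearity where
  /-- The nonlinearity. -/
  toFun : ℂ → ℂ
  /-- The coefficient, as a function of the modulus. -/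
  coeff : ℝ → ℝ
  eq_mul : ∀ z, toFun z = (coeff ‖z‖ : ℂ) * z
  /-- The Lipschitz constant. -/
  lipConst : ℝ≥0
  lipschitz : LipschitzWith lipConst toFun

namespace GaugeNonlinearity

variable (g : GaugeNonlinearity)

theorem zero_apply : g.toFun 0 = 0 := by rw [g.eq_mul]; simp

theorem norm_sub_le (z w : ℂ) : ‖g.toFun z - g.toFun w‖ ≤ g.lipConst * ‖z - w‖ :=
  g.lipschitz.norm_sub_le z w

theorem norm_apply_le (z : ℂ) : ‖g.toFun z‖ ≤ g.lipConst * ‖z‖ := by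
  simpa [g.zero_apply] using g.norm_sub_le z 0

theorem apply_ofReal {t : ℝ} (ht : 0 ≤ t) : g.toFun t = ((g.coeff t * t : ℝ) : ℂ) := by
  rw [g.eq_mul, Complex.norm_real, Real.norm_of_nonneg ht]
  push_cast
  rfl

/-- The potential of the nonlinearity: its gradient, with respect to the real inner product on
`ℂ`, is the nonlinearity. -/
def potential (z : ℂ) : ℝ := ∫ t in (0 : ℝ)..‖z‖, (g.toFun t).re

theorem continuous_re : Continuous fun t : ℝ => (g.toFun t).re :=
  Complex.continuous_re.comp (g.lipschitz.continuous.comp Complex.continuous_ofReal)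

theorem potential_sub (z w : ℂ) :
    g.potential w - g.potential z = ∫ t in ‖z‖..‖w‖, (g.toFun t).re :=
  intervalIntegral.integral_interval_sub_left (g.continuous_re.intervalIntegrable _ _)
    (g.continuous_re.intervalIntegrable _ _)

theorem potential_zero : g.potential 0 = 0 := by simp [potential]

/-- Taylor's formula from the Lipschitz property alone. Along the modulus, the integrand varies by
at most the Lipschitz constant times | |b| - |a| |. The angular part is the coefficient at |a| times
|a||b| - Re(āb), which is at most |b - a|²/2. -/
theorem abs_potential_sub_sub_le (a b : ℂ) :
    |g.potential b - g.potential a - (starRingEnd ℂ (g.toFun a) * (b - a)).re|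
      ≤ 2 * g.lipConst * ‖b - a‖ ^ 2 := by
  have hn : |‖b‖ - ‖a‖| ≤ ‖b - a‖ := abs_norm_sub_norm_le b a
  have hK : (0 : ℝ) ≤ g.lipConst := g.lipConst.2
  have h1 : |(∫ t in ‖a‖..‖b‖, (g.toFun t).re) - (g.toFun (‖a‖ : ℝ)).re * (‖b‖ - ‖a‖)|
      ≤ g.lipConst * ‖b - a‖ ^ 2 := by
    have e : (∫ t in ‖a‖..‖b‖, (g.toFun t).re) - (g.toFun (‖a‖ : ℝ)).re * (‖b‖ - ‖a‖)
        = ∫ t in ‖a‖..‖b‖, ((g.toFun t).re - (g.toFun (‖a‖ : ℝ)).re) := by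
      rw [intervalIntegral.integral_sub (g.continuous_re.intervalIntegrable _ _)
        intervalIntegrable_const, intervalIntegral.integral_const, smul_eq_mul]
      ring
    rw [e, ← Real.norm_eq_abs]
    have h2 := intervalIntegral.norm_integral_le_of_norm_le_const
      (f := fun t : ℝ => (g.toFun t).re - (g.toFun (‖a‖ : ℝ)).re) (a := ‖a‖) (b := ‖b‖)
      (C := g.lipConst * |‖b‖ - ‖a‖|) fun t ht => by
        rw [← Complex.sub_re]
        refine (Complex.abs_re_le_norm _).trans ((g.norm_sub_le _ _).trans ?_)
        refine mul_le_mul_of_nonneg_left ?_ hK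
        rw [← Complex.ofReal_sub, Complex.norm_real, Real.norm_eq_abs]
        have h3 := Set.uIoc_subset_uIcc ht
        exact Set.abs_sub_left_of_mem_uIcc h3
    refine h2.trans ?_
    rw [mul_assoc, ← sq]
    gcongr
  rw [g.potential_sub]
  have h2 : |(g.toFun (‖a‖ : ℝ)).re * (‖b‖ - ‖a‖) - (starRingEnd ℂ (g.toFun a) * (b - a)).re|
      ≤ g.lipConst * ‖b - a‖ ^ 2 := by
    rw [g.apply_ofReal (norm_nonneg a), Complex.ofReal_re, g.eq_mul a]
    have e1 : (starRingEnd ℂ ((g.coeff ‖a‖ : ℂ) * a) * (b - a)).re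
        = g.coeff ‖a‖ * ((starRingEnd ℂ a * b).re - ‖a‖ ^ 2) := by
      have : ‖a‖ ^ 2 = (starRingEnd ℂ a * a).re := by
        rw [Complex.conj_mul', ← Complex.ofReal_pow, Complex.ofReal_re]
      rw [map_mul, Complex.conj_ofReal, mul_assoc, Complex.re_ofReal_mul, mul_sub, Complex.sub_re,
        this]
    rw [e1]
    have e2 : ‖b - a‖ ^ 2 = ‖b‖ ^ 2 + ‖a‖ ^ 2 - 2 * (starRingEnd ℂ a * b).re := by
      rw [← Complex.normSq_eq_norm_sq, ← Complex.normSq_eq_norm_sq, ← Complex.normSq_eq_norm_sq,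
        Complex.normSq_sub]
      congr 2
      rw [mul_comm, ← Complex.conj_re]
    have e3 : (starRingEnd ℂ a * b).re ≤ ‖a‖ * ‖b‖ := by
      refine (Complex.re_le_norm _).trans ?_
      simp
    have e4 : |g.coeff ‖a‖| * ‖a‖ ≤ g.lipConst * ‖a‖ := by
      have := g.norm_apply_le a
      rwa [g.eq_mul, norm_mul, Complex.norm_real, Real.norm_eq_abs] at this
    have e5 : g.coeff ‖a‖ * ‖a‖ * (‖b‖ - ‖a‖)
        - g.coeff ‖a‖ * ((starRingEnd ℂ a * b).re - ‖a‖ ^ 2)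
        = g.coeff ‖a‖ * (‖a‖ * ‖b‖ - (starRingEnd ℂ a * b).re) := by ring
    rw [e5, abs_mul, abs_of_nonneg (sub_nonneg.2 e3)]
    rcases (norm_nonneg a).eq_or_lt with h0 | h0
    · have ha : a = 0 := norm_eq_zero.1 h0.symm
      subst ha
      simp only [map_zero, zero_mul, Complex.zero_re, norm_zero, mul_zero, sub_zero]
      positivity
    · have h6 : |g.coeff ‖a‖| ≤ g.lipConst := le_of_mul_le_mul_right e4 h0
      refine mul_le_mul h6 ?_ (sub_nonneg.2 e3) hK
      nlinarith [sq_nonneg (‖a‖ - ‖b‖), sq_nonneg ‖b - a‖]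
  have := abs_add_le ((∫ t in ‖a‖..‖b‖, (g.toFun t).re) - (g.toFun (‖a‖ : ℝ)).re * (‖b‖ - ‖a‖))
    ((g.toFun (‖a‖ : ℝ)).re * (‖b‖ - ‖a‖) - (starRingEnd ℂ (g.toFun a) * (b - a)).re)
  rw [sub_add_sub_cancel] at this
  linarith

theorem abs_potential_le (z : ℂ) : |g.potential z| ≤ 2 * g.lipConst * ‖z‖ ^ 2 := by
  simpa [g.potential_zero, g.zero_apply] using g.abs_potential_sub_sub_le 0 z

theorem continuous_potential : Continuous g.potential := by
  refine (?_ : Continuous fun r : ℝ => ∫ t in (0 : ℝ)..r, (g.toFun t).re).comp continuous_norm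
  exact intervalIntegral.continuous_primitive
    (fun a b => g.continuous_re.intervalIntegrable a b) 0

end GaugeNonlinearity

/-! ### Truncations of the cubic-quartic nonlinearity -/

/-- The coefficient of the truncated nonlinearity. -/
def cutoffCoeff (R r : ℝ) : ℝ := -(min r R) ^ 2 + (min r R) ^ 3

/-- The difference is split into the larger point's coefficient times z - w, plus the difference of
coefficients times z. The latter vanishes if both moduli exceed R. Otherwise |z| is the truncated
modulus itself, so no unbounded factor is left over. -/
theorem norm_cutoff_sub_le_of_le {R : ℝ} (hR : 0 ≤ R) {z w : ℂ} (h : ‖z‖ ≤ ‖w‖) :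
    ‖(cutoffCoeff R ‖z‖ : ℂ) * z - (cutoffCoeff R ‖w‖ : ℂ) * w‖
      ≤ (3 * (min ‖w‖ R) ^ 2 + 4 * (min ‖w‖ R) ^ 3) * ‖z - w‖ := by
  set n := min ‖w‖ R with hn
  set m := min ‖z‖ R with hm
  have hn0 : 0 ≤ n := le_min (norm_nonneg _) hR
  have hm0 : 0 ≤ m := le_min (norm_nonneg _) hR
  have hmn : m ≤ n := min_le_min_right _ h
  have e : (cutoffCoeff R ‖z‖ : ℂ) * z - (cutoffCoeff R ‖w‖ : ℂ) * w
      = (cutoffCoeff R ‖w‖ : ℂ) * (z - w) + ((cutoffCoeff R ‖z‖ - cutoffCoeff R ‖w‖ : ℝ) : ℂ) * z := by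
    push_cast; ring
  have h1 : |cutoffCoeff R ‖w‖| ≤ n ^ 2 + n ^ 3 := by
    rw [cutoffCoeff, ← hn, abs_le]
    constructor <;> nlinarith [pow_nonneg hn0 2, pow_nonneg hn0 3]
  have h2 : |cutoffCoeff R ‖z‖ - cutoffCoeff R ‖w‖| * ‖z‖ ≤ (2 * n ^ 2 + 3 * n ^ 3) * ‖z - w‖ := by
    have h0 : 0 ≤ (2 * n ^ 2 + 3 * n ^ 3) * ‖z - w‖ := by positivity
    rcases le_or_gt R ‖z‖ with hz | hz
    · have : m = n := by rw [hm, hn, min_eq_right hz, min_eq_right (hz.trans h)]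
      rw [cutoffCoeff, cutoffCoeff, ← hm, ← hn, this]
      simpa using h0
    · have hmz : ‖z‖ = m := by rw [hm, min_eq_left hz.le]
      have hd : n - m ≤ ‖z - w‖ := by
        have h3 : n ≤ ‖w‖ := min_le_left _ _
        have h4 := norm_sub_norm_le w z
        rw [norm_sub_rev] at h4
        linarith [hmz]
      have h5 : |cutoffCoeff R ‖z‖ - cutoffCoeff R ‖w‖|
          ≤ (n - m) * ((n + m) + (n ^ 2 + n * m + m ^ 2)) := by
        rw [cutoffCoeff, cutoffCoeff, ← hm, ← hn, abs_le]
        have p1 : 0 ≤ (n - m) * (n + m) := mul_nonneg (by linarith) (by linarith)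
        have p2 : 0 ≤ (n - m) * (n ^ 2 + n * m + m ^ 2) := mul_nonneg (by linarith) (by positivity)
        constructor <;> nlinarith
      have h6 : ((n + m) + (n ^ 2 + n * m + m ^ 2)) * m ≤ 2 * n ^ 2 + 3 * n ^ 3 := by
        have q1 : (n + m) * m ≤ (n + n) * n := by gcongr
        have q2 : (n ^ 2 + n * m + m ^ 2) * m ≤ (n ^ 2 + n * n + n ^ 2) * n := by gcongr
        nlinarith
      rw [hmz] at h5 ⊢
      calc _ ≤ (n - m) * ((n + m) + (n ^ 2 + n * m + m ^ 2)) * m :=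
            mul_le_mul_of_nonneg_right h5 hm0
        _ = (((n + m) + (n ^ 2 + n * m + m ^ 2)) * m) * (n - m) := by ring
        _ ≤ _ := mul_le_mul h6 hd (by linarith) (by positivity)
  rw [e]
  refine (norm_add_le _ _).trans ?_
  rw [norm_mul, norm_mul, Complex.norm_real, Complex.norm_real, Real.norm_eq_abs, Real.norm_eq_abs]
  have h3 := mul_le_mul_of_nonneg_right h1 (norm_nonneg (z - w))
  linarith

/-- The bound on the increments of the nonlinearity and of its truncations. -/
theorem norm_cutoff_sub_le {R : ℝ} (hR : 0 ≤ R) (z w : ℂ) :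
    ‖(cutoffCoeff R ‖z‖ : ℂ) * z - (cutoffCoeff R ‖w‖ : ℂ) * w‖
      ≤ 7 * (‖z‖ + ‖z‖ ^ 3 + ‖w‖ + ‖w‖ ^ 3) * ‖z - w‖ := by
  have key : ∀ z w : ℂ, ‖z‖ ≤ ‖w‖ → ‖(cutoffCoeff R ‖z‖ : ℂ) * z - (cutoffCoeff R ‖w‖ : ℂ) * w‖
      ≤ 7 * (‖z‖ + ‖z‖ ^ 3 + ‖w‖ + ‖w‖ ^ 3) * ‖z - w‖ := by
    intro z w h
    refine (norm_cutoff_sub_le_of_le hR h).trans (mul_le_mul_of_nonneg_right ?_ (norm_nonneg _))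
    have h1 : min ‖w‖ R ≤ ‖w‖ := min_le_left _ _
    have h2 : 0 ≤ min ‖w‖ R := le_min (norm_nonneg _) hR
    have h3 : (min ‖w‖ R) ^ 2 ≤ ‖w‖ ^ 2 := by gcongr
    have h4 : (min ‖w‖ R) ^ 3 ≤ ‖w‖ ^ 3 := by gcongr
    have h5 : ‖w‖ ^ 2 ≤ ‖w‖ + ‖w‖ ^ 3 := by
      nlinarith [norm_nonneg w, sq_nonneg (‖w‖ - 1), mul_nonneg (norm_nonneg w) (sq_nonneg (‖w‖ - 1))]
    nlinarith [norm_nonneg z, norm_nonneg w, pow_nonneg (norm_nonneg z) 3,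
      pow_nonneg (norm_nonneg w) 3]
  rcases le_total ‖z‖ ‖w‖ with h | h
  · exact key z w h
  · rw [norm_sub_rev, norm_sub_rev z w]
    refine (key w z h).trans_eq ?_
    ring

/-- The truncated cubic-quartic nonlinearity. -/
def cutoffNL (R : ℝ) (hR : 0 ≤ R) : GaugeNonlinearity where
  toFun z := (cutoffCoeff R ‖z‖ : ℂ) * z
  coeff := cutoffCoeff R
  eq_mul _ := rfl
  lipConst := (3 * R ^ 2 + 4 * R ^ 3).toNNReal
  lipschitz := by
    have key : ∀ z w : ℂ, ‖z‖ ≤ ‖w‖ →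
        ‖(cutoffCoeff R ‖z‖ : ℂ) * z - (cutoffCoeff R ‖w‖ : ℂ) * w‖
          ≤ (3 * R ^ 2 + 4 * R ^ 3) * ‖z - w‖ := by
      intro z w h
      refine (norm_cutoff_sub_le_of_le hR h).trans (mul_le_mul_of_nonneg_right ?_ (norm_nonneg _))
      have h1 : min ‖w‖ R ≤ R := min_le_right _ _
      have h2 : 0 ≤ min ‖w‖ R := le_min (norm_nonneg _) hR
      gcongr
    refine LipschitzWith.of_dist_le_mul fun z w => ?_
    rw [dist_eq_norm, dist_eq_norm, Real.coe_toNNReal _ (by positivity)]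
    rcases le_total ‖z‖ ‖w‖ with h | h
    · exact key z w h
    · rw [norm_sub_rev, norm_sub_rev z w]
      exact key w z h

theorem nonlinearity_eq_cutoff {R : ℝ} {z : ℂ} (h : ‖z‖ ≤ R) :
    nonlinearity z = (cutoffCoeff R ‖z‖ : ℂ) * z := by
  rw [nonlinearity, cutoffCoeff, min_eq_left h]
  push_cast
  ring

/-- Nonlinearities that satisfy the increment bound of the cubic-quartic one and differ from it
by at most `δ |z|^{9/2}`. -/
structure IsNearNL (g : ℂ → ℂ) (δ : ℝ) : Prop where
  zero : g 0 = 0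
  nonneg : 0 ≤ δ
  norm_sub_le : ∀ z w, ‖g z - g w‖ ≤ 7 * (‖z‖ + ‖z‖ ^ 3 + ‖w‖ + ‖w‖ ^ 3) * ‖z - w‖
  near : ∀ z, ‖g z - nonlinearity z‖ ≤ δ * ‖z‖ ^ (9 / 2 : ℝ)

theorem isNearNL_nonlinearity : IsNearNL nonlinearity 0 where
  zero := by simp [nonlinearity]
  nonneg := le_rfl
  norm_sub_le z w := by
    -- Truncation at the larger modulus changes neither value, so the uniform bound for truncations
    -- covers the nonlinearity itself.
    rw [nonlinearity_eq_cutoff (le_max_left ‖z‖ ‖w‖), nonlinearity_eq_cutoff (le_max_right ‖z‖ ‖w‖)]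
    exact norm_cutoff_sub_le (le_max_of_le_left (norm_nonneg _)) z w
  near z := by simp

/-- Both nonlinearities grow at most like |z|⁴ where they differ, and there the spare factor
|z|^{1/2} is at least R^{1/2}. The exponent 9/2 is the one for which L⁶ control is an L^{4/3} bound:
(9/2)(4/3) = 6. -/
theorem isNearNL_cutoff {R : ℝ} (hR : 1 ≤ R) :
    IsNearNL (cutoffNL R (zero_le_one.trans hR)).toFun (4 * R ^ (-(1 / 2) : ℝ)) where
  zero := (cutoffNL R _).zero_apply
  nonneg := by positivity
  norm_sub_le z w := norm_cutoff_sub_le (zero_le_one.trans hR) z w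
  near z := by
    have hR0 : 0 < R := zero_lt_one.trans_le hR
    rcases le_or_gt ‖z‖ R with h | h
    · rw [nonlinearity_eq_cutoff h]
      change ‖(cutoffCoeff R ‖z‖ : ℂ) * z - (cutoffCoeff R ‖z‖ : ℂ) * z‖ ≤ _
      rw [sub_self, norm_zero]
      positivity
    · change ‖(cutoffCoeff R ‖z‖ : ℂ) * z - nonlinearity z‖ ≤ _
      rw [nonlinearity_eq_cutoff le_rfl, ← sub_mul, ← Complex.ofReal_sub, norm_mul,
        Complex.norm_real, Real.norm_eq_abs, cutoffCoeff, cutoffCoeff, min_self,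
        min_eq_right h.le]
      have hr : 1 ≤ ‖z‖ := hR.trans h.le
      set r := ‖z‖
      have h1 : |-R ^ 2 + R ^ 3 - (-r ^ 2 + r ^ 3)| ≤ 4 * r ^ 3 := by
        have a1 : R ^ 3 ≤ r ^ 3 := by gcongr
        have a2 : R ^ 2 ≤ r ^ 2 := by gcongr
        have a3 : r ^ 2 ≤ r ^ 3 := pow_le_pow_right₀ hr (by norm_num)
        rw [abs_le]
        constructor <;> nlinarith [sq_nonneg R, pow_pos hR0 3]
      have h2 : r ^ 4 ≤ R ^ (-(1 / 2) : ℝ) * r ^ (9 / 2 : ℝ) := by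
        have h3 : r ^ (9 / 2 : ℝ) = r ^ (1 / 2 : ℝ) * r ^ 4 := by
          rw [← Real.rpow_natCast, ← Real.rpow_add (by linarith)]; norm_num
        have h4 : 1 ≤ R ^ (-(1 / 2) : ℝ) * r ^ (1 / 2 : ℝ) := by
          rw [Real.rpow_neg hR0.le, ← div_eq_inv_mul, one_le_div (by positivity)]
          gcongr
        rw [h3, ← mul_assoc]
        exact le_mul_of_one_le_left (by positivity) h4
      calc _ ≤ 4 * r ^ 3 * r := mul_le_mul_of_nonneg_right h1 (by linarith)
        _ = 4 * r ^ 4 := by ring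
        _ ≤ 4 * (R ^ (-(1 / 2) : ℝ) * r ^ (9 / 2 : ℝ)) := by gcongr
        _ = _ := by ring

/-- The potential `-|z|⁴/4 + |z|⁵/5` of the cubic-quartic nonlinearity. -/
def cqPotential (z : ℂ) : ℝ := -(1 / 4) * ‖z‖ ^ 4 + 1 / 5 * ‖z‖ ^ 5

theorem cutoff_potential_eq {R : ℝ} (hR : 0 ≤ R) {z : ℂ} (h : ‖z‖ ≤ R) :
    (cutoffNL R hR).potential z = cqPotential z := by
  have h1 : ∀ t ∈ Set.uIcc 0 ‖z‖, ((cutoffNL R hR).toFun t).re = -t ^ 3 + t ^ 4 := by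
    intro t ht
    rw [Set.uIcc_of_le (norm_nonneg z)] at ht
    rw [(cutoffNL R hR).apply_ofReal ht.1, Complex.ofReal_re]
    change cutoffCoeff R t * t = _
    rw [cutoffCoeff, min_eq_left (ht.2.trans h)]
    ring
  rw [GaugeNonlinearity.potential, intervalIntegral.integral_congr h1,
    intervalIntegral.integral_add (Continuous.intervalIntegrable (by fun_prop) _ _)
      (Continuous.intervalIntegrable (by fun_prop) _ _), intervalIntegral.integral_neg,
    integral_pow, integral_pow, cqPotential]
  norm_num
  ring

/-- Potentials with the increment bound of `cqPotential`, that differ from it by at most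
`δ |z|⁶`. -/
structure IsNearPotential (G : ℂ → ℝ) (δ : ℝ) : Prop where
  zero : G 0 = 0
  nonneg : 0 ≤ δ
  abs_sub_le : ∀ z w, |G z - G w|
    ≤ 4 * (‖z‖ + ‖z‖ ^ 3 + ‖w‖ + ‖w‖ ^ 3) * ((‖z‖ + ‖w‖) * ‖z - w‖)
  near : ∀ z, |G z - cqPotential z| ≤ δ * ‖z‖ ^ 6
  lower : ∀ z, -‖z‖ ^ 2 ≤ G z

theorem abs_cutoff_potential_sub_le {R : ℝ} (hR : 0 ≤ R) (z w : ℂ) :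
    |(cutoffNL R hR).potential z - (cutoffNL R hR).potential w|
      ≤ 4 * (‖z‖ + ‖z‖ ^ 3 + ‖w‖ + ‖w‖ ^ 3) * ((‖z‖ + ‖w‖) * ‖z - w‖) := by
  rw [GaugeNonlinearity.potential_sub]
  set M := max ‖z‖ ‖w‖ with hM
  have hM0 : 0 ≤ M := le_max_of_le_left (norm_nonneg _)
  have hMs : M + M ^ 3 ≤ ‖z‖ + ‖z‖ ^ 3 + ‖w‖ + ‖w‖ ^ 3 := by
    rcases le_total ‖z‖ ‖w‖ with h | h
    · rw [hM, max_eq_right h]; nlinarith [norm_nonneg z, pow_nonneg (norm_nonneg z) 3]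
    · rw [hM, max_eq_left h]; nlinarith [norm_nonneg w, pow_nonneg (norm_nonneg w) 3]
  have hMm : M ≤ ‖z‖ + ‖w‖ := max_le (by simp) (by simp)
  have h := intervalIntegral.norm_integral_le_of_norm_le_const
      (f := fun t : ℝ => ((cutoffNL R hR).toFun t).re) (a := ‖w‖) (b := ‖z‖)
      (C := 4 * (M + M ^ 3) * M) fun t ht => by
        have ht0 : 0 ≤ t := (le_min (norm_nonneg w) (norm_nonneg z)).trans ht.1.le
        have htM : t ≤ M := by rw [hM, max_comm]; exact ht.2
        rw [(cutoffNL R hR).apply_ofReal ht0, Complex.ofReal_re, norm_mul,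
          Real.norm_of_nonneg ht0]
        change ‖cutoffCoeff R t‖ * t ≤ _
        refine mul_le_mul ?_ htM ht0 (by positivity)
        have h1 : min t R ≤ M := (min_le_left _ _).trans htM
        have h2 : 0 ≤ min t R := le_min ht0 hR
        have h3 : (min t R) ^ 2 ≤ M ^ 2 := by gcongr
        have h4 : (min t R) ^ 3 ≤ M ^ 3 := by gcongr
        have h5 : M ^ 2 ≤ M + M ^ 3 := by
          nlinarith [mul_nonneg hM0 (sq_nonneg (M - 1))]
        rw [Real.norm_eq_abs, cutoffCoeff, abs_le]
        constructor <;> nlinarith [sq_nonneg (min t R), pow_nonneg h2 3, pow_nonneg hM0 3]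
  rw [← Real.norm_eq_abs]
  refine h.trans ?_
  rw [mul_assoc]
  refine mul_le_mul (by gcongr) ?_ (by positivity) (by positivity)
  exact mul_le_mul hMm (abs_norm_sub_norm_le z w) (abs_nonneg _) (by positivity)

/-- The coefficient is at least -1 at every height of truncation: the focusing cubic term costs only
mass, uniformly in R. -/
theorem cutoff_potential_lower {R : ℝ} (hR : 0 ≤ R) (z : ℂ) :
    -‖z‖ ^ 2 ≤ (cutoffNL R hR).potential z := by
  have h1 : ∫ t in (0 : ℝ)..‖z‖, -t ≤ (cutoffNL R hR).potential z := by
    refine intervalIntegral.integral_mono_on (norm_nonneg z)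
      (continuous_neg.intervalIntegrable _ _)
      ((cutoffNL R hR).continuous_re.intervalIntegrable _ _) fun t ht => ?_
    rw [(cutoffNL R hR).apply_ofReal ht.1, Complex.ofReal_re]
    change -t ≤ cutoffCoeff R t * t
    have h2 : 0 ≤ min t R := le_min ht.1 hR
    have h3 : -1 ≤ cutoffCoeff R t := by
      rw [cutoffCoeff]
      nlinarith [sq_nonneg (min t R - 1), mul_nonneg h2 (sq_nonneg (min t R - 1))]
    nlinarith [ht.1]
  rw [intervalIntegral.integral_neg, integral_id] at h1
  nlinarith [sq_nonneg ‖z‖]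

theorem isNearPotential_cqPotential : IsNearPotential cqPotential 0 where
  zero := by simp [cqPotential]
  nonneg := le_rfl
  abs_sub_le z w := by
    have h0 : (0 : ℝ) ≤ max ‖z‖ ‖w‖ := le_max_of_le_left (norm_nonneg _)
    rw [← cutoff_potential_eq h0 (le_max_left ‖z‖ ‖w‖),
      ← cutoff_potential_eq h0 (le_max_right ‖z‖ ‖w‖)]
    exact abs_cutoff_potential_sub_le h0 z w
  near z := by simp
  lower z := by
    rw [← cutoff_potential_eq (norm_nonneg z) le_rfl]
    exact cutoff_potential_lower (norm_nonneg z) z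

/-- Beyond R each potential is at most 8|z|⁵, and the spare power of |z| up to |z|⁶ supplies the
factor 1/R. -/
theorem isNearPotential_cutoff {R : ℝ} (hR : 1 ≤ R) :
    IsNearPotential (cutoffNL R (zero_le_one.trans hR)).potential (32 / R) where
  zero := (cutoffNL R _).potential_zero
  nonneg := by positivity
  abs_sub_le z w := abs_cutoff_potential_sub_le (zero_le_one.trans hR) z w
  lower z := cutoff_potential_lower (zero_le_one.trans hR) z
  near z := by
    have hR0 : 0 < R := zero_lt_one.trans_le hR
    rcases le_or_gt ‖z‖ R with h | h
    · rw [cutoff_potential_eq _ h, sub_self, abs_zero]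
      positivity
    · have hr : 1 ≤ ‖z‖ := hR.trans h.le
      have a1 := abs_cutoff_potential_sub_le (zero_le_one.trans hR) z 0
      have a2 := isNearPotential_cqPotential.abs_sub_le z 0
      rw [GaugeNonlinearity.potential_zero] at a1
      rw [isNearPotential_cqPotential.zero] at a2
      simp only [sub_zero, norm_zero, add_zero] at a1 a2
      norm_num at a1 a2
      set r := ‖z‖
      have a3 : 4 * (r + r ^ 3) * (r * r) ≤ 8 * r ^ 5 := by
        have : r ≤ r ^ 3 := le_self_pow₀ hr (by norm_num)
        nlinarith [mul_self_nonneg r]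
      have a4 : 16 * r ^ 5 ≤ 32 / R * r ^ 6 := by
        have : 16 * r ^ 5 * R ≤ 32 * r ^ 6 := by
          have : r ^ 5 * R ≤ r ^ 5 * r := by gcongr
          nlinarith [pow_pos (by linarith : 0 < r) 6]
        rw [div_mul_eq_mul_div, le_div_iff₀ hR0]
        exact this
      have a5 := abs_sub (GaugeNonlinearity.potential (cutoffNL R (zero_le_one.trans hR)) z)
        (cqPotential z)
      linarith

end

/-! ### Lebesgue norm estimates -/

/-- The exponents of the increment estimate: a weight in L² times a difference in L⁴ lies in
L^{4/3}, the dual of L⁴. -/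
instance holderTriple_two_four : ENNReal.HolderTriple 2 4 (4 / 3) where
  inv_add_inv_eq_inv := by
    rw [← ENNReal.toReal_eq_toReal_iff' (by simp) (by
      rw [Ne, ENNReal.inv_eq_top]; simp [ENNReal.div_eq_zero_iff])]
    rw [ENNReal.toReal_add (by simp) (by simp)]
    simp only [ENNReal.toReal_inv, ENNReal.toReal_div, ENNReal.toReal_ofNat]
    norm_num

instance holderTriple_fourThirds_four : ENNReal.HolderTriple (4 / 3) 4 1 where
  inv_add_inv_eq_inv := by
    rw [← ENNReal.toReal_eq_toReal_iff' (ENNReal.add_ne_top.2 ⟨by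
      rw [Ne, ENNReal.inv_eq_top]; simp [ENNReal.div_eq_zero_iff], by simp⟩) (by simp)]
    rw [ENNReal.toReal_add (by
      rw [Ne, ENNReal.inv_eq_top]; simp [ENNReal.div_eq_zero_iff]) (by simp)]
    simp only [ENNReal.toReal_inv, ENNReal.toReal_div, ENNReal.toReal_ofNat]
    norm_num

theorem one_le_fourThirds : (1 : ℝ≥0∞) ≤ 4 / 3 := by
  rw [ENNReal.le_div_iff_mul_le (by simp) (by simp)]
  norm_num

instance fact_one_le_fourThirds : Fact ((1 : ℝ≥0∞) ≤ 4 / 3) := ⟨one_le_fourThirds⟩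

theorem fourThirds_ne_top : (4 / 3 : ℝ≥0∞) ≠ ∞ := ENNReal.div_ne_top (by simp) (by simp)

theorem eLpNorm_le_mul_of_norm_le {α F G H : Type*} [MeasurableSpace α] {μ : Measure α}
    [NormedAddCommGroup F] [NormedAddCommGroup G] [NormedAddCommGroup H] (p q r : ℝ≥0∞)
    [ENNReal.HolderTriple p q r] {f : α → F} {g : α → G} {h : α → H}
    (hf : AEStronglyMeasurable f μ) (hg : AEStronglyMeasurable g μ)
    (hh : ∀ x, ‖h x‖ ≤ ‖f x‖ * ‖g x‖) :
    eLpNorm h r μ ≤ eLpNorm f p μ * eLpNorm g q μ := by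
  have h1 : eLpNorm h r μ ≤ eLpNorm ((fun x => ‖f x‖) • fun x => ‖g x‖) r μ :=
    eLpNorm_mono_real fun x => hh x
  have h2 := eLpNorm_smul_le_mul_eLpNorm (p := p) (q := q) (r := r) (μ := μ)
    (φ := fun x => ‖f x‖) (f := fun x => ‖g x‖) hg.norm hf.norm
  rw [eLpNorm_norm, eLpNorm_norm] at h2
  exact h1.trans h2

theorem norm_integral_le_of_eLpNorm_one_le {α F : Type*} [MeasurableSpace α] {μ : Measure α}
    [NormedAddCommGroup F] [NormedSpace ℝ F] {f : α → F} {A : ℝ} (hA : 0 ≤ A)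
    (h : eLpNorm f 1 μ ≤ ENNReal.ofReal A) : ‖∫ x, f x ∂μ‖ ≤ A := by
  rw [eLpNorm_one_eq_lintegral_enorm] at h
  have h1 := (enorm_integral_le_lintegral_enorm f).trans h
  rw [← ofReal_norm] at h1
  exact (ENNReal.ofReal_le_ofReal_iff hA).1 h1

theorem integrable_of_eLpNorm_one_le {α F : Type*} [MeasurableSpace α] {μ : Measure α}
    [NormedAddCommGroup F] {f : α → F} {A : ℝ} (hf : AEStronglyMeasurable f μ)
    (h : eLpNorm f 1 μ ≤ ENNReal.ofReal A) : Integrable f μ :=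
  memLp_one_iff_integrable.1 ⟨hf, h.trans_lt ENNReal.ofReal_lt_top⟩

theorem eLpNorm_mul_one_le {F G : Pt d → ℂ} (hF : AEStronglyMeasurable F)
    (hG : AEStronglyMeasurable G) {A B : ℝ} (hA : 0 ≤ A) (h1 : eLpNorm F (4 / 3) ≤ ENNReal.ofReal A)
    (h2 : eLpNorm G 4 ≤ ENNReal.ofReal B) :
    eLpNorm (fun x => F x * G x) 1 ≤ ENNReal.ofReal (A * B) := by
  refine (eLpNorm_le_mul_of_norm_le (4 / 3) 4 1 hF hG fun x => (norm_mul _ _).le).trans ?_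
  rw [ENNReal.ofReal_mul hA]
  exact mul_le_mul' h1 h2

theorem eLpNorm_cube_two (u : Pt d → ℂ) : eLpNorm (fun x => ‖u x‖ ^ 3) 2 = eLpNorm u 6 ^ 3 := by
  rw [← eLpNorm_six_eq]
  exact eLpNorm_congr_norm_ae (ae_of_all _ fun x => by simp)

/-! ### Bounded sets of L² ∩ L⁶ and estimates of the nonlinearity. -/

/-- Elements of `L² ∩ L⁶` with both norms at most `K`. -/
def IsBdd (K : ℝ) (w : L2 d) : Prop := ‖w‖ ≤ K ∧ eLpNorm w 6 ≤ ENNReal.ofReal K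

theorem IsBdd.nonneg {K : ℝ} {w : L2 d} (h : IsBdd K w) : 0 ≤ K := (norm_nonneg w).trans h.1

theorem IsBdd.mono {K K' : ℝ} {w : L2 d} (h : IsBdd K w) (hK : K ≤ K') : IsBdd K' w :=
  ⟨h.1.trans hK, h.2.trans (ENNReal.ofReal_le_ofReal hK)⟩

theorem IsBdd.sub {K K' : ℝ} {w w' : L2 d} (h : IsBdd K w) (h' : IsBdd K' w') :
    IsBdd (K + K') (w - w') := by
  refine ⟨(norm_sub_le _ _).trans (add_le_add h.1 h'.1), ?_⟩
  rw [eLpNorm_congr_ae (Lp.coeFn_sub w w'), ENNReal.ofReal_add h.nonneg h'.nonneg]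
  exact (eLpNorm_sub_le (Lp.aestronglyMeasurable _) (Lp.aestronglyMeasurable _)
    (by norm_num)).trans (add_le_add h.2 h'.2)

theorem IsBdd.of_tendsto {K : ℝ} {f : ℕ → L2 d} {f₀ : L2 d} (h : Tendsto f atTop (𝓝 f₀))
    (hB : ∀ n, IsBdd K (f n)) : IsBdd K f₀ :=
  ⟨le_of_tendsto h.norm (Eventually.of_forall fun n => (hB n).1),
    eLpNorm_le_of_tendsto_L2 h fun n => (hB n).2⟩

theorem IsBdd.eLpNorm_two_le {K : ℝ} {w : L2 d} (h : IsBdd K w) :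
    eLpNorm w 2 ≤ ENNReal.ofReal K := by
  rw [← ENNReal.ofReal_toReal (Lp.eLpNorm_ne_top w)]
  exact ENNReal.ofReal_le_ofReal h.1

theorem exists_isBdd (hd : d = 2 ∨ d = 3) :
    ∃ C : ℝ, 1 ≤ C ∧ ∀ u : H1 d, IsBdd (C * ‖u‖) u.fn := by
  obtain ⟨C, hC0, hC⟩ := exists_eLpNorm_six_le hd
  refine ⟨C + 1, by linarith, fun u => ⟨?_, (hC u).trans (ENNReal.ofReal_le_ofReal ?_)⟩⟩
  · nlinarith [u.norm_fn_le, norm_nonneg u]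
  · nlinarith [norm_nonneg u]

/-- The `L⁴` norm of an element of `L²`, as a real number. -/
def norm4 (w : L2 d) : ℝ := (eLpNorm w 4).toReal

theorem norm4_nonneg (w : L2 d) : 0 ≤ norm4 w := ENNReal.toReal_nonneg

/-- Cauchy–Schwarz for |w|⁴ = |w|·|w|³. Through it L² convergence of functions bounded in L⁶ becomes
L⁴ convergence. -/
theorem eLpNorm_four_pow_le (w : L2 d) :
    eLpNorm w 4 ^ 4 ≤ eLpNorm w 2 * eLpNorm w 6 ^ 3 := by
  have h1 : eLpNorm (fun x => ‖w x‖ ^ 4) 1 ≤ eLpNorm w 2 * eLpNorm w 6 ^ 3 := by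
    rw [← eLpNorm_cube_two]
    refine eLpNorm_le_mul_of_norm_le 2 2 1 (Lp.aestronglyMeasurable w)
      ((Lp.aestronglyMeasurable w).norm.pow 3) fun x => ?_
    rw [norm_pow, norm_pow, norm_norm]
    exact (by ring : ‖w x‖ ^ 4 = ‖w x‖ * ‖w x‖ ^ 3).le
  have h2 := eLpNorm_norm_rpow (μ := (volume : Measure (Pt d))) (p := 1) w
    (by norm_num : (0 : ℝ) < 4)
  rw [one_mul, ENNReal.ofReal_ofNat] at h2
  have h3 : eLpNorm w 4 ^ (4 : ℝ) = eLpNorm w 4 ^ 4 := by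
    rw [← ENNReal.rpow_natCast]; norm_num
  rw [← h3, ← h2]
  refine le_trans (le_of_eq ?_) h1
  refine eLpNorm_congr_ae (ae_of_all _ fun x => ?_)
  exact_mod_cast Real.rpow_natCast _ 4

theorem IsBdd.eLpNorm_four_le {K : ℝ} {w : L2 d} (h : IsBdd K w) :
    eLpNorm w 4 ≤ ENNReal.ofReal K := by
  refine (ENNReal.pow_le_pow_left_iff (n := 4) (by norm_num)).1 ?_
  refine (eLpNorm_four_pow_le w).trans ?_
  exact (mul_le_mul' h.eLpNorm_two_le (pow_le_pow_left' h.2 3)).trans_eq (pow_succ' _ 3).symm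

theorem IsBdd.eLpNorm_four_eq {K : ℝ} {w : L2 d} (h : IsBdd K w) :
    eLpNorm w 4 = ENNReal.ofReal (norm4 w) :=
  (ENNReal.ofReal_toReal (h.eLpNorm_four_le.trans_lt ENNReal.ofReal_lt_top).ne).symm

theorem IsBdd.norm4_le {K : ℝ} {w : L2 d} (h : IsBdd K w) : norm4 w ≤ K := by
  have := h.eLpNorm_four_le
  rw [h.eLpNorm_four_eq] at this
  exact (ENNReal.ofReal_le_ofReal_iff h.nonneg).1 this

/-- Interpolation between `L²` and `L⁶`. -/
theorem IsBdd.norm4_pow_le {K : ℝ} {w : L2 d} (h : IsBdd K w) : norm4 w ^ 4 ≤ ‖w‖ * K ^ 3 := by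
  have h1 : eLpNorm w 4 ^ 4 ≤ ENNReal.ofReal (‖w‖ * K ^ 3) := by
    refine (eLpNorm_four_pow_le w).trans ?_
    rw [ENNReal.ofReal_mul (norm_nonneg _), ENNReal.ofReal_pow h.nonneg]
    have e : eLpNorm w 2 = ENNReal.ofReal ‖w‖ := by
      rw [Lp.norm_def, ENNReal.ofReal_toReal (Lp.eLpNorm_ne_top w)]
    rw [e]
    exact mul_le_mul' le_rfl (pow_le_pow_left' h.2 3)
  rw [h.eLpNorm_four_eq, ← ENNReal.ofReal_pow (norm4_nonneg w)] at h1
  exact (ENNReal.ofReal_le_ofReal_iff (mul_nonneg (norm_nonneg _) (pow_nonneg h.nonneg 3))).1 h1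

/-- The `L²` weight that appears in the increment bounds. -/
theorem eLpNorm_weight_le {K : ℝ} {a b : L2 d} (ha : IsBdd K a) (hb : IsBdd K b) {c : ℝ}
    (hc : 0 ≤ c) :
    eLpNorm (fun x => c * (‖a x‖ + ‖a x‖ ^ 3 + ‖b x‖ + ‖b x‖ ^ 3)) 2
      ≤ ENNReal.ofReal (c * (2 * (K + K ^ 3))) := by
  have hK := ha.nonneg
  have ma := (Lp.aestronglyMeasurable a).norm
  have mb := (Lp.aestronglyMeasurable b).norm
  have h1 : ∀ w : L2 d, IsBdd K w → eLpNorm (fun x => ‖w x‖ + ‖w x‖ ^ 3) 2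
      ≤ ENNReal.ofReal (K + K ^ 3) := by
    intro w hw
    have mw := (Lp.aestronglyMeasurable w).norm
    have h2 := eLpNorm_add_le (p := 2) mw (mw.pow 3) (by norm_num)
    refine h2.trans ?_
    rw [eLpNorm_norm, ENNReal.ofReal_add hK (by positivity), ENNReal.ofReal_pow hK]
    refine add_le_add hw.eLpNorm_two_le ?_
    have h3 := eLpNorm_cube_two (d := d) w
    exact (le_of_eq h3).trans (pow_le_pow_left' hw.2 3)
  have h2 : eLpNorm (fun x => c * (‖a x‖ + ‖a x‖ ^ 3 + ‖b x‖ + ‖b x‖ ^ 3)) 2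
      ≤ ENNReal.ofReal c * eLpNorm ((fun x => ‖a x‖ + ‖a x‖ ^ 3) + fun x => ‖b x‖ + ‖b x‖ ^ 3) 2 := by
    refine eLpNorm_le_mul_eLpNorm_of_ae_le_mul (ae_of_all _ fun x => ?_) 2
    rw [norm_mul, Real.norm_of_nonneg hc, Pi.add_apply, add_assoc (‖a x‖ + ‖a x‖ ^ 3)]
  refine h2.trans ?_
  rw [ENNReal.ofReal_mul hc]
  refine mul_le_mul' le_rfl ?_
  refine (eLpNorm_add_le (ma.add (ma.pow 3)) (mb.add (mb.pow 3)) (by norm_num)).trans ?_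
  refine (add_le_add (h1 a ha) (h1 b hb)).trans ?_
  rw [← ENNReal.ofReal_add (by positivity) (by positivity)]
  exact ENNReal.ofReal_le_ofReal (by linarith)

theorem IsNearNL.continuous {g : ℂ → ℂ} {δ : ℝ} (hg : IsNearNL g δ) : Continuous g := by
  rw [continuous_iff_continuousAt]
  intro z
  rw [ContinuousAt, tendsto_iff_norm_sub_tendsto_zero]
  refine squeeze_zero (fun _ => norm_nonneg _) (fun w => hg.norm_sub_le w z) ?_
  have : Continuous fun w : ℂ => 7 * (‖w‖ + ‖w‖ ^ 3 + ‖z‖ + ‖z‖ ^ 3) * ‖w - z‖ := by fun_prop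
  simpa using this.tendsto z

theorem IsNearNL.aestronglyMeasurable {g : ℂ → ℂ} {δ : ℝ} (hg : IsNearNL g δ) (w : L2 d) :
    AEStronglyMeasurable fun x => g (w x) :=
  hg.continuous.comp_aestronglyMeasurable (Lp.aestronglyMeasurable w)

/-- The increments of the nonlinearity in `L^{4/3}`. -/
theorem IsNearNL.eLpNorm_sub_le {g : ℂ → ℂ} {δ : ℝ} (hg : IsNearNL g δ) {K : ℝ} {a b : L2 d}
    (ha : IsBdd K a) (hb : IsBdd K b) :
    eLpNorm (fun x => g (a x) - g (b x)) (4 / 3)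
      ≤ ENNReal.ofReal (14 * (K + K ^ 3) * norm4 (a - b)) := by
  have hK := ha.nonneg
  have ma := (Lp.aestronglyMeasurable a)
  have mb := (Lp.aestronglyMeasurable b)
  have h1 := eLpNorm_le_mul_of_norm_le 2 4 (4 / 3) (h := fun x => g (a x) - g (b x))
    (((((ma.norm).add (ma.norm.pow 3)).add mb.norm).add (mb.norm.pow 3)).const_mul 7)
    (ma.sub mb) (fun x => by
      refine (hg.norm_sub_le _ _).trans (mul_le_mul_of_nonneg_right (le_abs_self _) (norm_nonneg _)))
  refine h1.trans ?_
  have h2 : eLpNorm (⇑a - ⇑b) 4 = ENNReal.ofReal (norm4 (a - b)) := by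
    rw [← (ha.sub hb).eLpNorm_four_eq, eLpNorm_congr_ae (Lp.coeFn_sub a b)]
  rw [h2, ENNReal.ofReal_mul (by positivity)]
  refine mul_le_mul' ?_ le_rfl
  refine (eLpNorm_weight_le ha hb (by norm_num : (0 : ℝ) ≤ 7)).trans (ENNReal.ofReal_le_ofReal ?_)
  linarith

theorem IsNearNL.eLpNorm_sub_nonlinearity_le {g : ℂ → ℂ} {δ : ℝ} (hg : IsNearNL g δ) {K : ℝ}
    {a : L2 d} (ha : IsBdd K a) :
    eLpNorm (fun x => g (a x) - nonlinearity (a x)) (4 / 3)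
      ≤ ENNReal.ofReal (δ * K ^ (9 / 2 : ℝ)) := by
  have h1 : eLpNorm (fun x => g (a x) - nonlinearity (a x)) (4 / 3)
      ≤ ENNReal.ofReal δ * eLpNorm (fun x => ‖a x‖ ^ (9 / 2 : ℝ)) (4 / 3) := by
    refine eLpNorm_le_mul_eLpNorm_of_ae_le_mul (ae_of_all _ fun x => ?_) _
    rw [Real.norm_of_nonneg (by positivity)]
    exact hg.near _
  refine h1.trans ?_
  rw [eLpNorm_norm_rpow _ (by norm_num), ENNReal.ofReal_mul hg.nonneg,
    ← ENNReal.ofReal_rpow_of_nonneg ha.nonneg (by norm_num)]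
  have e : (4 / 3 : ℝ≥0∞) * ENNReal.ofReal (9 / 2) = 6 := by
    rw [← ENNReal.toReal_eq_toReal_iff' (ENNReal.mul_ne_top fourThirds_ne_top (by simp)) (by simp)]
    rw [ENNReal.toReal_mul, ENNReal.toReal_div, ENNReal.toReal_ofReal (by norm_num)]
    norm_num
  rw [e]
  exact mul_le_mul' le_rfl (ENNReal.rpow_le_rpow ha.2 (by norm_num))

/-- First move from a to b with g₁ fixed, then from g₁ to g₂ at b through the exact nonlinearity. -/
theorem IsNearNL.eLpNorm_sub_sub_le {g₁ g₂ : ℂ → ℂ} {δ₁ δ₂ : ℝ} (h₁ : IsNearNL g₁ δ₁)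
    (h₂ : IsNearNL g₂ δ₂) {K : ℝ} {a b : L2 d} (ha : IsBdd K a) (hb : IsBdd K b) :
    eLpNorm (fun x => g₁ (a x) - g₂ (b x)) (4 / 3)
      ≤ ENNReal.ofReal (14 * (K + K ^ 3) * norm4 (a - b) + (δ₁ + δ₂) * K ^ (9 / 2 : ℝ)) := by
  have hK := ha.nonneg
  have hn := norm4_nonneg (a - b)
  have m1 := h₁.aestronglyMeasurable a
  have m2 := h₁.aestronglyMeasurable b
  have m3 := isNearNL_nonlinearity.aestronglyMeasurable b
  have m4 := h₂.aestronglyMeasurable b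
  have e : (fun x => g₁ (a x) - g₂ (b x)) = (fun x => g₁ (a x) - g₁ (b x)) +
      ((fun x => g₁ (b x) - nonlinearity (b x)) - fun x => g₂ (b x) - nonlinearity (b x)) := by
    ext x; simp
  rw [e]
  refine (eLpNorm_add_le (m1.sub m2) ((m2.sub m3).sub (m4.sub m3)) one_le_fourThirds).trans ?_
  have hd1 := h₁.nonneg
  have hd2 := h₂.nonneg
  rw [ENNReal.ofReal_add (by positivity) (by positivity), add_mul,
    ENNReal.ofReal_add (by positivity) (by positivity)]
  refine add_le_add (h₁.eLpNorm_sub_le ha hb) ?_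
  exact (MeasureTheory.eLpNorm_sub_le (m2.sub m3) (m4.sub m3) one_le_fourThirds).trans
    (add_le_add (h₁.eLpNorm_sub_nonlinearity_le hb) (h₂.eLpNorm_sub_nonlinearity_le hb))

theorem isBdd_zero {K : ℝ} (hK : 0 ≤ K) : IsBdd K (0 : L2 d) := by
  refine ⟨by simpa using hK, ?_⟩
  rw [eLpNorm_congr_ae (Lp.coeFn_zero ℂ 2 volume)]
  simp

theorem IsNearNL.eLpNorm_le {g : ℂ → ℂ} {δ : ℝ} (hg : IsNearNL g δ) {K : ℝ} {a : L2 d}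
    (ha : IsBdd K a) :
    eLpNorm (fun x => g (a x)) (4 / 3) ≤ ENNReal.ofReal (14 * (K + K ^ 3) * K) := by
  have hK := ha.nonneg
  have h := hg.eLpNorm_sub_le ha (isBdd_zero hK)
  have e : eLpNorm (fun x => g (a x)) (4 / 3) = eLpNorm (fun x => g (a x) - g ((0 : L2 d) x)) (4 / 3) := by
    refine eLpNorm_congr_ae ?_
    filter_upwards [Lp.coeFn_zero ℂ 2 (volume : Measure (Pt d))] with x hx
    rw [hx, Pi.zero_apply, hg.zero, sub_zero]
  rw [e]
  refine h.trans (ENNReal.ofReal_le_ofReal ?_)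
  rw [sub_zero]
  exact mul_le_mul_of_nonneg_left ha.norm4_le (by positivity)

/-! ### Potentials -/

theorem IsNearPotential.continuous {G : ℂ → ℝ} {δ : ℝ} (hG : IsNearPotential G δ) :
    Continuous G := by
  rw [continuous_iff_continuousAt]
  intro z
  rw [ContinuousAt, tendsto_iff_norm_sub_tendsto_zero]
  refine squeeze_zero (fun _ => norm_nonneg _) (fun w => hG.abs_sub_le w z) ?_
  have : Continuous fun w : ℂ => 4 * (‖w‖ + ‖w‖ ^ 3 + ‖z‖ + ‖z‖ ^ 3) *
      ((‖w‖ + ‖z‖) * ‖w - z‖) := by fun_prop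
  simpa using this.tendsto z

theorem IsNearPotential.aestronglyMeasurable {G : ℂ → ℝ} {δ : ℝ} (hG : IsNearPotential G δ)
    (w : L2 d) : AEStronglyMeasurable fun x => G (w x) :=
  hG.continuous.comp_aestronglyMeasurable (Lp.aestronglyMeasurable w)

theorem IsNearPotential.eLpNorm_sub_le {G : ℂ → ℝ} {δ : ℝ} (hG : IsNearPotential G δ) {K : ℝ}
    {a b : L2 d} (ha : IsBdd K a) (hb : IsBdd K b) :
    eLpNorm (fun x => G (a x) - G (b x)) 1
      ≤ ENNReal.ofReal (16 * (K + K ^ 3) * K * norm4 (a - b)) := by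
  have hK := ha.nonneg
  have ma := (Lp.aestronglyMeasurable a)
  have mb := (Lp.aestronglyMeasurable b)
  have mw := (((((ma.norm).add (ma.norm.pow 3)).add mb.norm).add (mb.norm.pow 3)).const_mul 4)
  have m4 := ma.norm.add mb.norm
  have h1 := eLpNorm_le_mul_of_norm_le (4 / 3) 4 1 (h := fun x => G (a x) - G (b x))
    (mw.mul m4) (ma.sub mb) (fun x => by
      refine (hG.abs_sub_le _ _).trans ?_
      rw [← mul_assoc]
      exact mul_le_mul_of_nonneg_right (le_abs_self _) (norm_nonneg _))
  refine h1.trans ?_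
  have h2 : eLpNorm (⇑a - ⇑b) 4 = ENNReal.ofReal (norm4 (a - b)) := by
    rw [← (ha.sub hb).eLpNorm_four_eq, eLpNorm_congr_ae (Lp.coeFn_sub a b)]
  rw [h2, ENNReal.ofReal_mul (by positivity)]
  refine mul_le_mul' ?_ le_rfl
  refine (eLpNorm_le_mul_of_norm_le 2 4 (4 / 3) mw m4 fun x => (norm_mul _ _).le).trans ?_
  have h3 : eLpNorm ((fun x => ‖a x‖) + fun x => ‖b x‖) 4 ≤ ENNReal.ofReal (K + K) := by
    refine (eLpNorm_add_le ma.norm mb.norm (by norm_num)).trans ?_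
    rw [eLpNorm_norm, eLpNorm_norm, ENNReal.ofReal_add hK hK]
    exact add_le_add ha.eLpNorm_four_le hb.eLpNorm_four_le
  refine (mul_le_mul' (eLpNorm_weight_le ha hb (by norm_num : (0 : ℝ) ≤ 4)) h3).trans ?_
  rw [← ENNReal.ofReal_mul (by positivity)]
  exact ENNReal.ofReal_le_ofReal (by linarith)

theorem IsNearPotential.eLpNorm_sub_cqPotential_le {G : ℂ → ℝ} {δ : ℝ} (hG : IsNearPotential G δ)
    {K : ℝ} {a : L2 d} (ha : IsBdd K a) :
    eLpNorm (fun x => G (a x) - cqPotential (a x)) 1 ≤ ENNReal.ofReal (δ * K ^ 6) := by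
  have h1 : eLpNorm (fun x => G (a x) - cqPotential (a x)) 1
      ≤ ENNReal.ofReal δ * eLpNorm (fun x => ‖a x‖ ^ (6 : ℝ)) 1 := by
    refine eLpNorm_le_mul_eLpNorm_of_ae_le_mul (ae_of_all _ fun x => ?_) _
    rw [Real.norm_of_nonneg (Real.rpow_nonneg (norm_nonneg _) _), Real.norm_eq_abs]
    exact_mod_cast hG.near (a x)
  refine h1.trans ?_
  rw [eLpNorm_norm_rpow _ (by norm_num), ENNReal.ofReal_mul hG.nonneg, one_mul,
    ENNReal.ofReal_ofNat, ENNReal.ofReal_pow ha.nonneg, ← ENNReal.rpow_natCast]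
  refine mul_le_mul' le_rfl ?_
  norm_num
  exact pow_le_pow_left' ha.2 6

theorem IsNearPotential.integrable {G : ℂ → ℝ} {δ : ℝ} (hG : IsNearPotential G δ) {K : ℝ}
    {a : L2 d} (ha : IsBdd K a) : Integrable fun x => G (a x) := by
  have hK := ha.nonneg
  have h := hG.eLpNorm_sub_le ha (isBdd_zero hK)
  have e : eLpNorm (fun x => G (a x)) 1 = eLpNorm (fun x => G (a x) - G ((0 : L2 d) x)) 1 := by
    refine eLpNorm_congr_ae ?_
    filter_upwards [Lp.coeFn_zero ℂ 2 (volume : Measure (Pt d))] with x hx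
    rw [hx, Pi.zero_apply, hG.zero, sub_zero]
  rw [← e] at h
  exact integrable_of_eLpNorm_one_le (hG.aestronglyMeasurable a) h

theorem IsNearPotential.abs_integral_sub_le {G : ℂ → ℝ} {δ : ℝ} (hG : IsNearPotential G δ)
    {K : ℝ} {a b : L2 d} (ha : IsBdd K a) (hb : IsBdd K b) :
    |(∫ x, G (a x)) - ∫ x, cqPotential (b x)|
      ≤ 16 * (K + K ^ 3) * K * norm4 (a - b) + δ * K ^ 6 := by
  have hK := ha.nonneg
  have hn := norm4_nonneg (a - b)
  have hδ := hG.nonneg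
  have h1 := norm_integral_le_of_eLpNorm_one_le (by positivity) (hG.eLpNorm_sub_le ha hb)
  have h2 := norm_integral_le_of_eLpNorm_one_le (by positivity) (hG.eLpNorm_sub_cqPotential_le hb)
  rw [integral_sub (hG.integrable ha) (hG.integrable hb)] at h1
  rw [integral_sub (hG.integrable hb) (isNearPotential_cqPotential.integrable hb)] at h2
  have := norm_add_le ((∫ x, G (a x)) - ∫ x, G (b x))
    ((∫ x, G (b x)) - ∫ x, cqPotential (b x))
  rw [sub_add_sub_cancel] at this
  exact this.trans (add_le_add h1 h2)

theorem IsNearPotential.abs_integral_le {G : ℂ → ℝ} {δ : ℝ} (hG : IsNearPotential G δ)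
    {K : ℝ} {a : L2 d} (ha : IsBdd K a) :
    |∫ x, G (a x)| ≤ 16 * (K + K ^ 3) * K * K + δ * K ^ 6 := by
  have hK := ha.nonneg
  have h := hG.abs_integral_sub_le ha (isBdd_zero (d := d) hK)
  have e : ∫ x, cqPotential ((0 : L2 d) x) = 0 := by
    refine (integral_congr_ae ?_).trans (integral_zero (Pt d) ℝ)
    filter_upwards [Lp.coeFn_zero ℂ 2 (volume : Measure (Pt d))] with x hx
    rw [hx, Pi.zero_apply, isNearPotential_cqPotential.zero]
  rw [e, sub_zero, sub_zero] at h
  refine h.trans (add_le_add (mul_le_mul_of_nonneg_left ha.norm4_le (by positivity)) le_rfl)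

theorem IsNearPotential.neg_le_integral {G : ℂ → ℝ} {δ : ℝ} (hG : IsNearPotential G δ)
    {K : ℝ} {a : L2 d} (ha : IsBdd K a) : -‖a‖ ^ 2 ≤ ∫ x, G (a x) := by
  rw [L2.norm_sq_eq, ← integral_neg]
  refine integral_mono (L2.integrable_norm_sq a).neg (hG.integrable ha) fun x => ?_
  exact hG.lower _

/-! ### Duality between `L⁴` and `L^{4/3}` -/

theorem eLpNorm_pow_four_one (w : L2 d) : eLpNorm (fun x => ‖w x‖ ^ 4) 1 = eLpNorm w 4 ^ 4 := by
  have h2 := eLpNorm_norm_rpow (μ := (volume : Measure (Pt d))) (p := 1) w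
    (by norm_num : (0 : ℝ) < 4)
  rw [one_mul, ENNReal.ofReal_ofNat] at h2
  have h3 : eLpNorm w 4 ^ (4 : ℝ) = eLpNorm w 4 ^ 4 := by
    rw [← ENNReal.rpow_natCast]; norm_num
  rw [← h3, ← h2]
  refine eLpNorm_congr_ae (ae_of_all _ fun x => ?_)
  exact_mod_cast (Real.rpow_natCast _ 4).symm

theorem IsBdd.integrable_pow_four {K : ℝ} {w : L2 d} (h : IsBdd K w) :
    Integrable fun x => ‖w x‖ ^ 4 := by
  refine integrable_of_eLpNorm_one_le (A := K ^ 4) ((Lp.aestronglyMeasurable w).norm.pow 4) ?_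
  rw [eLpNorm_pow_four_one, ENNReal.ofReal_pow h.nonneg]
  exact pow_le_pow_left' h.eLpNorm_four_le 4

theorem integral_pow_four (w : L2 d) :
    ∫ x, ‖w x‖ ^ 4 = norm4 w ^ 4 := by
  have h1 := integral_norm_eq_lintegral_enorm (μ := (volume : Measure (Pt d)))
    (f := fun x => ‖w x‖ ^ 4) ((Lp.aestronglyMeasurable w).norm.pow 4)
  rw [← eLpNorm_one_eq_lintegral_enorm, eLpNorm_pow_four_one, ENNReal.toReal_pow] at h1
  rw [← norm4] at h1
  rw [← h1]
  refine integral_congr_ae (ae_of_all _ fun x => ?_)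
  simp

/-- The dual function `|w|² w̄`. -/
theorem IsBdd.eLpNorm_dual_le {K : ℝ} {w : L2 d} (h : IsBdd K w) :
    eLpNorm (fun x => (‖w x‖ : ℂ) ^ 2 * starRingEnd ℂ (w x)) (4 / 3)
      ≤ ENNReal.ofReal (norm4 w ^ 3) := by
  have h2 := eLpNorm_norm_rpow (μ := (volume : Measure (Pt d))) (p := 4 / 3) w
    (by norm_num : (0 : ℝ) < 3)
  have e : (4 / 3 : ℝ≥0∞) * ENNReal.ofReal 3 = 4 := by
    rw [ENNReal.ofReal_ofNat, ENNReal.div_mul_cancel (by simp) (by simp)]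
  rw [e] at h2
  have h3 : eLpNorm w 4 ^ (3 : ℝ) = eLpNorm w 4 ^ 3 := by
    rw [← ENNReal.rpow_natCast]; norm_num
  rw [ENNReal.ofReal_pow (norm4_nonneg w), ← h.eLpNorm_four_eq, ← h3, ← h2]
  refine (eLpNorm_congr_norm_ae (ae_of_all _ fun x => ?_)).le
  rw [Real.norm_of_nonneg (Real.rpow_nonneg (norm_nonneg _) _), norm_mul, norm_pow,
    RCLike.norm_conj, Complex.norm_real, norm_norm]
  rw [show (3 : ℝ) = ((3 : ℕ) : ℝ) by norm_num, Real.rpow_natCast]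
  ring

theorem exists_schwartz_eLpNorm_sub_le {F : Pt d → ℂ} (hF : MemLp F (4 / 3)) {ε : ℝ} (hε : 0 < ε) :
    ∃ φ : 𝓢(Pt d, ℂ), eLpNorm (fun x => F x - φ x) (4 / 3) ≤ ENNReal.ofReal ε := by
  obtain ⟨φ, hφ⟩ := Metric.denseRange_iff.1 (SchwartzMap.denseRange_toLpCLM (F := ℂ)
      (μ := (volume : Measure (Pt d))) (p := 4 / 3) fourThirds_ne_top) (hF.toLp F) ε hε
  refine ⟨φ, ?_⟩
  rw [dist_eq_norm, Lp.norm_def] at hφ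
  have h1 := ENNReal.ofReal_le_ofReal hφ.le
  rw [ENNReal.ofReal_toReal (Lp.eLpNorm_ne_top _)] at h1
  refine (eLpNorm_congr_ae ?_).trans_le h1
  filter_upwards [Lp.coeFn_sub (hF.toLp F) (SchwartzMap.toLpCLM ℝ ℂ (4 / 3) volume φ),
    hF.coeFn_toLp, φ.coeFn_toLp (4 / 3) volume] with x h1 h2 h3
  rw [h1, Pi.sub_apply, h2]
  rw [show SchwartzMap.toLpCLM ℝ ℂ (4 / 3) volume φ = φ.toLp (4 / 3) volume from rfl, h3]

/-- The extremal test function |w|²w̄ has L^{4/3} norm at most n³ and pairs with w to n⁴. It is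
approximated by Schwartz functions in L^{4/3}, and the a priori L⁴ bound `K` makes the error of the
pairing vanish. -/
theorem IsBdd.norm4_le_of_pairing {K : ℝ} {w : L2 d} (h : IsBdd K w) {A : ℝ} (hA : 0 ≤ A)
    (hw : ∀ φ : 𝓢(Pt d, ℂ), ‖∫ x, w x * φ x‖ ≤ A * (eLpNorm φ (4 / 3)).toReal) :
    norm4 w ≤ A := by
  have hK := h.nonneg
  set n := norm4 w with hn
  have hn0 : 0 ≤ n := norm4_nonneg w
  have mw := Lp.aestronglyMeasurable w
  set W : Pt d → ℂ := fun x => (‖w x‖ : ℂ) ^ 2 * starRingEnd ℂ (w x) with hW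
  have mW : AEStronglyMeasurable W := by
    refine (((Complex.continuous_ofReal.comp continuous_norm).pow 2).comp_aestronglyMeasurable
      mw).mul (Complex.continuous_conj.comp_aestronglyMeasurable mw)
  have hWb := h.eLpNorm_dual_le
  have hWm : MemLp W (4 / 3) := ⟨mW, hWb.trans_lt ENNReal.ofReal_lt_top⟩
  have hint : ‖∫ x, w x * W x‖ = n ^ 4 := by
    have e1 : ∀ x, w x * W x = ((‖w x‖ ^ 4 : ℝ) : ℂ) := fun x => by
      rw [hW]
      simp only
      rw [mul_left_comm, Complex.mul_conj']
      push_cast; ring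
    simp only [e1]
    rw [integral_complex_ofReal, integral_pow_four, Complex.norm_real,
      Real.norm_of_nonneg (by positivity)]
  have key : ∀ ε : ℝ, 0 < ε → n ^ 4 ≤ A * (n ^ 3 + ε) + ε * K := by
    intro ε hε
    obtain ⟨φ, hφ⟩ := exists_schwartz_eLpNorm_sub_le hWm hε
    have mφ : AEStronglyMeasurable φ (volume : Measure (Pt d)) :=
      φ.continuous.aestronglyMeasurable
    have i1 := eLpNorm_mul_one_le (mW.sub mφ) mw hε.le hφ h.eLpNorm_four_le
    have i2 : eLpNorm φ (4 / 3) ≤ ENNReal.ofReal (n ^ 3 + ε) := by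
      have e2 : ⇑φ = W - fun x => W x - φ x := by ext x; simp
      rw [e2, ENNReal.ofReal_add (by positivity) hε.le]
      exact (eLpNorm_sub_le mW (mW.sub mφ) one_le_fourThirds).trans (add_le_add hWb hφ)
    have i3 := eLpNorm_mul_one_le mφ mw (by positivity) i2 h.eLpNorm_four_le
    have e3 : ∫ x, w x * W x = (∫ x, w x * φ x) + ∫ x, (W x - φ x) * w x := by
      rw [← integral_add]
      · refine integral_congr_ae (ae_of_all _ fun x => ?_)
        simp only; ring
      · refine (integrable_of_eLpNorm_one_le (mφ.mul mw) i3).congr (ae_of_all _ fun x => ?_)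
        exact mul_comm _ _
      · exact integrable_of_eLpNorm_one_le ((mW.sub mφ).mul mw) i1
    rw [← hint, e3]
    refine (norm_add_le _ _).trans (add_le_add ((hw φ).trans ?_)
      (norm_integral_le_of_eLpNorm_one_le (by positivity) i1))
    refine mul_le_mul_of_nonneg_left ?_ hA
    exact ENNReal.toReal_le_of_le_ofReal (by positivity) i2
  have h4 : n ^ 4 ≤ A * n ^ 3 := by
    have hlim : Tendsto (fun ε : ℝ => A * (n ^ 3 + ε) + ε * K) (𝓝[>] 0)
        (𝓝 (A * (n ^ 3 + 0) + 0 * K)) :=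
      ((by fun_prop : Continuous fun ε : ℝ => A * (n ^ 3 + ε) + ε * K).tendsto 0).mono_left
        nhdsWithin_le_nhds
    simpa using ge_of_tendsto hlim (eventually_mem_nhdsWithin.mono fun ε hε => key ε hε)
  rcases hn0.eq_or_lt with h0 | h0
  · rw [← h0]; exact hA
  · have h5 : 0 < n ^ 3 := by positivity
    refine le_of_mul_le_mul_right ?_ h5
    calc n * n ^ 3 = n ^ 4 := by ring
      _ ≤ _ := h4

/-- The dispersive estimate between `L^{4/3}` and `L⁴`. -/
theorem eLpNorm_freeS_le {t : ℝ} (ht : t ≠ 0) (φ : 𝓢(Pt d, ℂ)) :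
    eLpNorm (freeS t φ) 4 ≤ ENNReal.ofReal (|t| ^ (-(d / 4) : ℝ)) * eLpNorm φ (4 / 3) := by
  have h := lintegral_freeS_pow_four_le ht φ
  have e1 := eLpNorm_eq_lintegral_rpow_enorm_toReal (μ := (volume : Measure (Pt d)))
    (p := 4) (by simp) (by simp) (f := freeS t φ)
  have e2 := eLpNorm_eq_lintegral_rpow_enorm_toReal (μ := (volume : Measure (Pt d)))
    (p := 4 / 3) (by simp [ENNReal.div_eq_zero_iff]) fourThirds_ne_top (f := φ)
  have e3 : (4 / 3 : ℝ≥0∞).toReal = 4 / 3 := by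
    rw [ENNReal.toReal_div]; norm_num
  rw [e3] at e2
  have ht0 : 0 < |t| := abs_pos.2 ht
  -- The factor (2π)^{-d} is only weakened to 1, so that the constant of the estimate is a pure
  -- power of |t|.
  have hπ : (1 : ℝ) ≤ 2 * Real.pi := by linarith [Real.two_le_pi]
  set I : ℝ≥0∞ := ∫⁻ x, ‖φ x‖ₑ ^ (4 / 3 : ℝ)
  have h2 : ∫⁻ x, ‖freeS t φ x‖ₑ ^ (4 : ℝ≥0∞).toReal
      ≤ ENNReal.ofReal (|t| ^ d)⁻¹ * I ^ 3 := by
    refine le_trans (le_of_eq (lintegral_congr fun x => ?_)) (h.trans (mul_le_mul' ?_ le_rfl))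
    · rw [ENNReal.toReal_ofNat]; exact_mod_cast ENNReal.rpow_natCast _ 4
    · refine ENNReal.ofReal_le_ofReal ?_
      gcongr
      exact le_mul_of_one_le_left ht0.le hπ
  rw [e1, e2, ENNReal.toReal_ofNat]
  rw [ENNReal.toReal_ofNat] at h2
  refine (ENNReal.rpow_le_rpow h2 (by norm_num : (0 : ℝ) ≤ 1 / 4)).trans_eq ?_
  rw [ENNReal.mul_rpow_of_nonneg _ _ (by norm_num), ENNReal.ofReal_rpow_of_pos (by positivity),
    ← ENNReal.rpow_natCast, ← ENNReal.rpow_mul]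
  congr 2
  · rw [← Real.rpow_natCast, ← Real.rpow_neg ht0.le, ← Real.rpow_mul ht0.le]
    congr 1; ring
  · norm_num

/-! ### A singular integral -/

/-- After the factor e^{l|t|} is extracted, the integral is at most ∫₀^∞ r^{-α}e^{-lr} dr = Γ(1-α)
l^{α-1}, which tends to 0 as l grows. A kernel with integrable singularity is thus small in an
exponentially weighted sup norm, over all times at once. -/
theorem exists_singular_integral_bound {α : ℝ} (hα : α < 1) {ε : ℝ} (hε : 0 < ε) :
    ∃ l : ℝ, 0 < l ∧ ∀ t : ℝ,
      IntervalIntegrable (fun s => |t - s| ^ (-α) * Real.exp (l * |s|)) volume 0 t ∧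
      |∫ s in (0 : ℝ)..t, |t - s| ^ (-α) * Real.exp (l * |s|)| ≤ ε * Real.exp (l * |t|) := by
  have ha : 0 < 1 - α := by linarith
  have hlim : Tendsto (fun l : ℝ => (1 / l) ^ (1 - α) * Real.Gamma (1 - α)) atTop (𝓝 0) := by
    have h1 : Tendsto (fun l : ℝ => l ^ (-(1 - α))) atTop (𝓝 0) := tendsto_rpow_neg_atTop ha
    have h2 := h1.mul_const (Real.Gamma (1 - α))
    rw [zero_mul] at h2
    refine h2.congr' ?_
    filter_upwards [eventually_gt_atTop 0] with l hl
    rw [one_div, Real.inv_rpow hl.le, Real.rpow_neg hl.le]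
  obtain ⟨l, hl0, hl⟩ := ((eventually_gt_atTop (0 : ℝ)).and
    (hlim.eventually (gt_mem_nhds hε))).exists
  have hint : IntegrableOn (fun r : ℝ => r ^ ((1 - α) - 1) * Real.exp (-(l * r))) (Set.Ioi 0) := by
    -- The integral of a non-integrable function is 0 by convention, whereas the Gamma formula gives
    -- a positive value.
    by_contra hcon
    have h1 := Real.integral_rpow_mul_exp_neg_mul_Ioi ha hl0
    rw [integral_undef hcon] at h1
    have : 0 < (1 / l) ^ (1 - α) * Real.Gamma (1 - α) :=
      mul_pos (by positivity) (Real.Gamma_pos_of_pos ha)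
    linarith
  have hpos : ∀ t : ℝ, 0 ≤ t →
      IntervalIntegrable (fun s => |t - s| ^ (-α) * Real.exp (l * |s|)) volume 0 t ∧
      |∫ s in (0 : ℝ)..t, |t - s| ^ (-α) * Real.exp (l * |s|)| ≤ ε * Real.exp (l * |t|) := by
    intro t ht
    have i1 : IntervalIntegrable (fun r => r ^ ((1 - α) - 1) * Real.exp (-(l * r))) volume 0 t :=
      (intervalIntegrable_iff_integrableOn_Ioc_of_le ht).2 (hint.mono_set Set.Ioc_subset_Ioi_self)
    have e : ∀ s ∈ Set.uIcc 0 t, |t - s| ^ (-α) * Real.exp (l * |s|)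
        = Real.exp (l * t) * ((t - s) ^ ((1 - α) - 1) * Real.exp (-(l * (t - s)))) := by
      intro s hs
      rw [Set.uIcc_of_le ht] at hs
      rw [abs_of_nonneg (sub_nonneg.2 hs.2), abs_of_nonneg hs.1, mul_left_comm, ← Real.exp_add]
      congr 2 <;> ring
    have i2 : IntervalIntegrable
        (fun s => (t - s) ^ ((1 - α) - 1) * Real.exp (-(l * (t - s)))) volume 0 t := by
      have := i1.comp_sub_left t
      rw [sub_zero, sub_self] at this
      exact this.symm
    have i3 := i2.const_mul (Real.exp (l * t))
    refine ⟨i3.congr fun s hs => (e s (Set.uIoc_subset_uIcc hs)).symm, ?_⟩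
    rw [intervalIntegral.integral_congr e, intervalIntegral.integral_const_mul,
      intervalIntegral.integral_comp_sub_left
        (fun r => r ^ ((1 - α) - 1) * Real.exp (-(l * r))), sub_self, sub_zero, abs_mul,
      Real.abs_exp, abs_of_nonneg ht, mul_comm]
    refine mul_le_mul_of_nonneg_right ?_ (Real.exp_pos _).le
    have hnn : ∀ r ∈ Set.Ioi (0 : ℝ), 0 ≤ r ^ ((1 - α) - 1) * Real.exp (-(l * r)) := fun r hr => by
      have : 0 < r := hr
      positivity
    rw [intervalIntegral.integral_of_le ht, abs_of_nonneg
      (setIntegral_nonneg measurableSet_Ioc fun r hr => hnn r hr.1)]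
    refine (setIntegral_mono_set hint ?_
      (ae_of_all _ fun x hx => Set.Ioc_subset_Ioi_self hx)).trans ?_
    · exact (ae_restrict_iff' measurableSet_Ioi).2 (ae_of_all _ hnn)
    · rw [Real.integral_rpow_mul_exp_neg_mul_Ioi ha hl0]
      exact hl.le
  refine ⟨l, hl0, fun t => ?_⟩
  rcases le_total 0 t with ht | ht
  · exact hpos t ht
  · obtain ⟨i, b⟩ := hpos (-t) (by linarith)
    have e : ∀ s : ℝ, |-t - s| ^ (-α) * Real.exp (l * |s|)
        = |t - -s| ^ (-α) * Real.exp (l * |-s|) := fun s => by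
      rw [abs_neg]
      congr 2
      rw [← abs_neg]
      congr 1; ring
    simp only [e] at i b
    constructor
    · have := IntervalIntegrable.comp_sub_left i 0
      simpa using this
    · rw [intervalIntegral.integral_comp_neg
        (fun s => |t - s| ^ (-α) * Real.exp (l * |s|)), neg_neg, neg_zero,
        intervalIntegral.integral_symm, abs_neg, abs_neg] at b
      exact b

/-! ### Weak trajectories and their stability in `L⁴` -/

/-- The free group is isometric on H¹, so the Sobolev embedding bounds the L⁶ norm uniformly in
time. -/
theorem exists_isBdd_freeS (hd : d = 2 ∨ d = 3) (φ : 𝓢(Pt d, ℂ)) :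
    ∃ B : ℝ, ∀ t, IsBdd B (freeGroup t (φ.toLp 2 volume) : L2 d) := by
  obtain ⟨C, -, hC⟩ := exists_isBdd hd
  refine ⟨C * ‖H1.ofSchwartz φ‖, fun t => ?_⟩
  have := hC ((H1.ofSchwartz φ).free t)
  rwa [H1.norm_free, H1.free_fn, H1.ofSchwartz_fn] at this

theorem coeFn_freeGroup_toLp (t : ℝ) (φ : 𝓢(Pt d, ℂ)) :
    (freeGroup t (φ.toLp 2 volume) : L2 d) =ᵐ[volume] freeS t φ := by
  rw [freeGroup_toLp]
  exact (freeS t φ).coeFn_toLp 2 volume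

theorem tendsto_norm4_zero {ι : Type*} {l : Filter ι} {w : ι → L2 d} {K : ℝ}
    (hb : ∀ᶠ i in l, IsBdd K (w i)) (h : Tendsto (fun i => ‖w i‖) l (𝓝 0)) :
    Tendsto (fun i => norm4 (w i)) l (𝓝 0) := by
  have h1 : Tendsto (fun i => norm4 (w i) ^ 4) l (𝓝 0) := by
    refine squeeze_zero' (Eventually.of_forall fun i => pow_nonneg (norm4_nonneg _) _)
      (hb.mono fun i hi => hi.norm4_pow_le) ?_
    simpa using h.mul_const (K ^ 3)
  have h2 := h1.sqrt.sqrt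
  simp only [Real.sqrt_zero] at h2
  refine h2.congr fun i => ?_
  rw [show norm4 (w i) ^ 4 = (norm4 (w i) ^ 2) ^ 2 by ring, Real.sqrt_sq (sq_nonneg _),
    Real.sqrt_sq (norm4_nonneg _)]

/-- The pairing of the nonlinearity with a free evolution. -/
def sourcePair (g : ℂ → ℂ) (u : L2 d) (τ : ℝ) (φ : 𝓢(Pt d, ℂ)) : ℂ :=
  ∫ x, g (u x) * freeS τ φ x

theorem sourcePair_eq (g : ℂ → ℂ) (u : L2 d) (τ : ℝ) (φ : 𝓢(Pt d, ℂ)) :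
    sourcePair g u τ φ = ∫ x, g (u x) * (freeGroup τ (φ.toLp 2 volume) : L2 d) x := by
  refine integral_congr_ae ?_
  filter_upwards [coeFn_freeGroup_toLp τ φ] with x hx
  rw [hx]

theorem norm_integral_sub_le_of_eLpNorm {F₁ F₂ : Pt d → ℂ} (m1 : AEStronglyMeasurable F₁)
    (m2 : AEStronglyMeasurable F₂) {A M B : ℝ} (hA : 0 ≤ A)
    (h12 : eLpNorm (fun x => F₁ x - F₂ x) (4 / 3) ≤ ENNReal.ofReal A) (hM : 0 ≤ M)
    (h1 : eLpNorm F₁ (4 / 3) ≤ ENNReal.ofReal M) (h2 : eLpNorm F₂ (4 / 3) ≤ ENNReal.ofReal M)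
    {ψ ψ' : L2 d} (hψ : IsBdd B ψ) (hψ' : IsBdd B ψ') :
    ‖(∫ x, F₁ x * ψ x) - ∫ x, F₂ x * ψ' x‖ ≤ A * norm4 ψ + M * norm4 (ψ - ψ') := by
  have hn1 := norm4_nonneg ψ
  have hn2 := norm4_nonneg (ψ - ψ')
  have mψ := Lp.aestronglyMeasurable ψ
  have mψ' := Lp.aestronglyMeasurable ψ'
  have i1 := eLpNorm_mul_one_le (m1.sub m2) mψ hA h12 hψ.eLpNorm_four_eq.le
  have h4 : eLpNorm (⇑ψ - ⇑ψ') 4 ≤ ENNReal.ofReal (norm4 (ψ - ψ')) := by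
    rw [← (hψ.sub hψ').eLpNorm_four_eq, eLpNorm_congr_ae (Lp.coeFn_sub ψ ψ')]
  have i2 := eLpNorm_mul_one_le m2 (mψ.sub mψ') hM h2 h4
  have j1 : Integrable fun x => F₁ x * ψ x := integrable_of_eLpNorm_one_le (m1.mul mψ)
    (eLpNorm_mul_one_le m1 mψ hM h1 hψ.eLpNorm_four_eq.le)
  have j2 : Integrable fun x => F₂ x * ψ' x := integrable_of_eLpNorm_one_le (m2.mul mψ')
    (eLpNorm_mul_one_le m2 mψ' hM h2 hψ'.eLpNorm_four_eq.le)
  have e : (∫ x, F₁ x * ψ x) - ∫ x, F₂ x * ψ' x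
      = (∫ x, (F₁ x - F₂ x) * ψ x) + ∫ x, F₂ x * (ψ x - ψ' x) := by
    have k1 : Integrable fun x => (F₁ x - F₂ x) * ψ x :=
      integrable_of_eLpNorm_one_le ((m1.sub m2).mul mψ) i1
    have k2 : Integrable fun x => F₂ x * (ψ x - ψ' x) :=
      integrable_of_eLpNorm_one_le (m2.mul (mψ.sub mψ')) i2
    rw [← integral_sub j1 j2, ← integral_add k1 k2]
    refine integral_congr_ae (ae_of_all _ fun x => ?_)
    ring
  rw [e]
  exact (norm_add_le _ _).trans (add_le_add (norm_integral_le_of_eLpNorm_one_le (by positivity) i1)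
    (norm_integral_le_of_eLpNorm_one_le (by positivity) i2))

theorem IsNearNL.norm_integral_sub_le {g₁ g₂ : ℂ → ℂ} {δ₁ δ₂ : ℝ} (h₁ : IsNearNL g₁ δ₁)
    (h₂ : IsNearNL g₂ δ₂) {K B : ℝ} {a b ψ ψ' : L2 d} (ha : IsBdd K a) (hb : IsBdd K b)
    (hψ : IsBdd B ψ) (hψ' : IsBdd B ψ') :
    ‖(∫ x, g₁ (a x) * ψ x) - ∫ x, g₂ (b x) * ψ' x‖
      ≤ (14 * (K + K ^ 3) * norm4 (a - b) + (δ₁ + δ₂) * K ^ (9 / 2 : ℝ)) * norm4 ψ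
        + 14 * (K + K ^ 3) * K * norm4 (ψ - ψ') := by
  have hK := ha.nonneg
  have hn := norm4_nonneg (a - b)
  have hd1 := h₁.nonneg
  have hd2 := h₂.nonneg
  exact norm_integral_sub_le_of_eLpNorm (h₁.aestronglyMeasurable a) (h₂.aestronglyMeasurable b)
    (by positivity) (h₁.eLpNorm_sub_sub_le h₂ ha hb) (by positivity) (h₁.eLpNorm_le ha)
    (h₂.eLpNorm_le hb) hψ hψ'

theorem IsNearNL.norm_integral_self_sub_le {g : ℂ → ℂ} {δ : ℝ} (h : IsNearNL g δ) {K B : ℝ}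
    {a b ψ ψ' : L2 d} (ha : IsBdd K a) (hb : IsBdd K b) (hψ : IsBdd B ψ) (hψ' : IsBdd B ψ') :
    ‖(∫ x, g (a x) * ψ x) - ∫ x, g (b x) * ψ' x‖
      ≤ 14 * (K + K ^ 3) * norm4 (a - b) * norm4 ψ + 14 * (K + K ^ 3) * K * norm4 (ψ - ψ') := by
  have h1 := norm_integral_sub_le_of_eLpNorm (h.aestronglyMeasurable a) (h.aestronglyMeasurable b)
    (mul_nonneg (mul_nonneg (by norm_num) (add_nonneg ha.nonneg (pow_nonneg ha.nonneg 3)))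
      (norm4_nonneg _)) (h.eLpNorm_sub_le ha hb)
    (by have := ha.nonneg; positivity) (h.eLpNorm_le ha) (h.eLpNorm_le hb) hψ hψ'
  exact h1

/-- Functions on `[-T, T]`, continuous in `L²` and bounded in `L² ∩ L⁶`, that satisfy Duhamel's
formula with the nonlinearity `g` in the sense of distributions. -/
structure WeakTraj (g : ℂ → ℂ) (T K : ℝ) (u : ℝ → L2 d) : Prop where
  continuous : Continuous u
  isBdd : ∀ t, |t| ≤ T → IsBdd K (u t)
  duhamel : ∀ t, |t| ≤ T → ∀ φ : 𝓢(Pt d, ℂ),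
    pairS φ (u t) = pairS φ (freeGroup t (u 0)) -
      Complex.I * ∫ s in (0 : ℝ)..t, sourcePair g (u s) (t - s) φ

theorem abs_le_of_mem_uIcc_zero {s t : ℝ} (hs : s ∈ Set.uIcc 0 t) : |s| ≤ |t| := by
  simpa using Set.abs_sub_left_of_mem_uIcc hs

/-- Both u and the evolved test function are continuous in L² and bounded in L⁶, hence continuous in
L⁴. This gives the integrability in s that Duhamel's formula needs, even at the singular time s = t.
-/
theorem continuousOn_sourcePair (hd : d = 2 ∨ d = 3) {g : ℂ → ℂ} {δ : ℝ} (hg : IsNearNL g δ)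
    {u : ℝ → L2 d} (hu : Continuous u) {S : Set ℝ} {K : ℝ} (hb : ∀ s ∈ S, IsBdd K (u s)) (t : ℝ)
    (φ : 𝓢(Pt d, ℂ)) : ContinuousOn (fun s => sourcePair g (u s) (t - s) φ) S := by
  obtain ⟨B, hB⟩ := exists_isBdd_freeS hd φ
  intro s₀ hs₀
  rw [ContinuousWithinAt, tendsto_iff_norm_sub_tendsto_zero]
  have hK := (hb s₀ hs₀).nonneg
  set ψ : ℝ → L2 d := fun s => freeGroup (t - s) (φ.toLp 2 volume) with hψ
  have hψc : Continuous ψ := continuous_freeGroup_comp (by fun_prop) continuous_const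
  have hle : ∀ s ∈ S, ‖sourcePair g (u s) (t - s) φ - sourcePair g (u s₀) (t - s₀) φ‖
      ≤ 14 * (K + K ^ 3) * norm4 (u s - u s₀) * B + 14 * (K + K ^ 3) * K * norm4 (ψ s - ψ s₀) := by
    intro s hs
    rw [sourcePair_eq, sourcePair_eq]
    have h1 := hg.norm_integral_self_sub_le (hb s hs) (hb s₀ hs₀) (hB (t - s)) (hB (t - s₀))
    refine h1.trans (add_le_add (mul_le_mul_of_nonneg_left (hB _).norm4_le ?_) le_rfl)
    have := norm4_nonneg (u s - u s₀)
    positivity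
  have l1 : Tendsto (fun s => norm4 (u s - u s₀)) (𝓝[S] s₀) (𝓝 0) := by
    refine tendsto_norm4_zero (K := K + K) ?_ ?_
    · filter_upwards [self_mem_nhdsWithin] with s hs using (hb s hs).sub (hb s₀ hs₀)
    · exact (tendsto_iff_norm_sub_tendsto_zero.1 (hu.tendsto s₀)).mono_left nhdsWithin_le_nhds
  have l2 : Tendsto (fun s => norm4 (ψ s - ψ s₀)) (𝓝[S] s₀) (𝓝 0) := by
    refine tendsto_norm4_zero (K := B + B) ?_ ?_
    · exact Eventually.of_forall fun s => (hB _).sub (hB _)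
    · exact (tendsto_iff_norm_sub_tendsto_zero.1 (hψc.tendsto s₀)).mono_left nhdsWithin_le_nhds
  refine squeeze_zero' (Eventually.of_forall fun _ => norm_nonneg _)
    (eventually_mem_nhdsWithin.mono hle) ?_
  simpa using ((l1.const_mul (14 * (K + K ^ 3))).mul_const B).add
    (l2.const_mul (14 * (K + K ^ 3) * K))

/-- Here the dispersive estimate enters, applied to the test function. The bound sees only its
L^{4/3} norm, as the duality argument for L⁴ requires. -/
theorem norm_sourcePair_sub_le (hd : d = 2 ∨ d = 3) {g₁ g₂ : ℂ → ℂ} {δ₁ δ₂ : ℝ}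
    (h₁ : IsNearNL g₁ δ₁) (h₂ : IsNearNL g₂ δ₂) {K : ℝ} {a b : L2 d} (ha : IsBdd K a)
    (hb : IsBdd K b) {τ : ℝ} (hτ : τ ≠ 0) (φ : 𝓢(Pt d, ℂ)) :
    ‖sourcePair g₁ a τ φ - sourcePair g₂ b τ φ‖
      ≤ |τ| ^ (-(d / 4) : ℝ) * (14 * (K + K ^ 3) * norm4 (a - b) + (δ₁ + δ₂) * K ^ (9 / 2 : ℝ))
        * (eLpNorm φ (4 / 3)).toReal := by
  obtain ⟨B, hB⟩ := exists_isBdd_freeS hd φ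
  have hK := ha.nonneg
  have hn := norm4_nonneg (a - b)
  have hd1 := h₁.nonneg
  have hd2 := h₂.nonneg
  rw [sourcePair_eq, sourcePair_eq]
  have h := h₁.norm_integral_sub_le h₂ ha hb (hB τ) (hB τ)
  have e : norm4 (0 : L2 d) = 0 := by
    refine le_antisymm ?_ (norm4_nonneg _)
    exact (isBdd_zero (d := d) le_rfl).norm4_le
  rw [sub_self (freeGroup τ (φ.toLp 2 volume) : L2 d), e, mul_zero, add_zero] at h
  refine h.trans ?_
  have hφ : eLpNorm φ (4 / 3) ≠ ∞ := (φ.eLpNorm_lt_top (4 / 3) volume).ne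
  have h3 : norm4 (freeGroup τ (φ.toLp 2 volume) : L2 d)
      ≤ |τ| ^ (-(d / 4) : ℝ) * (eLpNorm φ (4 / 3)).toReal := by
    refine ENNReal.toReal_le_of_le_ofReal (by positivity) ?_
    rw [eLpNorm_congr_ae (coeFn_freeGroup_toLp τ φ), ENNReal.ofReal_mul (by positivity),
      ENNReal.ofReal_toReal hφ]
    exact eLpNorm_freeS_le hτ φ
  calc _ ≤ _ := mul_le_mul_of_nonneg_left h3 (by positivity)
    _ = _ := by ring

theorem norm_pairS_le_of_norm4 {w : L2 d} {K A : ℝ} (hw : IsBdd K w) (hA : norm4 w ≤ A)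
    (φ : 𝓢(Pt d, ℂ)) : ‖pairS φ w‖ ≤ A * (eLpNorm φ (4 / 3)).toReal := by
  have hφ : eLpNorm φ (4 / 3) ≠ ∞ := (φ.eLpNorm_lt_top (4 / 3) volume).ne
  have hA0 := (norm4_nonneg w).trans hA
  have hN : (0 : ℝ) ≤ (eLpNorm φ (4 / 3)).toReal := ENNReal.toReal_nonneg
  have h1 : eLpNorm φ (4 / 3) ≤ ENNReal.ofReal (eLpNorm φ (4 / 3)).toReal := by
    rw [ENNReal.ofReal_toReal hφ]
  have h2 : eLpNorm w 4 ≤ ENNReal.ofReal A := by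
    rw [hw.eLpNorm_four_eq]
    exact ENNReal.ofReal_le_ofReal hA
  have m1 : AEStronglyMeasurable φ (volume : Measure (Pt d)) := φ.continuous.aestronglyMeasurable
  generalize (eLpNorm φ (4 / 3)).toReal = N at h1 hN ⊢
  have h3 := norm_integral_le_of_eLpNorm_one_le (mul_nonneg hN hA0)
    (eLpNorm_mul_one_le m1 (Lp.aestronglyMeasurable w) hN h1 h2)
  rw [pairS_apply, mul_comm A]
  refine le_trans (le_of_eq ?_) h3
  congr 1
  exact integral_congr_ae (ae_of_all _ fun x => mul_comm _ _)

/-- Stability of weak trajectories in `L⁴`. -/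
theorem exists_norm4_sub_le (hd : d = 2 ∨ d = 3) {K : ℝ} (hK : 0 ≤ K) :
    ∃ l : ℝ, 0 < l ∧ ∀ {T : ℝ} {g₁ g₂ : ℂ → ℂ} {δ₁ δ₂ : ℝ} {u₁ u₂ : ℝ → L2 d},
      IsNearNL g₁ δ₁ → IsNearNL g₂ δ₂ → WeakTraj g₁ T K u₁ → WeakTraj g₂ T K u₂ →
      ∀ A : ℝ, (∀ t, IsBdd A (freeGroup t (u₁ 0 - u₂ 0))) → ∀ t, |t| ≤ T →
        norm4 (u₁ t - u₂ t) ≤ 2 * (A + (δ₁ + δ₂) * K ^ (9 / 2 : ℝ)) * Real.exp (l * |t|) := by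
  set c : ℝ := 14 * (K + K ^ 3) with hc
  have hc0 : 0 ≤ c := by positivity
  have hα : (d / 4 : ℝ) < 1 := by
    rcases hd with rfl | rfl <;> norm_num
  -- The value (2(c+1))⁻¹ makes the Lipschitz constant c times the kernel at most 1/2, so the
  -- Duhamel term can be absorbed. The rate l does not depend on the time horizon or on the
  -- nonlinearities.
  obtain ⟨l, hl0, hl⟩ := exists_singular_integral_bound hα
    (by positivity : (0 : ℝ) < (2 * (c + 1))⁻¹)
  refine ⟨l, hl0, ?_⟩
  intro T g₁ g₂ δ₁ δ₂ u₁ u₂ h₁ h₂ hu₁ hu₂ A hA t₀ ht₀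
  have hT : 0 ≤ T := (abs_nonneg _).trans ht₀
  have hA0 : 0 ≤ A := (hA 0).nonneg
  set η : ℝ := (δ₁ + δ₂) * K ^ (9 / 2 : ℝ) with hη
  have hη0 : 0 ≤ η := by
    have := h₁.nonneg
    have := h₂.nonneg
    positivity
  set y : ℝ → ℝ := fun t => norm4 (u₁ t - u₂ t) with hy
  -- The weighted supremum is finite a priori, since both trajectories are bounded by `K` in L⁴;
  -- this justifies the absorption.
  set S : Set ℝ := (fun t => Real.exp (-(l * |t|)) * y t) '' {t | |t| ≤ T} with hS
  have hbdd : BddAbove S := by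
    refine ⟨K + K, ?_⟩
    rintro _ ⟨t, ht, rfl⟩
    have h3 : y t ≤ K + K := ((hu₁.isBdd t ht).sub (hu₂.isBdd t ht)).norm4_le
    have h4 : Real.exp (-(l * |t|)) ≤ 1 := Real.exp_le_one_iff.2 (by simp; positivity)
    calc Real.exp (-(l * |t|)) * y t ≤ 1 * (K + K) :=
          mul_le_mul h4 h3 (norm4_nonneg _) zero_le_one
      _ = _ := one_mul _
  have hne : S.Nonempty := ⟨_, 0, by simpa using hT, rfl⟩
  set Y := sSup S with hY
  have hyY : ∀ t, |t| ≤ T → y t ≤ Y * Real.exp (l * |t|) := by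
    intro t ht
    have : Real.exp (-(l * |t|)) * y t ≤ Y := le_csSup hbdd ⟨t, ht, rfl⟩
    rw [Real.exp_neg, inv_mul_le_iff₀ (Real.exp_pos _)] at this
    linarith
  have hY0 : 0 ≤ Y := by
    have := hyY 0 (by simpa using hT)
    simp only [abs_zero, mul_zero, Real.exp_zero, mul_one] at this
    exact (norm4_nonneg _).trans this
  have key : ∀ t, |t| ≤ T → y t ≤ A + (c * Y + η) * ((2 * (c + 1))⁻¹ * Real.exp (l * |t|)) := by
    intro t ht
    obtain ⟨hi, hb⟩ := hl t
    have hpos : 0 ≤ A + (c * Y + η) * ((2 * (c + 1))⁻¹ * Real.exp (l * |t|)) := by positivity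
    refine ((hu₁.isBdd t ht).sub (hu₂.isBdd t ht)).norm4_le_of_pairing hpos fun φ => ?_
    set N := (eLpNorm φ (4 / 3)).toReal with hN
    have hN0 : 0 ≤ N := ENNReal.toReal_nonneg
    have hsub : ∀ s ∈ Set.uIcc 0 t, |s| ≤ T := fun s hs => (abs_le_of_mem_uIcc_zero hs).trans ht
    have c1 : IntervalIntegrable (fun s => sourcePair g₁ (u₁ s) (t - s) φ) volume 0 t :=
      (continuousOn_sourcePair hd h₁ hu₁.continuous
        (fun s hs => hu₁.isBdd s (hsub s hs)) t φ).intervalIntegrable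
    have c2 : IntervalIntegrable (fun s => sourcePair g₂ (u₂ s) (t - s) φ) volume 0 t :=
      (continuousOn_sourcePair hd h₂ hu₂.continuous
        (fun s hs => hu₂.isBdd s (hsub s hs)) t φ).intervalIntegrable
    rw [← pairS_apply, map_sub, hu₁.duhamel t ht φ, hu₂.duhamel t ht φ]
    have e : pairS φ (freeGroup t (u₁ 0)) -
        Complex.I * (∫ s in (0 : ℝ)..t, sourcePair g₁ (u₁ s) (t - s) φ) -
        (pairS φ (freeGroup t (u₂ 0)) -
          Complex.I * ∫ s in (0 : ℝ)..t, sourcePair g₂ (u₂ s) (t - s) φ)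
        = pairS φ (freeGroup t (u₁ 0 - u₂ 0)) - Complex.I * ∫ s in (0 : ℝ)..t,
          (sourcePair g₁ (u₁ s) (t - s) φ - sourcePair g₂ (u₂ s) (t - s) φ) := by
      rw [intervalIntegral.integral_sub c1 c2, map_sub, map_sub]
      ring
    rw [e]
    refine (norm_sub_le _ _).trans ?_
    rw [norm_mul, Complex.norm_I, one_mul, add_mul]
    refine add_le_add (norm_pairS_le_of_norm4 (hA t) (hA t).norm4_le φ) ?_
    have hi2 := hi.const_mul ((c * Y + η) * N)
    have hle : ∀ᵐ s ∂(volume.restrict (Set.uIoc 0 t)),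
        ‖sourcePair g₁ (u₁ s) (t - s) φ - sourcePair g₂ (u₂ s) (t - s) φ‖
          ≤ (c * Y + η) * N * (|t - s| ^ (-(d / 4) : ℝ) * Real.exp (l * |s|)) := by
      have hne : ∀ᵐ s ∂(volume.restrict (Set.uIoc 0 t)), s ≠ t := by
        refine ae_restrict_of_ae ?_
        simp [ae_iff]
      filter_upwards [hne, ae_restrict_mem measurableSet_uIoc] with s hst hs
      have hsT := hsub s (Set.uIoc_subset_uIcc hs)
      refine (norm_sourcePair_sub_le hd h₁ h₂ (hu₁.isBdd s hsT) (hu₂.isBdd s hsT)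
        (sub_ne_zero.2 hst.symm) φ).trans ?_
      have h5 : c * norm4 (u₁ s - u₂ s) + η ≤ (c * Y + η) * Real.exp (l * |s|) := by
        have h6 := mul_le_mul_of_nonneg_left (hyY s hsT) hc0
        have h7 : η ≤ η * Real.exp (l * |s|) :=
          le_mul_of_one_le_right hη0 (Real.one_le_exp (by positivity))
        calc _ ≤ c * (Y * Real.exp (l * |s|)) + η * Real.exp (l * |s|) := add_le_add h6 h7
          _ = _ := by ring
      calc _ ≤ |t - s| ^ (-(d / 4) : ℝ) * ((c * Y + η) * Real.exp (l * |s|)) * N :=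
            mul_le_mul_of_nonneg_right (mul_le_mul_of_nonneg_left h5 (by positivity)) hN0
        _ = _ := by ring
    refine (intervalIntegral.norm_integral_le_abs_of_norm_le hle hi2).trans ?_
    rw [intervalIntegral.integral_const_mul, abs_mul, abs_of_nonneg (by positivity)]
    calc _ ≤ (c * Y + η) * N * ((2 * (c + 1))⁻¹ * Real.exp (l * |t|)) :=
          mul_le_mul_of_nonneg_left hb (by positivity)
      _ = _ := by ring
  have hfin : Y ≤ A + (c * Y + η) * (2 * (c + 1))⁻¹ := by
    refine csSup_le hne ?_
    rintro _ ⟨t, ht, rfl⟩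
    have h3 := key t ht
    have h4 : Real.exp (-(l * |t|)) ≤ 1 := Real.exp_le_one_iff.2 (by simp; positivity)
    have h5 : Real.exp (-(l * |t|)) * Real.exp (l * |t|) = 1 := by
      rw [← Real.exp_add]; simp
    calc Real.exp (-(l * |t|)) * y t
        ≤ Real.exp (-(l * |t|)) * (A + (c * Y + η) * ((2 * (c + 1))⁻¹ * Real.exp (l * |t|))) :=
          mul_le_mul_of_nonneg_left h3 (Real.exp_pos _).le
      _ = Real.exp (-(l * |t|)) * A + (c * Y + η) * (2 * (c + 1))⁻¹ *
          (Real.exp (-(l * |t|)) * Real.exp (l * |t|)) := by ring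
      _ ≤ 1 * A + (c * Y + η) * (2 * (c + 1))⁻¹ := by
          rw [h5, mul_one]
          exact add_le_add (mul_le_mul_of_nonneg_right h4 hA0) le_rfl
      _ = _ := by ring
  have hY2 : Y ≤ 2 * (A + η) := by
    have h3 : (c * Y + η) * (2 * (c + 1))⁻¹ ≤ Y / 2 + η / 2 := by
      rw [← div_eq_mul_inv, div_le_iff₀ (by positivity)]
      nlinarith [mul_nonneg hc0 hη0]
    linarith
  exact (hyY t₀ ht₀).trans (mul_le_mul_of_nonneg_right hY2 (Real.exp_pos _).le)

section

/-! ### Global solutions of ordinary differential equations with a Lipschitz right-hand side -/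

section ODE

variable {E : Type*} [NormedAddCommGroup E] [NormedSpace ℝ E]

/-- Picard iteration in the space of functions of at most exponential growth. -/
theorem exists_integral_equation_solution [CompleteSpace E] {F : ℝ → E → E}
    (hF : Continuous (Function.uncurry F)) {L : ℝ} (hL0 : 0 ≤ L)
    (hL : ∀ t x y, ‖F t x - F t y‖ ≤ L * ‖x - y‖) (h0 : ∀ t, F t 0 = 0) (x₀ : E) :
    ∃ v : ℝ → E, Continuous v ∧ ∀ t, v t = x₀ + ∫ s in (0 : ℝ)..t, F s (v s) := by
  obtain ⟨l, hl0, hl⟩ := exists_singular_integral_bound (α := 0) zero_lt_one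
    (by positivity : (0 : ℝ) < (2 * (L + 1))⁻¹)
  simp only [neg_zero, Real.rpow_zero, one_mul] at hl
  set e : ℝ → ℝ := fun t => Real.exp (l * |t|) with he
  have hec : Continuous e := by fun_prop
  have hepos : ∀ t, 0 < e t := fun t => Real.exp_pos _
  have he1 : ∀ t, 1 ≤ e t := fun t => Real.one_le_exp (by positivity)
  have hFw : ∀ w : ℝ →ᵇ E, Continuous fun s => F s (e s • w s) := fun w =>
    hF.comp (continuous_id.prodMk (hec.smul w.continuous))
  set I : (ℝ →ᵇ E) → ℝ → E := fun w t => ∫ s in (0 : ℝ)..t, F s (e s • w s) with hI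
  have hIc : ∀ w, Continuous (I w) := fun w =>
    intervalIntegral.continuous_primitive (fun a b => (hFw w).intervalIntegrable a b) 0
  have hIsub : ∀ (w w' : ℝ →ᵇ E) t, ‖I w t - I w' t‖ ≤ 1 / 2 * ‖w - w'‖ * e t := by
    intro w w' t
    rw [hI]
    simp only
    rw [← intervalIntegral.integral_sub ((hFw w).intervalIntegrable _ _)
      ((hFw w').intervalIntegrable _ _)]
    have h1 : ∀ s, ‖F s (e s • w s) - F s (e s • w' s)‖ ≤ L * ‖w - w'‖ * e s := by
      intro s
      refine (hL _ _ _).trans ?_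
      rw [← smul_sub, norm_smul, Real.norm_of_nonneg (hepos s).le]
      have h2 : ‖w s - w' s‖ ≤ ‖w - w'‖ := (w - w').norm_coe_le_norm s
      calc L * (e s * ‖w s - w' s‖) ≤ L * (e s * ‖w - w'‖) := by
            have := hepos s
            gcongr
        _ = _ := by ring
    refine (intervalIntegral.norm_integral_le_abs_of_norm_le (ae_of_all _ h1)
      ((hl t).1.const_mul _)).trans ?_
    rw [intervalIntegral.integral_const_mul, abs_mul, abs_of_nonneg (by positivity)]
    refine (mul_le_mul_of_nonneg_left (hl t).2 (by positivity)).trans ?_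
    have h3 : L * (2 * (L + 1))⁻¹ ≤ 1 / 2 := by
      rw [← div_eq_mul_inv, div_le_div_iff₀ (by positivity) (by norm_num)]
      linarith
    calc L * ‖w - w'‖ * ((2 * (L + 1))⁻¹ * e t)
        = (L * (2 * (L + 1))⁻¹) * ‖w - w'‖ * e t := by ring
      _ ≤ _ := by
        have := hepos t
        gcongr
  have hI0 : ∀ t, I 0 t = 0 := fun t => by simp [hI, h0]
  have hIbound : ∀ (w : ℝ →ᵇ E) t, ‖I w t‖ ≤ 1 / 2 * ‖w‖ * e t := fun w t => by
    simpa [hI0] using hIsub w 0 t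
  have hinv : ∀ (z : E) (C : ℝ) t, ‖z‖ ≤ C * e t → ‖(e t)⁻¹ • z‖ ≤ C := by
    intro z C t hz
    rw [norm_smul, norm_inv, Real.norm_of_nonneg (hepos t).le, inv_mul_le_iff₀ (hepos t)]
    linarith
  -- The unknown is v = e^{l|t|}w with w bounded and continuous. With l chosen so that the integral
  -- gains (2(L+1))⁻¹, the map contracts by 1/2 on the whole line.
  let Φ : (ℝ →ᵇ E) → ℝ →ᵇ E := fun w =>
    BoundedContinuousFunction.ofNormedAddCommGroup (fun t => (e t)⁻¹ • (x₀ + I w t))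
      ((hec.inv₀ fun t => (hepos t).ne').smul (continuous_const.add (hIc w)))
      (‖x₀‖ + 1 / 2 * ‖w‖) fun t => by
        refine hinv _ _ _ ((norm_add_le _ _).trans ?_)
        rw [add_mul]
        exact add_le_add (le_mul_of_one_le_right (norm_nonneg _) (he1 t)) (hIbound w t)
  have hΦ : ContractingWith (1 / 2 : ℝ≥0) Φ := by
    refine ⟨by norm_num [← NNReal.coe_lt_coe], LipschitzWith.of_dist_le_mul fun w w' => ?_⟩
    rw [dist_eq_norm, dist_eq_norm]
    refine (BoundedContinuousFunction.norm_le (by positivity)).2 fun t => ?_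
    change ‖(e t)⁻¹ • (x₀ + I w t) - (e t)⁻¹ • (x₀ + I w' t)‖ ≤ _
    rw [← smul_sub, add_sub_add_left_eq_sub]
    refine hinv _ _ _ ((hIsub w w' t).trans_eq ?_)
    norm_num
  set w := ContractingWith.fixedPoint Φ hΦ with hw
  have hfix : Φ w = w := hΦ.fixedPoint_isFixedPt
  refine ⟨fun t => e t • w t, hec.smul w.continuous, fun t => ?_⟩
  have h2 : w t = (e t)⁻¹ • (x₀ + I w t) := by
    conv_lhs => rw [← hfix]
    rfl
  change e t • w t = x₀ + I w t
  rw [h2, smul_inv_smul₀ (hepos t).ne']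

theorem exists_global_ode_solution [CompleteSpace E] {F : ℝ → E → E}
    (hF : Continuous (Function.uncurry F)) {L : ℝ} (hL0 : 0 ≤ L)
    (hL : ∀ t x y, ‖F t x - F t y‖ ≤ L * ‖x - y‖) (h0 : ∀ t, F t 0 = 0) (x₀ : E) :
    ∃ v : ℝ → E, v 0 = x₀ ∧ ∀ t, HasDerivAt v (F t (v t)) t := by
  obtain ⟨v, hv, h⟩ := exists_integral_equation_solution hF hL0 hL h0 x₀
  have hc : Continuous fun s => F s (v s) := hF.comp (continuous_id.prodMk hv)
  refine ⟨v, by rw [h]; simp, fun t => ?_⟩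
  have h1 := (intervalIntegral.integral_hasDerivAt_right (hc.intervalIntegrable 0 t)
    (hc.stronglyMeasurableAtFilter _ _) hc.continuousAt).const_add x₀
  exact h1.congr_of_eventuallyEq (Eventually.of_forall h)

/-- Exponential bound for the distance of two solutions, in both time directions. -/
theorem norm_sub_le_of_hasDerivAt {F : ℝ → E → E} {L : ℝ≥0}
    (hL : ∀ t x y, ‖F t x - F t y‖ ≤ L * ‖x - y‖) {v w : ℝ → E}
    (hv : ∀ t, HasDerivAt v (F t (v t)) t) (hw : ∀ t, HasDerivAt w (F t (w t)) t) (t : ℝ) :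
    ‖v t - w t‖ ≤ ‖v 0 - w 0‖ * Real.exp (L * |t|) := by
  have key : ∀ (F : ℝ → E → E), (∀ t x y, ‖F t x - F t y‖ ≤ L * ‖x - y‖) → ∀ v w : ℝ → E,
      (∀ t, HasDerivAt v (F t (v t)) t) → (∀ t, HasDerivAt w (F t (w t)) t) → ∀ t, 0 ≤ t →
      ‖v t - w t‖ ≤ ‖v 0 - w 0‖ * Real.exp (L * |t|) := by
    intro F hL v w hv hw t ht
    have h := dist_le_of_trajectories_ODE (v := F) (K := L) (f := v) (g := w) (a := 0) (b := t)
      (δ := ‖v 0 - w 0‖) (fun t => LipschitzWith.of_dist_le_mul fun x y => by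
        rw [dist_eq_norm, dist_eq_norm]; exact hL t x y)
      (fun s _ => (hv s).continuousAt.continuousWithinAt) (fun s _ => (hv s).hasDerivWithinAt)
      (fun s _ => (hw s).continuousAt.continuousWithinAt) (fun s _ => (hw s).hasDerivWithinAt)
      (dist_eq_norm _ _).le t ⟨ht, le_rfl⟩
    rwa [dist_eq_norm, sub_zero, ← congrArg (fun r : ℝ => (L : ℝ) * r) (abs_of_nonneg ht)] at h
  rcases le_total 0 t with ht | ht
  · exact key F hL v w hv hw t ht
  · have hneg : ∀ v : ℝ → E, (∀ t, HasDerivAt v (F t (v t)) t) →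
        ∀ t, HasDerivAt (fun s => v (-s)) (-F (-t) (v (-t))) t := by
      intro v hv t
      have := (hv (-t)).scomp t (hasDerivAt_neg t)
      rwa [neg_one_smul] at this
    have h := key (fun t x => -F (-t) x) (fun t x y => by
      rw [neg_sub_neg, norm_sub_rev]; exact hL _ _ _) (fun s => v (-s)) (fun s => w (-s))
      (hneg v hv) (hneg w hw) (-t) (by linarith)
    simpa using h

end ODE

/-! ### The action of Lipschitz nonlinearities on `L²` -/

namespace GaugeNonlinearity

variable (g : GaugeNonlinearity)

/-- The composition with the nonlinearity, on `L²`. -/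
def comp (f : L2 d) : L2 d := g.lipschitz.compLp g.zero_apply f

theorem coeFn_comp (f : L2 d) : ∀ᵐ x, g.comp f x = g.toFun (f x) :=
  g.lipschitz.coeFn_compLp g.zero_apply f

theorem norm_comp_sub_le (f f' : L2 d) : ‖g.comp f - g.comp f'‖ ≤ g.lipConst * ‖f - f'‖ :=
  g.lipschitz.norm_compLp_sub_le g.zero_apply f f'

theorem comp_zero : g.comp (0 : L2 d) = 0 := g.lipschitz.compLp_zero g.zero_apply

theorem norm_comp_le (f : L2 d) : ‖g.comp f‖ ≤ g.lipConst * ‖f‖ :=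
  g.lipschitz.norm_compLp_le g.zero_apply f

theorem continuous_comp : Continuous (g.comp : L2 d → L2 d) :=
  g.lipschitz.continuous_compLp g.zero_apply

theorem im_inner_comp (f : L2 d) : (inner ℂ f (g.comp f)).im = 0 := by
  have h : inner ℂ f (g.comp f) = ((∫ x, g.coeff ‖f x‖ * ‖f x‖ ^ 2 : ℝ) : ℂ) := by
    rw [L2.inner_eq, ← integral_complex_ofReal]
    refine integral_congr_ae ?_
    filter_upwards [g.coeFn_comp f] with x hx
    rw [hx, g.eq_mul, mul_left_comm, Complex.conj_mul']
    push_cast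
    rfl
  rw [h, Complex.ofReal_im]

theorem comp_translation (a : Pt d) (f : L2 d) :
    g.comp (translation a f) = translation a (g.comp f) := by
  apply Lp.ext
  have h := g.coeFn_comp f
  filter_upwards [g.coeFn_comp (translation a f), coeFn_translation a f,
    coeFn_translation a (g.comp f), (measurePreserving_add a).quasiMeasurePreserving.ae h]
    with x h1 h2 h3 h4
  rw [h1, h2, h3, h4]

theorem inner_comp_phaseOp (θ : C(Pt d, ℝ)) (f : L2 d) :
    inner ℂ (g.comp f) (phaseOp θ f) = inner ℂ f (phaseOp θ (g.comp f)) := by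
  rw [L2.inner_eq, L2.inner_eq]
  refine integral_congr_ae ?_
  filter_upwards [g.coeFn_comp f, coeFn_phaseOp θ f, coeFn_phaseOp θ (g.comp f)] with x h1 h2 h3
  rw [h2, h3, h1, g.eq_mul, map_mul, Complex.conj_ofReal]
  ring

end GaugeNonlinearity

/-! ### Functions that solve the Schrödinger equation with a source -/

/-- `i ∂ₜu + ½ Δu = a` at time `t`, in the interaction picture. -/
def HasSource (u : ℝ → L2 d) (a : L2 d) (t : ℝ) : Prop :=
  HasDerivAt (fun s => freeGroup (-s) (u s)) (freeGroup (-t) (-Complex.I • a)) t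

/-- Applying e^{-i(t/2)Δ} to both factors does not change the inner product, so the Laplacian never
appears and L² regularity suffices. -/
theorem HasSource.hasDerivAt_inner {u p : ℝ → L2 d} {a b : L2 d} {t : ℝ} (hu : HasSource u a t)
    (hp : HasSource p b t) :
    HasDerivAt (fun s => inner ℂ (u s) (p s))
      (Complex.I * inner ℂ a (p t) - Complex.I * inner ℂ (u t) b) t := by
  have h := HasDerivAt.inner ℂ hu hp
  simp only [LinearIsometry.inner_map_map] at h
  refine h.congr_deriv ?_
  rw [inner_smul_left, inner_smul_right]
  simp
  ring

theorem HasSource.sub {u p : ℝ → L2 d} {a b : L2 d} {t : ℝ} (hu : HasSource u a t)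
    (hp : HasSource p b t) : HasSource (fun s => u s - p s) (a - b) t := by
  have h := HasDerivAt.sub hu hp
  rw [← map_sub, ← smul_sub] at h
  refine h.congr_of_eventuallyEq (Eventually.of_forall fun s => ?_)
  simp

theorem HasSource.map {u : ℝ → L2 d} {a : L2 d} {t : ℝ} (hu : HasSource u a t)
    (A : L2 d →ₗᵢ[ℂ] L2 d) (hA : ∀ s f, A (freeGroup s f) = freeGroup s (A f)) :
    HasSource (fun s => A (u s)) (A a) t := by
  have h := (A.toContinuousLinearMap.restrictScalars ℝ).hasFDerivAt.comp_hasDerivAt t hu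
  have e : ∀ f, (A.toContinuousLinearMap.restrictScalars ℝ) f = A f := fun f => rfl
  rw [e, hA, map_smul] at h
  refine h.congr_of_eventuallyEq (Eventually.of_forall fun s => ?_)
  exact (hA _ _).symm

theorem HasSource.shift {u : ℝ → L2 d} {a : L2 d} {t h : ℝ} (hu : HasSource u a (t + h)) :
    HasSource (fun s => u (s + h)) a t := by
  have h1 := HasDerivAt.comp_add_const t h hu
  have h2 := ((freeGroup (d := d) h).toContinuousLinearMap.restrictScalars
    ℝ).hasFDerivAt.comp_hasDerivAt t h1
  have e : ∀ f, ((freeGroup (d := d) h).toContinuousLinearMap.restrictScalars ℝ) f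
    = freeGroup h f := fun f => rfl
  rw [e, ← freeGroup_add, show h + -(t + h) = -t by ring] at h2
  refine h2.congr_of_eventuallyEq (Eventually.of_forall fun s => ?_)
  change _ = freeGroup h (freeGroup (-(s + h)) (u (s + h)))
  rw [← freeGroup_add, show h + -(s + h) = -s by ring]

/-! ### Trajectories with a Lipschitz nonlinearity in L². -/

/-- Solutions in `L²` of the equation with a Lipschitz nonlinearity. -/
structure IsTraj (g : GaugeNonlinearity) (u : ℝ → L2 d) : Prop where
  continuous : Continuous u
  source : ∀ t, HasSource u (g.comp (u t)) t

/-- In the interaction picture the unbounded operator is gone. The vector field e^{-i(t/2)Δ}(-i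
g(e^{i(t/2)Δ}v)) is Lipschitz uniformly in t because the group is isometric, and jointly continuous
by strong continuity. -/
theorem exists_isTraj (g : GaugeNonlinearity) (u₀ : L2 d) :
    ∃ u : ℝ → L2 d, u 0 = u₀ ∧ IsTraj g u := by
  set F : ℝ → L2 d → L2 d := fun t v => freeGroup (-t) (-Complex.I • g.comp (freeGroup t v))
    with hF
  have hc : Continuous (Function.uncurry F) :=
    continuous_freeGroup_comp continuous_fst.neg
      ((continuous_const_smul (-Complex.I)).comp
        (g.continuous_comp.comp (continuous_freeGroup_comp continuous_fst continuous_snd)))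
  have hL : ∀ t x y, ‖F t x - F t y‖ ≤ g.lipConst * ‖x - y‖ := by
    intro t x y
    rw [hF]
    simp only
    rw [← map_sub, LinearIsometry.norm_map, ← smul_sub, norm_smul, norm_neg, Complex.norm_I,
      one_mul]
    refine (g.norm_comp_sub_le _ _).trans_eq ?_
    rw [← map_sub, LinearIsometry.norm_map]
  obtain ⟨v, hv0, hv⟩ := exists_global_ode_solution hc g.lipConst.2 hL
    (fun t => by simp [hF, g.comp_zero]) u₀
  have hvc : Continuous v := continuous_iff_continuousAt.2 fun t => (hv t).continuousAt
  refine ⟨fun t => freeGroup t (v t), by simp [hv0],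
    continuous_freeGroup_comp continuous_id hvc, fun t => ?_⟩
  refine (hv t).congr_of_eventuallyEq (Eventually.of_forall fun s => ?_)
  exact freeGroup_neg_apply s (v s)

variable {g : GaugeNonlinearity} {u : ℝ → L2 d}

theorem IsTraj.norm_sub_le {p : ℝ → L2 d} (hu : IsTraj g u) (hp : IsTraj g p) (t : ℝ) :
    ‖u t - p t‖ ≤ ‖u 0 - p 0‖ * Real.exp (g.lipConst * |t|) := by
  have h := norm_sub_le_of_hasDerivAt
    (F := fun t v => freeGroup (-t) (-Complex.I • g.comp (freeGroup t v))) (L := g.lipConst)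
    (v := fun t => freeGroup (-t) (u t)) (w := fun t => freeGroup (-t) (p t)) ?_ ?_ ?_ t
  · rw [← map_sub, LinearIsometry.norm_map] at h
    simpa using h
  · intro t x y
    rw [← map_sub, LinearIsometry.norm_map, ← smul_sub, norm_smul, norm_neg, Complex.norm_I,
      one_mul]
    refine (g.norm_comp_sub_le _ _).trans_eq ?_
    rw [← map_sub, LinearIsometry.norm_map]
  · intro t
    rw [freeGroup_apply_neg]
    exact hu.source t
  · intro t
    rw [freeGroup_apply_neg]
    exact hp.source t

/-- Conservation of mass. -/
theorem IsTraj.norm_eq (hu : IsTraj g u) (t : ℝ) : ‖u t‖ = ‖u 0‖ := by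
  have h : ∀ t, HasDerivAt (fun s => (inner ℂ (u s) (u s)).re) 0 t := by
    intro t
    have h1 := (hu.source t).hasDerivAt_inner (hu.source t)
    have h2 := Complex.reCLM.hasFDerivAt.comp_hasDerivAt t h1
    refine h2.congr_deriv ?_
    have h3 : (inner ℂ (g.comp (u t)) (u t)) = (starRingEnd ℂ) (inner ℂ (u t) (g.comp (u t))) :=
      (inner_conj_symm _ _).symm
    have h4 := g.im_inner_comp (u t)
    have h5 : (inner ℂ (g.comp (u t)) (u t)).im = 0 := by
      rw [h3, Complex.conj_im, h4, neg_zero]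
    simp [h4, h5]
  have h5 : ‖u t‖ ^ 2 = ‖u 0‖ ^ 2 := by
    have := is_const_of_deriv_eq_zero (fun t => (h t).differentiableAt) (fun t => (h t).deriv) t 0
    rwa [← RCLike.re_eq_complex_re, inner_self_eq_norm_sq, inner_self_eq_norm_sq] at this
  exact (sq_eq_sq₀ (norm_nonneg _) (norm_nonneg _)).1 h5

theorem fourierPhase_comm (θ θ' : C(Pt d, ℝ)) (f : L2 d) :
    fourierPhase θ (fourierPhase θ' f) = fourierPhase θ' (fourierPhase θ f) := by
  rw [← fourierPhase_add, ← fourierPhase_add, add_comm]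

theorem IsTraj.map (hu : IsTraj g u) (A : L2 d →ₗᵢ[ℂ] L2 d)
    (hA : ∀ s f, A (freeGroup s f) = freeGroup s (A f)) (hg : ∀ f, g.comp (A f) = A (g.comp f)) :
    IsTraj g fun t => A (u t) where
  continuous := A.continuous.comp hu.continuous
  source t := by
    rw [hg]
    exact (hu.source t).map A hA

theorem IsTraj.translate (hu : IsTraj g u) (a : Pt d) : IsTraj g fun t => translation a (u t) :=
  hu.map (translation a) (fun _ _ => fourierPhase_comm _ _ _)
    (g.comp_translation a)

/-- Propagation of `H¹` regularity. -/
theorem IsTraj.exists_H1 (hu : IsTraj g u) {a : H1 d} (h0 : u 0 = a.fn) (t : ℝ) :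
    ∃ w : H1 d, w.fn = u t ∧ ‖w‖ ≤ (1 + d) * ‖a‖ * Real.exp (g.lipConst * |t|) := by
  set e := Real.exp (g.lipConst * |t|) with he
  have he1 : 1 ≤ e := Real.one_le_exp (by positivity)
  have hn : Tendsto (fun n : ℕ => 1 / ((n : ℝ) + 1)) atTop (𝓝 0) :=
    tendsto_one_div_add_atTop_nhds_zero_nat
  obtain ⟨w, hw, hwg⟩ := H1.exists_of_translation_bound (u t) (K := ‖a‖ * e) (by positivity) hn
    (fun n => by positivity) fun j n => by
      -- The translate is another trajectory, so its L² distance from u grows at most exponentially.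
      -- The initial distance is at most the step times the norm of the initial gradient.
      have h1 := (hu.translate ((1 / ((n : ℝ) + 1)) • EuclideanSpace.single j 1)).norm_sub_le hu t
      rw [translation_smul_single, translation_smul_single, h0] at h1
      refine h1.trans ?_
      refine (mul_le_mul_of_nonneg_right (a.norm_translation_sub_le j _)
        (Real.exp_pos _).le).trans ?_
      have := a.norm_grad_apply_le j
      calc |1 / ((n : ℝ) + 1)| * ‖a.grad j‖ * e ≤ |1 / ((n : ℝ) + 1)| * ‖a‖ * e := by gcongr
        _ = _ := by ring
  refine ⟨w, hw, ?_⟩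
  have h2 : ‖w.fn‖ ≤ ‖a‖ * e := by
    rw [hw, hu.norm_eq, h0]
    exact a.norm_fn_le.trans (le_mul_of_one_le_right (norm_nonneg _) he1)
  refine (H1.norm_le_of_bounds h2 (by positivity) hwg).trans_eq ?_
  ring

/-- Duhamel's formula. -/
theorem IsTraj.duhamel (hu : IsTraj g u) (t : ℝ) (φ : 𝓢(Pt d, ℂ)) :
    pairS φ (u t) = pairS φ (freeGroup t (u 0)) -
      Complex.I * ∫ s in (0 : ℝ)..t, sourcePair g.toFun (u s) (t - s) φ := by
  set D : ℝ → L2 d := fun s => freeGroup (-s) (-Complex.I • g.comp (u s)) with hD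
  have hDc : Continuous D := continuous_freeGroup_comp continuous_neg
    ((continuous_const_smul (-Complex.I)).comp (g.continuous_comp.comp hu.continuous))
  have h1 : ∫ s in (0 : ℝ)..t, D s = freeGroup (-t) (u t) - freeGroup (-0) (u 0) :=
    intervalIntegral.integral_eq_sub_of_hasDerivAt (fun s _ => hu.source s)
      (hDc.intervalIntegrable _ _)
  rw [neg_zero, freeGroup_zero] at h1
  have h2 : u t = freeGroup t (u 0) + freeGroup t (∫ s in (0 : ℝ)..t, D s) := by
    rw [← map_add, h1, add_sub_cancel, freeGroup_apply_neg]
  set Λ : L2 d →L[ℂ] ℂ := (pairS φ).comp (freeGroup t).toContinuousLinearMap with hΛ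
  have h3 : pairS φ (freeGroup t (∫ s in (0 : ℝ)..t, D s)) = ∫ s in (0 : ℝ)..t, Λ (D s) :=
    (Λ.intervalIntegral_comp_comm (hDc.intervalIntegrable _ _)).symm
  have h4 : ∀ s, Λ (D s) = -Complex.I * sourcePair g.toFun (u s) (t - s) φ := by
    intro s
    have h5 : Λ (D s) = pairS φ (freeGroup t (D s)) := rfl
    rw [h5, hD]
    simp only
    rw [← freeGroup_add, map_smul, map_smul, smul_eq_mul, ← sub_eq_add_neg, pairS_freeGroup,
      pairS_apply, sourcePair]
    congr 1
    refine integral_congr_ae ?_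
    filter_upwards [g.coeFn_comp (u s)] with x hx
    rw [hx]
  rw [h2, map_add, h3]
  simp only [h4]
  rw [intervalIntegral.integral_const_mul]
  ring

end

section

/-! ### Conserved quantities of the flow in `L²` -/

theorem L2.real_smul_eq (r : ℝ) (f : L2 d) : r • f = (r : ℂ) • f :=
  RCLike.real_smul_eq_coe_smul (K := ℂ) r f

theorem L2.integrable_conj_mul (f g : L2 d) : Integrable fun x => starRingEnd ℂ (f x) * g x :=
  (L2.integrable_inner (𝕜 := ℂ) f g).congr (ae_of_all _ fun _ => mul_comm _ _)

namespace GaugeNonlinearity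

variable (g : GaugeNonlinearity)

/-- The potential energy. -/
def potentialEnergy (f : L2 d) : ℝ := ∫ x, g.potential (f x)

theorem integrable_potential (f : L2 d) : Integrable fun x => g.potential (f x) := by
  refine ((L2.integrable_norm_sq f).const_mul (2 * g.lipConst)).mono'
    (g.continuous_potential.comp_aestronglyMeasurable (Lp.aestronglyMeasurable f))
    (ae_of_all _ fun x => ?_)
  exact g.abs_potential_le _

theorem abs_potentialEnergy_sub_sub_le (a b : L2 d) :
    |g.potentialEnergy b - g.potentialEnergy a - (inner ℂ (g.comp a) (b - a)).re|
      ≤ 2 * g.lipConst * ‖b - a‖ ^ 2 := by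
  have h1 : (inner ℂ (g.comp a) (b - a)).re
      = ∫ x, (starRingEnd ℂ (g.comp a x) * (b - a : L2 d) x).re := by
    rw [L2.inner_eq]
    exact (integral_re (L2.integrable_conj_mul (g.comp a) (b - a))).symm
  have hi : Integrable fun x => (starRingEnd ℂ (g.comp a x) * (b - a : L2 d) x).re :=
    (L2.integrable_conj_mul (g.comp a) (b - a)).re
  rw [h1, potentialEnergy, potentialEnergy,
    ← integral_sub (g.integrable_potential b) (g.integrable_potential a),
    ← integral_sub (f := fun x => g.potential (b x) - g.potential (a x))
      ((g.integrable_potential b).sub (g.integrable_potential a)) hi,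
    L2.norm_sq_eq, ← integral_const_mul, ← Real.norm_eq_abs]
  refine norm_integral_le_of_norm_le ((L2.integrable_norm_sq _).const_mul _) ?_
  filter_upwards [g.coeFn_comp a, Lp.coeFn_sub b a] with x h2 h3
  rw [h2, h3, Pi.sub_apply]
  exact g.abs_potential_sub_sub_le _ _

/-- The density `2 Ψ(a) - Re ⟨a, g(a)⟩` that appears in the energy identity. -/
def virialDensity (a : L2 d) : ℝ := 2 * g.potentialEnergy a - (inner ℂ a (g.comp a)).re

/-- Subtract the Taylor expansions of Ψ at a and at b. The remaining first-order terms are exactly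
the increment of 2Ψ(a) - Re⟨a, g(a)⟩. -/
theorem abs_re_inner_sub_le (a b : L2 d) :
    |((inner ℂ (g.comp a) b).re - (inner ℂ a (g.comp b)).re) -
      (g.virialDensity b - g.virialDensity a)| ≤ 4 * g.lipConst * ‖b - a‖ ^ 2 := by
  have h1 := g.abs_potentialEnergy_sub_sub_le a b
  have h2 := g.abs_potentialEnergy_sub_sub_le b a
  rw [norm_sub_rev a b] at h2
  rw [inner_sub_right, Complex.sub_re] at h1 h2
  have e : ∀ x y : L2 d, (inner ℂ x y).re = (inner ℂ y x).re := fun x y => by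
    rw [← inner_conj_symm, Complex.conj_re]
  rw [virialDensity, virialDensity, e a (g.comp b), e b (g.comp b), e a (g.comp a)]
  rw [abs_le] at h1 h2 ⊢
  constructor <;> linarith

theorem continuous_potentialEnergy : Continuous (g.potentialEnergy : L2 d → ℝ) := by
  refine continuous_iff_continuousAt.2 fun a => ?_
  rw [ContinuousAt, tendsto_iff_norm_sub_tendsto_zero]
  have hle : ∀ b, ‖g.potentialEnergy b - g.potentialEnergy a‖
      ≤ ‖g.comp a‖ * ‖b - a‖ + 2 * g.lipConst * ‖b - a‖ ^ 2 := by
    intro b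
    have h1 := g.abs_potentialEnergy_sub_sub_le a b
    have h2 : |(inner ℂ (g.comp a) (b - a)).re| ≤ ‖g.comp a‖ * ‖b - a‖ :=
      (Complex.abs_re_le_norm _).trans (norm_inner_le_norm _ _)
    rw [Real.norm_eq_abs]
    rw [abs_le] at h1 h2 ⊢
    constructor <;> linarith
  refine squeeze_zero (fun _ => norm_nonneg _) hle ?_
  have : Continuous fun b : L2 d => ‖g.comp a‖ * ‖b - a‖ + 2 * g.lipConst * ‖b - a‖ ^ 2 := by
    fun_prop
  simpa using this.tendsto a

theorem continuous_virialDensity : Continuous (g.virialDensity : L2 d → ℝ) :=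
  (g.continuous_potentialEnergy.const_mul 2).sub
    (Complex.continuous_re.comp (continuous_id.inner g.continuous_comp))

theorem comp_compMeasurePreserving {ρ : Pt d → Pt d} (hρ : MeasurePreserving ρ volume volume)
    (f : L2 d) : g.comp (Lp.compMeasurePreserving ρ hρ f)
      = Lp.compMeasurePreserving ρ hρ (g.comp f) := by
  apply Lp.ext
  have h := g.coeFn_comp f
  filter_upwards [g.coeFn_comp (Lp.compMeasurePreserving ρ hρ f),
    Lp.coeFn_compMeasurePreserving f hρ, Lp.coeFn_compMeasurePreserving (g.comp f) hρ,
    hρ.quasiMeasurePreserving.ae h] with x h1 h2 h3 h4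
  rw [h1, h2, h3, Function.comp_apply, Function.comp_apply, h4]

theorem potentialEnergy_compMeasurePreserving {ρ : Pt d → Pt d}
    (hρ : MeasurePreserving ρ volume volume) (f : L2 d) :
    g.potentialEnergy (Lp.compMeasurePreserving ρ hρ f) = g.potentialEnergy f := by
  have hm : AEStronglyMeasurable (fun x => g.potential (f x)) (Measure.map ρ volume) := by
    rw [hρ.map_eq]
    exact g.continuous_potential.comp_aestronglyMeasurable (Lp.aestronglyMeasurable f)
  have h1 := integral_map hρ.measurable.aemeasurable hm
  rw [hρ.map_eq] at h1
  rw [potentialEnergy, potentialEnergy, h1]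
  refine integral_congr_ae ?_
  filter_upwards [Lp.coeFn_compMeasurePreserving f hρ] with x hx
  rw [hx, Function.comp_apply]

end GaugeNonlinearity

/-- Integration in time of approximate conservation laws. -/
theorem sub_eq_of_approximate_conservation {w r e : ℕ → ℝ → ℝ} {m : ℝ → ℝ} (hm : Continuous m)
    {h : ℕ → ℝ} (hpos : ∀ n, 0 < h n) (h0 : Tendsto h atTop (𝓝 0))
    (hw : ∀ n t, HasDerivAt (w n) (r n t) t) (hr : ∀ n, Continuous (r n))
    (hre : ∀ n t, |r n t - (m (t + h n) - m t)| ≤ e n t) {T M : ℝ}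
    (hM : ∀ n, ∀ t ∈ Set.uIcc 0 T, e n t ≤ M * h n)
    (hlim : ∀ t ∈ Set.uIcc 0 T, Tendsto (fun n => (h n)⁻¹ * e n t) atTop (𝓝 0)) {ω₀ ω₁ : ℝ}
    (hω₀ : Tendsto (fun n => (h n)⁻¹ * w n 0) atTop (𝓝 ω₀))
    (hω₁ : Tendsto (fun n => (h n)⁻¹ * w n T) atTop (𝓝 ω₁)) : ω₁ - ω₀ = m T - m 0 := by
  set ρ : ℕ → ℝ → ℝ := fun n t => (h n)⁻¹ * (r n t - (m (t + h n) - m t)) with hρ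
  have hms : ∀ n, Continuous fun t => m (t + h n) := fun n => hm.comp (by fun_prop)
  have hρc : ∀ n, Continuous (ρ n) := fun n =>
    continuous_const.mul ((hr n).sub ((hms n).sub hm))
  have hρle : ∀ n t, ‖ρ n t‖ ≤ (h n)⁻¹ * e n t := fun n t => by
    rw [hρ]
    simp only [norm_mul, norm_inv, Real.norm_eq_abs, abs_of_pos (hpos n)]
    have := hpos n
    exact mul_le_mul_of_nonneg_left (hre n t) (by positivity)
  have hint : Tendsto (fun n => ∫ t in (0 : ℝ)..T, ρ n t) atTop (𝓝 (∫ _t in (0 : ℝ)..T, (0 : ℝ))) := by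
    refine intervalIntegral.tendsto_integral_filter_of_dominated_convergence (fun _ => M)
      (Eventually.of_forall fun n => (hρc n).aestronglyMeasurable)
      (Eventually.of_forall fun n => ae_of_all _ fun t ht => ?_) intervalIntegrable_const
      (ae_of_all _ fun t ht => ?_)
    · refine (hρle n t).trans ?_
      rw [inv_mul_le_iff₀ (hpos n), mul_comm]
      exact hM n t (Set.uIoc_subset_uIcc ht)
    · exact squeeze_zero_norm (fun n => hρle n t) (hlim t (Set.uIoc_subset_uIcc ht))
  rw [intervalIntegral.integral_zero] at hint
  -- The time integral of m(t+h) - m(t) leaves two boundary layers, which are increments of the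
  -- primitive of m. Divided by h they tend to m(T) and m(0).
  set P : ℝ → ℝ := fun x => ∫ t in (0 : ℝ)..x, m t with hP
  have hPd : ∀ x, HasDerivAt P (m x) x := fun x =>
    intervalIntegral.integral_hasDerivAt_right (hm.intervalIntegrable _ _)
      (hm.stronglyMeasurableAtFilter _ _) hm.continuousAt
  have hPlim : ∀ x, Tendsto (fun n => (h n)⁻¹ * (P (x + h n) - P x)) atTop (𝓝 (m x)) := fun x => by
    have h1 := hasDerivAt_iff_tendsto_slope_zero.1 (hPd x)
    exact h1.comp (tendsto_nhdsWithin_iff.2 ⟨h0, Eventually.of_forall fun n => (hpos n).ne'⟩)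
  have hval : ∀ n, ∫ t in (0 : ℝ)..T, ρ n t = (h n)⁻¹ * w n T - (h n)⁻¹ * w n 0 -
      ((h n)⁻¹ * (P (T + h n) - P T) - (h n)⁻¹ * (P (0 + h n) - P 0)) := by
    intro n
    have e1 : ∫ t in (0 : ℝ)..T, r n t = w n T - w n 0 :=
      intervalIntegral.integral_eq_sub_of_hasDerivAt (fun t _ => hw n t)
        ((hr n).intervalIntegrable _ _)
    have e2 : ∫ t in (0 : ℝ)..T, m (t + h n) = P (T + h n) - P (0 + h n) := by
      rw [intervalIntegral.integral_comp_add_right (fun t => m t)]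
      exact (intervalIntegral.integral_interval_sub_left (hm.intervalIntegrable _ _)
        (hm.intervalIntegrable _ _)).symm
    have e3 : P 0 = 0 := intervalIntegral.integral_same
    rw [hρ]
    simp only
    rw [intervalIntegral.integral_const_mul,
      intervalIntegral.integral_sub (g := fun t => m (t + h n) - m t)
        ((hr n).intervalIntegrable _ _) (((hms n).sub hm).intervalIntegrable _ _),
      intervalIntegral.integral_sub ((hms n).intervalIntegrable _ _) (hm.intervalIntegrable _ _),
      e1, e2, e3]
    change _ * (_ - (_ - P T)) = _
    ring
  have hlim2 := (hω₁.sub hω₀).sub ((hPlim T).sub (hPlim 0))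
  have := tendsto_nhds_unique (hint.congr hval) hlim2
  linarith

variable {g : GaugeNonlinearity} {u : ℝ → L2 d}

theorem IsTraj.exists_H1_path (hu : IsTraj g u) {a : H1 d} (h0 : u 0 = a.fn) :
    ∃ w : ℝ → H1 d, (∀ t, (w t).fn = u t) ∧ ∀ T, ∃ M, 0 ≤ M ∧ ∀ t, |t| ≤ T → ‖w t‖ ≤ M := by
  choose w hw hb using fun t => hu.exists_H1 h0 t
  refine ⟨w, hw, fun T => ⟨(1 + d) * ‖a‖ * Real.exp (g.lipConst * T), by positivity,
    fun t ht => (hb t).trans ?_⟩⟩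
  gcongr

/-- The difference from the free evolution over a short time is differentiable in L², although u
itself need not be. -/
theorem IsTraj.tendsto_slope (hu : IsTraj g u) (t : ℝ) :
    Tendsto (fun h : ℝ => h⁻¹ • (u (t + h) - freeGroup h (u t))) (𝓝[≠] 0)
      (𝓝 (-Complex.I • g.comp (u t))) := by
  have h1 := hasDerivAt_iff_tendsto_slope_zero.1 (hu.source t)
  have hc : Continuous fun p : ℝ × L2 d => freeGroup (t + p.1) p.2 :=
    continuous_freeGroup_comp (continuous_const.add continuous_fst) continuous_snd
  have h2 := (hc.tendsto (0, freeGroup (-t) (-Complex.I • g.comp (u t)))).comp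
    ((tendsto_nhdsWithin_of_tendsto_nhds tendsto_id).prodMk_nhds h1)
  simp only [add_zero, freeGroup_apply_neg] at h2
  refine h2.congr fun h => ?_
  simp only [Function.comp_apply, id_eq]
  rw [L2.real_smul_eq, L2.real_smul_eq, map_smul, map_sub, freeGroup_apply_neg,
    ← freeGroup_add]
  rw [show t + h + -t = h by ring]

/-- The deviation from the free flow is O(h), hence O(h²) after squaring. The size of u(t+h) - u(t)
to the order needed is thus that of the free increment. -/
theorem IsTraj.norm_sub_freeGroup_le (hu : IsTraj g u) (t h : ℝ) :
    ‖u (t + h) - freeGroup h (u t)‖ ≤ g.lipConst * ‖u 0‖ * |h| := by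
  have h1 := Convex.norm_image_sub_le_of_norm_hasDerivWithin_le
    (f := fun s => freeGroup (-s) (u s)) (f' := fun s => freeGroup (-s) (-Complex.I • g.comp (u s)))
    (C := g.lipConst * ‖u 0‖) (s := Set.univ) (x := t) (y := t + h)
    (fun s _ => (hu.source s).hasDerivWithinAt) (fun s _ => by
      rw [LinearIsometry.norm_map, norm_smul, norm_neg, Complex.norm_I, one_mul, ← hu.norm_eq s]
      exact g.norm_comp_le _) convex_univ (Set.mem_univ _) (Set.mem_univ _)
  rw [add_sub_cancel_left, Real.norm_eq_abs] at h1
  refine le_trans (le_of_eq ?_) h1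
  conv_rhs => rw [← LinearIsometry.norm_map (freeGroup (d := d) (t + h)), map_sub,
    freeGroup_apply_neg, ← freeGroup_add, show t + h + -t = h by ring]

theorem tendsto_one_div_succ_nhdsNE :
    Tendsto (fun n : ℕ => 1 / ((n : ℝ) + 1)) atTop (𝓝[≠] 0) :=
  tendsto_nhdsWithin_iff.2 ⟨tendsto_one_div_add_atTop_nhds_zero_nat,
    Eventually.of_forall fun n => by
      have : (0 : ℝ) < 1 / ((n : ℝ) + 1) := by positivity
      exact this.ne'⟩

/-- The derivative of `Im ⟨u, p⟩` for two functions with sources. -/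
theorem HasSource.hasDerivAt_im_inner {u p : ℝ → L2 d} {a b : L2 d} {t : ℝ}
    (hu : HasSource u a t) (hp : HasSource p b t) :
    HasDerivAt (fun s => (inner ℂ (u s) (p s)).im)
      ((inner ℂ a (p t)).re - (inner ℂ (u t) b).re) t := by
  have h := Complex.imCLM.hasFDerivAt.comp_hasDerivAt t (hu.hasDerivAt_inner hp)
  refine h.congr_deriv ?_
  simp

/-- Conservation of energy. -/
theorem IsTraj.energy_eq (hu : IsTraj g u) {w : ℝ → H1 d} (hw : ∀ t, (w t).fn = u t)
    (hb : ∀ T, ∃ M, 0 ≤ M ∧ ∀ t, |t| ≤ T → ‖w t‖ ≤ M) (T : ℝ) :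
    1 / 2 * ‖(w T).grad‖ ^ 2 + 2 * g.potentialEnergy (u T)
      = 1 / 2 * ‖(w 0).grad‖ ^ 2 + 2 * g.potentialEnergy (u 0) := by
  obtain ⟨M, hM0, hM⟩ := hb |T|
  set h : ℕ → ℝ := fun n => 1 / ((n : ℝ) + 1) with hh
  have hpos : ∀ n, 0 < h n := fun n => by positivity
  have hle1 : ∀ n, h n ≤ 1 := fun n => by
    rw [hh]
    simp only
    rw [div_le_one (by positivity)]
    simp
  have h0 : Tendsto h atTop (𝓝 0) := tendsto_one_div_add_atTop_nhds_zero_nat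
  have h0' : Tendsto h atTop (𝓝[≠] 0) := tendsto_one_div_succ_nhdsNE
  set B : ℝ := g.lipConst * ‖u 0‖ with hB
  have hB0 : 0 ≤ B := by positivity
  have hshift : ∀ n, Continuous fun t => u (t + h n) := fun n => hu.continuous.comp (by fun_prop)
  have hsq : ∀ n t, ‖u (t + h n) - u t‖ ^ 2
      ≤ 2 * ‖freeGroup (h n) (u t) - u t‖ ^ 2 + 2 * B ^ 2 * h n ^ 2 := by
    intro n t
    have h1 := hu.norm_sub_freeGroup_le t (h n)
    rw [abs_of_pos (hpos n)] at h1
    have h2 : ‖u (t + h n) - u t‖ ≤ B * h n + ‖freeGroup (h n) (u t) - u t‖ := by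
      refine le_trans ?_ (add_le_add h1 le_rfl)
      refine le_trans (le_of_eq ?_) (norm_add_le _ _)
      rw [sub_add_sub_cancel]
    have h3 := pow_le_pow_left₀ (norm_nonneg _) h2 2
    nlinarith [sq_nonneg (B * h n - ‖freeGroup (h n) (u t) - u t‖)]
  -- The free part of u(t+h) yields the kinetic energy as a quadratic form, the Duhamel part yields
  -- -Re⟨u, g(u)⟩.
  have hω : ∀ t, Tendsto (fun n => (h n)⁻¹ * (inner ℂ (u t) (u (t + h n))).im) atTop
      (𝓝 (-(1 / 2 * ‖(w t).grad‖ ^ 2) - (inner ℂ (u t) (g.comp (u t))).re)) := by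
    intro t
    have h1 := (w t).tendsto_im_inner_freeGroup_div.comp h0'
    rw [hw t] at h1
    have h2 : Tendsto (fun n => (inner ℂ (u t)
        ((h n)⁻¹ • (u (t + h n) - freeGroup (h n) (u t)))).im) atTop
        (𝓝 (inner ℂ (u t) (-Complex.I • g.comp (u t))).im) :=
      ((Complex.continuous_im.comp (continuous_const.inner continuous_id)).tendsto _).comp
        ((hu.tendsto_slope t).comp h0')
    have h3 := h1.add h2
    have e : (inner ℂ (u t) (-Complex.I • g.comp (u t))).im
        = -(inner ℂ (u t) (g.comp (u t))).re := by
      rw [inner_smul_right]; simp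
    rw [e, ← sub_eq_add_neg] at h3
    refine h3.congr fun n => ?_
    simp only [Function.comp_apply]
    rw [L2.real_smul_eq, inner_smul_right, inner_sub_right, Complex.im_ofReal_mul, Complex.sub_im]
    ring
  -- The term -Re⟨u, g(u)⟩ occurs both in the limit ω and in the virial density; it cancels and
  -- leaves ½‖∇u‖² + 2Ψ.
  have key := sub_eq_of_approximate_conservation (m := fun t => g.virialDensity (u t))
    (w := fun n t => (inner ℂ (u t) (u (t + h n))).im)
    (r := fun n t => (inner ℂ (g.comp (u t)) (u (t + h n))).re
      - (inner ℂ (u t) (g.comp (u (t + h n)))).re)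
    (e := fun n t => 4 * g.lipConst * ‖u (t + h n) - u t‖ ^ 2)
    (g.continuous_virialDensity.comp hu.continuous) hpos h0
    (fun n t => (hu.source t).hasDerivAt_im_inner (hu.source (t + h n)).shift)
    (fun n => (Complex.continuous_re.comp ((g.continuous_comp.comp hu.continuous).inner
      (hshift n))).sub (Complex.continuous_re.comp (hu.continuous.inner
      (g.continuous_comp.comp (hshift n)))))
    (fun n t => g.abs_re_inner_sub_le _ _) (T := T)
    (M := 4 * g.lipConst * (2 * M ^ 2 + 2 * B ^ 2)) ?_ ?_ (hω 0) (hω T)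
  · simp only [GaugeNonlinearity.virialDensity] at key
    linarith
  · intro n t ht
    have h1 := (w t).norm_freeGroup_sub_sq_le (h n)
    rw [hw t, abs_of_pos (hpos n)] at h1
    have h2 : ‖(w t).grad‖ ^ 2 ≤ M ^ 2 := by
      have := (w t).norm_grad_le.trans (hM t (abs_le_of_mem_uIcc_zero ht))
      gcongr
    rw [mul_assoc (4 * (g.lipConst : ℝ))]
    refine mul_le_mul_of_nonneg_left ((hsq n t).trans ?_) (by positivity)
    nlinarith [hpos n, hle1 n, mul_le_mul_of_nonneg_left h2 (hpos n).le,
      mul_nonneg (sq_nonneg B) (mul_nonneg (hpos n).le (sub_nonneg.2 (hle1 n)))]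
  · intro t ht
    have h1 := (w t).tendsto_norm_freeGroup_sub_sq_div.comp h0
    rw [hw t] at h1
    have h2 := ((h1.const_mul 2).add (h0.const_mul (2 * B ^ 2))).const_mul (4 * (g.lipConst : ℝ))
    simp only [mul_zero, add_zero] at h2
    have hnn : ∀ n, 0 ≤ (h n)⁻¹ := fun n => (inv_pos.2 (hpos n)).le
    refine squeeze_zero (fun n => mul_nonneg (hnn n) (by positivity)) (fun n => ?_) h2
    simp only [Function.comp_apply]
    rw [abs_of_pos (hpos n)]
    have h3 := mul_le_mul_of_nonneg_left (hsq n t) (mul_nonneg (hnn n)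
      (by positivity : (0 : ℝ) ≤ 4 * g.lipConst))
    refine le_trans (le_of_eq (by ring)) (h3.trans (le_of_eq ?_))
    have := (hpos n).ne'
    field_simp

/-- Conservation of the generator of a symmetry. -/
theorem IsTraj.generator_eq (hu : IsTraj g u) (A : ℕ → L2 d →ₗᵢ[ℂ] L2 d)
    (hA : ∀ n s f, A n (freeGroup s f) = freeGroup s (A n f))
    (hg : ∀ n f, g.comp (A n f) = A n (g.comp f))
    (hΨ : ∀ n f, g.potentialEnergy (A n f) = g.potentialEnergy f)
    {h : ℕ → ℝ} (hpos : ∀ n, 0 < h n) (h0 : Tendsto h atTop (𝓝 0)) {T M : ℝ}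
    (hM : ∀ n, ∀ t ∈ Set.uIcc 0 T, ‖A n (u t) - u t‖ ^ 2 ≤ M * h n)
    (hlim : ∀ t ∈ Set.uIcc 0 T, Tendsto (fun n => (h n)⁻¹ * ‖A n (u t) - u t‖ ^ 2) atTop (𝓝 0))
    {ω₀ ω₁ : ℝ} (hω₀ : Tendsto (fun n => (h n)⁻¹ * (inner ℂ (u 0) (A n (u 0))).im) atTop (𝓝 ω₀))
    (hω₁ : Tendsto (fun n => (h n)⁻¹ * (inner ℂ (u T) (A n (u T))).im) atTop (𝓝 ω₁)) :
    ω₁ = ω₀ := by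
  have hAu : ∀ n, Continuous fun t => A n (u t) := fun n => (A n).continuous.comp hu.continuous
  have key := sub_eq_of_approximate_conservation (m := fun _ => 0)
    (w := fun n t => (inner ℂ (u t) (A n (u t))).im)
    (r := fun n t => (inner ℂ (g.comp (u t)) (A n (u t))).re
      - (inner ℂ (u t) (A n (g.comp (u t)))).re)
    (e := fun n t => 4 * g.lipConst * ‖A n (u t) - u t‖ ^ 2) (M := 4 * g.lipConst * M) (T := T)
    continuous_const hpos h0
    (fun n t => (hu.source t).hasDerivAt_im_inner ((hu.source t).map (A n) (hA n)))
    (fun n => (Complex.continuous_re.comp ((g.continuous_comp.comp hu.continuous).inner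
      (hAu n))).sub (Complex.continuous_re.comp (hu.continuous.inner
      ((A n).continuous.comp (g.continuous_comp.comp hu.continuous)))))
    (fun n t => ?_) (fun n t ht => ?_) (fun t ht => ?_) hω₀ hω₁
  · linarith
  -- The symmetry commutes with g and preserves Ψ and inner products, so the virial density is
  -- unchanged and only the quadratic error remains.
  · have h1 := g.abs_re_inner_sub_le (u t) (A n (u t))
    rw [hg, GaugeNonlinearity.virialDensity, GaugeNonlinearity.virialDensity, hΨ, hg,
      LinearIsometry.inner_map_map, sub_self] at h1
    rwa [sub_self]
  · rw [mul_assoc (4 * (g.lipConst : ℝ))]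
    exact mul_le_mul_of_nonneg_left (hM n t ht) (by positivity)
  · have h1 := (hlim t ht).const_mul (4 * (g.lipConst : ℝ))
    rw [mul_zero] at h1
    refine h1.congr fun n => ?_
    ring

/-- Conservation of momentum. -/
theorem IsTraj.momentum_eq (hu : IsTraj g u) {w : ℝ → H1 d} (hw : ∀ t, (w t).fn = u t)
    (hb : ∀ T, ∃ M, 0 ≤ M ∧ ∀ t, |t| ≤ T → ‖w t‖ ≤ M) (T : ℝ) (j : Fin d) :
    (inner ℂ (u T) ((w T).grad j)).im = (inner ℂ (u 0) ((w 0).grad j)).im := by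
  obtain ⟨M, hM0, hM⟩ := hb |T|
  set h : ℕ → ℝ := fun n => 1 / ((n : ℝ) + 1) with hh
  have hpos : ∀ n, 0 < h n := fun n => by positivity
  have hle1 : ∀ n, h n ≤ 1 := fun n => by
    rw [hh]
    simp only
    rw [div_le_one (by positivity)]
    simp
  have h0 : Tendsto h atTop (𝓝 0) := tendsto_one_div_add_atTop_nhds_zero_nat
  have hsq : ∀ n, ∀ t ∈ Set.uIcc 0 T,
      ‖translation (h n • EuclideanSpace.single j 1) (u t) - u t‖ ^ 2 ≤ M ^ 2 * h n ^ 2 := by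
    intro n t ht
    have h1 := (w t).norm_translation_sub_le j (h n)
    rw [← translation_smul_single, hw t, abs_of_pos (hpos n)] at h1
    have h2 := ((w t).norm_grad_apply_le j).trans (hM t (abs_le_of_mem_uIcc_zero ht))
    rw [← mul_pow]
    refine pow_le_pow_left₀ (norm_nonneg _) (h1.trans ?_) 2
    rw [mul_comm]
    exact mul_le_mul_of_nonneg_right h2 (hpos n).le
  have hω : ∀ t, Tendsto (fun n => (h n)⁻¹ * (inner ℂ (u t)
      (translation (h n • EuclideanSpace.single j 1) (u t))).im) atTop
      (𝓝 (inner ℂ (u t) ((w t).grad j)).im) := by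
    intro t
    have h1 := (w t).tendsto_translation_slope j |>.comp tendsto_one_div_succ_nhdsNE
    have h2 := ((Complex.continuous_im.comp ((continuous_const (y := u t)).inner
      continuous_id)).tendsto _).comp h1
    refine h2.congr fun n => ?_
    simp only [Function.comp_apply, id_eq]
    rw [← translation_smul_single, hw t, inner_smul_right, inner_sub_right, ← Complex.ofReal_inv,
      Complex.im_ofReal_mul, Complex.sub_im]
    have : (inner ℂ (u t) (u t)).im = 0 := inner_self_im (𝕜 := ℂ) (u t)
    rw [this, sub_zero]
  refine hu.generator_eq (fun n => translation (h n • EuclideanSpace.single j 1))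
    (fun _ _ _ => fourierPhase_comm _ _ _) (fun _ => g.comp_translation _) (fun n f => ?_) hpos h0
    (T := T) (M := M ^ 2) (fun n t ht => ?_) (fun t ht => ?_) (hω 0) (hω T)
  · rw [translation_eq_comp, g.potentialEnergy_compMeasurePreserving]
  · refine (hsq n t ht).trans ?_
    nlinarith [mul_nonneg (sq_nonneg M) (mul_nonneg (hpos n).le (sub_nonneg.2 (hle1 n)))]
  · have h2 := h0.const_mul (M ^ 2)
    rw [mul_zero] at h2
    have hnn : ∀ n, 0 ≤ (h n)⁻¹ := fun n => (inv_pos.2 (hpos n)).le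
    refine squeeze_zero (fun n => mul_nonneg (hnn n) (by positivity)) (fun n => ?_) h2
    refine (mul_le_mul_of_nonneg_left (hsq n t ht) (hnn n)).trans (le_of_eq ?_)
    have := (hpos n).ne'
    field_simp

end

section

/-! ### Propagation of moments -/

/-- An integrated form of (φ²)' ≤ 2Kφ, stated for squares because φ is a norm and may vanish. It is
compared with the square of a slightly steeper affine function that stays positive. -/
theorem le_add_mul_abs_of_sq_growth {φ : ℝ → ℝ} (hc : Continuous φ) (h0 : ∀ t, 0 ≤ φ t) {K : ℝ}
    (hK : 0 ≤ K) (hφ : ∀ t, ∀ ε > 0, ∀ᶠ h in 𝓝[≠] (0 : ℝ),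
      φ (t + h) ^ 2 ≤ φ t ^ 2 + (2 * K * φ t + ε) * |h|) (t : ℝ) : φ t ≤ φ 0 + K * |t| := by
  have key : ∀ ψ : ℝ → ℝ, Continuous ψ → (∀ t, 0 ≤ ψ t) → (∀ t, ∀ ε > 0, ∀ᶠ h in 𝓝[≠] (0 : ℝ),
      ψ (t + h) ^ 2 ≤ ψ t ^ 2 + (2 * K * ψ t + ε) * |h|) → ∀ t, 0 ≤ t →
      ψ t ≤ ψ 0 + K * t := by
    intro ψ hc h0 hψ t ht
    refine le_of_forall_pos_le_add fun δ hδ => ?_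
    -- The starting value and the slope are each raised by ε; at time t this costs ε(1 + t) = δ.
    set ε := δ / (1 + t) with hε
    have hεpos : 0 < ε := by positivity
    have h := image_le_of_liminf_slope_right_lt_deriv_boundary (f := fun s => ψ s ^ 2)
      (f' := fun s => 2 * K * ψ s) (a := 0) (b := t)
      (B := fun s => (ψ 0 + ε + (K + ε) * s) ^ 2)
      (B' := fun s => 2 * (ψ 0 + ε + (K + ε) * s) * (K + ε)) (hc.pow 2).continuousOn
      (fun x _ r hr => ?_) (by nlinarith [h0 0]) (fun x => ?_) (fun x hx hfB => ?_)
      (x := t) ⟨ht, le_rfl⟩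
    · have h1 : 0 ≤ ψ 0 + ε + (K + ε) * t := by
        have := h0 0
        positivity
      refine (abs_le_of_sq_le_sq' h h1).2.trans (le_of_eq ?_)
      rw [hε]
      field_simp
      ring
    · have hmap : Tendsto (fun z => z - x) (𝓝[>] x) (𝓝[≠] 0) := by
        refine tendsto_nhdsWithin_iff.2 ⟨?_, ?_⟩
        · have : Tendsto (fun z => z - x) (𝓝 x) (𝓝 (x - x)) := (continuous_sub_right x).tendsto x
          rw [sub_self] at this
          exact this.mono_left nhdsWithin_le_nhds
        · filter_upwards [self_mem_nhdsWithin] with z hz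
          exact (sub_pos.2 hz).ne'
      have h1 := hmap.eventually (hψ x ((r - 2 * K * ψ x) / 2) (by linarith))
      refine Eventually.frequently ?_
      filter_upwards [h1, self_mem_nhdsWithin] with z hz1 hz2
      have hz : 0 < z - x := sub_pos.2 hz2
      rw [add_sub_cancel, abs_of_pos hz] at hz1
      rw [slope_def_field, div_lt_iff₀ hz]
      nlinarith
    · have h1 := (((hasDerivAt_id x).const_mul (K + ε)).const_add (ψ 0 + ε)).pow 2
      refine h1.congr_deriv ?_
      simp
    · have hpos : 0 < ψ 0 + ε + (K + ε) * x := by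
        have := h0 0
        have := hx.1
        positivity
      have h2 : ψ x = ψ 0 + ε + (K + ε) * x := by
        exact (sq_eq_sq₀ (h0 x) hpos.le).1 hfB
      rw [h2]
      nlinarith
  rcases le_total 0 t with ht | ht
  · rw [abs_of_nonneg ht]
    exact key φ hc h0 hφ t ht
  · rw [abs_of_nonpos ht]
    have h := key (fun s => φ (-s)) (hc.comp continuous_neg) (fun s => h0 _) (fun s ε hε => ?_)
      (-t) (by linarith)
    · simpa using h
    · have hmap : Tendsto (fun z : ℝ => -z) (𝓝[≠] 0) (𝓝[≠] 0) := by
        refine tendsto_nhdsWithin_iff.2 ⟨?_, ?_⟩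
        · have : Tendsto (fun z : ℝ => -z) (𝓝 0) (𝓝 (-0)) := continuous_neg.tendsto 0
          rw [neg_zero] at this
          exact this.mono_left nhdsWithin_le_nhds
        · filter_upwards [self_mem_nhdsWithin] with z hz
          exact neg_ne_zero.2 hz
      filter_upwards [hmap.eventually (hφ (-s) ε hε)] with z hz
      rwa [abs_neg, ← neg_add] at hz

/-- The free flow moves modulated functions at a speed controlled by the gradient. -/
theorem H1.norm_modulation_freeGroup_sub_le (u : H1 d) (j : Fin d) (η h : ℝ) :
    ‖modulation (η • EuclideanSpace.single j 1) (freeGroup h u.fn) - freeGroup h u.fn‖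
      ≤ ‖modulation (η • EuclideanSpace.single j 1) u.fn - u.fn‖
        + (2 * Real.pi * |η| + 2 * Real.pi ^ 2 * η ^ 2) * ‖u‖ * |h| := by
  set a : Pt d := η • EuclideanSpace.single j 1 with ha
  have hna : ‖a‖ ^ 2 = η ^ 2 := by
    rw [ha, norm_smul]
    simp
  have hneg : ∀ f : L2 d, modulation a (modulation (-a) f) = f := by
    intro f
    have := phaseOp_neg_apply (linSymbol (-a)) f
    rwa [← linSymbol_neg, neg_neg] at this
  set θ : ℝ := -(2 * Real.pi ^ 2 * h * ‖a‖ ^ 2) with hθ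
  set S : L2 d := translation ((2 * Real.pi * h) • -a) (modulation (-a) u.fn) with hS
  set τ : L2 d →ₗᵢ[ℂ] L2 d := translation ((2 * Real.pi * h) • a) with hτ
  have hτS : τ S = modulation (-a) u.fn := by
    rw [hτ, hS, translation, translation, ← fourierPhase_add, smul_neg, linSymbol_neg,
      add_neg_cancel, fourierPhase_zero]
  have hmod := modulation_freeGroup (-a) h u.fn
  rw [norm_neg] at hmod
  have hc1 : ‖Complex.exp (Complex.I * (θ : ℝ))‖ = 1 := by
    rw [mul_comm, Complex.norm_exp_ofReal_mul_I]
  set c := Complex.exp (Complex.I * (θ : ℝ)) with hc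
  -- The Galilean identity removes the free group and replaces it by a translation of length
  -- 2π|h||η| and a scalar phase. These two account for the terms linear and quadratic in η.
  have h1 : ‖modulation a (freeGroup h u.fn) - freeGroup h u.fn‖ = ‖u.fn - c • S‖ := by
    have e : modulation a (freeGroup h u.fn) - freeGroup h u.fn
        = modulation a (freeGroup h u.fn - modulation (-a) (freeGroup h u.fn)) := by
      rw [map_sub, hneg]
    rw [e, LinearIsometry.norm_map, hmod, ← map_smul, ← map_sub, LinearIsometry.norm_map]
  have h2 : ‖u.fn - c • S‖ = ‖τ u.fn - c • modulation (-a) u.fn‖ := by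
    rw [← LinearIsometry.norm_map τ, map_sub, map_smul, hτS]
  have h3 : ‖modulation a u.fn - u.fn‖ = ‖u.fn - modulation (-a) u.fn‖ := by
    rw [← LinearIsometry.norm_map (modulation a) (u.fn - _), map_sub, hneg]
  have h4 : ‖τ u.fn - u.fn‖ ≤ 2 * Real.pi * |η| * ‖u‖ * |h| := by
    have := u.norm_translation_sub_le j (2 * Real.pi * h * η)
    rw [← translation_smul_single, ← smul_smul, ← ha, ← hτ] at this
    refine this.trans ?_
    rw [abs_mul, abs_mul, abs_of_pos (by positivity : 0 < 2 * Real.pi)]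
    refine (mul_le_mul_of_nonneg_left (u.norm_grad_apply_le j) (by positivity)).trans_eq ?_
    ring
  have h5 : ‖u.fn - c • u.fn‖ ≤ 2 * Real.pi ^ 2 * η ^ 2 * ‖u‖ * |h| := by
    have e : u.fn - c • u.fn = -((c - 1) • u.fn) := by
      rw [sub_smul, one_smul, neg_sub]
    rw [e, norm_neg, norm_smul]
    refine (mul_le_mul (norm_cexp_sub_one_le θ) u.norm_fn_le (norm_nonneg _)
      (abs_nonneg _)).trans_eq ?_
    rw [hθ, abs_neg, abs_mul, abs_mul, abs_of_pos (by positivity : 0 < 2 * Real.pi ^ 2), hna,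
      abs_of_nonneg (sq_nonneg η)]
    ring
  rw [h1, h2, h3]
  have e : τ u.fn - c • modulation (-a) u.fn
      = (τ u.fn - u.fn) + (u.fn - c • u.fn) + c • (u.fn - modulation (-a) u.fn) := by
    rw [smul_sub]
    abel
  rw [e]
  refine (norm_add_le _ _).trans ((add_le_add_left (norm_add_le _ _) _).trans ?_)
  rw [norm_smul, hc1, one_mul]
  linarith

/-- Gauge invariance: g(f) is a real multiple of f at each point, so e^{iθ} - 1 applied to -i g(f)
is pointwise orthogonal, over ℝ, to (e^{iθ} - 1)f. The nonlinearity therefore does not change the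
size of a modulation difference to first order. -/
theorem GaugeNonlinearity.re_inner_phaseOp_sub (g : GaugeNonlinearity) (θ : C(Pt d, ℝ)) (f : L2 d) :
    (inner ℂ (phaseOp θ f - f)
      (phaseOp θ (-Complex.I • g.comp f) - (-Complex.I • g.comp f))).re = 0 := by
  have h1 := g.inner_comp_phaseOp θ f
  have h2 := g.im_inner_comp f
  have h3 : (inner ℂ (phaseOp θ f) (g.comp f)).im = -(inner ℂ (g.comp f) (phaseOp θ f)).im := by
    rw [← inner_conj_symm, Complex.conj_im]
  rw [map_smul, ← smul_sub, inner_smul_right, inner_sub_left, inner_sub_right, inner_sub_right,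
    LinearIsometry.inner_map_map, ← h1]
  simp only [neg_mul, Complex.neg_re, Complex.mul_re, Complex.I_re, Complex.I_im,
    Complex.sub_im, h2, h3]
  ring

variable {g : GaugeNonlinearity} {u : ℝ → L2 d}

theorem IsTraj.norm_modulation_sub_le (hu : IsTraj g u) {w : ℝ → H1 d} (hw : ∀ t, (w t).fn = u t)
    {B : ℝ} (hB : ∀ t, ‖w t‖ ≤ B) (j : Fin d) (η t : ℝ) :
    ‖modulation (η • EuclideanSpace.single j 1) (u t) - u t‖
      ≤ ‖modulation (η • EuclideanSpace.single j 1) (u 0) - u 0‖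
        + (2 * Real.pi * |η| + 2 * Real.pi ^ 2 * η ^ 2) * B * |t| := by
  set A : L2 d →ₗᵢ[ℂ] L2 d := modulation (η • EuclideanSpace.single j 1) with hA
  have hB0 : 0 ≤ B := (norm_nonneg _).trans (hB 0)
  set K : ℝ := (2 * Real.pi * |η| + 2 * Real.pi ^ 2 * η ^ 2) * B with hK
  have hK0 : 0 ≤ K := by positivity
  set D : L2 d →L[ℂ] L2 d := A.toContinuousLinearMap - ContinuousLinearMap.id ℂ _ with hD
  have hDa : ∀ f, D f = A f - f := fun f => rfl
  have hφc : Continuous fun s => ‖A (u s) - u s‖ :=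
    ((A.continuous.comp hu.continuous).sub hu.continuous).norm
  refine le_add_mul_abs_of_sq_growth (φ := fun s => ‖A (u s) - u s‖) hφc
    (fun _ => norm_nonneg _) hK0 (fun t ε hε => ?_) t
  set S : ℝ → L2 d := fun h => h⁻¹ • (u (t + h) - freeGroup h (u t)) with hS
  have hSlim : Tendsto S (𝓝[≠] 0) (𝓝 (-Complex.I • g.comp (u t))) := hu.tendsto_slope t
  have hUlim : Tendsto (fun h => freeGroup h (u t)) (𝓝[≠] 0) (𝓝 (u t)) := by
    have h1 : Continuous fun h : ℝ => freeGroup h (u t) :=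
      continuous_freeGroup_comp continuous_id continuous_const
    have h2 := h1.tendsto 0
    rw [freeGroup_zero] at h2
    exact h2.mono_left nhdsWithin_le_nhds
  have hidlim : Tendsto (fun h : ℝ => h) (𝓝[≠] 0) (𝓝 0) :=
    tendsto_id.mono_left nhdsWithin_le_nhds
  -- This is the only term of first order in h that the nonlinearity could contribute to the squared
  -- norm; its limit vanishes by gauge invariance.
  have hlim1 : Tendsto (fun h => 2 * (inner ℂ (D (freeGroup h (u t))) (D (S h))).re) (𝓝[≠] 0)
      (𝓝 0) := by
    have h1 : Tendsto (fun h => (inner ℂ (D (freeGroup h (u t))) (D (S h)))) (𝓝[≠] 0)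
        (𝓝 (inner ℂ (D (u t)) (D (-Complex.I • g.comp (u t))))) :=
      ((D.continuous.tendsto _).comp hUlim).inner ((D.continuous.tendsto _).comp hSlim)
    have h2 := ((Complex.continuous_re.tendsto _).comp h1).const_mul 2
    have h3 : (inner ℂ (D (u t)) (D (-Complex.I • g.comp (u t)))).re = 0 :=
      g.re_inner_phaseOp_sub _ _
    rw [h3, mul_zero] at h2
    exact h2
  have hlim2 : Tendsto (fun h => |2 * (inner ℂ (D (freeGroup h (u t))) (D (S h))).re|
      + |h| * ‖D (S h)‖ ^ 2 + K ^ 2 * |h|) (𝓝[≠] 0) (𝓝 0) := by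
    have h1 := hlim1.abs
    have h2 := hidlim.abs
    have h3 := (((D.continuous.tendsto _).comp hSlim).norm).pow 2
    have h4 := (h1.add (h2.mul h3)).add (h2.const_mul (K ^ 2))
    simpa using h4
  filter_upwards [hlim2.eventually (gt_mem_nhds hε), self_mem_nhdsWithin] with h hh hne
  have hne' : h ≠ 0 := hne
  have hdec : u (t + h) = freeGroup h (u t) + (h : ℂ) • S h := by
    rw [hS]
    simp only
    rw [L2.real_smul_eq, smul_smul, ← Complex.ofReal_mul, mul_inv_cancel₀ hne',
      Complex.ofReal_one, one_smul, add_sub_cancel]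
  have h1 : ‖A (freeGroup h (u t)) - freeGroup h (u t)‖ ≤ ‖A (u t) - u t‖ + K * |h| := by
    have := (w t).norm_modulation_freeGroup_sub_le j η h
    rw [hw t] at this
    refine this.trans ?_
    rw [hK]
    have := hB t
    gcongr
  have h2 : ‖D (u (t + h))‖ ^ 2 = ‖D (freeGroup h (u t))‖ ^ 2
      + h * (2 * (inner ℂ (D (freeGroup h (u t))) (D (S h))).re) + |h| * (|h| * ‖D (S h)‖ ^ 2) := by
    have h3 := norm_add_sq (𝕜 := ℂ) (D (freeGroup h (u t))) ((h : ℂ) • D (S h))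
    rw [hdec, map_add, map_smul, h3, inner_smul_right, norm_smul, Complex.norm_real,
      Real.norm_eq_abs, RCLike.re_eq_complex_re, Complex.re_ofReal_mul]
    ring
  rw [← hDa, ← hDa, h2]
  rw [← hDa, ← hDa] at h1
  have h4 := pow_le_pow_left₀ (norm_nonneg _) h1 2
  have h5 : h * (2 * (inner ℂ (D (freeGroup h (u t))) (D (S h))).re)
      ≤ |h| * |2 * (inner ℂ (D (freeGroup h (u t))) (D (S h))).re| := by
    rw [← abs_mul]
    exact le_abs_self _
  have h6 := mul_le_mul_of_nonneg_left hh.le (abs_nonneg h)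
  nlinarith

end

/-! ### The approximating flows -/

/-- The nonlinearity truncated at height `n + 1`. -/
def approxNL (n : ℕ) : GaugeNonlinearity := cutoffNL ((n : ℝ) + 1) (by positivity)

theorem isNearNL_approxNL (n : ℕ) :
    IsNearNL (approxNL n).toFun (4 * ((n : ℝ) + 1) ^ (-(1 / 2) : ℝ)) :=
  isNearNL_cutoff (by simp)

theorem isNearPotential_approxNL (n : ℕ) :
    IsNearPotential (approxNL n).potential (32 / ((n : ℝ) + 1)) :=
  isNearPotential_cutoff (by simp)

theorem tendsto_approxNL_err :
    Tendsto (fun n : ℕ => 4 * ((n : ℝ) + 1) ^ (-(1 / 2) : ℝ)) atTop (𝓝 0) := by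
  have h1 : Tendsto (fun n : ℕ => (n : ℝ) + 1) atTop atTop :=
    tendsto_atTop_add_const_right _ _ tendsto_natCast_atTop_atTop
  have h2 := ((tendsto_rpow_neg_atTop (by norm_num : (0 : ℝ) < 1 / 2)).comp h1).const_mul 4
  simpa using h2

theorem tendsto_approxNL_potential_err :
    Tendsto (fun n : ℕ => 32 / ((n : ℝ) + 1)) atTop (𝓝 0) := by
  have h := tendsto_one_div_add_atTop_nhds_zero_nat (𝕜 := ℝ) |>.const_mul 32
  simpa [mul_one_div, div_eq_mul_inv] using h

theorem exists_approxFlow (n : ℕ) (a : H1 d) :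
    ∃ w : ℝ → H1 d, w 0 = a ∧ IsTraj (approxNL n) (fun t => (w t).fn) ∧
      ∀ T, ∃ M, 0 ≤ M ∧ ∀ t, |t| ≤ T → ‖w t‖ ≤ M := by
  obtain ⟨u, hu0, hu⟩ := exists_isTraj (approxNL n) a.fn
  obtain ⟨w, hw, hM⟩ := hu.exists_H1_path hu0
  refine ⟨w, H1.ext_fn (by rw [hw, hu0]), ?_, hM⟩
  simpa only [hw] using hu

/-- The flow in `H¹` of the equation with truncated nonlinearity. -/
def approxFlow (n : ℕ) (a : H1 d) : ℝ → H1 d := (exists_approxFlow n a).choose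

theorem approxFlow_zero (n : ℕ) (a : H1 d) : approxFlow n a 0 = a :=
  (exists_approxFlow n a).choose_spec.1

theorem isTraj_approxFlow (n : ℕ) (a : H1 d) :
    IsTraj (approxNL n) (fun t => (approxFlow n a t).fn) :=
  (exists_approxFlow n a).choose_spec.2.1

theorem approxFlow_locally_bounded (n : ℕ) (a : H1 d) (T : ℝ) :
    ∃ M, 0 ≤ M ∧ ∀ t, |t| ≤ T → ‖approxFlow n a t‖ ≤ M :=
  (exists_approxFlow n a).choose_spec.2.2 T

theorem norm_approxFlow_fn (n : ℕ) (a : H1 d) (t : ℝ) : ‖(approxFlow n a t).fn‖ = ‖a.fn‖ := by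
  have h := (isTraj_approxFlow n a).norm_eq t
  rwa [approxFlow_zero] at h

theorem energy_approxFlow (n : ℕ) (a : H1 d) (t : ℝ) :
    1 / 2 * ‖(approxFlow n a t).grad‖ ^ 2 + 2 * (approxNL n).potentialEnergy (approxFlow n a t).fn
      = 1 / 2 * ‖a.grad‖ ^ 2 + 2 * (approxNL n).potentialEnergy a.fn := by
  have h := (isTraj_approxFlow n a).energy_eq (fun _ => rfl) (approxFlow_locally_bounded n a) t
  rwa [approxFlow_zero] at h

theorem momentum_approxFlow (n : ℕ) (a : H1 d) (t : ℝ) (j : Fin d) :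
    (inner ℂ (approxFlow n a t).fn ((approxFlow n a t).grad j)).im
      = (inner ℂ a.fn (a.grad j)).im := by
  have h := (isTraj_approxFlow n a).momentum_eq (fun _ => rfl) (approxFlow_locally_bounded n a) t j
  rwa [approxFlow_zero] at h

/-- The approximating flows are bounded in `H¹`, uniformly in time and in the truncation. -/
theorem exists_approxFlow_bound (hd : d = 2 ∨ d = 3) (r : ℝ) :
    ∃ B, 0 ≤ B ∧ ∀ (n : ℕ) (a : H1 d), ‖a‖ ≤ r → ∀ t,
      IsBdd B (approxFlow n a t).fn ∧ ‖approxFlow n a t‖ ≤ B := by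
  obtain ⟨C, hC1, hC⟩ := exists_isBdd hd
  have hC0 : 0 ≤ C := by linarith
  set K := C * r with hK
  -- From energy and mass, ‖w‖² ≤ 5‖a‖²_{L²} + ‖∇a‖² + 4Ψ(a); the potential energy Ψ(a) of the datum
  -- is bounded through its L² ∩ L⁶ bound `K`.
  set S : ℝ := 6 * r ^ 2 + 4 * (16 * (K + K ^ 3) * K * K + 32 * K ^ 6) with hS
  have key : ∀ (n : ℕ) (a : H1 d), ‖a‖ ≤ r → ∀ t, ‖approxFlow n a t‖ ≤ √S := by
    intro n a ha t
    have haK : IsBdd K a.fn := (hC a).mono (mul_le_mul_of_nonneg_left ha hC0)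
    have hE := energy_approxFlow n a t
    -- The bound on w(t) used here serves only for integrability. The lower bound involves the mass
    -- alone, so the argument is not circular.
    have h1 := (isNearPotential_approxNL n).neg_le_integral (hC (approxFlow n a t))
    have h2 := (abs_le.1 ((isNearPotential_approxNL n).abs_integral_le haK)).2
    have h3 : 32 / ((n : ℝ) + 1) ≤ 32 := div_le_self (by norm_num) (by simp)
    have h4 : 32 / ((n : ℝ) + 1) * K ^ 6 ≤ 32 * K ^ 6 :=
      mul_le_mul_of_nonneg_right h3 (by positivity)
    rw [norm_approxFlow_fn] at h1
    rw [GaugeNonlinearity.potentialEnergy, GaugeNonlinearity.potentialEnergy] at hE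
    refine Real.le_sqrt_of_sq_le ?_
    have h5 := (approxFlow n a t).norm_sq_eq
    rw [norm_approxFlow_fn] at h5
    have h6 := a.norm_sq_eq
    have h7 : ‖a‖ ^ 2 ≤ r ^ 2 := by gcongr
    nlinarith [sq_nonneg ‖a.grad‖, sq_nonneg ‖a.fn‖]
  refine ⟨C * √S, by positivity, fun n a ha t => ⟨?_, ?_⟩⟩
  · exact (hC _).mono (mul_le_mul_of_nonneg_left (key n a ha t) hC0)
  · exact (key n a ha t).trans (le_mul_of_one_le_left (Real.sqrt_nonneg _) hC1)

theorem weakTraj_approxFlow {n : ℕ} {a : H1 d} {B : ℝ}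
    (hB : ∀ t, IsBdd B (approxFlow n a t).fn) (T : ℝ) :
    WeakTraj (approxNL n).toFun T B (fun t => (approxFlow n a t).fn) where
  continuous := (isTraj_approxFlow n a).continuous
  isBdd t _ := hB t
  duhamel t _ φ := (isTraj_approxFlow n a).duhamel t φ

/-- The growth of the `L²` distance of two trajectories. -/
theorem IsTraj.norm_sub_sq_le {g₁ g₂ : GaugeNonlinearity} {δ₁ δ₂ : ℝ}
    (h₁ : IsNearNL g₁.toFun δ₁) (h₂ : IsNearNL g₂.toFun δ₂) {u v : ℝ → L2 d} (hu : IsTraj g₁ u)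
    (hv : IsTraj g₂ v) {K : ℝ} (hK : 0 ≤ K) {T D : ℝ} (hub : ∀ t, |t| ≤ T → IsBdd K (u t))
    (hvb : ∀ t, |t| ≤ T → IsBdd K (v t)) (hD : ∀ t, |t| ≤ T → norm4 (u t - v t) ≤ D) {t : ℝ}
    (ht : |t| ≤ T) :
    ‖u t - v t‖ ^ 2 ≤ ‖u 0 - v 0‖ ^ 2
      + 4 * K * (14 * (K + K ^ 3) * D + (δ₁ + δ₂) * K ^ (9 / 2 : ℝ)) * |t| := by
  set A : ℝ := 14 * (K + K ^ 3) * D + (δ₁ + δ₂) * K ^ (9 / 2 : ℝ) with hA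
  have hD0 : 0 ≤ D := (norm4_nonneg _).trans (hD 0 (by simpa using (abs_nonneg t).trans ht))
  have hδ₁ := h₁.nonneg
  have hδ₂ := h₂.nonneg
  have hA0 : 0 ≤ A := by positivity
  set f : ℝ → ℝ := fun s => ‖u s - v s‖ ^ 2 with hf
  set f' : ℝ → ℝ := fun s => (Complex.I * inner ℂ (g₁.comp (u s) - g₂.comp (v s)) (u s - v s)
    - Complex.I * inner ℂ (u s - v s) (g₁.comp (u s) - g₂.comp (v s))).re with hf'
  have hder : ∀ s, HasDerivAt f (f' s) s := by
    intro s
    have h1 := (hu.source s).sub (hv.source s)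
    have h2 := Complex.reCLM.hasFDerivAt.comp_hasDerivAt s (h1.hasDerivAt_inner h1)
    refine h2.congr_of_eventuallyEq (Eventually.of_forall fun s => ?_)
    exact (inner_self_eq_norm_sq (𝕜 := ℂ) (u s - v s)).symm
  -- The increment of the nonlinearities is small in L^{4/3} by the L⁴ estimate; it is paired with u
  -- - v, for which boundedness in L⁴ is enough.
  have hinner : ∀ s, |s| ≤ T →
      ‖inner ℂ (u s - v s) (g₁.comp (u s) - g₂.comp (v s))‖ ≤ A * (2 * K) := by
    intro s hs
    have h3 : inner ℂ (u s - v s) (g₁.comp (u s) - g₂.comp (v s))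
        = ∫ x, (g₁.toFun (u s x) - g₂.toFun (v s x)) * starRingEnd ℂ ((u s - v s : L2 d) x) := by
      rw [L2.inner_eq]
      refine integral_congr_ae ?_
      filter_upwards [Lp.coeFn_sub (g₁.comp (u s)) (g₂.comp (v s)), g₁.coeFn_comp (u s),
        g₂.coeFn_comp (v s)] with x e1 e2 e3
      rw [e1, Pi.sub_apply, e2, e3, mul_comm]
    rw [h3]
    have h4 : eLpNorm (fun x => g₁.toFun (u s x) - g₂.toFun (v s x)) (4 / 3)
        ≤ ENNReal.ofReal A := by
      refine (h₁.eLpNorm_sub_sub_le h₂ (hub s hs) (hvb s hs)).trans (ENNReal.ofReal_le_ofReal ?_)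
      have := hD s hs
      rw [hA]
      gcongr
    have h5 : eLpNorm (fun x => starRingEnd ℂ ((u s - v s : L2 d) x)) 4
        ≤ ENNReal.ofReal (2 * K) := by
      have h6 := ((hub s hs).sub (hvb s hs)).eLpNorm_four_le
      rw [← two_mul] at h6
      refine le_trans (le_of_eq ?_) h6
      exact eLpNorm_congr_norm_ae (ae_of_all _ fun x => by simp)
    have m5 : AEStronglyMeasurable (fun x => starRingEnd ℂ ((u s - v s : L2 d) x)) :=
      Complex.continuous_conj.comp_aestronglyMeasurable (Lp.aestronglyMeasurable _)
    have m4 : AEStronglyMeasurable (fun x => g₁.toFun (u s x) - g₂.toFun (v s x)) :=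
      (h₁.aestronglyMeasurable (u s)).sub (h₂.aestronglyMeasurable (v s))
    exact norm_integral_le_of_eLpNorm_one_le (by positivity) (eLpNorm_mul_one_le m4 m5 hA0 h4 h5)
  have hbound : ∀ s ∈ Set.uIcc 0 t, ‖f' s‖ ≤ 4 * K * A := by
    intro s hs
    have h6 := hinner s ((abs_le_of_mem_uIcc_zero hs).trans ht)
    have h7 : ‖inner ℂ (g₁.comp (u s) - g₂.comp (v s)) (u s - v s)‖ ≤ A * (2 * K) := by
      rwa [norm_inner_symm]
    rw [hf']
    refine (Complex.abs_re_le_norm _).trans ((_root_.norm_sub_le _ _).trans ?_)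
    rw [norm_mul, norm_mul, Complex.norm_I, one_mul, one_mul]
    linarith
  have h8 := Convex.norm_image_sub_le_of_norm_hasDerivWithin_le
    (fun s _ => (hder s).hasDerivWithinAt) hbound (convex_uIcc 0 t) Set.left_mem_uIcc
    Set.right_mem_uIcc
  rw [sub_zero, Real.norm_eq_abs, Real.norm_eq_abs] at h8
  have h9 := (abs_le.1 h8).2
  rw [hf] at h9
  simp only at h9
  linarith

/-- The approximating flows form a Cauchy sequence, and depend continuously on the data, in `L²`
and locally uniformly in time. -/
theorem exists_approxFlow_sub_le (hd : d = 2 ∨ d = 3) (r T : ℝ) :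
    ∃ C, 0 ≤ C ∧ ∀ (n m : ℕ) (a b : H1 d), ‖a‖ ≤ r → ‖b‖ ≤ r → ∀ t, |t| ≤ T →
      ‖(approxFlow n a t).fn - (approxFlow m b t).fn‖ ^ 2
        ≤ C * (‖a - b‖ + 4 * ((n : ℝ) + 1) ^ (-(1 / 2) : ℝ)
          + 4 * ((m : ℝ) + 1) ^ (-(1 / 2) : ℝ)) := by
  obtain ⟨B, hB0, hB⟩ := exists_approxFlow_bound hd r
  obtain ⟨C, hC1, hC⟩ := exists_isBdd hd
  obtain ⟨l, hl, h4⟩ := exists_norm4_sub_le hd hB0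
  have hC0 : 0 ≤ C := by linarith
  set Q : ℝ := B ^ (9 / 2 : ℝ) with hQ
  have hQ0 : 0 ≤ Q := by positivity
  set P : ℝ := 2 * (C + Q) * Real.exp (l * |T|) with hP
  have hP0 : 0 ≤ P := by positivity
  refine ⟨2 * |r| + 4 * B * (14 * (B + B ^ 3) * P + Q) * |T|, by positivity,
    fun n m a b ha hb t ht => ?_⟩
  set δ₁ : ℝ := 4 * ((n : ℝ) + 1) ^ (-(1 / 2) : ℝ) with hδ₁
  set δ₂ : ℝ := 4 * ((m : ℝ) + 1) ^ (-(1 / 2) : ℝ) with hδ₂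
  have hδ₁0 : 0 ≤ δ₁ := by positivity
  have hδ₂0 : 0 ≤ δ₂ := by positivity
  set Δ : ℝ := ‖a - b‖ + δ₁ + δ₂ with hΔ
  have hΔ0 : 0 ≤ Δ := by positivity
  -- The initial L⁴ size along the free flow is bounded by the H¹ distance of the data, and the
  -- truncation errors enter as the sources.
  have hD : ∀ s, |s| ≤ T → norm4 ((approxFlow n a s).fn - (approxFlow m b s).fn) ≤ P * Δ := by
    intro s hs
    have h5 := h4 (isNearNL_approxNL n) (isNearNL_approxNL m)
      (weakTraj_approxFlow (fun t => (hB n a ha t).1) T)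
      (weakTraj_approxFlow (fun t => (hB m b hb t).1) T) (C * ‖a - b‖) (fun τ => by
        rw [approxFlow_zero, approxFlow_zero, ← H1.fn_sub, ← H1.free_fn]
        have := hC ((a - b).free τ)
        rwa [H1.norm_free] at this) s hs
    refine h5.trans ?_
    have h6 : C * ‖a - b‖ + (δ₁ + δ₂) * Q ≤ (C + Q) * Δ := by
      have := norm_nonneg (a - b)
      rw [hΔ]
      nlinarith [mul_nonneg hC0 hδ₁0, mul_nonneg hC0 hδ₂0, mul_nonneg hQ0 this]
    have h7 : Real.exp (l * |s|) ≤ Real.exp (l * |T|) := by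
      have := hs.trans (le_abs_self T)
      gcongr
    calc 2 * (C * ‖a - b‖ + (δ₁ + δ₂) * Q) * Real.exp (l * |s|)
        ≤ 2 * ((C + Q) * Δ) * Real.exp (l * |T|) := by gcongr
      _ = P * Δ := by rw [hP]; ring
  have h8 := (isTraj_approxFlow n a).norm_sub_sq_le (isNearNL_approxNL n) (isNearNL_approxNL m)
    (isTraj_approxFlow m b) hB0 (fun t _ => (hB n a ha t).1) (fun t _ => (hB m b hb t).1) hD ht
  refine h8.trans ?_
  simp only [approxFlow_zero]
  have h9 : ‖a.fn - b.fn‖ ^ 2 ≤ 2 * |r| * Δ := by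
    rw [← H1.fn_sub]
    have e1 := (a - b).norm_fn_le
    have e2 : ‖a - b‖ ≤ 2 * |r| := by
      have := norm_sub_le a b
      have := le_abs_self r
      linarith
    have e3 : ‖a - b‖ ≤ Δ := by rw [hΔ]; linarith
    calc ‖(a - b).fn‖ ^ 2 ≤ ‖a - b‖ ^ 2 := by gcongr
      _ = ‖a - b‖ * ‖a - b‖ := sq _
      _ ≤ 2 * |r| * Δ := by gcongr
  have h10 : 4 * B * (14 * (B + B ^ 3) * (P * Δ) + (δ₁ + δ₂) * Q) * |t|
      ≤ 4 * B * (14 * (B + B ^ 3) * P + Q) * |T| * Δ := by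
    have e1 : (δ₁ + δ₂) * Q ≤ Q * Δ := by
      rw [hΔ]
      nlinarith [mul_nonneg hQ0 (norm_nonneg (a - b))]
    have e2 := ht.trans (le_abs_self T)
    calc 4 * B * (14 * (B + B ^ 3) * (P * Δ) + (δ₁ + δ₂) * Q) * |t|
        ≤ 4 * B * (14 * (B + B ^ 3) * (P * Δ) + Q * Δ) * |T| := by gcongr
      _ = _ := by ring
  exact (add_le_add h9 h10).trans_eq (add_mul _ _ _).symm

section

/-! ### Weak convergence -/

section Weak

variable {E : Type*} [NormedAddCommGroup E] [InnerProductSpace ℂ E] {ι : Type*} {l : Filter ι}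
  {y : ι → E} {y₀ : E}

theorem tendsto_inner_of_dense {S : Set E} (hS : Dense S) {B : ℝ} (hb : ∀ᶠ i in l, ‖y i‖ ≤ B)
    (hw : ∀ h ∈ S, Tendsto (fun i => inner ℂ h (y i)) l (𝓝 (inner ℂ h y₀))) (v : E) :
    Tendsto (fun i => inner ℂ v (y i)) l (𝓝 (inner ℂ v y₀)) := by
  rw [Metric.tendsto_nhds]
  intro ε hε
  set A : ℝ := |B| + ‖y₀‖ + 1 with hA
  have hA0 : 0 < A := by positivity
  obtain ⟨h, hhS, hh⟩ := Metric.dense_iff.1 hS v (ε / (2 * A)) (by positivity)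
  rw [Metric.mem_ball, dist_eq_norm] at hhS
  have h1 := (Metric.tendsto_nhds.1 (hw h hh)) (ε / 2) (by positivity)
  filter_upwards [hb, h1] with i hi h2
  rw [dist_eq_norm] at h2 ⊢
  have e : inner ℂ v (y i) - inner ℂ v y₀
      = inner ℂ (v - h) (y i - y₀) + (inner ℂ h (y i) - inner ℂ h y₀) := by
    rw [inner_sub_left, inner_sub_right, inner_sub_right]
    ring
  rw [e]
  have h3 : ‖inner ℂ (v - h) (y i - y₀)‖ ≤ ε / 2 := by
    refine (norm_inner_le_norm _ _).trans ?_
    rw [norm_sub_rev v h]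
    have h4 : ‖y i - y₀‖ ≤ A := by
      have := norm_sub_le (y i) y₀
      have := le_abs_self B
      linarith
    refine (mul_le_mul hhS.le h4 (norm_nonneg _) (by positivity)).trans (le_of_eq ?_)
    field_simp
  exact (norm_add_le _ _).trans_lt (by linarith)

/-- The Radon–Riesz property of a Hilbert space: expand ‖y - y₀‖². -/
theorem tendsto_of_tendsto_inner_of_norm
    (hw : ∀ v, Tendsto (fun i => inner ℂ v (y i)) l (𝓝 (inner ℂ v y₀)))
    (hn : Tendsto (fun i => ‖y i‖) l (𝓝 ‖y₀‖)) : Tendsto y l (𝓝 y₀) := by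
  rw [tendsto_iff_norm_sub_tendsto_zero]
  have h1 : ∀ i, ‖y i - y₀‖ ^ 2 = ‖y i‖ ^ 2 - 2 * (inner ℂ y₀ (y i)).re + ‖y₀‖ ^ 2 := by
    intro i
    rw [norm_sub_sq (𝕜 := ℂ), ← inner_conj_symm, RCLike.conj_re, RCLike.re_eq_complex_re]
  have h2 : Tendsto (fun i => ‖y i - y₀‖ ^ 2) l (𝓝 0) := by
    simp only [h1]
    have h3 := (Complex.continuous_re.tendsto _).comp (hw y₀)
    have h4 := ((hn.pow 2).sub (h3.const_mul 2)).add_const (‖y₀‖ ^ 2)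
    have h5 : (inner ℂ y₀ y₀).re = ‖y₀‖ ^ 2 := inner_self_eq_norm_sq (𝕜 := ℂ) y₀
    rw [h5, show ‖y₀‖ ^ 2 - 2 * ‖y₀‖ ^ 2 + ‖y₀‖ ^ 2 = 0 by ring] at h4
    exact h4
  have h3 := (Real.continuous_sqrt.tendsto 0).comp h2
  simpa [Function.comp_def] using h3

/-- Weak lower semicontinuity of the norm, which needs the limit only against y₀ itself. -/
theorem norm_le_of_tendsto_inner [l.NeBot] {B : ℝ} (hb : ∀ᶠ i in l, ‖y i‖ ≤ B)
    (hw : Tendsto (fun i => inner ℂ y₀ (y i)) l (𝓝 (inner ℂ y₀ y₀))) : ‖y₀‖ ≤ B := by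
  have h1 : ‖inner ℂ y₀ y₀‖ ≤ ‖y₀‖ * B := by
    refine le_of_tendsto hw.norm ?_
    filter_upwards [hb] with i hi
    exact (norm_inner_le_norm _ _).trans (mul_le_mul_of_nonneg_left hi (norm_nonneg _))
  have h2 : ‖inner ℂ y₀ y₀‖ = ‖y₀‖ * ‖y₀‖ := by
    rw [inner_self_eq_norm_sq_to_K]
    simp [sq]
  rw [h2] at h1
  rcases eq_or_lt_of_le (norm_nonneg y₀) with h | h
  · obtain ⟨i, hi⟩ := hb.exists
    rw [← h]
    exact (norm_nonneg _).trans hi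
  · exact le_of_mul_le_mul_left h1 h

end Weak

theorem H1.inner_eq (u v : H1 d) :
    inner ℂ u v = inner ℂ u.fn v.fn + ∑ j, inner ℂ (u.grad j) (v.grad j) := by
  rw [Submodule.coe_inner, WithLp.prod_inner_apply, PiLp.inner_apply]
  rfl

theorem H1.dense_range_ofSchwartz : Dense (Set.range (H1.ofSchwartz (d := d))) := by
  refine Metric.dense_iff.2 fun u ε hε => ?_
  obtain ⟨φ, hφ⟩ := u.exists_schwartz_norm_sub_lt hε
  exact ⟨H1.ofSchwartz φ, by rwa [Metric.mem_ball, dist_comm, dist_eq_norm], φ, rfl⟩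

section H1Weak

variable {ι : Type*} {l : Filter ι} {w : ι → H1 d} {w₀ : H1 d}

/-- Bounded sequences in `H¹` that converge in `L²` converge weakly in `H¹`. -/
theorem H1.tendsto_inner (hfn : Tendsto (fun i => (w i).fn) l (𝓝 w₀.fn)) {B : ℝ}
    (hb : ∀ᶠ i in l, ‖w i‖ ≤ B) (v : H1 d) :
    Tendsto (fun i => inner ℂ v (w i)) l (𝓝 (inner ℂ v w₀)) := by
  refine tendsto_inner_of_dense H1.dense_range_ofSchwartz hb ?_ v
  rintro _ ⟨φ, rfl⟩
  -- Against a Schwartz function the gradient pairing is integrated by parts, so only the L² limit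
  -- enters; boundedness and density do the rest.
  have h1 : ∀ u : H1 d, inner ℂ (H1.ofSchwartz φ) u = inner ℂ (H1.ofSchwartz φ).fn u.fn
      + ∑ j, -inner ℂ ((H1.ofSchwartz (∂_{EuclideanSpace.single j (1 : ℝ)} φ)).grad j) u.fn := by
    intro u
    rw [H1.inner_eq]
    congr 1
    refine Finset.sum_congr rfl fun j _ => ?_
    rw [H1.inner_grad, neg_neg]
    rfl
  simp only [h1]
  exact (tendsto_const_nhds.inner hfn).add
    (tendsto_finsetSum _ fun j _ => (tendsto_const_nhds.inner hfn).neg)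

theorem H1.tendsto_of_tendsto_fn_of_norm (hfn : Tendsto (fun i => (w i).fn) l (𝓝 w₀.fn))
    (hn : Tendsto (fun i => ‖(w i).grad‖ ^ 2) l (𝓝 (‖w₀.grad‖ ^ 2))) : Tendsto w l (𝓝 w₀) := by
  have h1 : Tendsto (fun i => ‖w i‖ ^ 2) l (𝓝 (‖w₀‖ ^ 2)) := by
    simp only [H1.norm_sq_eq]
    exact (hfn.norm.pow 2).add hn
  have h2 : Tendsto (fun i => ‖w i‖) l (𝓝 ‖w₀‖) := by
    have := (Real.continuous_sqrt.tendsto _).comp h1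
    simpa [Function.comp_def] using this
  have hb : ∀ᶠ i in l, ‖w i‖ ≤ ‖w₀‖ + 1 :=
    h2.eventually (eventually_le_nhds (by linarith))
  exact tendsto_of_tendsto_inner_of_norm (H1.tendsto_inner hfn hb) h2

end H1Weak

/-- The L² convergence is strong in L⁴ by interpolation, and the potential is Lipschitz there on
bounded sets. The kinetic term is thus the only part of the energy that could drop in the limit. -/
theorem tendsto_potential {ι : Type*} {l : Filter ι} {G : ι → ℂ → ℝ} {δ : ι → ℝ}
    (hG : ∀ i, IsNearPotential (G i) (δ i)) (hδ : Tendsto δ l (𝓝 0)) {w : ι → L2 d} {w₀ : L2 d}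
    {B : ℝ} (hb : ∀ᶠ i in l, IsBdd B (w i)) (hb₀ : IsBdd B w₀) (hw : Tendsto w l (𝓝 w₀)) :
    Tendsto (fun i => ∫ x, G i (w i x)) l (𝓝 (∫ x, cqPotential (w₀ x))) := by
  rw [tendsto_iff_norm_sub_tendsto_zero]
  have h1 : Tendsto (fun i => norm4 (w i - w₀)) l (𝓝 0) :=
    tendsto_norm4_zero (K := B + B) (hb.mono fun i hi => hi.sub hb₀)
      (tendsto_iff_norm_sub_tendsto_zero.1 hw)
  have h2 := (h1.const_mul (16 * (B + B ^ 3) * B)).add (hδ.mul_const (B ^ 6))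
  rw [mul_zero, zero_mul, add_zero] at h2
  refine squeeze_zero' (Eventually.of_forall fun _ => norm_nonneg _) ?_ h2
  filter_upwards [hb] with i hi
  exact (hG i).abs_integral_sub_le hi hb₀

theorem IsBdd.eq_zero_of_norm4 {K : ℝ} {w : L2 d} (h : IsBdd K w) (h4 : norm4 w ≤ 0) : w = 0 := by
  have h1 := h.eLpNorm_four_eq
  rw [le_antisymm h4 (norm4_nonneg w), ENNReal.ofReal_zero,
    eLpNorm_eq_zero_iff (Lp.aestronglyMeasurable w) (by norm_num)] at h1
  exact (Lp.eq_zero_iff_ae_eq_zero).2 h1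

/-! ### Limits of approximating trajectories -/

/-- Dominated convergence in time in Duhamel's formula: at each s the sources converge by L⁴
convergence and the vanishing truncation error, with a bound uniform in n and s. -/
theorem WeakTraj.of_tendsto (hd : d = 2 ∨ d = 3) {v : ℕ → ℝ → L2 d}
    (hv : ∀ n, IsTraj (approxNL n) (v n)) {B : ℝ} (hB : ∀ n t, IsBdd B (v n t)) {u : ℝ → L2 d}
    (hu : Continuous u) (hlim : ∀ t, Tendsto (fun n => v n t) atTop (𝓝 (u t))) (T : ℝ) :
    WeakTraj nonlinearity T B u := by
  have huB : ∀ t, IsBdd B (u t) := fun t => IsBdd.of_tendsto (hlim t) fun n => hB n t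
  have hB0 : 0 ≤ B := (huB 0).nonneg
  refine ⟨hu, fun t _ => huB t, fun t _ φ => ?_⟩
  obtain ⟨A, hA⟩ := exists_isBdd_freeS hd φ
  have hA0 : 0 ≤ A := (hA 0).nonneg
  set e : ℕ → ℝ → ℂ := fun n s => sourcePair (approxNL n).toFun (v n s) (t - s) φ
    - sourcePair nonlinearity (u s) (t - s) φ with he
  have c1 : ∀ n, Continuous fun s => sourcePair (approxNL n).toFun (v n s) (t - s) φ := fun n =>
    continuousOn_univ.1 (continuousOn_sourcePair hd (isNearNL_approxNL n) (hv n).continuous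
      (fun s _ => hB n s) t φ)
  have c2 : Continuous fun s => sourcePair nonlinearity (u s) (t - s) φ :=
    continuousOn_univ.1 (continuousOn_sourcePair hd isNearNL_nonlinearity hu
      (fun s _ => huB s) t φ)
  set Q : ℝ := B ^ (9 / 2 : ℝ) with hQ
  have hQ0 : 0 ≤ Q := by positivity
  have hle : ∀ n s, ‖e n s‖ ≤ (14 * (B + B ^ 3) * norm4 (v n s - u s)
      + (4 * ((n : ℝ) + 1) ^ (-(1 / 2) : ℝ) + 0) * Q) * A := by
    intro n s
    have h1 := (isNearNL_approxNL n).norm_integral_sub_le isNearNL_nonlinearity (hB n s) (huB s)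
      (hA (t - s)) (hA (t - s))
    rw [← sourcePair_eq, ← sourcePair_eq, sub_self] at h1
    have h0 : norm4 (0 : L2 d) = 0 := by
      have := (isBdd_zero (d := d) le_rfl).norm4_le
      exact le_antisymm this (norm4_nonneg _)
    rw [h0, mul_zero, add_zero] at h1
    refine h1.trans ?_
    have h2 := (hA (t - s)).norm4_le
    have h3 := norm4_nonneg (v n s - u s)
    gcongr
  have hint : Tendsto (fun n => ∫ s in (0 : ℝ)..t, e n s) atTop
      (𝓝 (∫ _s in (0 : ℝ)..t, (0 : ℂ))) := by
    refine intervalIntegral.tendsto_integral_filter_of_dominated_convergence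
      (fun _ => (14 * (B + B ^ 3) * (B + B) + (4 * 1 + 0) * Q) * A)
      (Eventually.of_forall fun n => ((c1 n).sub c2).aestronglyMeasurable)
      (Eventually.of_forall fun n => ae_of_all _ fun s _ => ?_) intervalIntegrable_const
      (ae_of_all _ fun s _ => ?_)
    · refine (hle n s).trans ?_
      have h1 := ((hB n s).sub (huB s)).norm4_le
      have h2 : ((n : ℝ) + 1) ^ (-(1 / 2) : ℝ) ≤ 1 :=
        Real.rpow_le_one_of_one_le_of_nonpos (by simp) (by norm_num)
      gcongr
    · have h1 : Tendsto (fun n => norm4 (v n s - u s)) atTop (𝓝 0) :=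
        tendsto_norm4_zero (K := B + B) (Eventually.of_forall fun n => (hB n s).sub (huB s))
          (tendsto_iff_norm_sub_tendsto_zero.1 (hlim s))
      have h2 := (((h1.const_mul (14 * (B + B ^ 3))).add
        ((tendsto_approxNL_err.add_const 0).mul_const Q)).mul_const A)
      simp only [mul_zero, add_zero, zero_mul] at h2
      refine squeeze_zero_norm (fun n => hle n s) ?_
      simpa using h2
  rw [intervalIntegral.integral_zero] at hint
  have h1 : ∀ n, pairS φ (v n t) = pairS φ (freeGroup t (v n 0)) - Complex.I *
      ((∫ s in (0 : ℝ)..t, e n s) + ∫ s in (0 : ℝ)..t, sourcePair nonlinearity (u s) (t - s) φ) := by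
    intro n
    rw [(hv n).duhamel t φ, he]
    simp only
    rw [intervalIntegral.integral_sub ((c1 n).intervalIntegrable _ _) (c2.intervalIntegrable _ _),
      sub_add_cancel]
  have h2 : Tendsto (fun n => pairS φ (v n t)) atTop (𝓝 (pairS φ (u t))) :=
    ((pairS φ).continuous.tendsto _).comp (hlim t)
  have h3 : Tendsto (fun n => pairS φ (freeGroup t (v n 0))) atTop
      (𝓝 (pairS φ (freeGroup t (u 0)))) :=
    ((pairS φ).continuous.tendsto _).comp (((freeGroup t).continuous.tendsto _).comp (hlim 0))
  simp only [h1] at h2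
  refine tendsto_nhds_unique h2 ?_
  have h4 := h3.sub ((hint.add_const (∫ s in (0 : ℝ)..t,
    sourcePair nonlinearity (u s) (t - s) φ)).const_mul Complex.I)
  rwa [zero_add] at h4

/-- Uniqueness of bounded solutions of Duhamel's formula. -/
theorem WeakTraj.eq_of_eq (hd : d = 2 ∨ d = 3) {T K : ℝ} {u v : ℝ → L2 d}
    (hu : WeakTraj nonlinearity T K u) (hv : WeakTraj nonlinearity T K v) (h0 : u 0 = v 0) {t : ℝ}
    (ht : |t| ≤ T) : u t = v t := by
  have hK := (hu.isBdd t ht).nonneg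
  obtain ⟨l, -, h⟩ := exists_norm4_sub_le hd hK
  have h1 := h isNearNL_nonlinearity isNearNL_nonlinearity hu hv 0
    (fun s => by rw [h0, sub_self, map_zero]; exact isBdd_zero le_rfl) t ht
  rw [add_zero, zero_mul, add_zero, mul_zero, zero_mul] at h1
  exact sub_eq_zero.1 (((hu.isBdd t ht).sub (hv.isBdd t ht)).eq_zero_of_norm4 h1)

end

section

/-! ### The flow in `H¹` -/

theorem IsTraj.shift {g : GaugeNonlinearity} {u : ℝ → L2 d} (hu : IsTraj g u) (h : ℝ) :
    IsTraj g fun s => u (s + h) where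
  continuous := hu.continuous.comp (continuous_id.add continuous_const)
  source s := (hu.source (s + h)).shift

theorem WeakTraj.mono {g : ℂ → ℂ} {T K K' : ℝ} {u : ℝ → L2 d} (hu : WeakTraj g T K u)
    (hK : K ≤ K') : WeakTraj g T K' u :=
  ⟨hu.continuous, fun t ht => (hu.isBdd t ht).mono hK, hu.duhamel⟩

/-- The truncated solutions are Cauchy in L²; their uniform gradient bound passes to the limit
through difference quotients. -/
theorem exists_flow (hd : d = 2 ∨ d = 3) (a : H1 d) (t : ℝ) :
    ∃ w : H1 d, Tendsto (fun n => (approxFlow n a t).fn) atTop (𝓝 w.fn) := by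
  obtain ⟨C, hC0, hC⟩ := exists_approxFlow_sub_le hd ‖a‖ |t|
  obtain ⟨B, hB0, hB⟩ := exists_approxFlow_bound hd ‖a‖
  have hcauchy : CauchySeq fun n => (approxFlow n a t).fn := by
    refine cauchySeq_of_le_tendsto_0
      (fun n : ℕ => √(C * (2 * (4 * ((n : ℝ) + 1) ^ (-(1 / 2) : ℝ))))) (fun n m N hn hm => ?_) ?_
    · rw [dist_eq_norm]
      refine Real.le_sqrt_of_sq_le ((hC n m a a le_rfl le_rfl t le_rfl).trans ?_)
      have hmono : ∀ k : ℕ, N ≤ k →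
          ((k : ℝ) + 1) ^ (-(1 / 2) : ℝ) ≤ ((N : ℝ) + 1) ^ (-(1 / 2) : ℝ) := fun k hk =>
        Real.rpow_le_rpow_of_nonpos (by positivity) (by gcongr) (by norm_num)
      have h1 := hmono n hn
      have h2 := hmono m hm
      rw [sub_self, norm_zero]
      refine mul_le_mul_of_nonneg_left ?_ hC0
      linarith
    · have h1 := (tendsto_approxNL_err.const_mul 2).const_mul C
      have h2 := (Real.continuous_sqrt.tendsto _).comp h1
      simpa [Function.comp_def] using h2
  obtain ⟨f, hf⟩ := cauchySeq_tendsto_of_complete hcauchy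
  have hn : Tendsto (fun n : ℕ => 1 / ((n : ℝ) + 1)) atTop (𝓝 0) :=
    tendsto_one_div_add_atTop_nhds_zero_nat
  obtain ⟨w, hw, -⟩ := H1.exists_of_translation_bound f hB0 hn (fun n => by positivity)
    fun j k => by
      refine le_of_tendsto' (((fourierPhase _).continuous.tendsto _).comp hf |>.sub hf).norm
        fun n => ?_
      refine ((approxFlow n a t).norm_translation_sub_le j _).trans ?_
      rw [mul_comm]
      exact mul_le_mul_of_nonneg_right
        (((approxFlow n a t).norm_grad_apply_le j).trans (hB n a le_rfl t).2) (abs_nonneg _)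
  exact ⟨w, by rwa [hw]⟩

/-- The flow of the cubic-quartic Schrödinger equation. -/
def flow (hd : d = 2 ∨ d = 3) (a : H1 d) (t : ℝ) : H1 d := (exists_flow hd a t).choose

section Flow

variable (hd : d = 2 ∨ d = 3)

theorem tendsto_approxFlow_fn (a : H1 d) (t : ℝ) :
    Tendsto (fun n => (approxFlow n a t).fn) atTop (𝓝 (flow hd a t).fn) :=
  (exists_flow hd a t).choose_spec

theorem flow_zero (a : H1 d) : flow hd a 0 = a := by
  have h := tendsto_approxFlow_fn hd a 0
  simp only [approxFlow_zero] at h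
  exact H1.ext_fn (tendsto_nhds_unique h tendsto_const_nhds)

theorem norm_flow_fn (a : H1 d) (t : ℝ) : ‖(flow hd a t).fn‖ = ‖a.fn‖ := by
  have h := (tendsto_approxFlow_fn hd a t).norm
  simp only [norm_approxFlow_fn] at h
  exact tendsto_nhds_unique h tendsto_const_nhds

theorem exists_flow_bound (r : ℝ) :
    ∃ B, 0 ≤ B ∧ ∀ a : H1 d, ‖a‖ ≤ r → ∀ t,
      (∀ n, IsBdd B (approxFlow n a t).fn ∧ ‖approxFlow n a t‖ ≤ B) ∧
        IsBdd B (flow hd a t).fn ∧ ‖flow hd a t‖ ≤ B := by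
  obtain ⟨B, hB0, hB⟩ := exists_approxFlow_bound hd r
  refine ⟨B, hB0, fun a ha t => ⟨fun n => hB n a ha t, ?_, ?_⟩⟩
  · exact IsBdd.of_tendsto (tendsto_approxFlow_fn hd a t) fun n => (hB n a ha t).1
  · have hb : ∀ᶠ n in atTop, ‖approxFlow n a t‖ ≤ B :=
      Eventually.of_forall fun n => (hB n a ha t).2
    exact norm_le_of_tendsto_inner hb (H1.tendsto_inner (tendsto_approxFlow_fn hd a t) hb _)

theorem exists_flow_sub_le (r T : ℝ) :
    ∃ C, 0 ≤ C ∧ ∀ a b : H1 d, ‖a‖ ≤ r → ‖b‖ ≤ r → ∀ t, |t| ≤ T →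
      ‖(flow hd a t).fn - (flow hd b t).fn‖ ^ 2 ≤ C * ‖a - b‖ ∧
      ∀ n : ℕ, ‖(flow hd a t).fn - (approxFlow n a t).fn‖ ^ 2
        ≤ C * (4 * ((n : ℝ) + 1) ^ (-(1 / 2) : ℝ)) := by
  obtain ⟨C, hC0, hC⟩ := exists_approxFlow_sub_le hd r T
  have herr := tendsto_approxNL_err
  refine ⟨C, hC0, fun a b ha hb t ht => ⟨?_, fun n => ?_⟩⟩
  · have h1 := (((tendsto_approxFlow_fn hd a t).sub (tendsto_approxFlow_fn hd b t)).norm).pow 2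
    have h2 := (((herr.const_add ‖a - b‖).add herr).const_mul C)
    rw [add_zero, add_zero] at h2
    exact le_of_tendsto_of_tendsto' h1 h2 fun n => hC n n a b ha hb t ht
  · have h1 := (((tendsto_approxFlow_fn hd a t).sub_const (approxFlow n a t).fn).norm).pow 2
    have h2 := (((herr.const_add ‖a - a‖).add_const
      (4 * ((n : ℝ) + 1) ^ (-(1 / 2) : ℝ))).const_mul C)
    rw [add_zero, sub_self, norm_zero, zero_add] at h2
    refine le_of_tendsto_of_tendsto' h1 h2 fun m => ?_
    have h3 := hC m n a a ha ha t ht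
    rwa [sub_self, norm_zero] at h3

theorem continuous_flow_fn (a : H1 d) : Continuous fun t => (flow hd a t).fn := by
  have h : TendstoLocallyUniformly (fun n t => (approxFlow n a t).fn)
      (fun t => (flow hd a t).fn) atTop := by
    refine Metric.tendstoLocallyUniformly_iff.2 fun ε hε x => ?_
    obtain ⟨C, hC0, hC⟩ := exists_flow_sub_le hd ‖a‖ (|x| + 1)
    refine ⟨Metric.ball x 1, Metric.ball_mem_nhds x one_pos, ?_⟩
    have h1 := tendsto_approxNL_err.const_mul C
    rw [mul_zero] at h1
    filter_upwards [h1.eventually (gt_mem_nhds (by positivity : 0 < ε ^ 2))] with n hn y hy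
    rw [Metric.mem_ball, Real.dist_eq] at hy
    have hy' : |y| ≤ |x| + 1 := by
      have := abs_sub_abs_le_abs_sub y x
      linarith
    have h2 := (hC a a le_rfl le_rfl y hy').2 n
    rw [dist_eq_norm]
    exact lt_of_pow_lt_pow_left₀ 2 hε.le (h2.trans_lt hn)
  exact h.continuous (Frequently.of_forall fun n => (isTraj_approxFlow n a).continuous)

theorem weakTraj_flow_shift {a : H1 d} {B : ℝ} (hB : ∀ n t, IsBdd B (approxFlow n a t).fn)
    (h T : ℝ) : WeakTraj nonlinearity T B fun s => (flow hd a (s + h)).fn :=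
  WeakTraj.of_tendsto hd (fun n => (isTraj_approxFlow n a).shift h) (fun n _ => hB n _)
    ((continuous_flow_fn hd a).comp (continuous_id.add continuous_const))
    (fun t => tendsto_approxFlow_fn hd a (t + h)) T

theorem weakTraj_flow {a : H1 d} {B : ℝ} (hB : ∀ n t, IsBdd B (approxFlow n a t).fn) (T : ℝ) :
    WeakTraj nonlinearity T B fun s => (flow hd a s).fn := by
  simpa using weakTraj_flow_shift hd hB 0 T

/-- Both sides solve Duhamel's formula from the same datum. For the shifted side the formula is
inherited from the truncated trajectories, for which a change of initial time is immediate. -/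
theorem flow_flow (a : H1 d) (h s : ℝ) : flow hd (flow hd a h) s = flow hd a (s + h) := by
  obtain ⟨B, hB0, hB⟩ := exists_flow_bound hd (max ‖a‖ ‖flow hd a h‖)
  refine H1.ext_fn ?_
  have h1 := weakTraj_flow hd (a := flow hd a h)
    (fun n t => ((hB _ (le_max_right _ _) t).1 n).1) |s|
  have h2 := weakTraj_flow_shift hd (a := a)
    (fun n t => ((hB _ (le_max_left _ _) t).1 n).1) h |s|
  exact h1.eq_of_eq hd h2 (by simp only [flow_zero, zero_add]) le_rfl

/-- The energy, in terms of the potential. -/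
theorem H1.energy_eq (hd : d = 2 ∨ d = 3) (u : H1 d) :
    energy u = 1 / 2 * ‖u.grad‖ ^ 2 + 2 * ∫ x, cqPotential (u.fn x) := by
  obtain ⟨C, -, hC⟩ := exists_isBdd hd
  have i4 : Integrable fun x => -(1 / 4) * ‖u.fn x‖ ^ 4 := (hC u).integrable_pow_four.const_mul _
  have i5 : Integrable fun x => 1 / 5 * ‖u.fn x‖ ^ 5 := by
    refine ((isNearPotential_cqPotential.integrable (hC u)).sub i4).congr (ae_of_all _ fun x => ?_)
    simp only [Pi.sub_apply, cqPotential]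
    ring
  have h : ∫ x, cqPotential (u.fn x)
      = -(1 / 4) * (∫ x, ‖u.fn x‖ ^ 4) + 1 / 5 * ∫ x, ‖u.fn x‖ ^ 5 := by
    rw [← integral_const_mul, ← integral_const_mul, ← integral_add i4 i5]
    rfl
  rw [h, energy]
  ring

/-- The truncated energies are conserved and their potential parts converge, hence the gradient
norms do. That the limit is the gradient norm of the flow is known only after the energy is shown to
be conserved. -/
theorem tendsto_norm_sq_approxFlow_grad (a : H1 d) (t : ℝ) :
    Tendsto (fun n => ‖(approxFlow n a t).grad‖ ^ 2) atTop
      (𝓝 (2 * energy a - 4 * ∫ x, cqPotential ((flow hd a t).fn x))) := by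
  obtain ⟨B, hB0, hB⟩ := exists_flow_bound hd ‖a‖
  obtain ⟨C, -, hC⟩ := exists_isBdd hd
  have h1 := tendsto_potential isNearPotential_approxNL tendsto_approxNL_potential_err
    (Eventually.of_forall fun n => ((hB a le_rfl t).1 n).1) (hB a le_rfl t).2.1
    (tendsto_approxFlow_fn hd a t)
  have h2 := tendsto_potential isNearPotential_approxNL tendsto_approxNL_potential_err
    (Eventually.of_forall fun n => hC a) (hC a) tendsto_const_nhds
  have h3 := ((h2.const_mul 4).const_add (‖a.grad‖ ^ 2)).sub (h1.const_mul 4)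
  have e : 2 * energy a - 4 * ∫ x, cqPotential ((flow hd a t).fn x)
      = ‖a.grad‖ ^ 2 + 4 * (∫ x, cqPotential (a.fn x))
        - 4 * ∫ x, cqPotential ((flow hd a t).fn x) := by
    rw [H1.energy_eq hd a]
    ring
  rw [e]
  refine h3.congr fun n => ?_
  have h4 := energy_approxFlow n a t
  rw [GaugeNonlinearity.potentialEnergy, GaugeNonlinearity.potentialEnergy] at h4
  linarith

/-- Weak lower semicontinuity of the H¹ norm; the mass and the potential energy pass to the limit
exactly. -/
theorem energy_flow_le (a : H1 d) (t : ℝ) : energy (flow hd a t) ≤ energy a := by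
  set G : ℝ := 2 * energy a - 4 * ∫ x, cqPotential ((flow hd a t).fn x) with hG
  have h1 := tendsto_norm_sq_approxFlow_grad hd a t
  have hG0 : 0 ≤ G := ge_of_tendsto' h1 fun n => by positivity
  have h2 : Tendsto (fun n => ‖approxFlow n a t‖) atTop (𝓝 (√(‖a.fn‖ ^ 2 + G))) := by
    have h3 := (Real.continuous_sqrt.tendsto _).comp (h1.const_add (‖a.fn‖ ^ 2))
    refine h3.congr fun n => ?_
    rw [Function.comp_apply, ← norm_approxFlow_fn n a t, ← H1.norm_sq_eq, Real.sqrt_sq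
      (norm_nonneg _)]
  have h3 : ‖flow hd a t‖ ≤ √(‖a.fn‖ ^ 2 + G) := by
    refine le_of_forall_pos_le_add fun ε hε => ?_
    have hb : ∀ᶠ n in atTop, ‖approxFlow n a t‖ ≤ √(‖a.fn‖ ^ 2 + G) + ε :=
      h2.eventually (eventually_le_nhds (by linarith))
    exact norm_le_of_tendsto_inner hb (H1.tendsto_inner (tendsto_approxFlow_fn hd a t) hb _)
  have h4 := pow_le_pow_left₀ (norm_nonneg _) h3 2
  rw [Real.sq_sqrt (by positivity), H1.norm_sq_eq, norm_flow_fn] at h4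
  rw [H1.energy_eq hd (flow hd a t)]
  linarith

/-- Conservation of energy. -/
theorem energy_flow (a : H1 d) (t : ℝ) : energy (flow hd a t) = energy a := by
  refine le_antisymm (energy_flow_le hd a t) ?_
  -- Reversibility: the same inequality, from the state at time t back to time 0, is the opposite
  -- one.
  have h := energy_flow_le hd (flow hd a t) (-t)
  rwa [flow_flow, neg_add_cancel, flow_zero] at h

theorem norm_sq_flow_grad (a : H1 d) (t : ℝ) :
    ‖(flow hd a t).grad‖ ^ 2 = 2 * energy a - 4 * ∫ x, cqPotential ((flow hd a t).fn x) := by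
  have h := energy_flow hd a t
  rw [H1.energy_eq hd (flow hd a t)] at h
  linarith

/-- Conservation of energy excludes any loss of gradient norm, so the weak H¹ limit is strong.
Momentum and angular momentum need this. -/
theorem tendsto_approxFlow (a : H1 d) (t : ℝ) :
    Tendsto (fun n => approxFlow n a t) atTop (𝓝 (flow hd a t)) := by
  refine H1.tendsto_of_tendsto_fn_of_norm (tendsto_approxFlow_fn hd a t) ?_
  rw [norm_sq_flow_grad]
  exact tendsto_norm_sq_approxFlow_grad hd a t

theorem H1.continuous_energy (hd : d = 2 ∨ d = 3) : Continuous (energy : H1 d → ℝ) := by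
  obtain ⟨C, hC1, hC⟩ := exists_isBdd hd
  refine continuous_iff_continuousAt.2 fun a => ?_
  have hb : ∀ᶠ b in 𝓝 a, IsBdd (C * (‖a‖ + 1)) (H1.fn b) := by
    filter_upwards [(continuous_norm.tendsto a).eventually
      (eventually_le_nhds (by linarith : ‖a‖ < ‖a‖ + 1))] with b hb
    exact (hC b).mono (mul_le_mul_of_nonneg_left hb (by linarith))
  have h1 := tendsto_potential (fun _ : H1 d => isNearPotential_cqPotential) tendsto_const_nhds hb
    hb.self_of_nhds (H1.continuous_fn.tendsto a)
  have h2 : Tendsto (fun b : H1 d => 1 / 2 * ‖b.grad‖ ^ 2) (𝓝 a) (𝓝 (1 / 2 * ‖a.grad‖ ^ 2)) :=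
    ((H1.continuous_grad.norm.pow 2).const_mul _).tendsto a
  have h3 := h2.add (h1.const_mul 2)
  rw [← H1.energy_eq hd a] at h3
  exact h3.congr fun b => (H1.energy_eq hd b).symm

/-- Joint continuity of the flow. -/
theorem continuous_flow : Continuous fun p : H1 d × ℝ => flow hd p.1 p.2 := by
  refine continuous_iff_continuousAt.2 fun ⟨a, t⟩ => ?_
  obtain ⟨B, hB0, hB⟩ := exists_flow_bound hd (‖a‖ + 1)
  obtain ⟨C, hC0, hC⟩ := exists_flow_sub_le hd (‖a‖ + 1) (|t| + 1)
  have e1 : ∀ᶠ p : H1 d × ℝ in 𝓝 (a, t), ‖p.1‖ ≤ ‖a‖ + 1 :=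
    (continuous_fst.norm.tendsto (a, t)).eventually (eventually_le_nhds (by simp))
  have e2 : ∀ᶠ p : H1 d × ℝ in 𝓝 (a, t), |p.2| ≤ |t| + 1 :=
    (continuous_snd.abs.tendsto (a, t)).eventually (eventually_le_nhds (by simp))
  have hfn : Tendsto (fun p : H1 d × ℝ => (flow hd p.1 p.2).fn) (𝓝 (a, t))
      (𝓝 (flow hd a t).fn) := by
    rw [tendsto_iff_norm_sub_tendsto_zero]
    have c : Continuous fun p : H1 d × ℝ =>
        √(C * ‖p.1 - a‖) + ‖(flow hd a p.2).fn - (flow hd a t).fn‖ :=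
      (Real.continuous_sqrt.comp ((continuous_fst.sub continuous_const).norm.const_mul C)).add
        ((((continuous_flow_fn hd a).comp continuous_snd).sub continuous_const).norm)
    have h1 := c.tendsto (a, t)
    simp only [sub_self, norm_zero, mul_zero, Real.sqrt_zero, add_zero] at h1
    refine squeeze_zero' (Eventually.of_forall fun _ => norm_nonneg _) ?_ h1
    filter_upwards [e1, e2] with p h1 h2
    have h3 := (hC p.1 a h1 (by linarith) p.2 h2).1
    have h4 := Real.le_sqrt_of_sq_le h3
    refine le_trans (le_of_eq ?_) ((norm_add_le _ _).trans (add_le_add h4 le_rfl))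
    rw [sub_add_sub_cancel]
  have hpot := tendsto_potential (fun _ : H1 d × ℝ => isNearPotential_cqPotential)
    tendsto_const_nhds (e1.mono fun p hp => (hB p.1 hp p.2).2.1)
    (hB a (by linarith) t).2.1 hfn
  -- L² continuity is upgraded to H¹: by conservation the gradient norm is a function of the initial
  -- energy and the current potential energy, both continuous.
  refine H1.tendsto_of_tendsto_fn_of_norm hfn ?_
  simp only [norm_sq_flow_grad]
  exact ((((H1.continuous_energy hd).comp continuous_fst).const_mul 2).tendsto (a, t)).sub
    (hpot.const_mul 4)

/-- Conservation of momentum. -/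
theorem momentum_flow (a : H1 d) (t : ℝ) (j : Fin d) :
    (inner ℂ (flow hd a t).fn ((flow hd a t).grad j)).im = (inner ℂ a.fn (a.grad j)).im := by
  have hc : Continuous fun w : H1 d => (inner ℂ w.fn (w.grad j)).im :=
    Complex.continuous_im.comp (H1.continuous_fn.inner
      ((PiLp.continuous_apply 2 (fun _ : Fin d => L2 d) j).comp H1.continuous_grad))
  have h := (hc.tendsto _).comp (tendsto_approxFlow hd a t)
  refine tendsto_nhds_unique h (tendsto_const_nhds.congr fun n => ?_)
  exact (momentum_approxFlow n a t j).symm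

end Flow

end

/-! ### Solutions in `C(ℝ; H¹)` -/

theorem isSolution_iff (u₀ : H1 d) (u : C(ℝ, H1 d)) :
    IsSolution u₀ u ↔ ∀ (t : ℝ) (φ : 𝓢(Pt d, ℂ)),
      pairS φ (u t).fn = pairS φ (freeGroup t u₀.fn) -
        Complex.I * ∫ s in (0 : ℝ)..t, sourcePair nonlinearity (u s).fn (t - s) φ := by
  refine forall₂_congr fun t φ => ?_
  rw [pairS_freeGroup]
  simp only [pairS_apply, freeEvolution_eq, sourcePair]

theorem IsSolution.apply_zero {u₀ : H1 d} {u : C(ℝ, H1 d)} (h : IsSolution u₀ u) : u 0 = u₀ := by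
  refine H1.ext_fn (L2.eq_of_pairS fun φ => ?_)
  have h1 := (isSolution_iff u₀ u).1 h 0 φ
  rwa [intervalIntegral.integral_same, mul_zero, sub_zero, freeGroup_zero] at h1

/-- Continuity in H¹ gives boundedness on compact time intervals, hence in L² ∩ L⁶. Uniqueness
therefore holds in the whole of C(ℝ; H¹). -/
theorem IsSolution.exists_weakTraj (hd : d = 2 ∨ d = 3) {u₀ : H1 d} {u : C(ℝ, H1 d)}
    (h : IsSolution u₀ u) (T : ℝ) :
    ∃ K, 0 ≤ K ∧ WeakTraj nonlinearity T K fun t => (u t).fn := by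
  obtain ⟨C, hC1, hC⟩ := exists_isBdd hd
  obtain ⟨M, hM⟩ := (isCompact_Icc (a := -T) (b := T)).exists_bound_of_continuousOn
    u.continuous.continuousOn
  refine ⟨C * |M|, by positivity, H1.continuous_fn.comp u.continuous, fun t ht => ?_,
    fun t _ φ => ?_⟩
  · exact (hC (u t)).mono (mul_le_mul_of_nonneg_left
      ((hM t (Set.mem_Icc.2 (abs_le.1 ht))).trans (le_abs_self M)) (by linarith))
  · simp only [h.apply_zero]
    exact (isSolution_iff u₀ u).1 h t φ

theorem IsSolution.eq_of_isSolution (hd : d = 2 ∨ d = 3) {u₀ : H1 d} {u v : C(ℝ, H1 d)}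
    (hu : IsSolution u₀ u) (hv : IsSolution u₀ v) : u = v := by
  ext1 t
  obtain ⟨K, hK0, hK⟩ := hu.exists_weakTraj hd |t|
  obtain ⟨K', hK0', hK'⟩ := hv.exists_weakTraj hd |t|
  refine H1.ext_fn ((hK.mono (le_max_left K K')).eq_of_eq hd (hK'.mono (le_max_right K K')) ?_
    le_rfl)
  simp only [hu.apply_zero, hv.apply_zero]

/-- The data-to-solution map. -/
def solutionMap (hd : d = 2 ∨ d = 3) : C(H1 d, C(ℝ, H1 d)) :=
  ContinuousMap.curry ⟨fun p : H1 d × ℝ => flow hd p.1 p.2, continuous_flow hd⟩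

theorem isSolution_solutionMap (hd : d = 2 ∨ d = 3) (a : H1 d) :
    IsSolution a (solutionMap hd a) := by
  obtain ⟨B, hB0, hB⟩ := exists_flow_bound hd ‖a‖
  refine (isSolution_iff _ _).2 fun t φ => ?_
  have h := (weakTraj_flow hd (a := a) (fun n t => ((hB a le_rfl t).1 n).1) |t|).duhamel t le_rfl φ
  rwa [flow_zero] at h

theorem mass_eq (u : H1 d) : mass u = ‖u.fn‖ ^ 2 := (L2.norm_sq_eq u.fn).symm

theorem momentum_eq (u : H1 d) (j : Fin d) : momentum u j = (inner ℂ u.fn (u.grad j)).im := by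
  rw [L2.inner_eq]
  exact integral_im (L2.integrable_conj_mul u.fn (u.grad j))

theorem mass_flow (hd : d = 2 ∨ d = 3) (a : H1 d) (t : ℝ) : mass (flow hd a t) = mass a := by
  rw [mass_eq, mass_eq, norm_flow_fn]

theorem momentum_flow_eq (hd : d = 2 ∨ d = 3) (a : H1 d) (t : ℝ) :
    momentum (flow hd a t) = momentum a := by
  ext j
  rw [momentum_eq, momentum_eq, momentum_flow]

section

/-! ### Composition with linear isometries -/

/-- Composition with a linear isometry, on `L²`. -/
def isometryOp (ρ : Pt d ≃ₗᵢ[ℝ] Pt d) : L2 d →ₗᵢ[ℂ] L2 d :=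
  Lp.compMeasurePreservingₗᵢ ℂ ρ ρ.measurePreserving

theorem coeFn_isometryOp (ρ : Pt d ≃ₗᵢ[ℝ] Pt d) (f : L2 d) :
    ∀ᵐ x, isometryOp ρ f x = f (ρ x) :=
  Lp.coeFn_compMeasurePreserving f ρ.measurePreserving

theorem coeFn_isometryOp_toLp (ρ : Pt d ≃ₗᵢ[ℝ] Pt d) (φ : 𝓢(Pt d, ℂ)) :
    ∀ᵐ x, isometryOp ρ (φ.toLp 2 volume) x = φ (ρ x) := by
  have h : ∀ᵐ x, (φ.toLp 2 volume : L2 d) x = φ x := φ.coeFn_toLp 2 volume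
  filter_upwards [coeFn_isometryOp ρ (φ.toLp 2 volume),
    ρ.measurePreserving.quasiMeasurePreserving.ae h] with x h1 h2
  rw [h1, h2]

theorem fourier_isometryOp (ρ : Pt d ≃ₗᵢ[ℝ] Pt d) (f : L2 d) :
    𝓕 (isometryOp ρ f) = isometryOp ρ (𝓕 f) := by
  have hF : Continuous fun f : L2 d => 𝓕 f := (Lp.fourierTransformₗᵢ (Pt d) ℂ).continuous
  refine L2.induction_schwartz (p := fun f => 𝓕 (isometryOp ρ f) = isometryOp ρ (𝓕 f))
    (isClosed_eq (hF.comp (isometryOp ρ).continuous) ((isometryOp ρ).continuous.comp hF))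
    (fun φ => ?_) f
  set ψ : 𝓢(Pt d, ℂ) :=
    SchwartzMap.compCLMOfContinuousLinearEquiv ℂ ρ.toContinuousLinearEquiv φ with hψ
  have h1 : isometryOp ρ (φ.toLp 2 volume) = ψ.toLp 2 volume := by
    apply Lp.ext
    filter_upwards [coeFn_isometryOp_toLp ρ φ, ψ.coeFn_toLp 2 volume] with x h1 h2
    rw [h1, h2]
    rfl
  rw [h1, SchwartzMap.toLp_fourier_eq, SchwartzMap.toLp_fourier_eq]
  apply Lp.ext
  filter_upwards [(𝓕 ψ).coeFn_toLp 2 volume, coeFn_isometryOp_toLp ρ (𝓕 φ)] with x h2 h3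
  rw [h2, h3, SchwartzMap.fourier_coe, SchwartzMap.fourier_coe,
    ← Real.fourier_comp_linearIsometry ρ]
  rfl

theorem isometryOp_freeGroup (ρ : Pt d ≃ₗᵢ[ℝ] Pt d) (t : ℝ) (f : L2 d) :
    isometryOp ρ (freeGroup t f) = freeGroup t (isometryOp ρ f) := by
  apply fourier_inj
  rw [fourier_isometryOp, freeGroup, fourier_fourierPhase, fourier_fourierPhase,
    fourier_isometryOp]
  apply Lp.ext
  have h := coeFn_phaseOp (t • freeSymbol d) (𝓕 f)
  filter_upwards [coeFn_isometryOp ρ (phaseOp (t • freeSymbol d) (𝓕 f)), coeFn_isometryOp ρ (𝓕 f),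
    coeFn_phaseOp (t • freeSymbol d) (isometryOp ρ (𝓕 f)),
    ρ.measurePreserving.quasiMeasurePreserving.ae h] with x h1 h2 h3 h4
  rw [h1, h3, h4, h2]
  simp

/-! ### Rotations in a coordinate plane -/

/-- The rotation by the angle `θ` in the plane of the coordinates `i` and `j`. -/
def rotationFun (i j : Fin d) (θ : ℝ) (x : Pt d) : Pt d :=
  x + ((Real.cos θ - 1) * x i - Real.sin θ * x j) • EuclideanSpace.single i (1 : ℝ)
    + (Real.sin θ * x i + (Real.cos θ - 1) * x j) • EuclideanSpace.single j (1 : ℝ)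

section Rotation

variable {i j : Fin d}

theorem rotationFun_left (hij : i ≠ j) (θ : ℝ) (x : Pt d) :
    rotationFun i j θ x i = Real.cos θ * x i - Real.sin θ * x j := by
  simp [rotationFun, hij]
  ring

theorem rotationFun_right (hij : i ≠ j) (θ : ℝ) (x : Pt d) :
    rotationFun i j θ x j = Real.sin θ * x i + Real.cos θ * x j := by
  simp [rotationFun, hij.symm]
  ring

theorem norm_rotationFun (hij : i ≠ j) (θ : ℝ) (x : Pt d) : ‖rotationFun i j θ x‖ = ‖x‖ := by
  rw [← sq_eq_sq₀ (norm_nonneg _) (norm_nonneg _), rotationFun, norm_add_sq_real,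
    norm_add_sq_real]
  simp only [inner_add_left, inner_smul_left, inner_smul_right, EuclideanSpace.inner_single_right,
    norm_smul, mul_pow]
  simp [hij.symm]
  linear_combination (x i ^ 2 + x j ^ 2) * Real.sin_sq_add_cos_sq θ

/-- The rotation as a linear isometry. -/
def rotation (hij : i ≠ j) (θ : ℝ) : Pt d ≃ₗᵢ[ℝ] Pt d :=
  LinearIsometry.toLinearIsometryEquiv
    { toFun := rotationFun i j θ
      map_add' := fun x y => by
        simp only [rotationFun, PiLp.add_apply]
        module
      map_smul' := fun c x => by
        simp only [rotationFun, PiLp.smul_apply, smul_eq_mul, RingHom.id_apply]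
        module
      norm_map' := norm_rotationFun hij θ } rfl

theorem rotation_apply (hij : i ≠ j) (θ : ℝ) (x : Pt d) :
    rotation hij θ x = rotationFun i j θ x := rfl

theorem rotationFun_neg (hij : i ≠ j) (θ : ℝ) (x : Pt d) :
    rotationFun i j (-θ) (rotationFun i j θ x) = x := by
  rw [rotationFun, rotationFun_left hij, rotationFun_right hij, rotationFun, Real.cos_neg,
    Real.sin_neg]
  have h := Real.sin_sq_add_cos_sq θ
  match_scalars
  · rfl
  · linear_combination (x i) * h
  · linear_combination (x j) * h

theorem hasDerivAt_rotationFun (hij : i ≠ j) (θ : ℝ) (x : Pt d) :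
    HasDerivAt (fun s => rotationFun i j s x)
      ((-rotationFun i j θ x j) • EuclideanSpace.single i (1 : ℝ)
        + rotationFun i j θ x i • EuclideanSpace.single j (1 : ℝ)) θ := by
  have hc := (Real.hasDerivAt_cos θ).sub_const 1
  have hs := Real.hasDerivAt_sin θ
  have h1 := ((hc.mul_const (x i)).sub (hs.mul_const (x j))).smul_const
    (EuclideanSpace.single i (1 : ℝ))
  have h2 := ((hs.mul_const (x i)).add (hc.mul_const (x j))).smul_const
    (EuclideanSpace.single j (1 : ℝ))
  refine ((h1.const_add x).add h2).congr_deriv ?_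
  rw [rotationFun_left hij, rotationFun_right hij]
  module

/-- Rotation on `L²`. -/
def rotationOp (hij : i ≠ j) (θ : ℝ) : L2 d →ₗᵢ[ℂ] L2 d := isometryOp (rotation hij θ)

theorem rotationOp_zero (hij : i ≠ j) (f : L2 d) : rotationOp hij 0 f = f := by
  apply Lp.ext
  filter_upwards [coeFn_isometryOp (rotation hij 0) f] with x hx
  rw [rotationOp, hx, rotation_apply, rotationFun]
  simp

theorem rotationOp_neg_apply (hij : i ≠ j) (θ : ℝ) (f : L2 d) :
    rotationOp hij θ (rotationOp hij (-θ) f) = f := by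
  apply Lp.ext
  have h := coeFn_isometryOp (rotation hij (-θ)) f
  filter_upwards [coeFn_isometryOp (rotation hij θ) (rotationOp hij (-θ) f),
    (rotation hij θ).measurePreserving.quasiMeasurePreserving.ae h] with x h1 h2
  rw [rotationOp, h1, rotationOp, h2, rotation_apply, rotation_apply, rotationFun_neg hij]

theorem inner_rotationOp_neg (hij : i ≠ j) (θ : ℝ) (f : L2 d) :
    inner ℂ f (rotationOp hij (-θ) f) = starRingEnd ℂ (inner ℂ f (rotationOp hij θ f)) := by
  rw [inner_conj_symm, ← LinearIsometry.inner_map_map (rotationOp hij θ) f,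
    rotationOp_neg_apply]

end Rotation

/-! ### First moments -/

/-- `y` is the function `xⱼ f`. -/
def IsMoment (j : Fin d) (f y : L2 d) : Prop := ∀ᵐ x, y x = (x j : ℂ) * f x

theorem IsMoment.unique {j : Fin d} {f y y' : L2 d} (h : IsMoment j f y) (h' : IsMoment j f y') :
    y = y' := by
  apply Lp.ext
  filter_upwards [h, h'] with x h1 h2
  rw [h1, h2]

theorem IsMoment.inner_left {j : Fin d} {f y f' y' : L2 d} (h : IsMoment j f y)
    (h' : IsMoment j f' y') : inner ℂ f y' = inner ℂ y f' := by
  rw [L2.inner_eq, L2.inner_eq]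
  refine integral_congr_ae ?_
  filter_upwards [h, h'] with x h1 h2
  rw [h1, h2, map_mul, Complex.conj_ofReal]
  ring

theorem modulation_smul_single (h : ℝ) (j : Fin d) (f : L2 d) :
    modulation (h • EuclideanSpace.single j 1) f = phaseOp (h • coordSymbol j) f := by
  rw [modulation, linSymbol_smul]
  rfl

theorem IsMoment.norm_modulation_sub_le {j : Fin d} {f y : L2 d} (h : IsMoment j f y) (η : ℝ) :
    ‖modulation (η • EuclideanSpace.single j 1) f - f‖ ≤ 2 * Real.pi * |η| * ‖y‖ := by
  rw [modulation_smul_single]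
  have h1 := norm_phaseOp_smul_sub_le (coordSymbol j) (f := f)
    (g := (Complex.I * (2 * Real.pi : ℝ)) • y) ?_ η
  · refine h1.trans (le_of_eq ?_)
    rw [norm_smul, norm_mul, Complex.norm_I, Complex.norm_real, Real.norm_of_nonneg
      (by positivity)]
    ring
  · filter_upwards [h, Lp.coeFn_smul (Complex.I * (2 * Real.pi : ℝ)) y] with x h2 h3
    rw [h3, Pi.smul_apply, h2, coordSymbol_apply]
    push_cast
    simp only [smul_eq_mul]
    ring

/-- Multiplication by xⱼ generates the modulations up to the factor 2πi, so a Lipschitz bound near η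
= 0 is a bound for xⱼf in L². -/
theorem exists_moment_of_bound {j : Fin d} {f : L2 d} {K : ℝ} (hK : 0 ≤ K)
    (h : ∀ η : ℝ, |η| ≤ 1 →
      ‖modulation (η • EuclideanSpace.single j 1) f - f‖ ≤ 2 * Real.pi * K * |η|) :
    ∃ y, IsMoment j f y ∧ ‖y‖ ≤ K := by
  have hpos : ∀ n : ℕ, (0 : ℝ) < 1 / ((n : ℝ) + 1) := fun n => by positivity
  obtain ⟨g, hg, hgK⟩ := exists_phase_generator_of_bound (coordSymbol j) f
    (K := 2 * Real.pi * K) (by positivity) tendsto_one_div_add_atTop_nhds_zero_nat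
    (fun n => (hpos n).ne') fun n => by
      rw [← modulation_smul_single]
      refine h _ ?_
      rw [abs_of_pos (hpos n), div_le_one (by positivity)]
      simp
  set c : ℂ := (Complex.I * (2 * Real.pi : ℝ))⁻¹ with hc
  have hc0 : Complex.I * ((2 * Real.pi : ℝ) : ℂ) ≠ 0 :=
    mul_ne_zero Complex.I_ne_zero (Complex.ofReal_ne_zero.2 (by positivity))
  refine ⟨c • g, ?_, ?_⟩
  · filter_upwards [hg, Lp.coeFn_smul c g] with x h1 h2
    rw [h2, Pi.smul_apply, h1, coordSymbol_apply, hc, smul_eq_mul, inv_mul_eq_iff_eq_mul₀ hc0]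
    push_cast
    ring
  · rw [norm_smul, hc, norm_inv, norm_mul, Complex.norm_I, one_mul, Complex.norm_real,
      Real.norm_of_nonneg (by positivity), inv_mul_le_iff₀ (by positivity)]
    exact hgK

/-- Multiplication of a Schwartz function by a coordinate. -/
def coordS (j : Fin d) (φ : 𝓢(Pt d, ℂ)) : 𝓢(Pt d, ℂ) :=
  SchwartzMap.smulLeftCLM ℂ (fun x : Pt d => (x j : ℂ)) φ

theorem hasTemperateGrowth_coord (j : Fin d) :
    Function.HasTemperateGrowth fun x : Pt d => (x j : ℂ) :=
  (Complex.ofRealCLM.comp (EuclideanSpace.proj (𝕜 := ℝ) j)).hasTemperateGrowth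

theorem coordS_apply (j : Fin d) (φ : 𝓢(Pt d, ℂ)) (x : Pt d) : coordS j φ x = (x j : ℂ) * φ x :=
  SchwartzMap.smulLeftCLM_apply_apply (hasTemperateGrowth_coord j) φ x

theorem isMoment_toLp (j : Fin d) (φ : 𝓢(Pt d, ℂ)) :
    IsMoment j (φ.toLp 2 volume) ((coordS j φ).toLp 2 volume) := by
  filter_upwards [φ.coeFn_toLp 2 volume, (coordS j φ).coeFn_toLp 2 volume] with x h1 h2
  rw [h1, h2, coordS_apply]

/-- Bounded first moments of functions that converge in `L²` converge weakly. -/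
theorem IsMoment.tendsto_inner {ι : Type*} {l : Filter ι} {j : Fin d} {f y : ι → L2 d}
    {f₀ y₀ : L2 d} (hf : Tendsto f l (𝓝 f₀)) (hy : ∀ k, IsMoment j (f k) (y k))
    (hy₀ : IsMoment j f₀ y₀) {B : ℝ} (hb : ∀ᶠ k in l, ‖y k‖ ≤ B) (v : L2 d) :
    Tendsto (fun k => inner ℂ v (y k)) l (𝓝 (inner ℂ v y₀)) := by
  refine tendsto_inner_of_dense (SchwartzMap.denseRange_toLpCLM (F := ℂ)
    (μ := (volume : Measure (Pt d))) (p := 2) ENNReal.ofNat_ne_top) hb ?_ v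
  rintro _ ⟨φ, rfl⟩
  have h : ∀ f y : L2 d, IsMoment j f y → inner ℂ (φ.toLp 2 volume : L2 d) y
      = inner ℂ ((coordS j φ).toLp 2 volume : L2 d) f := fun f y h =>
    (isMoment_toLp j φ).inner_left h
  change Tendsto (fun k => inner ℂ (φ.toLp 2 volume : L2 d) (y k)) l
    (𝓝 (inner ℂ (φ.toLp 2 volume : L2 d) y₀))
  rw [h _ _ hy₀]
  simp only [fun k => h _ _ (hy k)]
  exact tendsto_const_nhds.inner hf

end

section

variable {i j : Fin d}
/-! ### The generator of rotations -/

/-- `xᵢ ∂ⱼφ - xⱼ ∂ᵢφ`. -/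
def rotGenS (i j : Fin d) (φ : 𝓢(Pt d, ℂ)) : 𝓢(Pt d, ℂ) :=
  coordS i (∂_{EuclideanSpace.single j (1 : ℝ)} φ) - coordS j (∂_{EuclideanSpace.single i (1 : ℝ)} φ)

theorem rotGenS_apply (φ : 𝓢(Pt d, ℂ)) (x : Pt d) :
    rotGenS i j φ x = (x i : ℂ) * (∂_{EuclideanSpace.single j (1 : ℝ)} φ : 𝓢(Pt d, ℂ)) x
      - (x j : ℂ) * (∂_{EuclideanSpace.single i (1 : ℝ)} φ : 𝓢(Pt d, ℂ)) x := by
  rw [rotGenS, sub_apply, coordS_apply, coordS_apply]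

theorem hasDerivAt_schwartz_rotationFun (hij : i ≠ j) (φ : 𝓢(Pt d, ℂ)) (x : Pt d) (θ : ℝ) :
    HasDerivAt (fun s => φ (rotationFun i j s x)) (rotGenS i j φ (rotationFun i j θ x)) θ := by
  have h := (φ.differentiableAt (x := rotationFun i j θ x)).hasFDerivAt.comp_hasDerivAt θ
    (hasDerivAt_rotationFun hij θ x)
  refine h.congr_deriv ?_
  rw [map_add, map_smul, map_smul, rotGenS_apply, SchwartzMap.lineDerivOp_apply_eq_fderiv,
    SchwartzMap.lineDerivOp_apply_eq_fderiv]
  simp only [Complex.real_smul]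
  push_cast
  ring

/-- A majorant depending on |x| alone dominates all rotations at once, which differentiation under
the integral requires. The power d + 1 is square integrable. -/
theorem exists_radial_majorant (φ : 𝓢(Pt d, ℂ)) :
    ∃ b : Pt d → ℝ, MemLp b 2 ∧ ∀ x y, ‖x‖ = ‖y‖ → ‖φ y‖ ≤ b x := by
  obtain ⟨A, hle⟩ : ∃ A, ∀ x, (1 + ‖x‖) ^ (d + 1) * ‖φ x‖ ≤ A := ⟨_, fun x => by
    have h := SchwartzMap.one_add_le_sup_seminorm_apply (𝕜 := ℝ) (m := (d + 1, 0)) (k := d + 1)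
      (n := 0) le_rfl le_rfl φ x
    rwa [norm_iteratedFDeriv_zero] at h⟩
  set b : Pt d → ℝ := fun x => A * ((1 + ‖x‖) ^ (d + 1))⁻¹ with hb
  have hc : Continuous fun x : Pt d => (1 + ‖x‖) ^ (d + 1) := by fun_prop
  have hbc : Continuous b := continuous_const.mul (hc.inv₀ fun x => by positivity)
  refine ⟨b, (memLp_two_iff_integrable_sq hbc.aestronglyMeasurable).2 ?_, fun x y hxy => ?_⟩
  · have h1 : Integrable fun x : Pt d => A ^ 2 * (1 + ‖x‖) ^ (-((2 * (d + 1) : ℕ) : ℝ)) := by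
      refine (integrable_one_add_norm ?_).const_mul _
      rw [finrank_euclideanSpace_fin]
      push_cast
      linarith [(Nat.cast_nonneg d : (0 : ℝ) ≤ d)]
    refine h1.congr (ae_of_all _ fun x => ?_)
    simp only [hb]
    rw [Real.rpow_neg (by positivity), Real.rpow_natCast, mul_pow, inv_pow, ← pow_mul, mul_comm 2]
  · simp only [hb]
    rw [hxy, ← div_eq_mul_inv, le_div_iff₀ (by positivity), mul_comm]
    exact hle y

theorem inner_rotationOp_toLp (hij : i ≠ j) (χ : L2 d) (φ : 𝓢(Pt d, ℂ)) (θ : ℝ) :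
    inner ℂ χ (rotationOp hij θ (φ.toLp 2 volume))
      = ∫ x, starRingEnd ℂ (χ x) * φ (rotationFun i j θ x) := by
  rw [L2.inner_eq]
  refine integral_congr_ae ?_
  filter_upwards [coeFn_isometryOp_toLp (rotation hij θ) φ] with x hx
  rw [rotationOp, hx, rotation_apply]

theorem aestronglyMeasurable_conj_mul_rotation (hij : i ≠ j) (χ : L2 d) (φ : 𝓢(Pt d, ℂ)) (θ : ℝ) :
    AEStronglyMeasurable fun x => starRingEnd ℂ (χ x) * φ (rotationFun i j θ x) :=
  (Complex.continuous_conj.comp_aestronglyMeasurable (Lp.aestronglyMeasurable χ)).mul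
    (φ.continuous.comp (rotation hij θ).continuous).aestronglyMeasurable

theorem integrable_conj_mul_rotation (hij : i ≠ j) (χ : L2 d) (φ : 𝓢(Pt d, ℂ)) (θ : ℝ) :
    Integrable fun x => starRingEnd ℂ (χ x) * φ (rotationFun i j θ x) := by
  refine (L2.integrable_conj_mul χ (rotationOp hij θ (φ.toLp 2 volume))).congr ?_
  filter_upwards [coeFn_isometryOp_toLp (rotation hij θ) φ] with x hx
  rw [rotationOp, hx, rotation_apply]

/-- The derivative at every angle, not only at 0, is needed: the Lipschitz bound in the angle comes
from the mean value inequality. -/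
theorem hasDerivAt_inner_rotationOp (hij : i ≠ j) (χ : L2 d) (φ : 𝓢(Pt d, ℂ)) (θ : ℝ) :
    HasDerivAt (fun s => inner ℂ χ (rotationOp hij s (φ.toLp 2 volume)))
      (inner ℂ χ (rotationOp hij θ ((rotGenS i j φ).toLp 2 volume))) θ := by
  simp only [inner_rotationOp_toLp]
  obtain ⟨b, hb, hle⟩ := exists_radial_majorant (rotGenS i j φ)
  refine (hasDerivAt_integral_of_dominated_loc_of_deriv_le (s := Set.univ)
    (F := fun s x => starRingEnd ℂ (χ x) * φ (rotationFun i j s x))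
    (F' := fun s x => starRingEnd ℂ (χ x) * rotGenS i j φ (rotationFun i j s x))
    (bound := fun x => ‖χ x‖ * b x) Filter.univ_mem
    (Eventually.of_forall fun s => aestronglyMeasurable_conj_mul_rotation hij χ φ s)
    (integrable_conj_mul_rotation hij χ φ θ)
    (aestronglyMeasurable_conj_mul_rotation hij χ _ θ)
    (ae_of_all _ fun x s _ => ?_) ((Lp.memLp χ).norm.integrable_mul hb)
    (ae_of_all _ fun x s _ => (hasDerivAt_schwartz_rotationFun hij φ x s).const_mul _)).2
  rw [norm_mul, RCLike.norm_conj]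
  exact mul_le_mul_of_nonneg_left (hle _ _ (norm_rotationFun hij s x).symm) (norm_nonneg _)

section Moments

variable {χ Yi Yj : L2 d}

/-- The coordinates in the generator are moved onto χ, which has first moments, and only gradients
remain on φ. The bound then involves the H¹ norm of φ and extends by density. -/
theorem inner_rotationOp_rotGenS (hij : i ≠ j) (hi : IsMoment i χ Yi) (hj : IsMoment j χ Yj)
    (φ : 𝓢(Pt d, ℂ)) (θ : ℝ) :
    inner ℂ χ (rotationOp hij θ ((rotGenS i j φ).toLp 2 volume))
      = inner ℂ ((Real.cos θ : ℂ) • Yi - (Real.sin θ : ℂ) • Yj)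
          (rotationOp hij θ ((H1.ofSchwartz φ).grad j))
        - inner ℂ ((Real.sin θ : ℂ) • Yi + (Real.cos θ : ℂ) • Yj)
          (rotationOp hij θ ((H1.ofSchwartz φ).grad i)) := by
  rw [H1.ofSchwartz_grad, H1.ofSchwartz_grad, inner_rotationOp_toLp, inner_rotationOp_toLp,
    inner_rotationOp_toLp, ← integral_sub (integrable_conj_mul_rotation hij _ _ θ)
      (integrable_conj_mul_rotation hij _ _ θ)]
  refine integral_congr_ae ?_
  filter_upwards [hi, hj, Lp.coeFn_sub ((Real.cos θ : ℂ) • Yi) ((Real.sin θ : ℂ) • Yj),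
    Lp.coeFn_add ((Real.sin θ : ℂ) • Yi) ((Real.cos θ : ℂ) • Yj),
    Lp.coeFn_smul (Real.cos θ : ℂ) Yi, Lp.coeFn_smul (Real.sin θ : ℂ) Yj,
    Lp.coeFn_smul (Real.sin θ : ℂ) Yi, Lp.coeFn_smul (Real.cos θ : ℂ) Yj]
    with x h1 h2 h3 h4 h5 h6 h7 h8
  rw [h3, h4, Pi.sub_apply, Pi.add_apply, h5, h6, h7, h8]
  simp only [Pi.smul_apply, smul_eq_mul]
  rw [h1, h2, rotGenS_apply, rotationFun_left hij, rotationFun_right hij]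
  simp only [map_sub, map_add, map_mul, Complex.conj_ofReal]
  push_cast
  ring

theorem norm_inner_rotationOp_rotGenS_le (hij : i ≠ j) (hi : IsMoment i χ Yi)
    (hj : IsMoment j χ Yj) (φ : 𝓢(Pt d, ℂ)) (θ : ℝ) :
    ‖inner ℂ χ (rotationOp hij θ ((rotGenS i j φ).toLp 2 volume))‖
      ≤ 2 * (‖Yi‖ + ‖Yj‖) * ‖H1.ofSchwartz φ‖ := by
  rw [inner_rotationOp_rotGenS hij hi hj]
  have hc : ‖(Real.cos θ : ℂ)‖ ≤ 1 := by
    rw [Complex.norm_real]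
    exact Real.abs_cos_le_one θ
  have hs : ‖(Real.sin θ : ℂ)‖ ≤ 1 := by
    rw [Complex.norm_real]
    exact Real.abs_sin_le_one θ
  have hsm : ∀ (c : ℂ) (y : L2 d), ‖c‖ ≤ 1 → ‖c • y‖ ≤ ‖y‖ := fun c y h => by
    rw [norm_smul]
    exact mul_le_of_le_one_left (norm_nonneg _) h
  have h1 : ‖(Real.cos θ : ℂ) • Yi - (Real.sin θ : ℂ) • Yj‖ ≤ ‖Yi‖ + ‖Yj‖ :=
    (norm_sub_le _ _).trans (add_le_add (hsm _ _ hc) (hsm _ _ hs))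
  have h2 : ‖(Real.sin θ : ℂ) • Yi + (Real.cos θ : ℂ) • Yj‖ ≤ ‖Yi‖ + ‖Yj‖ :=
    (norm_add_le _ _).trans (add_le_add (hsm _ _ hs) (hsm _ _ hc))
  have h3 : ∀ (y : L2 d) (k : Fin d), ‖y‖ ≤ ‖Yi‖ + ‖Yj‖ →
      ‖inner ℂ y (rotationOp hij θ ((H1.ofSchwartz φ).grad k))‖
        ≤ (‖Yi‖ + ‖Yj‖) * ‖H1.ofSchwartz φ‖ := fun y k hy => by
    refine (norm_inner_le_norm _ _).trans ?_
    rw [LinearIsometry.norm_map]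
    exact mul_le_mul hy (H1.norm_grad_apply_le _ k) (norm_nonneg _) (by positivity)
  refine (norm_sub_le _ _).trans ((add_le_add (h3 _ j h1) (h3 _ i h2)).trans (le_of_eq ?_))
  ring

theorem H1.norm_inner_rotationOp_sub_le (hij : i ≠ j) (hi : IsMoment i χ Yi) (hj : IsMoment j χ Yj)
    (w : H1 d) (θ : ℝ) :
    ‖inner ℂ χ (rotationOp hij θ w.fn - w.fn)‖ ≤ 2 * (‖Yi‖ + ‖Yj‖) * ‖w‖ * |θ| := by
  refine isClosed_property (p := fun w : H1 d =>
    ‖inner ℂ χ (rotationOp hij θ w.fn - w.fn)‖ ≤ 2 * (‖Yi‖ + ‖Yj‖) * ‖w‖ * |θ|)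
    H1.dense_range_ofSchwartz ?_ (fun φ => ?_) w
  · exact isClosed_le (continuous_const.inner
      (((rotationOp hij θ).continuous.comp H1.continuous_fn).sub H1.continuous_fn)).norm
      ((continuous_norm.const_mul _).mul_const _)
  · have h := Convex.norm_image_sub_le_of_norm_hasDerivWithin_le
      (fun s _ => (hasDerivAt_inner_rotationOp hij χ φ s).hasDerivWithinAt)
      (fun s _ => norm_inner_rotationOp_rotGenS_le hij hi hj φ s) (convex_univ)
      (Set.mem_univ 0) (Set.mem_univ θ)
    rw [rotationOp_zero, ← inner_sub_right, sub_zero, Real.norm_eq_abs] at h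
    exact h

/-- A weak derivative of rotations: moments are required of χ and a gradient of w, so the limit is a
quadratic form and need not come from a vector in L². -/
theorem H1.tendsto_inner_rotationOp (hij : i ≠ j) (hi : IsMoment i χ Yi) (hj : IsMoment j χ Yj)
    (w : H1 d) :
    Tendsto (fun θ : ℝ => (θ : ℂ)⁻¹ * inner ℂ χ (rotationOp hij θ w.fn - w.fn)) (𝓝[≠] 0)
      (𝓝 (inner ℂ Yi (w.grad j) - inner ℂ Yj (w.grad i))) := by
  rw [Metric.tendsto_nhds]
  intro ε hε
  set Q : ℝ := ‖Yi‖ + ‖Yj‖ with hQ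
  have hQ0 : 0 ≤ Q := by positivity
  -- For the remainder v the quotient costs 2Q‖v‖ and the limiting form Q‖v‖, which is the 3 in the
  -- denominator.
  obtain ⟨φ, hφ⟩ := w.exists_schwartz_norm_sub_lt
    (by positivity : 0 < ε / 2 / (3 * (Q + 1)))
  set v : H1 d := w - H1.ofSchwartz φ with hv
  have h1 := hasDerivAt_iff_tendsto_slope_zero.1 (hasDerivAt_inner_rotationOp hij χ φ 0)
  rw [inner_rotationOp_rotGenS hij hi hj] at h1
  simp only [zero_add, rotationOp_zero, Real.cos_zero, Real.sin_zero, Complex.ofReal_one,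
    Complex.ofReal_zero, one_smul, zero_smul, sub_zero] at h1
  filter_upwards [(Metric.tendsto_nhds.1 h1) (ε / 2) (by positivity), self_mem_nhdsWithin]
    with θ hθ hne
  have hθ0 : θ ≠ 0 := hne
  rw [dist_eq_norm] at hθ ⊢
  have hfn : w.fn = v.fn + (H1.ofSchwartz φ).fn := by rw [hv, H1.fn_sub, sub_add_cancel]
  have hgr : ∀ k, w.grad k = v.grad k + (H1.ofSchwartz φ).grad k := fun k => by
    rw [hv, H1.grad_sub, PiLp.sub_apply, sub_add_cancel]
  have e : (θ : ℂ)⁻¹ * inner ℂ χ (rotationOp hij θ w.fn - w.fn)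
        - (inner ℂ Yi (w.grad j) - inner ℂ Yj (w.grad i))
      = ((θ : ℂ)⁻¹ * inner ℂ χ (rotationOp hij θ v.fn - v.fn)
        - (inner ℂ Yi (v.grad j) - inner ℂ Yj (v.grad i)))
      + (θ⁻¹ • (inner ℂ χ (rotationOp hij θ (φ.toLp 2 volume)) - inner ℂ χ (φ.toLp 2 volume : L2 d))
        - (inner ℂ Yi ((H1.ofSchwartz φ).grad j) - inner ℂ Yj ((H1.ofSchwartz φ).grad i))) := by
    rw [hfn, hgr, hgr, map_add, H1.ofSchwartz_fn, Complex.real_smul]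
    simp only [inner_sub_right, inner_add_right]
    push_cast
    ring
  rw [e]
  have hv1 : ‖(θ : ℂ)⁻¹ * inner ℂ χ (rotationOp hij θ v.fn - v.fn)‖ ≤ 2 * Q * ‖v‖ := by
    rw [norm_mul, norm_inv, Complex.norm_real, Real.norm_eq_abs,
      inv_mul_le_iff₀ (abs_pos.2 hθ0), mul_comm |θ|]
    exact v.norm_inner_rotationOp_sub_le hij hi hj θ
  have hv2 : ‖inner ℂ Yi (v.grad j) - inner ℂ Yj (v.grad i)‖ ≤ Q * ‖v‖ := by
    refine (norm_sub_le _ _).trans ((add_le_add (norm_inner_le_norm _ _)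
      (norm_inner_le_norm _ _)).trans ?_)
    rw [hQ, add_mul]
    exact add_le_add (mul_le_mul_of_nonneg_left (v.norm_grad_apply_le j) (norm_nonneg _))
      (mul_le_mul_of_nonneg_left (v.norm_grad_apply_le i) (norm_nonneg _))
  have hv3 : 3 * Q * ‖v‖ ≤ ε / 2 := by
    have h2 : 3 * Q * ‖v‖ ≤ 3 * (Q + 1) * (ε / 2 / (3 * (Q + 1))) := by
      have := hφ.le
      gcongr
      linarith
    rwa [mul_div_cancel₀ _ (by positivity)] at h2
  refine (norm_add_le _ _).trans_lt ?_
  have := norm_sub_le ((θ : ℂ)⁻¹ * inner ℂ χ (rotationOp hij θ v.fn - v.fn))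
    (inner ℂ Yi (v.grad j) - inner ℂ Yj (v.grad i))
  linarith

/-- The quadratic form of the generator of rotations has no real part. -/
theorem H1.re_rotation_form (hij : i ≠ j) (w : H1 d) (hi : IsMoment i w.fn Yi)
    (hj : IsMoment j w.fn Yj) : (inner ℂ Yi (w.grad j) - inner ℂ Yj (w.grad i)).re = 0 := by
  set ω := inner ℂ Yi (w.grad j) - inner ℂ Yj (w.grad i) with hω
  have h1 := w.tendsto_inner_rotationOp hij hi hj
  rw [← hω] at h1
  have hneg : Tendsto (fun θ : ℝ => -θ) (𝓝[≠] 0) (𝓝[≠] 0) := by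
    refine tendsto_nhdsWithin_iff.2 ⟨?_, ?_⟩
    · have : Tendsto (fun z : ℝ => -z) (𝓝 0) (𝓝 (-0)) := continuous_neg.tendsto 0
      rw [neg_zero] at this
      exact this.mono_left nhdsWithin_le_nhds
    · filter_upwards [self_mem_nhdsWithin] with z hz
      exact neg_ne_zero.2 hz
  have h2 := h1.comp hneg
  have h3 := ((Complex.continuous_conj.tendsto _).comp h1).neg
  -- The rotation by -θ is the adjoint of the rotation by θ, so replacing θ by -θ shows that the
  -- form equals minus its conjugate.
  have h4 := tendsto_nhds_unique h2 (h3.congr fun θ => by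
    simp only [Function.comp_apply, map_mul, map_inv₀, Complex.conj_ofReal, inner_sub_right,
      map_sub, inner_rotationOp_neg]
    rw [inner_conj_symm w.fn w.fn]
    push_cast
    rw [inv_neg]
    ring)
  have h5 := congrArg Complex.re h4
  rw [Complex.neg_re, Complex.conj_re] at h5
  linarith

/-- For an isometry the squared increment is a real part of the same quadratic form. As that form
has no real part in the limit, the increment is o(θ) without strong differentiability. -/
theorem norm_rotationOp_sub_sq (hij : i ≠ j) (θ : ℝ) (f : L2 d) :
    ‖rotationOp hij θ f - f‖ ^ 2 = -2 * (inner ℂ f (rotationOp hij θ f - f)).re := by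
  have h1 : (inner ℂ f f).re = ‖f‖ ^ 2 := inner_self_eq_norm_sq (𝕜 := ℂ) f
  rw [norm_sub_sq (𝕜 := ℂ), LinearIsometry.norm_map, inner_sub_right, Complex.sub_re, h1,
    ← inner_conj_symm, RCLike.conj_re, RCLike.re_eq_complex_re]
  ring

end Moments

/-- Conservation of angular momentum. -/
theorem IsTraj.rotation_form_eq {g : GaugeNonlinearity} (hij : i ≠ j) {w : ℝ → H1 d}
    (hu : IsTraj g fun t => (w t).fn) {Yi Yj : ℝ → L2 d} (hi : ∀ t, IsMoment i (w t).fn (Yi t))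
    (hj : ∀ t, IsMoment j (w t).fn (Yj t)) {T M : ℝ} (hw : ∀ t, |t| ≤ |T| → ‖w t‖ ≤ M)
    (hYi : ∀ t, |t| ≤ |T| → ‖Yi t‖ ≤ M) (hYj : ∀ t, |t| ≤ |T| → ‖Yj t‖ ≤ M) :
    inner ℂ (Yi T) ((w T).grad j) - inner ℂ (Yj T) ((w T).grad i)
      = inner ℂ (Yi 0) ((w 0).grad j) - inner ℂ (Yj 0) ((w 0).grad i) := by
  set ω : ℝ → ℂ := fun t => inner ℂ (Yi t) ((w t).grad j) - inner ℂ (Yj t) ((w t).grad i) with hω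
  have hre : ∀ t, (ω t).re = 0 := fun t => (w t).re_rotation_form hij (hi t) (hj t)
  set h : ℕ → ℝ := fun n => 1 / ((n : ℝ) + 1) with hh
  have hpos : ∀ n, 0 < h n := fun n => by positivity
  have h0 : Tendsto h atTop (𝓝 0) := tendsto_one_div_add_atTop_nhds_zero_nat
  have hM0 : 0 ≤ M := (norm_nonneg _).trans (hw 0 (by simp))
  have hlim : ∀ t, Tendsto (fun n => ((h n : ℝ) : ℂ)⁻¹ *
      inner ℂ (w t).fn (rotationOp hij (h n) (w t).fn - (w t).fn)) atTop (𝓝 (ω t)) := fun t =>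
    ((w t).tendsto_inner_rotationOp hij (hi t) (hj t)).comp tendsto_one_div_succ_nhdsNE
  have him : ∀ t, Tendsto (fun n => (h n)⁻¹ *
      (inner ℂ (w t).fn (rotationOp hij (h n) (w t).fn)).im) atTop (𝓝 (ω t).im) := by
    intro t
    refine ((Complex.continuous_im.tendsto _).comp (hlim t)).congr fun n => ?_
    rw [Function.comp_apply, ← Complex.ofReal_inv, Complex.im_ofReal_mul, inner_sub_right,
      Complex.sub_im]
    have : (inner ℂ (w t).fn (w t).fn).im = 0 := inner_self_im (𝕜 := ℂ) (w t).fn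
    rw [this, sub_zero]
  refine Complex.ext ((hre T).trans (hre 0).symm) ?_
  -- Only the imaginary part needs conservation; the real part vanishes at each time separately.
  refine hu.generator_eq (fun n => rotationOp hij (h n)) (fun _ _ _ => isometryOp_freeGroup _ _ _)
    (fun _ f => g.comp_compMeasurePreserving (rotation hij _).measurePreserving f)
    (fun _ f => g.potentialEnergy_compMeasurePreserving (rotation hij _).measurePreserving f)
    hpos h0 (T := T) (M := 2 * (2 * (M + M) * M)) (fun n t ht => ?_) (fun t ht => ?_)
    (him 0) (him T)
  · have ht' := abs_le_of_mem_uIcc_zero ht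
    rw [norm_rotationOp_sub_sq]
    have h1 := (w t).norm_inner_rotationOp_sub_le hij (hi t) (hj t) (h n)
    rw [abs_of_pos (hpos n)] at h1
    have h2 : 2 * (‖Yi t‖ + ‖Yj t‖) * ‖w t‖ * h n ≤ 2 * (M + M) * M * h n := by
      have := hYi t ht'
      have := hYj t ht'
      have := hw t ht'
      have := (hpos n).le
      gcongr
    have h3 := (abs_le.1 (Complex.abs_re_le_norm
      (inner ℂ (w t).fn (rotationOp hij (h n) (w t).fn - (w t).fn)))).1
    linarith
  · have h1 := ((Complex.continuous_re.tendsto _).comp (hlim t)).const_mul (-2)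
    rw [hre, mul_zero] at h1
    refine h1.congr fun n => ?_
    rw [Function.comp_apply, ← Complex.ofReal_inv, Complex.re_ofReal_mul, norm_rotationOp_sub_sq]
    ring

end

section

/-! ### The flow in the conformal space -/

section ConformalFlow

variable {j : Fin d} {a : H1 d} {Y : L2 d} {B : ℝ}

theorem norm_modulation_approxFlow_sub_le (hY : IsMoment j a.fn Y) {n : ℕ}
    (hB : ∀ t, ‖approxFlow n a t‖ ≤ B) (t : ℝ) {η : ℝ} (hη : |η| ≤ 1) :
    ‖modulation (η • EuclideanSpace.single j 1) (approxFlow n a t).fn - (approxFlow n a t).fn‖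
      ≤ 2 * Real.pi * (‖Y‖ + 5 * B * |t|) * |η| := by
  have hB0 : 0 ≤ B := (norm_nonneg _).trans (hB 0)
  have h1 := (isTraj_approxFlow n a).norm_modulation_sub_le (fun _ => rfl) hB j η t
  simp only [approxFlow_zero] at h1
  have h2 := hY.norm_modulation_sub_le η
  -- For |η| ≤ 1 the factor 1 + π|η| is at most 1 + 4 = 5, as π ≤ 4.
  have h3 : 2 * Real.pi * |η| + 2 * Real.pi ^ 2 * η ^ 2 ≤ 2 * Real.pi * |η| * 5 := by
    rw [← sq_abs η]
    have h4 : Real.pi * |η| ≤ 4 * 1 :=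
      mul_le_mul Real.pi_le_four hη (abs_nonneg _) (by norm_num)
    have h5 : 0 ≤ 2 * Real.pi * |η| := by positivity
    nlinarith [mul_le_mul_of_nonneg_left h4 h5]
  have h6 : (2 * Real.pi * |η| + 2 * Real.pi ^ 2 * η ^ 2) * B * |t|
      ≤ 2 * Real.pi * |η| * 5 * B * |t| := by gcongr
  linarith

theorem exists_moment_approxFlow (hY : IsMoment j a.fn Y) {n : ℕ}
    (hB : ∀ t, ‖approxFlow n a t‖ ≤ B) (t : ℝ) :
    ∃ y, IsMoment j (approxFlow n a t).fn y ∧ ‖y‖ ≤ ‖Y‖ + 5 * B * |t| := by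
  have hB0 : 0 ≤ B := (norm_nonneg _).trans (hB 0)
  exact exists_moment_of_bound (by positivity) fun η hη =>
    norm_modulation_approxFlow_sub_le hY hB t hη

theorem exists_moment_flow (hd : d = 2 ∨ d = 3) (hY : IsMoment j a.fn Y)
    (hB : ∀ n t, ‖approxFlow n a t‖ ≤ B) (t : ℝ) :
    ∃ y, IsMoment j (flow hd a t).fn y ∧ ‖y‖ ≤ ‖Y‖ + 5 * B * |t| := by
  have hB0 : 0 ≤ B := (norm_nonneg _).trans (hB 0 0)
  refine exists_moment_of_bound (by positivity) fun η hη => ?_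
  have h := tendsto_approxFlow_fn hd a t
  exact le_of_tendsto' ((((modulation _).continuous.tendsto _).comp h).sub h).norm
    fun n => norm_modulation_approxFlow_sub_le hY (hB n) t hη

/-- The growth bound, restarted at any time in either direction, makes the norm of the moment
Lipschitz. With weak continuity this gives strong continuity. -/
theorem exists_moment_path (hd : d = 2 ∨ d = 3) (hY : IsMoment j a.fn Y) :
    ∃ y : ℝ → L2 d, Continuous y ∧ ∀ t, IsMoment j (flow hd a t).fn (y t) := by
  obtain ⟨B, hB0, hB⟩ := exists_flow_bound hd ‖a‖
  -- A second bound, for data of norm at most `B`, gives one speed valid after a restart from every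
  -- state of the trajectory.
  obtain ⟨B', hB0', hB'⟩ := exists_flow_bound hd B
  choose y hy _ using fun t =>
    exists_moment_flow hd hY (fun n t => ((hB a le_rfl t).1 n).2) t
  refine ⟨y, ?_, hy⟩
  have hlip : ∀ s t, ‖y t‖ ≤ ‖y s‖ + 5 * B' * |t - s| := by
    intro s t
    obtain ⟨z, hz, hzb⟩ := exists_moment_flow hd (hy s)
      (fun n τ => ((hB' _ (hB a le_rfl s).2.2 τ).1 n).2) (t - s)
    rw [flow_flow, sub_add_cancel] at hz
    rwa [hz.unique (hy t)] at hzb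
  have hnorm : Continuous fun t => ‖y t‖ := by
    refine (LipschitzWith.of_dist_le_mul (K := ⟨5 * B', by positivity⟩) fun s t => ?_).continuous
    rw [Real.dist_eq, Real.dist_eq, abs_le]
    have h1 := hlip s t
    have h2 := hlip t s
    rw [abs_sub_comm] at h1
    change -(5 * B' * _) ≤ _ ∧ _ ≤ 5 * B' * _
    constructor <;> linarith
  refine continuous_iff_continuousAt.2 fun t => ?_
  refine tendsto_of_tendsto_inner_of_norm (fun v => ?_) (hnorm.tendsto t)
  exact IsMoment.tendsto_inner ((continuous_flow_fn hd a).tendsto t) hy (hy t)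
    ((hnorm.tendsto t).eventually (eventually_le_nhds (lt_add_one _))) v

theorem tendsto_inner_of_weak_of_strong {y g : ℕ → L2 d} {y₀ g₀ : L2 d} {M : ℝ}
    (hy : ∀ v, Tendsto (fun n => inner ℂ v (y n)) atTop (𝓝 (inner ℂ v y₀)))
    (hM : ∀ n, ‖y n‖ ≤ M) (hg : Tendsto g atTop (𝓝 g₀)) :
    Tendsto (fun n => inner ℂ (y n) (g n)) atTop (𝓝 (inner ℂ y₀ g₀)) := by
  have h1 : Tendsto (fun n => inner ℂ (y n) g₀) atTop (𝓝 (inner ℂ y₀ g₀)) := by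
    have h := (Complex.continuous_conj.tendsto _).comp (hy g₀)
    rw [inner_conj_symm] at h
    exact h.congr fun n => inner_conj_symm _ _
  have h2 : Tendsto (fun n => inner ℂ (y n) (g n - g₀)) atTop (𝓝 0) := by
    have h3 := (tendsto_iff_norm_sub_tendsto_zero.1 hg).const_mul M
    rw [mul_zero] at h3
    exact squeeze_zero_norm (fun n => (norm_inner_le_norm _ _).trans
      (mul_le_mul_of_nonneg_right (hM n) (norm_nonneg _))) h3
  have h4 := h1.add h2
  rw [add_zero] at h4
  refine h4.congr fun n => ?_
  rw [inner_sub_right, add_sub_cancel]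

/-- The moments of the truncated solutions converge only weakly, but the gradients converge
strongly, which suffices for the product. The truncated forms are constant in time. -/
theorem rotation_form_flow (hd : d = 2 ∨ d = 3) {i j : Fin d} (hij : i ≠ j) {Yi Yj yi yj : L2 d}
    (hi : IsMoment i a.fn Yi) (hj : IsMoment j a.fn Yj) {t : ℝ}
    (hi' : IsMoment i (flow hd a t).fn yi) (hj' : IsMoment j (flow hd a t).fn yj) :
    inner ℂ yi ((flow hd a t).grad j) - inner ℂ yj ((flow hd a t).grad i)
      = inner ℂ Yi (a.grad j) - inner ℂ Yj (a.grad i) := by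
  obtain ⟨B, hB0, hB⟩ := exists_flow_bound hd ‖a‖
  have hBn : ∀ n t, ‖approxFlow n a t‖ ≤ B := fun n t => ((hB a le_rfl t).1 n).2
  choose Zi hZi hZib using fun n t => exists_moment_approxFlow hi (hBn n) t
  choose Zj hZj hZjb using fun n t => exists_moment_approxFlow hj (hBn n) t
  set M : ℝ := B + ‖Yi‖ + ‖Yj‖ + 5 * B * |t| with hM
  have hbt : ∀ s, |s| ≤ |t| → 5 * B * |s| ≤ 5 * B * |t| := fun s hs => by gcongr
  have hZiM : ∀ n s, |s| ≤ |t| → ‖Zi n s‖ ≤ M := fun n s hs => by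
    have := hZib n s
    have := hbt s hs
    have := norm_nonneg Yj
    linarith
  have hZjM : ∀ n s, |s| ≤ |t| → ‖Zj n s‖ ≤ M := fun n s hs => by
    have := hZjb n s
    have := hbt s hs
    have := norm_nonneg Yi
    linarith
  have hcons : ∀ n, inner ℂ (Zi n t) ((approxFlow n a t).grad j)
      - inner ℂ (Zj n t) ((approxFlow n a t).grad i)
        = inner ℂ Yi (a.grad j) - inner ℂ Yj (a.grad i) := by
    intro n
    have h := (isTraj_approxFlow n a).rotation_form_eq hij (hZi n) (hZj n) (T := t) (M := M)
      (fun s _ => by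
        have := hBn n s
        have : 0 ≤ ‖Yi‖ + ‖Yj‖ + 5 * B * |t| := by positivity
        linarith) (hZiM n) (hZjM n)
    have e1 := hZi n 0
    have e2 := hZj n 0
    rw [approxFlow_zero] at e1 e2
    rwa [e1.unique hi, e2.unique hj, approxFlow_zero] at h
  have hgrad : ∀ k, Tendsto (fun n => (approxFlow n a t).grad k) atTop
      (𝓝 ((flow hd a t).grad k)) := fun k =>
    (((PiLp.continuous_apply 2 (fun _ : Fin d => L2 d) k).comp
      H1.continuous_grad).tendsto _).comp (tendsto_approxFlow hd a t)
  have hlim : ∀ (k l : Fin d) (Z : ℕ → L2 d) (z : L2 d),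
      (∀ n, IsMoment k (approxFlow n a t).fn (Z n)) → IsMoment k (flow hd a t).fn z →
      (∀ n, ‖Z n‖ ≤ M) → Tendsto (fun n => inner ℂ (Z n) ((approxFlow n a t).grad l)) atTop
        (𝓝 (inner ℂ z ((flow hd a t).grad l))) := fun k l Z z hZ hz hb =>
    tendsto_inner_of_weak_of_strong (fun v => IsMoment.tendsto_inner
      (tendsto_approxFlow_fn hd a t) hZ hz (Eventually.of_forall hb) v) hb (hgrad l)
  have h := (hlim i j _ _ (fun n => hZi n t) hi' fun n => hZiM n t le_rfl).sub
    (hlim j i _ _ (fun n => hZj n t) hj' fun n => hZjM n t le_rfl)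
  simp only [hcons] at h
  exact (tendsto_nhds_unique tendsto_const_nhds h).symm

end ConformalFlow

/-- The vector field `x u` of an element of `Σ`. -/
def ConformalSpace.moment (w : ConformalSpace d) : L2Vec d := w.1.snd

theorem ConformalSpace.isMoment (w : ConformalSpace d) (j : Fin d) :
    IsMoment j w.toH1.fn (w.moment j) := w.2 j

/-- An element of `Σ` from its components. -/
def ConformalSpace.mk (u : H1 d) (y : Fin d → L2 d) (h : ∀ j, IsMoment j u.fn (y j)) :
    ConformalSpace d := ⟨WithLp.toLp 2 (u, WithLp.toLp 2 y), h⟩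

theorem angularMomentum_eq (hd : 2 ≤ d) (w : ConformalSpace d) :
    angularMomentum hd w = Complex.I * (inner ℂ (w.moment ⟨0, by omega⟩) (w.toH1.grad ⟨1, by omega⟩)
      - inner ℂ (w.moment ⟨1, by omega⟩) (w.toH1.grad ⟨0, by omega⟩)) := by
  rw [L2.inner_eq, L2.inner_eq, ← integral_sub (L2.integrable_conj_mul _ _)
    (L2.integrable_conj_mul _ _), ← integral_const_mul, angularMomentum]
  refine integral_congr_ae ?_
  filter_upwards [w.isMoment ⟨0, by omega⟩, w.isMoment ⟨1, by omega⟩] with x h0 h1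
  rw [h0, h1]
  simp only [map_mul, Complex.conj_ofReal]
  ring

theorem exists_conformal_flow (hd : d = 2 ∨ d = 3) (hd2 : 2 ≤ d) (w₀ : ConformalSpace d) :
    ∃ w : C(ℝ, ConformalSpace d), (∀ t, (w t).toH1 = flow hd w₀.toH1 t) ∧
      ∀ t, angularMomentum hd2 (w t) = angularMomentum hd2 w₀ := by
  choose y hyc hy using fun j => exists_moment_path hd (w₀.isMoment j)
  have hflow : Continuous fun t => flow hd w₀.toH1 t := (solutionMap hd w₀.toH1).continuous
  refine ⟨⟨fun t => ConformalSpace.mk (flow hd w₀.toH1 t) (fun j => y j t) fun j => hy j t, ?_⟩,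
    fun t => rfl, fun t => ?_⟩
  · refine Continuous.subtype_mk ?_ _
    exact (WithLp.prod_continuous_toLp 2 _ _).comp (hflow.prodMk
      ((PiLp.continuous_toLp 2 _).comp (continuous_pi hyc)))
  · rw [angularMomentum_eq, angularMomentum_eq]
    congr 1
    exact rotation_form_flow hd (by simp [Fin.ext_iff]) (w₀.isMoment _) (w₀.isMoment _)
      (hy _ t) (hy _ t)

end

end CubicQuarticNLS

end

/-! ### The main theorem. -/

open CubicQuarticNLS in
theorem theorem2p2 (d : ℕ) (hd : d = 2 ∨ d = 3) :
    -- the data-to-solution map, continuous into `C(ℝ; H¹)` with locally uniform convergence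
    ∃ Φ : C(H1 d, C(ℝ, H1 d)),
      (∀ u₀ : H1 d,
        -- existence and uniqueness of a global solution in `C(ℝ; H¹)`
        IsSolution u₀ (Φ u₀) ∧
        (∀ v : C(ℝ, H1 d), IsSolution u₀ v → v = Φ u₀) ∧
        -- conservation laws
        (∀ t : ℝ, mass (Φ u₀ t) = mass u₀ ∧ energy (Φ u₀ t) = energy u₀ ∧
          momentum (Φ u₀ t) = momentum u₀)) ∧
      -- data in `Σ`: the solution is in `C(ℝ; Σ)` and conserves the angular momentum
      (∀ w₀ : ConformalSpace d, ∃ w : C(ℝ, ConformalSpace d),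
        (∀ t : ℝ, (w t).toH1 = Φ w₀.toH1 t) ∧
        ∀ t : ℝ, angularMomentum (by omega) (w t) = angularMomentum (by omega) w₀) := by
  refine ⟨solutionMap hd, fun u₀ => ⟨isSolution_solutionMap hd u₀, fun v hv =>
    hv.eq_of_isSolution hd (isSolution_solutionMap hd u₀), fun t => ⟨mass_flow hd u₀ t,
    energy_flow hd u₀ t, momentum_flow_eq hd u₀ t⟩⟩, fun w₀ => ?_⟩
  exact exists_conformal_flow hd _ w₀
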